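/- **Data.** Let $M\in\mathbb N$, $k_m\in\mathbb R$ ($m=1,\dots,M$), and for $i=1,2$ let $$F_i^m(x_1,x_2)=\alpha_{i,1}^mx_1+\alpha_{i,2}^mx_2+\tfrac12\big(\beta_{i,11}^mx_1^2+2\beta_{i,12}^mx_1x_2+\beta_{i,22}^mx_2^2\big)+\Psi_i^m(x_1,x_2),\qquad F^m=(F^m_1,F^m_2).$$ With $\delta_{+\eta}Y=\frac{Y(\cdot+\eta)-Y}{\eta}$ and $\delta_{-\eta}Y=\frac{Y-Y(\cdot-\eta)}{\eta}$, consider for $Q:\mathbb R\to\mathbb R^2$ the advance–delay equation $$\epsilon^3c^2\,Q''=\sum_{m=1}^Mk_m\epsilon\,\delta_{-k_m\epsilon}F^m\big(k_m\epsilon^2\,\delta_{+k_m\epsilon}Q\big)\qquad(1)$$ (terms with $k_m=0$ are zero). Let $c_1=\sum_mk_m^2\alpha_{1,1}^m$, $c_2=\sum_mk_m^2\alpha_{1,2}^m$, $c_3=\sum_mk_m^2\alpha_{2,2}^m$, and let $$\sigma_0=\tfrac12\Big(c_1+c_3+\sqrt{(c_1-c_3)^2+4c_2^2}\Big),\qquad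 \lambda=\frac{c_2}{\sigma_0-c_3},$$ so that $\sigma_0$ is the larger root of $(c_1-\sigma)(c_3-\sigma)=c_2^2$. Put $a_1=\sum\frac{k_m^4}{12}\alpha^m_{1,1}$, $a_2=\sum\frac{k_m^4}{12}\alpha^m_{1,2}$, $b_1=\sum\frac{k_m^4}{12}\alpha^m_{2,2}$, $b_2=\sum\frac{k_m^4}{12}\alpha^m_{2,1}$, $a_3=\sum\frac{k_m^3}2\beta^m_{1,11}$, $a_4=\sum\frac{k_m^3}2\beta^m_{1,22}$, $a_5=\sum k_m^3\beta^m_{1,12}$, $b_3=\sum\frac{k_m^3}2\beta^m_{2,22}$, $b_4=\sum\frac{k_m^3}2\beta^m_{2,11}$, $b_5=\sum k_m^3\beta^m_{2,12}$ and $$d_1=\frac{1+\lambda^2}{(a_1+\lambda a_2)+\lambda(b_2+\lambda b_1)},\qquad d_2=\frac{(a_3+\lambda^2a_4+\lambda a_5)+\lambda(\lambda b_5+\lambda^2b_3+b_4)}{(a_1+\lambda a_2)+\lambda(b_2+\lambda b_1)},$$ $$W_*(\xi)=\frac{3d_1}{2d_2}\operatorname{sech}^2\big(\tfrac12\sqrt{d_1}\,\xi\big),\qquad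 W_0=(W_*,\lambda W_*).$$ **Assumptions.** (1) $\alpha_{1,2}^m=\alpha_{2,1}^m$, $\beta_{1,22}^m=\beta_{2,12}^m$, $\beta_{1,12}^m=\beta_{2,11}^m$ for all $m$. (2) $\sigma_0>0$, $c_2\ne0$, $d_1>0$, $d_2\neq0$ (in particular the common denominator of $d_1$, $d_2$ is nonzero). (3) $\Psi_i^m(0,0)=0$ and there are constants $\gamma_i^m$ with $|\Psi_i^m(x)-\Psi_i^m(y)|\le\gamma_i^m(x_1^2+x_2^2+y_1^2+y_2^2)(|x_1-y_1|+|x_2-y_2|)$ for all $x,y\in\mathbb R^2$. (4) With $S_k(z)=1-\operatorname{sinc}^2(kz/2)$, there is $\delta_0>0$ such that for all $z\in\mathbb R$ $$T(z):=\big(2\sigma_0-(c_1+c_3)\big)\Big[\sum_mk_m^2\big((\sigma_0-c_3)\alpha^m_{1,1}+(\sigma_0-c_1)\alpha_{2,2}^m+2c_2\alpha_{1,2}^m\big)S_{k_m}(z)+\sum_mk_m^2\alpha_{1,1}^mS_{k_m}(z)\sum_mk_m^2\alpha_{2,2}^mS_{k_m}(z)-\Big(\sum_mk_m^2\alpha_{1,2}^mS_{k_m}(z)\Big)^2\Big]\ge\delta_0\min\{|z|,2\}^2.$$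 **Operators.** For $\epsilon>0$ let $\mathcal A_m Y(\xi)=\frac1{k_m\epsilon}\int_{\xi-k_m\epsilon/2}^{\xi+k_m\epsilon/2}Y$ (terms containing $\mathcal A_m$ with $k_m=0$ are zero, since they carry a positive power of $k_m$ as a factor). For $W=(W_1,W_2)$ let $$(\mathcal B^{can}_\epsilon W)_i=\epsilon^{-2}\Big((\sigma_0+\epsilon^2)W_i-\sum_{m}k_m^2\big(\alpha_{i,1}^m\mathcal A_m^2W_1+\alpha_{i,2}^m\mathcal A_m^2W_2\big)\Big),\qquad \mathcal B_\epsilon=\begin{pmatrix}1&\lambda\\0&\epsilon^2\end{pmatrix}\mathcal B^{can}_\epsilon ,$$ and let $$q_i[W]=\tfrac12\sum_mk_m^3\mathcal A_m\big(\beta_{i,11}^m(\mathcal A_mW_1)^2+2\beta_{i,12}^m(\mathcal A_mW_1)(\mathcal A_mW_2)+\beta^m_{i,22}(\mathcal A_mW_2)^2\big),$$ $$p_i[W]=\sum_mk_m\mathcal A_m\Psi_i^m(\epsilon^2k_m\mathcal A_mW_1,\epsilon^2k_m\mathcal A_mW_2),$$ $\mathcal Q_\epsilon=(q_1+\lambda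 q_2,\ \epsilon^2q_2)$ and $\mathcal P_\epsilon=(\epsilon^{-6}(p_1+\lambda p_2),\ \epsilon^{-4}p_2)$. Let $\mathcal M_\epsilon$ be the linear operator obtained by linearizing $\mathcal Q_\epsilon$ at $W_0$, that is $$(\mathcal M_\epsilon V)_i=\epsilon^{2(i-1)}\sum_m\sum_{j=1}^2\eta_{i,j}^m\,\mathcal A_m\big((\mathcal A_mW_*)(\mathcal A_mV_j)\big)$$ with $\eta_{2,1}^m=k_m^3(\beta_{2,11}^m+\lambda\beta_{2,12}^m)$, $\eta_{2,2}^m=k_m^3(\beta_{2,12}^m+\lambda\beta_{2,22}^m)$, $\eta_{1,1}^m=k_m^3(\beta_{1,11}^m+\lambda\beta_{1,12}^m)+\lambda\eta_{2,1}^m$ and $\eta_{1,2}^m=k_m^3(\beta_{1,12}^m+\lambda\beta_{1,22}^m)+\lambda\eta_{2,2}^m$. Finally let $\mathcal L_\epsilon=\mathcal B_\epsilon-\mathcal M_\epsilon$ and $$\mathcal F_\epsilon[V]=\epsilon^2\mathcal L_\epsilon^{-1}\Big(\mathcal Q_\epsilon[V]+\frac{\mathcal P_\epsilon[W_0+\epsilon^2V]-\mathcal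 P_\epsilon[W_0]}{\epsilon^2}\Big)+\mathcal L_\epsilon^{-1}\Big(\frac{\mathcal Q_\epsilon[W_0]-\mathcal B_\epsilon W_0}{\epsilon^2}+\mathcal P_\epsilon[W_0]\Big).$$ **Theorem.** Under assumptions (1)–(4), $W_*$ is the unique non-trivial even $C^2$ solution of $W_*''=d_1W_*-d_2W_*^2$ with $W_*(\xi)\to0$ as $\xi\to\pm\infty$, and $W_0\in(L^2_{even}(\mathbb R))^2$. There are constants $C,D,\epsilon_*>0$ and $q<1$, depending only on the data, such that for every $0<\epsilon<\epsilon_*$: (a) $\mathcal L_\epsilon$ maps $(L^2_{even}(\mathbb R))^2$ bijectively onto itself, the arguments of $\mathcal L_\epsilon^{-1}$ in the definition of $\mathcal F_\epsilon$ belong to this space for every $V$ in it, and so $\mathcal F_\epsilon$ is a well-defined map of $(L^2_{even}(\mathbb R))^2$ into itself. (b) $\mathcal F_\epsilon$ maps the ball $B_D=\{V\in(L^2_{even}(\mathbb R))^2:\|V\|_2\le D\}$ into itself, is there a contraction with constant $q$, and has exactly one fixed point $V_\epsilon$ in $B_D$. (c) Equation (1) with $c=c_\epsilon=\sqrt{\sigma_0+\epsilon^2}$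 has a solution $Q_\epsilon\in C^2(\mathbb R;\mathbb R^2)$ whose velocity profile $W_\epsilon=Q_\epsilon'$ belongs to $(L^2_{even}(\mathbb R))^2$, equals $W_0+\epsilon^2V_\epsilon$ almost everywhere, and satisfies $\|W_\epsilon-W_0\|_2\le C\epsilon^2$. -/

import Mathlib

open MeasureTheory Filter Topology
open scoped NNReal ENNReal

noncomputable section

/-! ### Function spaces and elementary operators -/

/-- The plane `ℝ²` with its Euclidean norm. Coordinate `0` is the first component, coordinate `1`
the second one. -/
abbrev Plane : Type := EuclideanSpace ℝ (Fin 2)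

/-- `f ∈ (L²_even(ℝ))²`, for a function `f : ℝ → ℝ²`. -/
def IsEvenL2 (f : ℝ → Plane) : Prop :=
  MemLp f 2 volume ∧ ∀ᵐ x : ℝ, f (-x) = f x

/-- The space `(L²_even(ℝ))²` of (classes of) square integrable even functions `ℝ → ℝ²`, with the
norm `‖V‖₂ = (∫ V₁² + V₂²)^{1/2}`. -/
def L2Even : Submodule ℝ (Lp Plane 2 (volume : Measure ℝ)) where
  carrier := {f | ∀ᵐ x : ℝ, f (-x) = f x}
  zero_mem' := by
    have h := Lp.coeFn_zero Plane 2 (volume : Measure ℝ)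
    have h' := (Measure.measurePreserving_neg (volume : Measure ℝ)).quasiMeasurePreserving.ae h
    filter_upwards [h, h'] with x hx hx'
    rw [hx, hx', Pi.zero_apply, Pi.zero_apply]
  add_mem' := by
    intro f g hf hg
    change ∀ᵐ x : ℝ, (f + g) (-x) = (f + g) x
    have h := Lp.coeFn_add f g
    have h' := (Measure.measurePreserving_neg (volume : Measure ℝ)).quasiMeasurePreserving.ae h
    filter_upwards [h, h', hf, hg] with x hx hx' hfx hgx
    rw [hx, hx', Pi.add_apply, Pi.add_apply, hfx, hgx]
  smul_mem' := by
    intro c f hf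
    change ∀ᵐ x : ℝ, (c • f) (-x) = (c • f) x
    have h := Lp.coeFn_smul c f
    have h' := (Measure.measurePreserving_neg (volume : Measure ℝ)).quasiMeasurePreserving.ae h
    filter_upwards [h, h', hf] with x hx hx' hfx
    rw [hx, hx', Pi.smul_apply, Pi.smul_apply, hfx]

/-- A representative of an element of `(L²_even(ℝ))²`. -/
def rep (V : L2Even) : ℝ → Plane := fun x => (V : Lp Plane 2 (volume : Measure ℝ)) x

/-- The averaging operator `(A_η Y)(ξ) = η⁻¹ ∫_{ξ-η/2}^{ξ+η/2} Y`. One has `A_{-η} = A_η`. The value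
for `η = 0` is irrelevant: `A_{k ε}` is always multiplied by a positive power of `k` below. -/
def avg (η : ℝ) (Y : ℝ → ℝ) : ℝ → ℝ :=
  fun ξ => η⁻¹ * ∫ x in (ξ - η / 2)..(ξ + η / 2), Y x

/-- The forward difference operator `δ_{+η}`. -/
def diffPlus (η : ℝ) (Y : ℝ → Plane) : ℝ → Plane :=
  fun ξ => η⁻¹ • (Y (ξ + η) - Y ξ)

/-- The backward difference operator `δ_{-η}`. -/
def diffMinus (η : ℝ) (Y : ℝ → Plane) : ℝ → Plane :=
  fun ξ => η⁻¹ • (Y ξ - Y (ξ - η))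

/-- The `i`-th component of a vector-valued function. -/
def comp (W : ℝ → Plane) (i : Fin 2) : ℝ → ℝ := fun x => W x i

/-- The function `S_k(z) = 1 - sinc²(k z / 2)`. -/
def symbolS (k z : ℝ) : ℝ := 1 - Real.sinc (k * z / 2) ^ 2

/-- `w` is a non-trivial even solution of `w'' = d₁ w - d₂ w²` that is homoclinic to `0`. -/
def IsKdVWave (d₁ d₂ : ℝ) (w : ℝ → ℝ) : Prop :=
  ContDiff ℝ 2 w ∧ (∀ ξ, deriv (deriv w) ξ = d₁ * w ξ - d₂ * w ξ ^ 2) ∧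
    (∀ ξ, w (-ξ) = w ξ) ∧ Tendsto w atTop (𝓝 0) ∧ Tendsto w atBot (𝓝 0) ∧ ∃ ξ, w ξ ≠ 0

/-! ### The data of the lattice equation -/

/-- The data of the advance-delay equation: the constants `k_m`, the linear coefficients
`α_{i,j}^m` (field `αᵢⱼ`), the quadratic coefficients `β_{i,jl}^m` (field `βᵢⱼₗ`), and the higher
order terms `Ψ_i^m`. -/
structure LatticeData (M : ℕ) where
  k : Fin M → ℝ
  α₁₁ : Fin M → ℝ
  α₁₂ : Fin M → ℝ
  α₂₁ : Fin M → ℝ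
  α₂₂ : Fin M → ℝ
  β₁₁₁ : Fin M → ℝ
  β₁₁₂ : Fin M → ℝ
  β₁₂₂ : Fin M → ℝ
  β₂₁₁ : Fin M → ℝ
  β₂₁₂ : Fin M → ℝ
  β₂₂₂ : Fin M → ℝ
  Ψ₁ : Fin M → Plane → ℝ
  Ψ₂ : Fin M → Plane → ℝ

namespace LatticeData

variable {M : ℕ} (G : LatticeData M)

/-- The nonlinearities `F^m : ℝ² → ℝ²`. -/
def F (m : Fin M) (x : Plane) : Plane :=
  !₂[G.α₁₁ m * x 0 + G.α₁₂ m * x 1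
      + (1 / 2) * (G.β₁₁₁ m * x 0 ^ 2 + 2 * G.β₁₁₂ m * x 0 * x 1 + G.β₁₂₂ m * x 1 ^ 2) + G.Ψ₁ m x,
    G.α₂₁ m * x 0 + G.α₂₂ m * x 1
      + (1 / 2) * (G.β₂₁₁ m * x 0 ^ 2 + 2 * G.β₂₁₂ m * x 0 * x 1 + G.β₂₂₂ m * x 1 ^ 2) + G.Ψ₂ m x]

/-- `Q` is a (twice continuously differentiable) solution, with speed `c`, of
`ε³ c² Q'' = ∑ₘ kₘ ε δ_{-kₘε} F^m(kₘ ε² δ_{+kₘε} Q)`. For `kₘ = 0` the `m`-th term is zero. -/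
def IsLatticeWave (ε c : ℝ) (Q : ℝ → Plane) : Prop :=
  ContDiff ℝ 2 Q ∧ ∀ ξ, (ε ^ 3 * c ^ 2) • deriv (deriv Q) ξ =
    ∑ m, (G.k m * ε) • diffMinus (G.k m * ε)
      (fun ζ => G.F m ((G.k m * ε ^ 2) • diffPlus (G.k m * ε) Q ζ)) ξ

/-! ### Constants -/

def c₁ : ℝ := ∑ m, G.k m ^ 2 * G.α₁₁ m
def c₂ : ℝ := ∑ m, G.k m ^ 2 * G.α₁₂ m
def c₃ : ℝ := ∑ m, G.k m ^ 2 * G.α₂₂ m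

/-- The larger solution of `(c₁ - σ)(c₃ - σ) = c₂²`. -/
def σ₀ : ℝ := ((G.c₁ + G.c₃) + √((G.c₁ - G.c₃) ^ 2 + 4 * G.c₂ ^ 2)) / 2

/-- The constant `λ`. -/
def lam : ℝ := G.c₂ / (G.σ₀ - G.c₃)

def a₁ : ℝ := ∑ m, G.k m ^ 4 / 12 * G.α₁₁ m
def a₂ : ℝ := ∑ m, G.k m ^ 4 / 12 * G.α₁₂ m
def b₁ : ℝ := ∑ m, G.k m ^ 4 / 12 * G.α₂₂ m
def b₂ : ℝ := ∑ m, G.k m ^ 4 / 12 * G.α₂₁ m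
def a₃ : ℝ := ∑ m, G.k m ^ 3 / 2 * G.β₁₁₁ m
def a₄ : ℝ := ∑ m, G.k m ^ 3 / 2 * G.β₁₂₂ m
def a₅ : ℝ := ∑ m, G.k m ^ 3 * G.β₁₁₂ m
def b₃ : ℝ := ∑ m, G.k m ^ 3 / 2 * G.β₂₂₂ m
def b₄ : ℝ := ∑ m, G.k m ^ 3 / 2 * G.β₂₁₁ m
def b₅ : ℝ := ∑ m, G.k m ^ 3 * G.β₂₁₂ m

def d₁ : ℝ :=
  (1 + G.lam ^ 2) / ((G.a₁ + G.lam * G.a₂) + G.lam * (G.b₂ + G.lam * G.b₁))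

def d₂ : ℝ :=
  ((G.a₃ + G.lam ^ 2 * G.a₄ + G.lam * G.a₅)
      + G.lam * (G.lam * G.b₅ + G.lam ^ 2 * G.b₃ + G.b₄))
    / ((G.a₁ + G.lam * G.a₂) + G.lam * (G.b₂ + G.lam * G.b₁))

/-- The KdV soliton `W_*(ξ) = (3 d₁ / (2 d₂)) sech²(√d₁ ξ / 2)`. -/
def Wstar (ξ : ℝ) : ℝ :=
  3 * G.d₁ / (2 * G.d₂) * (1 / Real.cosh (1 / 2 * √G.d₁ * ξ)) ^ 2

/-- The limit profile `W₀ = (W_*, λ W_*)`. -/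
def W₀ (ξ : ℝ) : Plane := !₂[G.Wstar ξ, G.lam * G.Wstar ξ]

/-- The function `T`. -/
def T (z : ℝ) : ℝ :=
  (2 * G.σ₀ - (G.c₁ + G.c₃)) *
    ((∑ m, G.k m ^ 2 * ((G.σ₀ - G.c₃) * G.α₁₁ m + (G.σ₀ - G.c₁) * G.α₂₂ m
          + 2 * G.c₂ * G.α₁₂ m) * symbolS (G.k m) z)
      + (∑ m, G.k m ^ 2 * G.α₁₁ m * symbolS (G.k m) z)
          * (∑ m, G.k m ^ 2 * G.α₂₂ m * symbolS (G.k m) z)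
      - (∑ m, G.k m ^ 2 * G.α₁₂ m * symbolS (G.k m) z) ^ 2)

/-! ### Assumptions -/

/-- Symmetry of the Taylor coefficients. -/
def SymmetricCoefficients : Prop :=
  ∀ m, G.α₁₂ m = G.α₂₁ m ∧ G.β₁₂₂ m = G.β₂₁₂ m ∧ G.β₁₁₂ m = G.β₂₁₁ m

/-- Genericity and existence of the KdV wave. -/
def Generic : Prop :=
  (0 < G.σ₀ ∧ G.c₂ ≠ 0) ∧ (0 < G.d₁ ∧ G.d₂ ≠ 0)

/-- `ψ` vanishes at the origin and satisfies the cubic Lipschitz bound. -/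
def IsCubicRemainder (ψ : Plane → ℝ) : Prop :=
  ψ 0 = 0 ∧ ∃ γ : ℝ, ∀ x y : Plane,
    |ψ x - ψ y| ≤ γ * (x 0 ^ 2 + x 1 ^ 2 + y 0 ^ 2 + y 1 ^ 2) * (|x 0 - y 0| + |x 1 - y 1|)

/-- The higher order terms are cubic remainders. -/
def CubicRemainders : Prop :=
  ∀ m, IsCubicRemainder (G.Ψ₁ m) ∧ IsCubicRemainder (G.Ψ₂ m)

/-- The lower bound for `T`. -/
def SymbolBound : Prop :=
  ∃ δ₀ : ℝ, 0 < δ₀ ∧ ∀ z : ℝ, δ₀ * (min |z| 2) ^ 2 ≤ G.T z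

/-! ### The operators in the equation for the corrector -/

/-- The matrix operator `B_ε^can`, with `σ_ε = σ₀ + ε²`. -/
def Bcan (ε : ℝ) (W : ℝ → Plane) : ℝ → Plane := fun ξ =>
  !₂[(1 / ε ^ 2) * ((G.σ₀ + ε ^ 2) * W ξ 0
        - ∑ m, G.k m ^ 2 * G.α₁₁ m * avg (G.k m * ε) (avg (G.k m * ε) (comp W 0)) ξ
        - ∑ m, G.k m ^ 2 * G.α₁₂ m * avg (G.k m * ε) (avg (G.k m * ε) (comp W 1)) ξ),
    (1 / ε ^ 2) * ((G.σ₀ + ε ^ 2) * W ξ 1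
        - ∑ m, G.k m ^ 2 * G.α₂₁ m * avg (G.k m * ε) (avg (G.k m * ε) (comp W 0)) ξ
        - ∑ m, G.k m ^ 2 * G.α₂₂ m * avg (G.k m * ε) (avg (G.k m * ε) (comp W 1)) ξ)]

/-- The operator `B_ε`, the product of the matrix with rows `(1, λ)`, `(0, ε²)` and `B_ε^can`. -/
def B (ε : ℝ) (W : ℝ → Plane) : ℝ → Plane := fun ξ =>
  !₂[G.Bcan ε W ξ 0 + G.lam * G.Bcan ε W ξ 1, ε ^ 2 * G.Bcan ε W ξ 1]

/-- `A_{kₘε}((A_{kₘε} f)(A_{kₘε} g))`. -/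
def quadTerm (ε : ℝ) (m : Fin M) (f g : ℝ → ℝ) : ℝ → ℝ :=
  avg (G.k m * ε) (fun x => avg (G.k m * ε) f x * avg (G.k m * ε) g x)

/-- The quadratic operator `Q_ε`. -/
def Qop (ε : ℝ) (W : ℝ → Plane) : ℝ → Plane := fun ξ =>
  !₂[(1 / 2) * ∑ m, G.k m ^ 3 *
        ((G.β₁₁₁ m + G.lam * G.β₂₁₁ m) * G.quadTerm ε m (comp W 0) (comp W 0) ξ
          + 2 * (G.β₁₁₂ m + G.lam * G.β₂₁₂ m) * G.quadTerm ε m (comp W 0) (comp W 1) ξ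
          + (G.β₁₂₂ m + G.lam * G.β₂₂₂ m) * G.quadTerm ε m (comp W 1) (comp W 1) ξ),
    (ε ^ 2 / 2) * ∑ m, G.k m ^ 3 *
        (G.β₂₁₁ m * G.quadTerm ε m (comp W 0) (comp W 0) ξ
          + 2 * G.β₂₁₂ m * G.quadTerm ε m (comp W 0) (comp W 1) ξ
          + G.β₂₂₂ m * G.quadTerm ε m (comp W 1) (comp W 1) ξ)]

/-- `ε² kₘ A_{kₘε} W`, the argument of the nonlinearities. -/
def arg (ε : ℝ) (m : Fin M) (W : ℝ → Plane) : ℝ → Plane := fun x =>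
  !₂[ε ^ 2 * G.k m * avg (G.k m * ε) (comp W 0) x, ε ^ 2 * G.k m * avg (G.k m * ε) (comp W 1) x]

/-- The operator `P_ε` of the higher order terms. -/
def Pop (ε : ℝ) (W : ℝ → Plane) : ℝ → Plane := fun ξ =>
  !₂[(1 / ε ^ 6) * ∑ m, G.k m * avg (G.k m * ε)
        (fun x => G.Ψ₁ m (G.arg ε m W x) + G.lam * G.Ψ₂ m (G.arg ε m W x)) ξ,
    (1 / ε ^ 4) * ∑ m, G.k m * avg (G.k m * ε) (fun x => G.Ψ₂ m (G.arg ε m W x)) ξ]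

def η₁₁ (m : Fin M) : ℝ :=
  G.k m ^ 3 * ((G.β₁₁₁ m + G.lam * G.β₁₁₂ m) + G.lam * (G.lam * G.β₂₁₂ m + G.β₂₁₁ m))
def η₁₂ (m : Fin M) : ℝ :=
  G.k m ^ 3 * ((G.lam * G.β₁₂₂ m + G.β₁₁₂ m) + G.lam * (G.lam * G.β₂₂₂ m + G.β₂₁₂ m))
def η₂₁ (m : Fin M) : ℝ := G.k m ^ 3 * (G.lam * G.β₂₁₂ m + G.β₂₁₁ m)
def η₂₂ (m : Fin M) : ℝ := G.k m ^ 3 * (G.lam * G.β₂₂₂ m + G.β₂₁₂ m)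

/-- The operator `M_ε`, the linearization of `Q_ε` at `W₀`. -/
def Mop (ε : ℝ) (V : ℝ → Plane) : ℝ → Plane := fun ξ =>
  !₂[∑ m, (G.η₁₁ m * G.quadTerm ε m G.Wstar (comp V 0) ξ
        + G.η₁₂ m * G.quadTerm ε m G.Wstar (comp V 1) ξ),
    ε ^ 2 * ∑ m, (G.η₂₁ m * G.quadTerm ε m G.Wstar (comp V 0) ξ
        + G.η₂₂ m * G.quadTerm ε m G.Wstar (comp V 1) ξ)]

/-- The operator `L_ε = B_ε - M_ε`. -/
def L (ε : ℝ) (V : ℝ → Plane) : ℝ → Plane := G.B ε V - G.Mop ε V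

/-- The residual `R_ε[W₀] = (Q_ε[W₀] - B_ε W₀) / ε²`. -/
def Rop (ε : ℝ) : ℝ → Plane := (1 / ε ^ 2) • (G.Qop ε G.W₀ - G.B ε G.W₀)

/-- The operator `N_ε[W₀; V] = (P_ε[W₀ + ε² V] - P_ε[W₀]) / ε²`. -/
def Nop (ε : ℝ) (V : ℝ → Plane) : ℝ → Plane :=
  (1 / ε ^ 2) • (G.Pop ε (G.W₀ + ε ^ 2 • V) - G.Pop ε G.W₀)

/-- `L_ε` maps `(L²_even)²` bijectively onto itself. -/
def LInvertible (ε : ℝ) : Prop :=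
  (∀ V : L2Even, IsEvenL2 (G.L ε (rep V))) ∧
    ∀ g : ℝ → Plane, IsEvenL2 g → ∃! U : L2Even, G.L ε (rep U) =ᵐ[volume] g

/-- `L_ε⁻¹ g`, the element `U` of `(L²_even)²` with `L_ε U = g` almost everywhere. -/
def Linv (ε : ℝ) (g : ℝ → Plane) : L2Even :=
  Classical.epsilon fun U : L2Even => G.L ε (rep U) =ᵐ[volume] g

/-- The map `F_ε` on `(L²_even)²`,
`F_ε[V] = ε² L_ε⁻¹(Q_ε[V] + N_ε[W₀; V]) + L_ε⁻¹(R_ε[W₀] + P_ε[W₀])`. -/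
def Fop (ε : ℝ) (V : L2Even) : L2Even :=
  ε ^ 2 • G.Linv ε (G.Qop ε (rep V) + G.Nop ε (rep V)) + G.Linv ε (G.Rop ε + G.Pop ε G.W₀)

end LatticeData

end

/-!
The velocity profile is sought in the form `W₀ + ε² V`, and the equation for `V` is solved by the
Banach fixed point theorem. Since `Q_ε` is quadratic and `M_ε` is its linearization at `W₀`
(`Qop_W₀_add_smul`), a fixed point `V` of `F_ε` gives a solution of
`B_ε W = Q_ε[W] + ε² P_ε[W]` (`B_profile`). Up to an invertible matrix this is the advance-delay
equation, integrated once: the average over an interval of length `kₘε` is the difference quotient of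
the primitive `Q`. The equation expresses `W` through averages, so it has a `C¹` representative and
`Q` is of class `C²` (`exists_isLatticeWave`).

The contraction (`exists_Fop_contraction`) rests on three estimates that are uniform in `ε`.

* The inhomogeneity `R_ε[W₀] + P_ε[W₀]` is bounded in `L²` (`exists_residual_bound`). The expansion
  `A_η² w = w + η² w'' / 12 + O(η⁴)` reduces this to the definition of `σ₀`, by which `(1, λ)` is an
  eigenvector of the matrix of the constants `c`, and to the differential equation for the soliton.
* `Q_ε + N_ε` is locally Lipschitz continuous on `L²` with a constant of order `1 / ε`
  (`exists_nonlinear_lipschitz`), since `A_η` maps `L²` to `L^∞` with norm `O(1 / η)` for small `η`.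
  The factor `ε²` in `F_ε` compensates this.
* `L_ε` is invertible on even functions with a bounded inverse (`exists_lInvertible`).

For the last point, `L_ε = B_ε (1 - B_ε⁻¹ M_ε)`, where `B_ε` and the averages are Fourier multipliers
on `L²(ℝ; ℂ)`. The lower bound for `T` bounds the determinant of the matrix symbol of `B_ε` from below,
so that `B_ε⁻¹` is bounded, and the first column of the symbol of `B_ε⁻¹ A_{kₘε}²` converges uniformly
to `(1, λ) / (1 + λ² + den (2πξ)²)` (`exists_inverse_symbol`); the second column only meets the second
row of `M_ε`, which carries a factor `ε²`. As averages almost commute with multiplication by the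
soliton, `B_ε⁻¹ M_ε` converges in operator norm to an operator built from
`(d₁ - ∂²)⁻¹` and the multiplication by the soliton (`exists_norm_preconditioned_sub_le`). The limit
operator is compact, because its kernel is of Hilbert-Schmidt type, so the Fredholm alternative applies:
`1` is not an eigenvalue on even functions, because the decaying solutions of
`u'' = (d₁ - 2 d₂ W_*) u` are the multiples of the odd function `W_*'`, by constancy of the Wronskian
(`isUnit_one_sub_kdvOp`). Operators near an invertible one are invertible.

That the soliton is the only even homoclinic solution follows from conservation of energy, which
determines the value at the origin, and uniqueness for the initial value problem
(`IsKdVWave.eq_soliton`).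
-/


noncomputable section

section

open scoped FourierTransform ComplexInnerProductSpace

/-! ### Multiplication operators and Fourier multipliers -/

/-- The complex Hilbert space `L²(ℝ; ℂ)`. -/
abbrev L2C : Type := Lp ℂ 2 (volume : Measure ℝ)

/-- The algebra of bounded measurable functions on the line, with real or complex values. These
serve as symbols of Fourier multipliers and as multiplication operators. -/
def Bdd (𝕜 : Type) [RCLike 𝕜] : Subalgebra 𝕜 (ℝ → 𝕜) where
  carrier := {m | Measurable m ∧ ∃ C : ℝ, ∀ x, ‖m x‖ ≤ C}
  mul_mem' := by
    rintro f g ⟨hf, C, hC⟩ ⟨hg, D, hD⟩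
    refine ⟨hf.mul hg, C * D, fun x => ?_⟩
    rw [Pi.mul_apply, norm_mul]
    exact mul_le_mul (hC x) (hD x) (norm_nonneg _) ((norm_nonneg _).trans (hC x))
  add_mem' := by
    rintro f g ⟨hf, C, hC⟩ ⟨hg, D, hD⟩
    exact ⟨hf.add hg, C + D, fun x => (norm_add_le _ _).trans (add_le_add (hC x) (hD x))⟩
  algebraMap_mem' := fun r => ⟨measurable_const, ‖r‖, fun x => le_rfl⟩

section Multiplication

variable {𝕜 : Type} [RCLike 𝕜] [NormedAlgebra 𝕜 ℂ]

lemma memLp_bdd_smul (m : Bdd 𝕜) (f : L2C) : MemLp (fun x => m.1 x • f x) 2 volume := by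
  obtain ⟨hm, C, hC⟩ := m.2
  refine MemLp.of_le_mul (c := C) (Lp.memLp f)
    (hm.aestronglyMeasurable.smul (Lp.aestronglyMeasurable f)) (ae_of_all _ fun x => ?_)
  rw [norm_smul]
  exact mul_le_mul_of_nonneg_right (hC x) (norm_nonneg _)

/-- Multiplication by a bounded measurable function, as an operator on `L²(ℝ; ℂ)`. -/
def mulOp (m : Bdd 𝕜) : L2C →L[ℂ] L2C :=
  LinearMap.mkContinuousOfExistsBound
    { toFun := fun f => (memLp_bdd_smul m f).toLp
      map_add' := fun f g => by
        rw [← MemLp.toLp_add]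
        refine MemLp.toLp_congr _ _ ?_
        filter_upwards [Lp.coeFn_add f g] with x hx
        rw [hx, Pi.add_apply, smul_add]
        rfl
      map_smul' := fun c f => by
        rw [RingHom.id_apply, ← MemLp.toLp_const_smul]
        refine MemLp.toLp_congr _ _ ?_
        filter_upwards [Lp.coeFn_smul c f] with x hx
        simp [hx] }
    (by
      obtain ⟨hm, C, hC⟩ := m.2
      refine ⟨C, fun f => Lp.norm_le_mul_norm_of_ae_le_mul ?_⟩
      filter_upwards [(memLp_bdd_smul m f).coeFn_toLp] with x hx
      change ‖(memLp_bdd_smul m f).toLp _ x‖ ≤ _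
      rw [hx, norm_smul]
      exact mul_le_mul_of_nonneg_right (hC x) (norm_nonneg _))

lemma mulOp_coeFn (m : Bdd 𝕜) (f : L2C) : mulOp m f =ᵐ[volume] fun x => m.1 x • f x :=
  (memLp_bdd_smul m f).coeFn_toLp

lemma norm_mulOp_le (m : Bdd 𝕜) {C : ℝ} (hC : ∀ x, ‖m.1 x‖ ≤ C) : ‖mulOp m‖ ≤ C := by
  refine ContinuousLinearMap.opNorm_le_bound _ ((norm_nonneg _).trans (hC 0)) fun f => ?_
  refine Lp.norm_le_mul_norm_of_ae_le_mul ?_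
  filter_upwards [mulOp_coeFn m f] with x hx
  rw [hx, norm_smul]
  exact mul_le_mul_of_nonneg_right (hC x) (norm_nonneg _)

lemma mulOp_add (m n : Bdd 𝕜) : mulOp (m + n) = mulOp m + mulOp n := by
  ext1 f
  refine Lp.ext ?_
  filter_upwards [mulOp_coeFn (m + n) f, mulOp_coeFn m f, mulOp_coeFn n f,
    Lp.coeFn_add (mulOp m f) (mulOp n f)] with x h1 h2 h3 h4
  rw [h1, add_apply, h4, Pi.add_apply, h2, h3, ← add_smul]
  rfl

lemma mulOp_mul (m n : Bdd 𝕜) : mulOp (m * n) = mulOp m * mulOp n := by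
  ext1 f
  refine Lp.ext ?_
  filter_upwards [mulOp_coeFn (m * n) f, mulOp_coeFn m (mulOp n f), mulOp_coeFn n f]
    with x h1 h2 h3
  rw [h1, mul_apply_eq_comp, h2, h3, smul_smul]
  rfl

lemma mulOp_one : mulOp (1 : Bdd 𝕜) = 1 := by
  ext1 f
  refine Lp.ext ?_
  filter_upwards [mulOp_coeFn (1 : Bdd 𝕜) f] with x h1
  rw [h1, one_apply_eq_self]
  exact one_smul 𝕜 (f x)

lemma mulOp_zero : mulOp (0 : Bdd 𝕜) = 0 := by
  have := mulOp_add (0 : Bdd 𝕜) 0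
  simpa using this

end Multiplication

/-- The Fourier multiplier with real symbol `m`, as a ring homomorphism from the bounded
symbols to the bounded operators on `L²(ℝ; ℂ)`. The frequency variable is that of Mathlib's Fourier
transform, with phase `e^{-2πixξ}`. -/
def fourierMul : Bdd ℝ →+* (L2C →L[ℂ] L2C) where
  toFun m := (Lp.fourierTransformₗᵢ ℝ ℂ).symm.toContinuousLinearEquiv.toContinuousLinearMap ∘L
    mulOp m ∘L (Lp.fourierTransformₗᵢ ℝ ℂ).toContinuousLinearEquiv.toContinuousLinearMap
  map_one' := by ext1 f; simp [mulOp_one]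
  map_mul' m n := by ext1 f; simp [mulOp_mul]
  map_zero' := by ext1 f; simp [mulOp_zero]
  map_add' m n := by ext1 f; simp [mulOp_add]

lemma fourierMul_apply (m : Bdd ℝ) (f : L2C) : fourierMul m f = 𝓕⁻ (mulOp m (𝓕 f)) := rfl

lemma fourier_fourierMul (m : Bdd ℝ) (f : L2C) : 𝓕 (fourierMul m f) = mulOp m (𝓕 f) := by
  rw [fourierMul_apply]
  exact (Lp.fourierTransformₗᵢ ℝ ℂ).apply_symm_apply _

lemma norm_fourierMul_le (m : Bdd ℝ) {C : ℝ} (hC : ∀ x, |m.1 x| ≤ C) : ‖fourierMul m‖ ≤ C := by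
  refine ContinuousLinearMap.opNorm_le_bound _ ((abs_nonneg _).trans (hC 0)) fun f => ?_
  rw [← Lp.norm_fourier_eq (fourierMul m f), fourier_fourierMul, ← Lp.norm_fourier_eq f]
  exact (mulOp m).le_of_opNorm_le (norm_mulOp_le m hC) _

lemma fourierMul_smul (c : ℝ) (m : Bdd ℝ) : fourierMul (c • m) = c • fourierMul m := by
  have h : mulOp (c • m) = (c : ℂ) • mulOp m := by
    ext1 f
    refine Lp.ext ?_
    filter_upwards [mulOp_coeFn (c • m) f, mulOp_coeFn m f, Lp.coeFn_smul (c : ℂ) (mulOp m f)]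
      with x h1 h2 h3
    rw [h1, smul_apply, h3, Pi.smul_apply, h2]
    simp [mul_assoc]
  ext1 f
  rw [smul_apply, fourierMul_apply, fourierMul_apply, h, smul_apply]
  exact (Lp.fourierTransformₗᵢ ℝ ℂ).symm.map_smul (c : ℂ) _

/-! ### Convolution operators as Fourier multipliers -/

/-- Translation by `t` on `L²(ℝ; ℂ)`. -/
def transL2 (t : ℝ) : L2C →ₗᵢ[ℂ] L2C :=
  Lp.compMeasurePreservingₗᵢ ℂ (fun x : ℝ => x - t) (measurePreserving_sub_right volume t)

lemma transL2_coeFn (t : ℝ) (f : L2C) : transL2 t f =ᵐ[volume] fun x => f (x - t) :=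
  Lp.coeFn_compMeasurePreserving f (measurePreserving_sub_right volume t)

/-- The phase `ξ ↦ e^{-2πitξ}`. -/
def phase (t : ℝ) : Bdd ℂ :=
  ⟨fun ξ => (Real.fourierChar (-(t * ξ)) : ℂ), by
    constructor
    · exact (Continuous.measurable (by fun_prop))
    · exact ⟨1, fun x => (Circle.norm_coe _).le⟩⟩

lemma fourier_transL2 (t : ℝ) (f : L2C) : 𝓕 (transL2 t f) = mulOp (phase t) (𝓕 f) := by
  refine DenseRange.induction_on (p := fun f : L2C => 𝓕 (transL2 t f) = mulOp (phase t) (𝓕 f))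
    (SchwartzMap.denseRange_toLpCLM (F := ℂ) (E := ℝ) (μ := volume) (p := 2) ENNReal.ofNat_ne_top)
    f ?_ ?_
  · refine isClosed_eq ?_ ?_
    · exact (Lp.fourierTransformₗᵢ ℝ ℂ).continuous.comp (transL2 t).continuous
    · exact (mulOp (phase t)).continuous.comp (Lp.fourierTransformₗᵢ ℝ ℂ).continuous
  · intro φ
    have h1 : transL2 t (φ.toLp 2) = (φ.compSubConstCLM ℂ t).toLp 2 := by
      refine Lp.ext ?_
      have h := (measurePreserving_sub_right (volume : Measure ℝ) t).quasiMeasurePreserving.ae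
        (φ.coeFn_toLp 2 volume)
      filter_upwards [transL2_coeFn t (φ.toLp 2), (φ.compSubConstCLM ℂ t).coeFn_toLp 2, h]
        with x h1 h2 h3
      rw [h1, h2, h3]; rfl
    change 𝓕 (transL2 t (φ.toLp 2)) = mulOp (phase t) (𝓕 (φ.toLp 2))
    rw [h1, SchwartzMap.toLp_fourier_eq, SchwartzMap.toLp_fourier_eq]
    refine Lp.ext ?_
    filter_upwards [mulOp_coeFn (phase t) ((𝓕 φ).toLp 2), (𝓕 φ).coeFn_toLp 2,
      (𝓕 (φ.compSubConstCLM ℂ t)).coeFn_toLp 2] with ξ h1 h2 h3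
    rw [h1, h2, h3, SchwartzMap.fourier_coe, SchwartzMap.fourier_coe, Real.fourier_real_eq,
      Real.fourier_real_eq]
    have := integral_sub_right_eq_self (μ := (volume : Measure ℝ))
      (fun v => Real.fourierChar (-((v + t) * ξ)) • φ v) t
    simp only [sub_add_cancel] at this
    refine this.trans ?_
    rw [← integral_smul]
    congr 1
    ext v
    simp only [phase, Circle.smul_def, smul_eq_mul, ← mul_assoc]
    rw [← Circle.coe_mul, ← AddChar.map_add_eq_mul]
    congr 3
    ring

lemma memLp_comp_sub {F : Type*} [NormedAddCommGroup F] {f : ℝ → F} (hf : MemLp f 2 volume)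
    (t : ℝ) : MemLp (fun x => f (x - t)) 2 volume :=
  hf.comp_measurePreserving (measurePreserving_sub_right volume t)

/-- The pairing `(x, t) ↦ h(x) g(t) f(x - t)` of two square integrable functions with the kernel of
a convolution is integrable. -/
lemma integrable_convolution_pairing {g : ℝ → ℝ} (hg : Integrable g) (h f : L2C) :
    Integrable (fun p : ℝ × ℝ => inner ℂ (h p.1) (g p.2 • f (p.1 - p.2)))
      (volume.prod volume) := by
  have hmeas : AEStronglyMeasurable
      (fun p : ℝ × ℝ => inner ℂ (h p.1) (g p.2 • f (p.1 - p.2))) (volume.prod volume) := by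
    refine AEStronglyMeasurable.inner ?_ (AEStronglyMeasurable.fun_smul ?_ ?_)
    · exact ((Lp.stronglyMeasurable h).comp_measurable measurable_fst).aestronglyMeasurable
    · exact hg.aestronglyMeasurable.comp_snd
    · exact ((Lp.stronglyMeasurable f).comp_measurable
        (measurable_fst.sub measurable_snd)).aestronglyMeasurable
  rw [integrable_prod_iff' hmeas]
  have hint : ∀ t : ℝ, Integrable (fun x => ‖h x‖ * ‖f (x - t)‖) := fun t =>
    (Lp.memLp h).norm.integrable_mul (memLp_comp_sub (Lp.memLp f) t).norm
  have hbound : ∀ t : ℝ, ∫ x, ‖h x‖ * ‖f (x - t)‖ ≤ ‖h‖ * ‖f‖ := by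
    intro t
    have e1 : ∀ u : L2C, (∫ x, ‖u x‖ ^ (2 : ℝ)) ^ (1 / (2 : ℝ)) = ‖u‖ := by
      intro u
      rw [Lp.norm_def, eLpNorm_eq_lintegral_rpow_enorm_toReal (by norm_num) (by norm_num),
        integral_eq_lintegral_of_nonneg_ae (ae_of_all _ fun x => by positivity)
          ((Lp.aestronglyMeasurable u).norm.aemeasurable.pow_const _).aestronglyMeasurable,
        ENNReal.toReal_rpow]
      congr 2
      simp only [ENNReal.toReal_ofNat]
      congr 1
      ext x
      rw [← ENNReal.ofReal_rpow_of_nonneg (norm_nonneg _) (by norm_num), ofReal_norm]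
    have := integral_mul_le_Lp_mul_Lq_of_nonneg (μ := (volume : Measure ℝ))
      Real.HolderConjugate.two_two (f := fun x => ‖h x‖) (g := fun x => ‖f (x - t)‖)
      (ae_of_all _ fun x => norm_nonneg _) (ae_of_all _ fun x => norm_nonneg _)
      (by simpa using (Lp.memLp h).norm) (by simpa using (memLp_comp_sub (Lp.memLp f) t).norm)
    rw [integral_sub_right_eq_self (fun x => ‖f x‖ ^ (2 : ℝ)) t, e1, e1] at this
    exact this
  have hnorm : ∀ t x : ℝ, ‖inner ℂ (h x) (g t • f (x - t))‖ = |g t| * (‖h x‖ * ‖f (x - t)‖) := by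
    intro t x
    simp
    ring
  refine ⟨ae_of_all _ fun t => ?_, ?_⟩
  · refine ⟨?_, ?_⟩
    · refine AEStronglyMeasurable.inner (Lp.aestronglyMeasurable h) ?_
      exact (memLp_comp_sub (Lp.memLp f) t).aestronglyMeasurable.const_smul (g t)
    · refine HasFiniteIntegral.mono' ((hint t).const_mul |g t|).2 (ae_of_all _ fun x => ?_)
      rw [hnorm]
  · refine Integrable.mono' (hg.abs.mul_const (‖h‖ * ‖f‖)) ?_ (ae_of_all _ fun t => ?_)
    · exact hmeas.norm.prod_swap.integral_prod_right'
    · rw [Real.norm_of_nonneg (integral_nonneg fun x => norm_nonneg _)]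
      simp only [hnorm]
      rw [integral_const_mul]
      exact mul_le_mul_of_nonneg_left (hbound t) (abs_nonneg _)

/-- **Convolution theorem on `L²`.** If `m` is the Fourier transform of the integrable function `g`,
then the multiplier with symbol `m` is the convolution with `g`. -/
lemma fourierMul_eq_convolution {g : ℝ → ℝ} (hg : Integrable g) (m : Bdd ℝ)
    (hm : ∀ ξ : ℝ, ((m.1 ξ : ℝ) : ℂ) = ∫ t : ℝ, (Real.fourierChar (-(t * ξ)) : ℂ) * (g t : ℂ))
    (f : L2C) : fourierMul m f =ᵐ[volume] fun x => ∫ t : ℝ, g t • f (x - t) := by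
  -- for fixed `h`, move the pairing to the Fourier side, exchange the integrals over `t` and the
  -- frequency, and move each translate back
  have hsplit : ∀ h : L2C, ∀ᵐ x : ℝ, ∫ t, inner ℂ (h x) (g t • f (x - t))
      = inner ℂ (h x) (∫ t : ℝ, g t • f (x - t)) := by
    intro h
    filter_upwards [(integrable_convolution_pairing hg h f).prod_right_ae] with x hx
    by_cases h0 : h x = 0
    · simp [h0]
    · refine integral_inner ?_ _
      have h0' : (starRingEnd ℂ) (h x) ≠ 0 := by simpa using h0
      refine (hx.const_mul ((starRingEnd ℂ) (h x))⁻¹).congr (ae_of_all _ fun t => ?_)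
      simp only [RCLike.inner_apply]
      field_simp
  have key : ∀ h : L2C, ∫ x, inner ℂ (h x) (fourierMul m f x)
      = ∫ x, inner ℂ (h x) (∫ t : ℝ, g t • f (x - t)) := by
    intro h
    have hint : Integrable (fun p : ℝ × ℝ => ((Real.fourierChar (-(p.2 * p.1)) : ℂ) * (g p.2 : ℂ))
        * inner ℂ ((𝓕 h : L2C) p.1) ((𝓕 f : L2C) p.1)) (volume.prod volume) := by
      have hg' : Integrable fun t => (g t : ℂ) := hg.ofReal
      have h2 := (L2.integrable_inner (𝕜 := ℂ) (𝓕 h : L2C) (𝓕 f)).mul_prod hg'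
      refine (h2.bdd_mul (c := 1) (f := fun p : ℝ × ℝ => (Real.fourierChar (-(p.2 * p.1)) : ℂ))
        (Continuous.aestronglyMeasurable (by fun_prop))
        (ae_of_all _ fun p => (Circle.norm_coe _).le)).congr (ae_of_all _ fun p => ?_)
      simp only
      ring
    calc ∫ x, inner ℂ (h x) (fourierMul m f x)
        = ∫ ξ, ∫ t, ((Real.fourierChar (-(t * ξ)) : ℂ) * (g t : ℂ))
            * inner ℂ ((𝓕 h : L2C) ξ) ((𝓕 f : L2C) ξ) := by
          rw [← L2.inner_def, ← Lp.inner_fourier_eq, fourier_fourierMul, L2.inner_def]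
          refine integral_congr_ae ?_
          filter_upwards [mulOp_coeFn m (𝓕 f)] with ξ hξ
          rw [hξ, integral_mul_const, Complex.real_smul, ← hm ξ, ← smul_eq_mul, inner_smul_right]
      _ = ∫ t, ∫ ξ, ((Real.fourierChar (-(t * ξ)) : ℂ) * (g t : ℂ))
            * inner ℂ ((𝓕 h : L2C) ξ) ((𝓕 f : L2C) ξ) := integral_integral_swap hint
      _ = ∫ t, ∫ x, inner ℂ (h x) (g t • f (x - t)) := by
          congr 1
          ext t
          have h3 : (g t : ℂ) * inner ℂ h (transL2 t f)
              = ∫ x, inner ℂ (h x) (g t • f (x - t)) := by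
            rw [L2.inner_def, ← integral_const_mul]
            refine integral_congr_ae ?_
            filter_upwards [transL2_coeFn t f] with x hx
            rw [hx, ← Complex.coe_smul, inner_smul_right]
          rw [← h3, ← Lp.inner_fourier_eq, fourier_transL2, L2.inner_def, ← integral_const_mul]
          refine integral_congr_ae ?_
          filter_upwards [mulOp_coeFn (phase t) (𝓕 f)] with ξ hξ
          rw [hξ, inner_smul_right]
          simp only [phase]
          ring
      _ = ∫ x, ∫ t, inner ℂ (h x) (g t • f (x - t)) :=
          (integral_integral_swap (integrable_convolution_pairing hg h f)).symm
      _ = _ := integral_congr_ae (hsplit h)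
  -- test with indicator functions
  have hind : ∀ s : Set ℝ, ∀ hs : MeasurableSet s, ∀ hμ : volume s < ⊤, ∀ u : ℝ → ℂ,
      (fun x => inner ℂ (indicatorConstLp 2 hs hμ.ne (1 : ℂ) x) (u x))
        =ᵐ[volume] s.indicator u := by
    intro s hs hμ u
    filter_upwards [indicatorConstLp_coeFn (p := 2) (hs := hs) (hμs := hμ.ne) (c := (1 : ℂ))]
      with x hx
    rw [hx]
    by_cases hxs : x ∈ s <;> simp [hxs]
  refine ae_eq_of_forall_setIntegral_eq_of_sigmaFinite ?_ ?_ ?_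
  · intro s hs hμ
    rw [← integrable_indicator_iff hs]
    exact (L2.integrable_inner (𝕜 := ℂ) (indicatorConstLp 2 hs hμ.ne (1 : ℂ))
      (fourierMul m f)).congr (hind s hs hμ _)
  · intro s hs hμ
    rw [← integrable_indicator_iff hs]
    have h1 := (integrable_convolution_pairing hg (indicatorConstLp 2 hs hμ.ne (1 : ℂ))
      f).integral_prod_left
    exact (h1.congr (hsplit _)).congr (hind s hs hμ _)
  · intro s hs hμ
    rw [← integral_indicator hs, ← integral_indicator hs,
      ← integral_congr_ae (hind s hs hμ _), ← integral_congr_ae (hind s hs hμ _)]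
    exact key _

end

section

open scoped FourierTransform ComplexInnerProductSpace

/-! ### Averages -/

section Average

set_option linter.unusedSectionVars false

variable {F : Type*} [NormedAddCommGroup F] [NormedSpace ℝ F]

/-- The average of `f` over the interval of length `η` centred at `ξ`, for functions with values in
a normed space. On real-valued functions it is `avg`. -/
def av (η : ℝ) (f : ℝ → F) : ℝ → F :=
  fun ξ => η⁻¹ • ∫ x in (ξ - η / 2)..(ξ + η / 2), f x

/-- Integrability on all bounded intervals. -/
def LocInt (f : ℝ → F) : Prop := ∀ a b : ℝ, IntervalIntegrable f volume a b

lemma avg_eq_av (η : ℝ) (f : ℝ → ℝ) : avg η f = av η f := rfl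

lemma MeasureTheory.MemLp.locInt {f : ℝ → F} (hf : MemLp f 2 volume) : LocInt f := fun a b =>
  ((hf.locallyIntegrable (by norm_num)).integrableOn_isCompact isCompact_uIcc).intervalIntegrable

lemma Continuous.locInt {f : ℝ → F} (hf : Continuous f) : LocInt f :=
  fun a b => hf.intervalIntegrable a b

lemma LocInt.norm {f : ℝ → F} (hf : LocInt f) : LocInt fun x => ‖f x‖ :=
  fun a b => (hf a b).norm

lemma LocInt.add {f g : ℝ → F} (hf : LocInt f) (hg : LocInt g) : LocInt (f + g) :=
  fun a b => (hf a b).add (hg a b)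

lemma LocInt.sub {f g : ℝ → F} (hf : LocInt f) (hg : LocInt g) : LocInt (f - g) :=
  fun a b => (hf a b).sub (hg a b)

lemma LocInt.const_smul {f : ℝ → F} (hf : LocInt f) (c : ℝ) : LocInt (c • f) :=
  fun a b => (hf a b).smul c

lemma LocInt.bdd_smul {f : ℝ → F} (hf : LocInt f) (W : Bdd ℝ) :
    LocInt fun x => W.1 x • f x := by
  intro a b
  obtain ⟨hm, C, hC⟩ := W.2
  rw [intervalIntegrable_iff]
  exact (intervalIntegrable_iff.1 (hf a b)).bdd_smul C
    hm.aestronglyMeasurable (ae_of_all _ hC)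

lemma Bdd.locInt (W : Bdd ℝ) : LocInt W.1 := by
  have h := LocInt.bdd_smul (F := ℝ) (f := fun _ => (1 : ℝ)) continuous_const.locInt W
  simpa using h

lemma av_zero (f : ℝ → F) : av 0 f = 0 := by
  ext x; simp [av]

lemma av_neg_eta (η : ℝ) (f : ℝ → F) : av (-η) f = av η f := by
  ext x
  simp only [av]
  rw [show x - -η / 2 = x + η / 2 by ring, show x + -η / 2 = x - η / 2 by ring,
    intervalIntegral.integral_symm, inv_neg, smul_neg, neg_smul, neg_neg]

lemma av_abs (η : ℝ) (f : ℝ → F) : av |η| f = av η f := by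
  rcases abs_choice η with h | h <;> rw [h]
  exact av_neg_eta η f

lemma av_congr_ae {η : ℝ} {f g : ℝ → F} (h : f =ᵐ[volume] g) : av η f = av η g := by
  ext x
  simp only [av]
  congr 1
  exact intervalIntegral.integral_congr_ae (h.mono fun x hx _ => hx)

lemma av_comp_neg (η : ℝ) (f : ℝ → F) (x : ℝ) : av η (fun y => f (-y)) x = av η f (-x) := by
  simp only [av]
  rw [intervalIntegral.integral_comp_neg]
  congr 2 <;> ring

lemma av_add {f g : ℝ → F} (η : ℝ) (hf : LocInt f) (hg : LocInt g) :
    av η (f + g) = av η f + av η g := by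
  ext x
  simp only [av, Pi.add_apply]
  rw [intervalIntegral.integral_add (hf _ _) (hg _ _), smul_add]

lemma av_sub {f g : ℝ → F} (η : ℝ) (hf : LocInt f) (hg : LocInt g) :
    av η (f - g) = av η f - av η g := by
  ext x
  simp only [av, Pi.sub_apply]
  rw [intervalIntegral.integral_sub (hf _ _) (hg _ _), smul_sub]

lemma av_smul (η c : ℝ) (f : ℝ → F) : av η (c • f) = c • av η f := by
  ext x
  simp only [av, Pi.smul_apply]
  rw [intervalIntegral.integral_smul, smul_comm]

lemma av_clm {F' : Type*} [NormedAddCommGroup F'] [NormedSpace ℝ F'] [CompleteSpace F]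
    [CompleteSpace F'] (φ : F →L[ℝ] F') {f : ℝ → F} (η : ℝ) (hf : LocInt f) (x : ℝ) :
    av η (fun y => φ (f y)) x = φ (av η f x) := by
  simp only [av]
  rw [φ.intervalIntegral_comp_comm (hf _ _), map_smul]

lemma av_const [CompleteSpace F] {η : ℝ} (hη : η ≠ 0) (c : F) (x : ℝ) :
    av η (fun _ => c) x = c := by
  simp only [av]
  rw [intervalIntegral.integral_const, smul_smul, show x + η / 2 - (x - η / 2) = η by ring,
    inv_mul_cancel₀ hη, one_smul]

lemma av_mono {f g : ℝ → ℝ} (η : ℝ) (hf : LocInt f) (hg : LocInt g) (x : ℝ)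
    (h : ∀ y, |y - x| ≤ |η| / 2 → f y ≤ g y) : av η f x ≤ av η g x := by
  rw [← av_abs η f, ← av_abs η g]
  simp only [av, smul_eq_mul]
  refine mul_le_mul_of_nonneg_left ?_ (inv_nonneg.2 (abs_nonneg _))
  refine intervalIntegral.integral_mono_on (by linarith [abs_nonneg η]) (hf _ _) (hg _ _) ?_
  intro y hy
  refine h y (abs_le.2 ⟨?_, ?_⟩) <;> linarith [hy.1, hy.2]

lemma norm_av_le (η : ℝ) (f : ℝ → F) (x : ℝ) : ‖av η f x‖ ≤ av η (fun y => ‖f y‖) x := by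
  rw [← av_abs η f, ← av_abs η fun y => ‖f y‖]
  simp only [av]
  rw [norm_smul, norm_inv, Real.norm_eq_abs, abs_abs, smul_eq_mul]
  refine mul_le_mul_of_nonneg_left ?_ (inv_nonneg.2 (abs_nonneg _))
  exact intervalIntegral.norm_integral_le_integral_norm (by linarith [abs_nonneg η])

lemma norm_av_le_of_forall {f : ℝ → F} {C : ℝ} (hf : LocInt f) (η x : ℝ)
    (hC : ∀ y, |y - x| ≤ |η| / 2 → ‖f y‖ ≤ C) : ‖av η f x‖ ≤ C := by
  rcases eq_or_ne η 0 with rfl | hη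
  · rw [av_zero]
    simpa using (norm_nonneg _).trans (hC x (by simp))
  · refine (norm_av_le η f x).trans ?_
    rw [← av_const hη C x]
    exact av_mono η hf.norm continuous_const.locInt x hC

lemma continuous_av {f : ℝ → F} (hf : LocInt f) (η : ℝ) : Continuous (av η f) := by
  have h0 : Continuous fun x => ∫ t in (0 : ℝ)..x, f t :=
    intervalIntegral.continuous_primitive hf 0
  have h : av η f = fun x => η⁻¹ • ((∫ t in (0 : ℝ)..(x + η / 2), f t)
      - ∫ t in (0 : ℝ)..(x - η / 2), f t) := by
    ext x
    simp only [av]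
    rw [intervalIntegral.integral_interval_sub_left (hf _ _) (hf _ _)]
  rw [h]
  fun_prop

end Average

/-- The symbol `ξ ↦ sinc(πηξ)` of the average over an interval of length `η`. -/
def avSymbol (η : ℝ) : Bdd ℝ :=
  ⟨fun ξ => Real.sinc (Real.pi * η * ξ),
    Real.measurable_sinc.comp (measurable_const_mul _), 1, fun _ => Real.abs_sinc_le_one _⟩

/-- The averaging operator on `L²(ℝ; ℂ)`. For `η = 0` it is the identity, while `av 0 f = 0`. -/
def avOp (η : ℝ) : L2C →L[ℂ] L2C := fourierMul (avSymbol η)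

lemma norm_avOp_le (η : ℝ) : ‖avOp η‖ ≤ 1 :=
  norm_fourierMul_le _ fun _ => Real.abs_sinc_le_one _

lemma norm_avOp_apply_le (η : ℝ) (f : L2C) : ‖avOp η f‖ ≤ ‖f‖ := by
  simpa using (avOp η).le_of_opNorm_le (norm_avOp_le η) f

lemma avOp_abs (η : ℝ) : avOp |η| = avOp η := by
  rcases abs_choice η with h | h <;> rw [h]
  unfold avOp
  congr 1
  ext ξ
  simp [avSymbol]

lemma avOp_coeFn {η : ℝ} (hη : η ≠ 0) (f : L2C) : avOp η f =ᵐ[volume] av η f := by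
  rw [← avOp_abs, ← av_abs]
  have hpos : 0 < |η| := abs_pos.2 hη
  generalize |η| = a at hpos
  have hle : -(a / 2) ≤ a / 2 := by linarith
  let g : ℝ → ℝ := (Set.Ioc (-(a / 2)) (a / 2)).indicator fun _ => a⁻¹
  have hg : Integrable g :=
    (integrable_indicator_iff measurableSet_Ioc).2 (integrableOn_const (by simp))
  have h := fourierMul_eq_convolution hg (avSymbol a) (fun ξ => ?_) f
  · refine h.trans (ae_of_all _ fun x => ?_)
    have h1 : ∀ t, g t • f (x - t)
        = (Set.Ioc (-(a / 2)) (a / 2)).indicator (fun t => a⁻¹ • f (x - t)) t := by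
      intro t
      by_cases ht : t ∈ Set.Ioc (-(a / 2)) (a / 2) <;> simp [g, ht]
    simp only [h1]
    rw [integral_indicator measurableSet_Ioc, ← intervalIntegral.integral_of_le hle,
      intervalIntegral.integral_smul, intervalIntegral.integral_comp_sub_left]
    simp [av]
  · have h1 : ∀ t, (Real.fourierChar (-(t * ξ)) : ℂ) * (g t : ℂ)
        = (Set.Ioc (-(a / 2)) (a / 2)).indicator
            (fun t => (a : ℂ)⁻¹ * Complex.exp ((((-(2 * Real.pi * ξ)) * t : ℝ) : ℂ) * Complex.I))
            t := by
      intro t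
      by_cases ht : t ∈ Set.Ioc (-(a / 2)) (a / 2)
      · simp only [g, ht, Set.indicator_of_mem, Real.fourierChar_apply]
        rw [mul_comm]
        push_cast
        ring_nf
      · simp [g, ht]
    simp only [h1]
    rw [integral_indicator measurableSet_Ioc, ← intervalIntegral.integral_of_le hle,
      intervalIntegral.integral_const_mul]
    rcases eq_or_ne ξ 0 with rfl | hξ
    · simp [avSymbol, hpos.ne']
    · have hc : -(2 * Real.pi * ξ) ≠ 0 := by
        simp [hξ, Real.pi_ne_zero]
      rw [intervalIntegral.integral_comp_mul_left
        (fun t : ℝ => Complex.exp ((t : ℂ) * Complex.I)) hc, mul_neg,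
        integral_exp_mul_I_eq_sinc]
      have : Real.sinc (-(2 * Real.pi * ξ) * (a / 2)) = Real.sinc (Real.pi * a * ξ) := by
        rw [← Real.sinc_neg]; congr 1; ring
      rw [this]
      have hξ' : (ξ : ℂ) ≠ 0 := by exact_mod_cast hξ
      have ha' : (a : ℂ) ≠ 0 := by exact_mod_cast hpos.ne'
      have hp' : (Real.pi : ℂ) ≠ 0 := by exact_mod_cast Real.pi_ne_zero
      simp only [avSymbol, Complex.real_smul]
      push_cast
      field_simp

/-- The average of a bounded measurable function. -/
def avBdd (η : ℝ) (W : Bdd ℝ) : Bdd ℝ :=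
  ⟨av η W.1, (continuous_av (Bdd.locInt W) η).measurable, by
    obtain ⟨_, C, hC⟩ := W.2
    exact ⟨C, fun x => norm_av_le_of_forall (Bdd.locInt W) η x fun y _ => hC y⟩⟩

/-- The modulus of an element of `L²`, as a complex-valued function. -/
def absL2 (f : L2C) : L2C := ((Lp.memLp f).norm.ofReal (K := ℂ)).toLp

lemma absL2_coeFn (f : L2C) : absL2 f =ᵐ[volume] fun x => ((‖f x‖ : ℝ) : ℂ) :=
  ((Lp.memLp f).norm.ofReal (K := ℂ)).coeFn_toLp

lemma norm_absL2 (f : L2C) : ‖absL2 f‖ = ‖f‖ := by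
  refine le_antisymm ?_ ?_ <;> refine Lp.norm_le_norm_of_ae_le ?_ <;>
  filter_upwards [absL2_coeFn f] with x hx <;> simp [hx]

/-- Averages almost commute with the multiplication by a Lipschitz function. -/
lemma norm_avOp_commutator_le {W : Bdd ℝ} {K : ℝ} (hK : 0 ≤ K)
    (hW : ∀ x y, |W.1 x - W.1 y| ≤ K * |x - y|) {η : ℝ} (hη : η ≠ 0) (f : L2C) :
    ‖mulOp (avBdd η W) (avOp η f) - avOp η (mulOp W f)‖ ≤ K * |η| * ‖f‖ := by
  have hf : LocInt f := (Lp.memLp f).locInt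
  have h1 : ‖mulOp (avBdd η W) (avOp η f) - avOp η (mulOp W f)‖
      ≤ K * |η| * ‖avOp η (absL2 f)‖ := by
    refine Lp.norm_le_mul_norm_of_ae_le_mul ?_
    filter_upwards [mulOp_coeFn (avBdd η W) (avOp η f), avOp_coeFn hη f,
      avOp_coeFn hη (mulOp W f), Lp.coeFn_sub (mulOp (avBdd η W) (avOp η f)) (avOp η (mulOp W f)),
      avOp_coeFn hη (absL2 f)] with x e1 e2 e3 e4 e5
    rw [e4, Pi.sub_apply, e1, e2, e3, e5, av_congr_ae (mulOp_coeFn W f),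
      av_congr_ae (absL2_coeFn f)]
    have h2 : av η (fun y => ((‖f y‖ : ℝ) : ℂ)) x = ((av η (fun y => ‖f y‖) x : ℝ) : ℂ) :=
      av_clm Complex.ofRealCLM η hf.norm x
    have h0 : 0 ≤ av η (fun y => ‖f y‖) x := (norm_nonneg _).trans (norm_av_le η f x)
    rw [h2, Complex.norm_real, Real.norm_of_nonneg h0]
    -- the commutator averages `(av W x - W y) f y`, where `av W x` is within `K |η|` of `W y`
    have h3 : (avBdd η W).1 x • av η f x - av η (fun y => W.1 y • f y) x
        = av η (fun y => ((avBdd η W).1 x - W.1 y) • f y) x := by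
      have := av_sub η (hf.const_smul ((avBdd η W).1 x)) (LocInt.bdd_smul hf W)
      rw [av_smul] at this
      rw [← Pi.smul_apply, ← Pi.sub_apply, ← this]
      congr 1
      ext y
      simp [sub_mul]
    have h4 : LocInt fun y => ((avBdd η W).1 x - W.1 y) • f y := by
      have := (hf.const_smul ((avBdd η W).1 x)).sub (LocInt.bdd_smul hf W)
      convert this using 1
      ext y
      simp [sub_mul]
    rw [h3]
    refine (norm_av_le η _ x).trans ?_
    have h5 := congrFun (av_smul η (K * |η|) fun y => ‖f y‖) x
    rw [Pi.smul_apply, smul_eq_mul] at h5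
    rw [← h5]
    refine av_mono η h4.norm (hf.norm.const_smul _) x fun y hy => ?_
    rw [norm_smul, Pi.smul_apply, smul_eq_mul]
    refine mul_le_mul_of_nonneg_right ?_ (norm_nonneg _)
    have h6 : (avBdd η W).1 x - W.1 y = av η (fun z => W.1 z - W.1 y) x := by
      have := congrFun (av_sub (g := fun _ => W.1 y) η (Bdd.locInt W) continuous_const.locInt) x
      rw [Pi.sub_apply, av_const hη] at this
      exact this.symm
    rw [h6]
    refine norm_av_le_of_forall ((Bdd.locInt W).sub continuous_const.locInt) η x fun z hz => ?_
    refine (hW z y).trans (mul_le_mul_of_nonneg_left ?_ hK)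
    have := abs_sub_le z x y
    rw [abs_sub_comm x y] at this
    linarith
  refine h1.trans (mul_le_mul_of_nonneg_left ?_ (by positivity))
  exact (norm_avOp_apply_le η _).trans_eq (norm_absL2 f)

end

section

open scoped FourierTransform ComplexInnerProductSpace

lemma norm_sq_eq_integral (f : L2C) : ‖f‖ ^ 2 = ∫ x, ‖f x‖ ^ 2 := by
  have h := inner_self_eq_norm_sq_to_K (𝕜 := ℂ) f
  rw [L2.inner_def] at h
  simp only [inner_self_eq_norm_sq_to_K] at h
  norm_cast at h
  exact_mod_cast h.symm

/-! ### Hilbert-Schmidt operators -/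

/-- An operator on `L²` given by a kernel `x ↦ k x` in `L²(ℝ; L²)` is compact: it is the norm limit
of the finite rank operators whose kernels are simple functions. -/
lemma isCompactOperator_of_kernel {S : L2C →L[ℂ] L2C} {k : ℝ → L2C} (hk : MemLp k 2 volume)
    (hS : ∀ f, S f =ᵐ[volume] fun x => inner ℂ (k x) f) : IsCompactOperator S := by
  suffices h : S ∈ closure {A : L2C →L[ℂ] L2C | IsCompactOperator A} by
    rwa [IsClosed.closure_eq isClosed_setOfPred_isCompactOperator] at h
  refine Metric.mem_closure_iff.2 fun ε hε => ?_
  obtain ⟨s, hs, hsm⟩ := hk.exists_simpleFunc_eLpNorm_sub_lt (by norm_num)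
    (ENNReal.ofReal_pos.2 (half_pos hε)).ne'
  have hχ : ∀ e : L2C, ∃ χ : L2C, e ≠ 0 →
      χ =ᵐ[volume] (s ⁻¹' {e}).indicator fun _ => (1 : ℂ) := by
    intro e
    by_cases he : e = 0
    · exact ⟨0, fun h => absurd he h⟩
    · exact ⟨indicatorConstLp 2 (s.measurableSet_fiber e)
        (SimpleFunc.measure_preimage_lt_top_of_memLp (by norm_num) (by norm_num) s hsm e he).ne 1,
        fun _ => indicatorConstLp_coeFn⟩
  choose χ hχ using hχ
  let A : L2C →L[ℂ] L2C := ∑ e ∈ s.range, (innerSL ℂ e).smulRight (χ e)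
  have hA : ∀ f, A f =ᵐ[volume] fun x => inner ℂ (s x) f := by
    intro f
    have h0 : A f = ∑ e ∈ s.range, inner ℂ e f • χ e := by
      simp [A]
    have h1 : ∀ e ∈ s.range, ∀ᵐ x, (inner ℂ e f • χ e : L2C) x
        = inner ℂ e f * (s ⁻¹' {e}).indicator (fun _ => (1 : ℂ)) x := by
      intro e _
      by_cases he : e = 0
      · filter_upwards [Lp.coeFn_smul (inner ℂ e f) (χ e)] with x hx
        rw [hx, he]
        simp
      · filter_upwards [Lp.coeFn_smul (inner ℂ e f) (χ e), hχ e he] with x hx hx'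
        rw [hx, Pi.smul_apply, hx', smul_eq_mul]
    rw [h0]
    filter_upwards [Lp.coeFn_finsetSum s.range fun e => (inner ℂ e f • χ e : L2C),
      (Finset.eventually_all s.range).2 h1] with x hx hx'
    rw [hx, Finset.sum_apply, Finset.sum_congr rfl hx', Finset.sum_eq_single (s x)]
    · simp
    · intro e _ he
      have : x ∉ s ⁻¹' {e} := fun h => he (by simpa using h.symm)
      simp [this]
    · intro h
      exact absurd (s.mem_range_self x) h
  refine ⟨A, ?_, ?_⟩
  · refine Submodule.sum_mem (compactOperator (RingHom.id ℂ) L2C L2C) fun e _ => ?_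
    exact (isCompactOperator_of_locallyCompactSpace_dom (innerSL ℂ e)).clm_comp
      (ContinuousLinearMap.toSpanSingleton ℂ (χ e))
  · rw [dist_eq_norm]
    refine lt_of_le_of_lt (ContinuousLinearMap.opNorm_le_bound _ (half_pos hε).le fun f => ?_)
      (half_lt_self hε)
    have hle : eLpNorm ((S - A) f) 2 volume
        ≤ ENNReal.ofReal (‖f‖) * eLpNorm (k - ⇑s) 2 volume := by
      refine eLpNorm_le_mul_eLpNorm_of_ae_le_mul ?_ 2
      filter_upwards [hS f, hA f, Lp.coeFn_sub (S f) (A f)] with x h1 h2 h3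
      rw [sub_apply, h3, Pi.sub_apply, h1, h2, ← inner_sub_left, mul_comm]
      exact norm_inner_le_norm _ _
    rw [Lp.norm_def]
    refine ENNReal.toReal_le_of_le_ofReal (by positivity) (hle.trans ?_)
    rw [mul_comm (ε / 2), ENNReal.ofReal_mul (norm_nonneg _)]
    gcongr

/-! ### The resolvent of the second derivative -/

/-- The Green function `e^{-a|x|} / (2a)` of the operator `a² - ∂²`. -/
def greenKernel (a x : ℝ) : ℝ := Real.exp (-a * |x|) / (2 * a)

lemma continuous_greenKernel (a : ℝ) : Continuous (greenKernel a) := by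
  unfold greenKernel; fun_prop

lemma greenKernel_neg (a x : ℝ) : greenKernel a (-x) = greenKernel a x := by
  simp [greenKernel]

lemma integrable_exp_neg_mul_abs {a : ℝ} (ha : 0 < a) :
    Integrable fun x : ℝ => Real.exp (-a * |x|) := by
  rw [← integrableOn_univ, ← Set.Iic_union_Ioi (a := (0 : ℝ))]
  refine IntegrableOn.union ?_ ?_
  · refine (integrableOn_exp_mul_Iic ha 0).congr_fun (fun x hx => ?_) measurableSet_Iic
    simp only
    rw [abs_of_nonpos hx, neg_mul_neg]
  · refine (integrableOn_exp_mul_Ioi (neg_lt_zero.2 ha) 0).congr_fun (fun x hx => ?_)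
      measurableSet_Ioi
    simp only
    rw [abs_of_pos hx]

lemma integrable_greenKernel {a : ℝ} (ha : 0 < a) : Integrable (greenKernel a) :=
  (integrable_exp_neg_mul_abs ha).div_const _

lemma greenKernel_sq (a x : ℝ) :
    greenKernel a x ^ 2 = Real.exp (-(2 * a) * |x|) / (2 * a) ^ 2 := by
  rw [greenKernel, div_pow, ← Real.exp_nat_mul]
  congr 2
  push_cast; ring

lemma memLp_greenKernel {a : ℝ} (ha : 0 < a) : MemLp (greenKernel a) 2 volume := by
  rw [memLp_two_iff_integrable_sq (continuous_greenKernel a).aestronglyMeasurable]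
  simp only [greenKernel_sq]
  exact (integrable_exp_neg_mul_abs (by positivity)).div_const _

/-- The symbol `1 / (a² + (2πξ)²)` of the inverse of `a² - ∂²`. -/
def greenSymbol (a : ℝ) (ha : 0 < a) : Bdd ℝ :=
  ⟨fun ξ => 1 / (a ^ 2 + (2 * Real.pi * ξ) ^ 2), by
    constructor
    · exact Measurable.const_div (by fun_prop) _
    · refine ⟨1 / a ^ 2, fun ξ => ?_⟩
      rw [Real.norm_of_nonneg (by positivity)]
      exact one_div_le_one_div_of_le (by positivity) (by nlinarith [sq_nonneg (2 * Real.pi * ξ)])⟩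

/-- The operator `(a² - ∂²)⁻¹` on `L²(ℝ; ℂ)`. -/
def greenOp (a : ℝ) (ha : 0 < a) : L2C →L[ℂ] L2C := fourierMul (greenSymbol a ha)

lemma fourier_greenKernel {a : ℝ} (ha : 0 < a) (ξ : ℝ) :
    ∫ t : ℝ, (Real.fourierChar (-(t * ξ)) : ℂ) * (greenKernel a t : ℂ)
      = ((1 / (a ^ 2 + (2 * Real.pi * ξ) ^ 2) : ℝ) : ℂ) := by
  have hint : Integrable fun t : ℝ =>
      (Real.fourierChar (-(t * ξ)) : ℂ) * (greenKernel a t : ℂ) :=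
    (integrable_greenKernel ha).ofReal.bdd_mul (c := 1)
      (Continuous.aestronglyMeasurable (by fun_prop)) (ae_of_all _ fun p => (Circle.norm_coe _).le)
  have hz : ∀ s : ℝ, (a : ℂ) + s * Complex.I ≠ 0 := fun s h => ha.ne' (by
    simpa using congrArg Complex.re h)
  have h1 := hz (2 * Real.pi * ξ)
  have h2 := hz (-(2 * Real.pi * ξ))
  have ha' : (a : ℂ) ≠ 0 := by exact_mod_cast ha.ne'
  rw [← intervalIntegral.integral_Iic_add_Ioi hint.integrableOn hint.integrableOn (b := 0)]
  have hI : ∫ t : ℝ in Set.Iic 0, (Real.fourierChar (-(t * ξ)) : ℂ) * (greenKernel a t : ℂ)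
      = (1 / (2 * a)) * (1 / (a + ((-(2 * Real.pi * ξ) : ℝ) : ℂ) * Complex.I)) := by
    have := integral_exp_mul_complex_Iic
      (a := (a + ((-(2 * Real.pi * ξ) : ℝ) : ℂ) * Complex.I)) (by simpa using ha) 0
    rw [Complex.ofReal_zero, mul_zero, Complex.exp_zero] at this
    rw [← this, ← integral_const_mul]
    refine setIntegral_congr_fun measurableSet_Iic fun t ht => ?_
    have : greenKernel a t = Real.exp (a * t) / (2 * a) := by
      rw [greenKernel, abs_of_nonpos ht]; congr 2; ring
    simp only [this, Real.fourierChar_apply]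
    push_cast
    rw [mul_div_assoc', ← Complex.exp_add, div_mul_eq_mul_div, one_mul]
    congr 2
    ring
  have hJ : ∫ t : ℝ in Set.Ioi 0, (Real.fourierChar (-(t * ξ)) : ℂ) * (greenKernel a t : ℂ)
      = (1 / (2 * a)) * (1 / (a + ((2 * Real.pi * ξ : ℝ) : ℂ) * Complex.I)) := by
    have := integral_exp_mul_complex_Ioi
      (a := -(a + ((2 * Real.pi * ξ : ℝ) : ℂ) * Complex.I)) (by simpa using ha) 0
    rw [Complex.ofReal_zero, mul_zero, Complex.exp_zero, neg_div_neg_eq] at this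
    rw [← this, ← integral_const_mul]
    refine setIntegral_congr_fun measurableSet_Ioi fun t ht => ?_
    have : greenKernel a t = Real.exp (-a * t) / (2 * a) := by
      rw [greenKernel, abs_of_pos ht]
    simp only [this, Real.fourierChar_apply]
    push_cast
    rw [mul_div_assoc', ← Complex.exp_add, div_mul_eq_mul_div, one_mul]
    congr 2
    ring
  have h3 : (a : ℂ) ^ 2 + (2 * Real.pi * ξ) ^ 2
      = (a + ((2 * Real.pi * ξ : ℝ) : ℂ) * Complex.I)
        * (a + ((-(2 * Real.pi * ξ) : ℝ) : ℂ) * Complex.I) := by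
    push_cast
    ring_nf
    rw [Complex.I_sq]; ring
  rw [hI, hJ]
  push_cast at h1 h2 h3 ⊢
  rw [h3, ← mul_add, one_div_add_one_div h2 h1]
  field_simp
  ring

lemma greenOp_coeFn {a : ℝ} (ha : 0 < a) (f : L2C) :
    greenOp a ha f =ᵐ[volume] fun x => ∫ y : ℝ, greenKernel a (x - y) • f y := by
  refine (fourierMul_eq_convolution (integrable_greenKernel ha) (greenSymbol a ha)
    (fun ξ => (fourier_greenKernel ha ξ).symm) f).trans (ae_of_all _ fun x => ?_)
  have := integral_sub_left_eq_self (fun y => greenKernel a (x - y) • f y) volume x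
  simpa using this

/-- The resolvent composed with a square integrable potential is compact. -/
lemma isCompactOperator_greenOp_mulOp {a : ℝ} (ha : 0 < a) {W : Bdd ℝ}
    (hW : MemLp W.1 2 volume) : IsCompactOperator (greenOp a ha ∘L mulOp W) := by
  have hG : MemLp (fun x => (greenKernel a x : ℂ)) 2 volume := (memLp_greenKernel ha).ofReal
  let k : ℝ → L2C := fun x => mulOp W (transL2 x hG.toLp)
  have hk : ∀ x, k x =ᵐ[volume] fun y => ((W.1 y * greenKernel a (x - y) : ℝ) : ℂ) := by
    intro x
    have h1 := (measurePreserving_sub_right (volume : Measure ℝ) x).quasiMeasurePreserving.ae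
      hG.coeFn_toLp
    filter_upwards [mulOp_coeFn W (transL2 x hG.toLp), transL2_coeFn x hG.toLp, h1]
      with y e1 e2 e3
    rw [e1, e2, e3, ← greenKernel_neg a (x - y), neg_sub]
    simp
  have hcont : Continuous k := by
    refine (mulOp W).continuous.comp ?_
    let g : ℝ → C(ℝ, ℝ) := fun x => ⟨fun y => y - x, by fun_prop⟩
    have hg : Continuous g :=
      ContinuousMap.continuous_of_continuous_uncurry _ (continuous_snd.sub continuous_fst)
    exact (continuous_const (y := hG.toLp)).compMeasurePreservingLp hg
      (fun x => measurePreserving_sub_right volume x) (by norm_num)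
  refine isCompactOperator_of_kernel (k := k) ?_ ?_
  · rw [memLp_two_iff_integrable_sq_norm hcont.aestronglyMeasurable]
    have h := (((memLp_two_iff_integrable_sq hW.aestronglyMeasurable).1 hW)).integrable_convolution
      (ContinuousLinearMap.mul ℝ ℝ) ((memLp_two_iff_integrable_sq
        (memLp_greenKernel ha).aestronglyMeasurable).1 (memLp_greenKernel ha))
    refine h.congr (ae_of_all _ fun x => ?_)
    simp only
    rw [norm_sq_eq_integral, convolution_def]
    refine integral_congr_ae ?_
    filter_upwards [hk x] with y hy
    rw [hy, Complex.norm_real, Real.norm_eq_abs, sq_abs, mul_pow]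
    rfl
  · intro f
    refine (greenOp_coeFn ha (mulOp W f)).trans (ae_of_all _ fun x => ?_)
    simp only
    rw [L2.inner_def]
    refine integral_congr_ae ?_
    filter_upwards [mulOp_coeFn W f, hk x] with y e1 e2
    rw [e1, e2]
    simp
    ring

end

section

open scoped FourierTransform ComplexInnerProductSpace

/-! ### Even functions and the linearized soliton equation -/

/-- The reflection `f ↦ f(-·)` on `L²(ℝ; ℂ)`. -/
def reflOp : L2C →L[ℂ] L2C :=
  (Lp.compMeasurePreservingₗᵢ ℂ (fun x : ℝ => -x)
    (Measure.measurePreserving_neg volume)).toContinuousLinearMap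

lemma reflOp_coeFn (f : L2C) : reflOp f =ᵐ[volume] fun x => f (-x) :=
  Lp.coeFn_compMeasurePreserving f (Measure.measurePreserving_neg volume)

lemma ae_neg {p : ℝ → Prop} (h : ∀ᵐ x : ℝ, p x) : ∀ᵐ x : ℝ, p (-x) :=
  (Measure.measurePreserving_neg (volume : Measure ℝ)).quasiMeasurePreserving.ae h

lemma reflOp_reflOp (f : L2C) : reflOp (reflOp f) = f := by
  refine Lp.ext ?_
  filter_upwards [reflOp_coeFn (reflOp f), ae_neg (reflOp_coeFn f)] with x h1 h2
  rw [h1, h2, neg_neg]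

lemma norm_reflOp (f : L2C) : ‖reflOp f‖ = ‖f‖ :=
  (Lp.compMeasurePreservingₗᵢ ℂ (fun x : ℝ => -x)
    (Measure.measurePreserving_neg volume)).norm_map f

/-- The orthogonal projection of `L²(ℝ; ℂ)` onto the even functions. -/
def evenOp : L2C →L[ℂ] L2C := (1 / 2 : ℂ) • (1 + reflOp)

lemma evenOp_coeFn (f : L2C) : evenOp f =ᵐ[volume] fun x => (1 / 2 : ℂ) * (f x + f (-x)) := by
  have h : evenOp f = (1 / 2 : ℂ) • (f + reflOp f) := rfl
  rw [h]
  filter_upwards [Lp.coeFn_smul (1 / 2 : ℂ) (f + reflOp f), Lp.coeFn_add f (reflOp f),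
    reflOp_coeFn f] with x h1 h2 h3
  rw [h1, Pi.smul_apply, h2, Pi.add_apply, h3, smul_eq_mul]

lemma evenOp_of_reflOp {f : L2C} (hf : reflOp f = f) : evenOp f = f := by
  have h : evenOp f = (1 / 2 : ℂ) • (f + reflOp f) := rfl
  rw [h, hf, ← two_smul ℂ f, smul_smul]
  norm_num

lemma reflOp_evenOp (f : L2C) : reflOp (evenOp f) = evenOp f := by
  have h : evenOp f = (1 / 2 : ℂ) • (f + reflOp f) := rfl
  rw [h, map_smul, map_add, reflOp_reflOp, add_comm]

lemma norm_evenOp_le (f : L2C) : ‖evenOp f‖ ≤ ‖f‖ := by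
  have h : evenOp f = (1 / 2 : ℂ) • (f + reflOp f) := rfl
  rw [h, norm_smul]
  have := norm_add_le f (reflOp f)
  rw [norm_reflOp] at this
  norm_num
  linarith

/-- Uniqueness for the Cauchy problem of `u'' = p u`. -/
lemma eq_zero_of_linear_ode {F : Type*} [NormedAddCommGroup F] [NormedSpace ℝ F] {p : ℝ → ℝ}
    (hp : Continuous p) {u u' : ℝ → F} (hu : ∀ t, HasDerivAt u (u' t) t)
    (hu' : ∀ t, HasDerivAt u' (p t • u t) t) (h0 : u 0 = 0) (h0' : u' 0 = 0) (t : ℝ) :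
    u t = 0 := by
  obtain ⟨K, hK⟩ := (isCompact_Icc (a := -(|t| + 1)) (b := |t| + 1)).exists_bound_of_continuousOn
    hp.continuousOn
  have hK0 : 0 ≤ K := (norm_nonneg _).trans (hK 0 ⟨by linarith [abs_nonneg t], by positivity⟩)
  lift K to ℝ≥0 using hK0
  have hsol : ∀ s, HasDerivAt (fun s => (u s, u' s)) (u' s, p s • u s) s :=
    fun s => (hu s).prodMk (hu' s)
  have key := ODE_solution_unique_of_mem_Icc (K := K + 1)
    (v := fun s (y : F × F) => (y.2, p s • y.1)) (s := fun _ => Set.univ)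
    (a := -(|t| + 1)) (b := |t| + 1) (t₀ := 0) (f := fun s => (u s, u' s)) (g := fun _ => 0)
    ?_ ⟨by linarith [abs_nonneg t], by positivity⟩
    (fun s _ => (hsol s).continuousAt.continuousWithinAt) (fun s _ => hsol s)
    (fun _ _ => trivial) continuousOn_const ?_ (fun _ _ => trivial) (by simp [h0, h0'])
  · have := key (x := t) ⟨by linarith [neg_abs_le t], by linarith [le_abs_self t]⟩
    exact congrArg Prod.fst this
  · intro s hs
    refine (LipschitzWith.of_dist_le_mul fun y z => ?_).lipschitzOnWith
    simp only [dist_eq_norm, NNReal.coe_add, NNReal.coe_one]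
    rw [show ((y.2, p s • y.1) - (z.2, p s • z.1) : F × F) = ((y - z).2, p s • (y - z).1) by
      simp [smul_sub]]
    refine max_le ?_ ?_
    · exact (norm_snd_le (y - z)).trans (le_mul_of_one_le_left (norm_nonneg _) (by linarith [K.coe_nonneg]))
    · rw [norm_smul]
      have h1 := hK s ⟨hs.1.le, hs.2.le⟩
      exact mul_le_mul (by linarith) (norm_fst_le (y - z)) (norm_nonneg _) (by positivity)
  · intro s _
    convert! hasDerivAt_const s (0 : F × F) using 1
    simp

section Green

variable {a : ℝ} {f : ℝ → ℂ} {M : ℝ}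

lemma integrable_greenKernel_smul (ha : 0 < a) (hf : Continuous f) (hM : ∀ x, ‖f x‖ ≤ M) (x : ℝ) :
    Integrable fun y => greenKernel a (x - y) • f y :=
  ((integrable_greenKernel ha).comp_sub_left x).smul_bdd M hf.aestronglyMeasurable
    (ae_of_all _ hM)

lemma integrableOn_exp_smul_Iic (ha : 0 < a) (hf : Continuous f) (hM : ∀ x, ‖f x‖ ≤ M) (x : ℝ) :
    IntegrableOn (fun y => Real.exp (a * y) • f y) (Set.Iic x) :=
  (integrableOn_exp_mul_Iic ha x).smul_bdd M hf.aestronglyMeasurable (ae_of_all _ hM)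

lemma integrableOn_exp_smul_Ioi (ha : 0 < a) (hf : Continuous f) (hM : ∀ x, ‖f x‖ ≤ M) (x : ℝ) :
    IntegrableOn (fun y => Real.exp (-a * y) • f y) (Set.Ioi x) :=
  (integrableOn_exp_mul_Ioi (neg_lt_zero.2 ha) x).smul_bdd M hf.aestronglyMeasurable
    (ae_of_all _ hM)

lemma integral_greenKernel_smul (ha : 0 < a) (hf : Continuous f) (hM : ∀ x, ‖f x‖ ≤ M) (x : ℝ) :
    ∫ y, greenKernel a (x - y) • f y = (1 / (2 * a)) •
      (Real.exp (-a * x) • (∫ y in Set.Iic x, Real.exp (a * y) • f y)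
        + Real.exp (a * x) • ∫ y in Set.Ioi x, Real.exp (-a * y) • f y) := by
  have h := integrable_greenKernel_smul ha hf hM x
  rw [← intervalIntegral.integral_Iic_add_Ioi h.integrableOn h.integrableOn (b := x), smul_add,
    ← integral_smul, ← integral_smul, ← integral_smul, ← integral_smul]
  congr 1
  · refine setIntegral_congr_fun measurableSet_Iic fun y hy => ?_
    simp only [greenKernel, smul_smul]
    rw [abs_of_nonneg (sub_nonneg.2 hy), ← Real.exp_add, one_div_mul_eq_div]
    congr 3; ring
  · refine setIntegral_congr_fun measurableSet_Ioi fun y hy => ?_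
    simp only [greenKernel, smul_smul]
    rw [abs_of_nonpos (sub_nonpos.2 (le_of_lt hy)), ← Real.exp_add, one_div_mul_eq_div]
    congr 3; ring

/-- For bounded continuous `f`, the function `U = G ⋆ f` solves `U'' = a² U - f` with bounded
derivative. -/
lemma exists_deriv_greenKernel_conv (ha : 0 < a) (hf : Continuous f) (hM : ∀ x, ‖f x‖ ≤ M) :
    ∃ U' : ℝ → ℂ, (∀ x, HasDerivAt (fun x => ∫ y, greenKernel a (x - y) • f y) (U' x) x) ∧
      (∀ x, HasDerivAt U' (a ^ 2 • (∫ y, greenKernel a (x - y) • f y) - f x) x) ∧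
      ∀ x, ‖U' x‖ ≤ M / a := by
  set I : ℝ → ℂ := fun x => ∫ y in Set.Iic x, Real.exp (a * y) • f y with hI
  set J : ℝ → ℂ := fun x => ∫ y in Set.Ioi x, Real.exp (-a * y) • f y with hJ
  have hI' : ∀ x, HasDerivAt I (Real.exp (a * x) • f x) x := by
    intro x
    have hc : Continuous fun y => Real.exp (a * y) • f y := by fun_prop
    have h1 : I = fun x => I 0 + ∫ y in (0 : ℝ)..x, Real.exp (a * y) • f y := by
      ext x
      rw [← intervalIntegral.integral_Iic_sub_Iic (integrableOn_exp_smul_Iic ha hf hM 0)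
        (integrableOn_exp_smul_Iic ha hf hM x)]
      simp [hI]
    rw [h1]
    exact (intervalIntegral.integral_hasDerivAt_right (hc.intervalIntegrable _ _)
      (hc.stronglyMeasurableAtFilter _ _) hc.continuousAt).const_add _
  have hJ' : ∀ x, HasDerivAt J (-(Real.exp (-a * x) • f x)) x := by
    intro x
    have hc : Continuous fun y => Real.exp (-a * y) • f y := by fun_prop
    have h1 : J = fun x => J 0 - ∫ y in (0 : ℝ)..x, Real.exp (-a * y) • f y := by
      ext x
      rw [eq_sub_iff_add_eq, add_comm]
      exact intervalIntegral.integral_interval_add_Ioi (integrableOn_exp_smul_Ioi ha hf hM 0)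
        (integrableOn_exp_smul_Ioi ha hf hM x)
    rw [h1]
    exact (intervalIntegral.integral_hasDerivAt_right (hc.intervalIntegrable _ _)
      (hc.stronglyMeasurableAtFilter _ _) hc.continuousAt).const_sub _
  have hE : ∀ b x : ℝ, HasDerivAt (fun x => Real.exp (b * x)) (b * Real.exp (b * x)) x := by
    intro b x
    have := ((hasDerivAt_id x).const_mul b).exp
    simpa [mul_comm] using this
  have hU : (fun x => ∫ y, greenKernel a (x - y) • f y) = fun x => (1 / (2 * a)) •
      (Real.exp (-a * x) • I x + Real.exp (a * x) • J x) :=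
    funext fun x => integral_greenKernel_smul ha hf hM x
  have hexp : ∀ x, Real.exp (-a * x) * Real.exp (a * x) = 1 := fun x => by
    rw [← Real.exp_add]; simp
  have hexp' : ∀ x, (Real.exp (-a * x) : ℂ) * Real.exp (a * x) = 1 := fun x => by
    exact_mod_cast hexp x
  have ha' : (a : ℂ) ≠ 0 := by exact_mod_cast ha.ne'
  refine ⟨fun x => (1 / 2 : ℝ) • (Real.exp (a * x) • J x - Real.exp (-a * x) • I x), ?_, ?_, ?_⟩
  · intro x
    rw [hU]
    refine ((((hE (-a) x).fun_smul (hI' x)).fun_add ((hE a x).fun_smul (hJ' x))).fun_const_smul _).congr_deriv ?_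
    simp only [Complex.real_smul]
    push_cast
    have := hexp' x
    push_cast at this
    field_simp
    ring
  · intro x
    rw [congrFun hU x]
    refine ((((hE a x).fun_smul (hJ' x)).fun_sub ((hE (-a) x).fun_smul (hI' x))).fun_const_smul _).congr_deriv ?_
    simp only [Complex.real_smul]
    push_cast
    have := hexp' x
    push_cast at this
    rw [neg_mul] at this
    field_simp
    linear_combination (-2 * f x) * this
  · intro x
    have hIb : ‖I x‖ ≤ M * (Real.exp (a * x) / a) := by
      rw [← integral_exp_mul_Iic ha x, ← integral_const_mul]
      refine norm_integral_le_of_norm_le ((integrableOn_exp_mul_Iic ha x).const_mul M)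
        (ae_of_all _ fun y => ?_)
      rw [norm_smul, Real.norm_of_nonneg (Real.exp_pos _).le, mul_comm]
      exact mul_le_mul_of_nonneg_right (hM y) (Real.exp_pos _).le
    have hJb : ‖J x‖ ≤ M * (Real.exp (-a * x) / a) := by
      have h1 := integral_exp_mul_Ioi (neg_lt_zero.2 ha) x
      rw [neg_div_neg_eq] at h1
      rw [← h1, ← integral_const_mul]
      refine norm_integral_le_of_norm_le
        ((integrableOn_exp_mul_Ioi (neg_lt_zero.2 ha) x).const_mul M) (ae_of_all _ fun y => ?_)
      rw [norm_smul, Real.norm_of_nonneg (Real.exp_pos _).le, mul_comm]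
      exact mul_le_mul_of_nonneg_right (hM y) (Real.exp_pos _).le
    have h1 : ‖Real.exp (a * x) • J x‖ ≤ M / a := by
      rw [norm_smul, Real.norm_of_nonneg (Real.exp_pos _).le]
      refine (mul_le_mul_of_nonneg_left hJb (Real.exp_pos _).le).trans_eq ?_
      linear_combination (M / a) * hexp x
    have h2 : ‖Real.exp (-a * x) • I x‖ ≤ M / a := by
      rw [norm_smul, Real.norm_of_nonneg (Real.exp_pos _).le]
      refine (mul_le_mul_of_nonneg_left hIb (Real.exp_pos _).le).trans_eq ?_
      linear_combination (M / a) * hexp x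
    rw [norm_smul, Real.norm_of_nonneg (by norm_num)]
    linarith [norm_sub_le (Real.exp (a * x) • J x) (Real.exp (-a * x) • I x)]

end Green

/-- Let `φ` be an odd decaying solution of `φ'' = (a² - p) φ`, where the potential `p` is even. Then
this equation has no non-trivial even solution in `L²`: the Wronskian with `φ` vanishes at infinity,
hence at the origin. The equation is stated in integrated form. -/
lemma eq_zero_of_eq_greenOp (ha : 0 < a) {p : Bdd ℝ} (hp : Continuous p.1)
    (hpe : ∀ x, p.1 (-x) = p.1 x) {φ φ' : ℝ → ℝ} (hφ : ∀ t, HasDerivAt φ (φ' t) t)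
    (hφ' : ∀ t, HasDerivAt φ' ((a ^ 2 - p.1 t) * φ t) t) (h0 : φ 0 = 0) (h0' : φ' 0 ≠ 0)
    (hlim : Tendsto φ atTop (𝓝 0)) (hlim' : Tendsto φ' atTop (𝓝 0)) {u : L2C}
    (hu : u = greenOp a ha (mulOp p (evenOp u))) : u = 0 := by
  obtain ⟨_, Cp, hCp⟩ := id p.2
  have hG : MemLp (fun x => (greenKernel a x : ℂ)) 2 volume := (memLp_greenKernel ha).ofReal
  set F0 : L2C := mulOp p (evenOp u) with hF0
  -- the continuous representative of `u`
  let U : ℝ → ℂ := fun x => inner ℂ (transL2 x hG.toLp) F0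
  have hUc : Continuous U := by
    let g : ℝ → C(ℝ, ℝ) := fun x => ⟨fun y => y - x, by fun_prop⟩
    have hg : Continuous g :=
      ContinuousMap.continuous_of_continuous_uncurry _ (continuous_snd.sub continuous_fst)
    have : Continuous fun x => transL2 x hG.toLp :=
      (continuous_const (y := hG.toLp)).compMeasurePreservingLp hg
        (fun x => measurePreserving_sub_right volume x) (by norm_num)
    exact this.inner continuous_const
  have hUb : ∀ x, ‖U x‖ ≤ ‖hG.toLp‖ * ‖F0‖ := by
    intro x
    refine (norm_inner_le_norm _ _).trans_eq ?_
    rw [(transL2 x).norm_map]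
  have hU1 : ∀ x, U x = ∫ y, greenKernel a (x - y) • F0 y := by
    intro x
    simp only [U]
    rw [L2.inner_def]
    have h1 := (measurePreserving_sub_right (volume : Measure ℝ) x).quasiMeasurePreserving.ae
      hG.coeFn_toLp
    refine integral_congr_ae ?_
    filter_upwards [transL2_coeFn x hG.toLp, h1] with y e2 e3
    rw [e2, e3, ← greenKernel_neg a (x - y), neg_sub]
    simp [mul_comm]
  have huU : u =ᵐ[volume] U := by
    have h1 := greenOp_coeFn ha F0
    rw [← hu] at h1
    exact h1.trans (ae_of_all _ fun x => (hU1 x).symm)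
  have hF0e : ∀ᵐ y : ℝ, F0 (-y) = F0 y := by
    filter_upwards [mulOp_coeFn p (evenOp u), evenOp_coeFn u, ae_neg (mulOp_coeFn p (evenOp u)),
      ae_neg (evenOp_coeFn u)] with y e1 e2 e3 e4
    rw [e3, e1, e2, e4, hpe, neg_neg, add_comm]
  have hUe : ∀ x, U (-x) = U x := by
    intro x
    rw [hU1, hU1, ← integral_neg_eq_self (fun y => greenKernel a (-x - y) • F0 y)]
    refine integral_congr_ae ?_
    filter_upwards [hF0e] with y hy
    rw [hy, ← greenKernel_neg a (x - y)]
    congr 2; ring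
  have hF0U : F0 =ᵐ[volume] fun y => p.1 y • U y := by
    filter_upwards [mulOp_coeFn p (evenOp u), evenOp_coeFn u, huU, ae_neg huU] with y e1 e2 e3 e4
    rw [e1, e2, e3, e4, hUe]
    congr 1; ring
  have hU2 : U = fun x => ∫ y, greenKernel a (x - y) • (p.1 y • U y) := by
    ext x
    rw [hU1]
    refine integral_congr_ae ?_
    filter_upwards [hF0U] with y hy
    rw [hy]
  obtain ⟨U', hU', hU'', hUb'⟩ := exists_deriv_greenKernel_conv (f := fun y => p.1 y • U y)
    (M := Cp * (‖hG.toLp‖ * ‖F0‖)) ha (hp.smul hUc) (fun x => by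
      rw [norm_smul]
      exact mul_le_mul (hCp x) (hUb x) (norm_nonneg _) ((norm_nonneg _).trans (hCp x)))
  rw [← hU2] at hU'
  have hU3 : ∀ x, HasDerivAt U' ((a ^ 2 - p.1 x) • U x) x := by
    intro x
    refine (hU'' x).congr_deriv ?_
    rw [← congrFun hU2 x, sub_smul]
  -- the Wronskian
  have hW : ∀ x, HasDerivAt (fun x => φ' x • U x - φ x • U' x) 0 x := by
    intro x
    refine (((hφ' x).fun_smul (hU' x)).fun_sub ((hφ x).fun_smul (hU3 x))).congr_deriv ?_
    simp only [smul_smul]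
    rw [mul_comm (φ x)]
    abel
  have hconst : ∀ x y, φ' x • U x - φ x • U' x = φ' y • U y - φ y • U' y :=
    is_const_of_deriv_eq_zero (fun x => (hW x).differentiableAt) fun x => (hW x).deriv
  have hWlim : Tendsto (fun x => φ' x • U x - φ x • U' x) atTop (𝓝 0) := by
    have h1 : Tendsto (fun x => φ' x • U x) atTop (𝓝 0) :=
      hlim'.zero_smul_isBoundedUnder_le ⟨_, eventually_map.2 (Eventually.of_forall hUb)⟩
    have h2 : Tendsto (fun x => φ x • U' x) atTop (𝓝 0) :=
      hlim.zero_smul_isBoundedUnder_le ⟨_, eventually_map.2 (Eventually.of_forall hUb')⟩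
    simpa using h1.sub h2
  have hW0 : φ' 0 • U 0 - φ 0 • U' 0 = 0 := by
    have : (fun x => φ' x • U x - φ x • U' x) = fun _ => φ' 0 • U 0 - φ 0 • U' 0 :=
      funext fun x => hconst x 0
    rw [this] at hWlim
    exact tendsto_const_nhds_iff.1 hWlim
  have hU0 : U 0 = 0 := by
    rw [h0, zero_smul, sub_zero, smul_eq_zero] at hW0
    exact hW0.resolve_left h0'
  have hU0' : U' 0 = 0 := by
    have h1 : HasDerivAt (fun x => U (-x)) (-U' 0) 0 := by
      have := (hU' (-0)).scomp (0 : ℝ) (hasDerivAt_neg (0 : ℝ))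
      simpa [Function.comp_def] using this
    have h2 : (fun x => U (-x)) = U := funext hUe
    rw [h2] at h1
    exact self_eq_neg.1 ((hU' 0).unique h1)
  have hUz := eq_zero_of_linear_ode (p := fun x => a ^ 2 - p.1 x) (by fun_prop) hU' hU3 hU0 hU0'
  refine Lp.ext ?_
  filter_upwards [huU, Lp.coeFn_zero ℂ 2 (volume : Measure ℝ)] with x h1 h2
  rw [h1, h2, hUz, Pi.zero_apply]

end

/-! ### The soliton -/

/-- The function `x ↦ sech²(κx)`, which dominates the soliton and all its derivatives. -/
def sechSq (κ x : ℝ) : ℝ := (1 / Real.cosh (κ * x)) ^ 2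

lemma continuous_sechSq (κ : ℝ) : Continuous (sechSq κ) := by
  unfold sechSq
  exact (continuous_const.div (by fun_prop) fun x => (Real.cosh_pos _).ne').pow 2

lemma sechSq_pos (κ x : ℝ) : 0 < sechSq κ x := by
  have := Real.cosh_pos (κ * x)
  unfold sechSq; positivity

lemma sechSq_le_one (κ x : ℝ) : sechSq κ x ≤ 1 := by
  unfold sechSq
  have h1 := Real.one_le_cosh (κ * x)
  have h2 : 0 ≤ 1 / Real.cosh (κ * x) := by positivity
  exact pow_le_one₀ h2 ((div_le_one (by positivity)).2 h1)

lemma sechSq_neg (κ x : ℝ) : sechSq κ (-x) = sechSq κ x := by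
  simp [sechSq]

lemma sechSq_le_exp_mul (κ x y : ℝ) :
    sechSq κ y ≤ Real.exp (2 * |κ * (x - y)|) * sechSq κ x := by
  have h : Real.cosh (κ * x) ≤ Real.exp |κ * (x - y)| * Real.cosh (κ * y) := by
    have e : κ * x = κ * (x - y) + κ * y := by ring
    rw [e, Real.cosh_eq, Real.cosh_eq, neg_add, Real.exp_add, Real.exp_add]
    have h1 : Real.exp (κ * (x - y)) ≤ Real.exp |κ * (x - y)| := Real.exp_le_exp.2 (le_abs_self _)
    have h2 : Real.exp (-(κ * (x - y))) ≤ Real.exp |κ * (x - y)| :=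
      Real.exp_le_exp.2 (neg_le_abs _)
    nlinarith [Real.exp_pos (κ * y), Real.exp_pos (-(κ * y))]
  have hx := Real.cosh_pos (κ * x)
  have hy := Real.cosh_pos (κ * y)
  have h3 : 1 / Real.cosh (κ * y) ≤ Real.exp |κ * (x - y)| * (1 / Real.cosh (κ * x)) := by
    rw [mul_one_div, div_le_div_iff₀ hy hx]
    linarith
  unfold sechSq
  rw [show (2 : ℝ) * |κ * (x - y)| = (2 : ℕ) * |κ * (x - y)| by norm_num, Real.exp_nat_mul,
    ← mul_pow]
  exact pow_le_pow_left₀ (by positivity) h3 2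

lemma sechSq_le_exp_neg (κ x : ℝ) : sechSq κ x ≤ 4 * Real.exp (-(2 * |κ * x|)) := by
  have h : Real.exp |κ * x| / 2 ≤ Real.cosh (κ * x) := by
    rw [← Real.cosh_abs, Real.cosh_eq]
    linarith [Real.exp_pos (-|κ * x|)]
  have hx := Real.cosh_pos (κ * x)
  have h1 : 1 / Real.cosh (κ * x) ≤ 2 * Real.exp (-|κ * x|) := by
    rw [Real.exp_neg, div_le_iff₀ hx]
    have := Real.exp_pos |κ * x|
    field_simp
    linarith
  unfold sechSq
  rw [show -(2 * |κ * x|) = (2 : ℕ) * (-|κ * x|) by push_cast; ring, Real.exp_nat_mul,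
    show (4 : ℝ) = 2 ^ 2 by norm_num, ← mul_pow]
  exact pow_le_pow_left₀ (by positivity) h1 2

lemma tendsto_sechSq_atTop {κ : ℝ} (hκ : 0 < κ) : Tendsto (sechSq κ) atTop (𝓝 0) := by
  have h1 : Tendsto (fun x : ℝ => 4 * Real.exp (-(2 * κ * x))) atTop (𝓝 (4 * 0)) :=
    (Real.tendsto_exp_neg_atTop_nhds_zero.comp
      (tendsto_id.const_mul_atTop (by positivity : 0 < 2 * κ))).const_mul 4
  rw [mul_zero] at h1
  refine squeeze_zero' (Eventually.of_forall fun x => (sechSq_pos κ x).le) ?_ h1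
  filter_upwards [eventually_ge_atTop 0] with x hx
  refine (sechSq_le_exp_neg κ x).trans_eq ?_
  rw [abs_of_nonneg (by positivity), mul_assoc]

lemma memLp_sechSq {κ : ℝ} (hκ : 0 < κ) : MemLp (sechSq κ) 2 volume := by
  have h := (memLp_greenKernel (a := 2 * κ) (by positivity)).const_mul (4 * (2 * (2 * κ)))
  refine h.mono (continuous_sechSq κ).aestronglyMeasurable (ae_of_all _ fun x => ?_)
  rw [Real.norm_of_nonneg (sechSq_pos κ x).le]
  refine (sechSq_le_exp_neg κ x).trans ((le_of_eq ?_).trans (le_abs_self _))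
  rw [greenKernel, abs_mul, abs_of_pos hκ]
  field_simp

/-- The soliton `(3 d₁ / (2 d₂)) sech²(√d₁ ξ / 2)`. -/
def soliton (d₁ d₂ ξ : ℝ) : ℝ :=
  3 * d₁ / (2 * d₂) * (1 / Real.cosh (1 / 2 * √d₁ * ξ)) ^ 2

/-- The derivative of the soliton. -/
def solitonDeriv (d₁ d₂ ξ : ℝ) : ℝ :=
  -√d₁ * (Real.sinh (1 / 2 * √d₁ * ξ) / Real.cosh (1 / 2 * √d₁ * ξ)) * soliton d₁ d₂ ξ

section Soliton

variable {d₁ d₂ : ℝ}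

lemma soliton_eq_sechSq (d₁ d₂ ξ : ℝ) :
    soliton d₁ d₂ ξ = 3 * d₁ / (2 * d₂) * sechSq (1 / 2 * √d₁) ξ := rfl

lemma continuous_soliton (d₁ d₂ : ℝ) : Continuous (soliton d₁ d₂) :=
  continuous_const.mul (continuous_sechSq _)

lemma soliton_neg (d₁ d₂ ξ : ℝ) : soliton d₁ d₂ (-ξ) = soliton d₁ d₂ ξ := by
  rw [soliton_eq_sechSq, soliton_eq_sechSq, sechSq_neg]

lemma soliton_ne_zero (hd₁ : 0 < d₁) (hd₂ : d₂ ≠ 0) (ξ : ℝ) : soliton d₁ d₂ ξ ≠ 0 := by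
  rw [soliton_eq_sechSq]
  exact mul_ne_zero (by positivity) (sechSq_pos _ _).ne'

lemma soliton_zero (d₁ d₂ : ℝ) : soliton d₁ d₂ 0 = 3 * d₁ / (2 * d₂) := by
  simp [soliton]

lemma solitonDeriv_zero (d₁ d₂ : ℝ) : solitonDeriv d₁ d₂ 0 = 0 := by
  simp [solitonDeriv]

lemma hasDerivAt_soliton (d₁ d₂ ξ : ℝ) :
    HasDerivAt (soliton d₁ d₂) (solitonDeriv d₁ d₂ ξ) ξ := by
  have h1 : HasDerivAt (fun ξ : ℝ => 1 / 2 * √d₁ * ξ) (1 / 2 * √d₁) ξ := by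
    simpa using (hasDerivAt_id ξ).const_mul (1 / 2 * √d₁)
  have hc := (Real.cosh_pos (1 / 2 * √d₁ * ξ)).ne'
  have h2 := ((((hasDerivAt_const ξ (1 : ℝ)).fun_div h1.cosh hc).fun_pow 2).const_mul
    (3 * d₁ / (2 * d₂)))
  refine h2.congr_deriv ?_
  simp only [solitonDeriv, soliton]
  generalize Real.sinh (1 / 2 * √d₁ * ξ) = S
  generalize Real.cosh (1 / 2 * √d₁ * ξ) = Co at hc ⊢
  norm_num
  field_simp

lemma hasDerivAt_solitonDeriv (hd₁ : 0 < d₁) (hd₂ : d₂ ≠ 0) (ξ : ℝ) :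
    HasDerivAt (solitonDeriv d₁ d₂) (d₁ * soliton d₁ d₂ ξ - d₂ * soliton d₁ d₂ ξ ^ 2) ξ := by
  have h1 : HasDerivAt (fun ξ : ℝ => 1 / 2 * √d₁ * ξ) (1 / 2 * √d₁) ξ := by
    simpa using (hasDerivAt_id ξ).const_mul (1 / 2 * √d₁)
  have hc := (Real.cosh_pos (1 / 2 * √d₁ * ξ)).ne'
  have h2 := ((h1.sinh.fun_div h1.cosh hc).const_mul (-√d₁)).fun_mul (hasDerivAt_soliton d₁ d₂ ξ)
  refine h2.congr_deriv ?_
  simp only [solitonDeriv, soliton]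
  have hs : Real.sinh (1 / 2 * √d₁ * ξ) ^ 2 = Real.cosh (1 / 2 * √d₁ * ξ) ^ 2 - 1 := by
    linarith [Real.cosh_sq (1 / 2 * √d₁ * ξ)]
  have hq : √d₁ ^ 2 = d₁ := Real.sq_sqrt hd₁.le
  generalize Real.sinh (1 / 2 * √d₁ * ξ) = S at *
  generalize Real.cosh (1 / 2 * √d₁ * ξ) = Co at *
  field_simp
  rw [hs, hq]
  ring

lemma contDiff_soliton (hd₁ : 0 < d₁) (hd₂ : d₂ ≠ 0) : ContDiff ℝ 2 (soliton d₁ d₂) := by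
  have e1 : deriv (soliton d₁ d₂) = solitonDeriv d₁ d₂ :=
    funext fun ξ => (hasDerivAt_soliton d₁ d₂ ξ).deriv
  have e2 : deriv (solitonDeriv d₁ d₂) = fun ξ => d₁ * soliton d₁ d₂ ξ - d₂ * soliton d₁ d₂ ξ ^ 2 :=
    funext fun ξ => (hasDerivAt_solitonDeriv hd₁ hd₂ ξ).deriv
  rw [show (2 : WithTop ℕ∞) = 1 + 1 by norm_num, contDiff_succ_iff_deriv, e1]
  refine ⟨fun ξ => (hasDerivAt_soliton d₁ d₂ ξ).differentiableAt, by simp, ?_⟩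
  rw [contDiff_one_iff_deriv, e2]
  refine ⟨fun ξ => (hasDerivAt_solitonDeriv hd₁ hd₂ ξ).differentiableAt, ?_⟩
  have := continuous_soliton d₁ d₂
  fun_prop

lemma abs_soliton_le (d₁ d₂ ξ : ℝ) :
    |soliton d₁ d₂ ξ| ≤ |3 * d₁ / (2 * d₂)| * sechSq (1 / 2 * √d₁) ξ := by
  rw [soliton_eq_sechSq, abs_mul, abs_of_pos (sechSq_pos _ _)]

lemma abs_solitonDeriv_le (d₁ d₂ ξ : ℝ) :
    |solitonDeriv d₁ d₂ ξ| ≤ √d₁ * |3 * d₁ / (2 * d₂)| * sechSq (1 / 2 * √d₁) ξ := by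
  have h : |Real.sinh (1 / 2 * √d₁ * ξ) / Real.cosh (1 / 2 * √d₁ * ξ)| ≤ 1 := by
    rw [← Real.tanh_eq_sinh_div_cosh]
    exact (Real.abs_tanh_lt_one _).le
  rw [solitonDeriv, abs_mul, abs_mul, abs_neg, abs_of_nonneg (Real.sqrt_nonneg _), mul_assoc √d₁,
    mul_assoc √d₁]
  refine mul_le_mul_of_nonneg_left ?_ (Real.sqrt_nonneg _)
  exact (mul_le_mul h (abs_soliton_le d₁ d₂ ξ) (abs_nonneg _) zero_le_one).trans_eq (one_mul _)

lemma tendsto_soliton_atTop (hd₁ : 0 < d₁) : Tendsto (soliton d₁ d₂) atTop (𝓝 0) := by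
  have := (tendsto_sechSq_atTop (κ := 1 / 2 * √d₁) (by positivity)).const_mul (3 * d₁ / (2 * d₂))
  rw [mul_zero] at this
  exact this

lemma tendsto_solitonDeriv_atTop (hd₁ : 0 < d₁) : Tendsto (solitonDeriv d₁ d₂) atTop (𝓝 0) := by
  have := (tendsto_sechSq_atTop (κ := 1 / 2 * √d₁) (by positivity)).const_mul
    (√d₁ * |3 * d₁ / (2 * d₂)|)
  rw [mul_zero] at this
  exact squeeze_zero_norm (abs_solitonDeriv_le d₁ d₂) this

lemma isKdVWave_soliton (hd₁ : 0 < d₁) (hd₂ : d₂ ≠ 0) : IsKdVWave d₁ d₂ (soliton d₁ d₂) := by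
  have e1 : deriv (soliton d₁ d₂) = solitonDeriv d₁ d₂ :=
    funext fun ξ => (hasDerivAt_soliton d₁ d₂ ξ).deriv
  refine ⟨contDiff_soliton hd₁ hd₂, fun ξ => ?_, soliton_neg d₁ d₂, tendsto_soliton_atTop hd₁, ?_,
    0, soliton_ne_zero hd₁ hd₂ 0⟩
  · rw [e1]
    exact (hasDerivAt_solitonDeriv hd₁ hd₂ ξ).deriv
  · have h := (tendsto_soliton_atTop (d₂ := d₂) hd₁).comp tendsto_neg_atBot_atTop
    refine h.congr fun ξ => soliton_neg d₁ d₂ ξ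

/-- The energy of an even homoclinic solution vanishes, so `w(0)` is `0` or `3 d₁ / (2 d₂)`, and the
Cauchy problem has a unique solution. -/
lemma IsKdVWave.eq_soliton (hd₁ : 0 < d₁) (hd₂ : d₂ ≠ 0) {w : ℝ → ℝ} (hw : IsKdVWave d₁ d₂ w) :
    w = soliton d₁ d₂ := by
  obtain ⟨hC, hode, heven, htop, -, ξ₀, hξ₀⟩ := hw
  have hw1 : ∀ t, HasDerivAt w (deriv w t) t := fun t =>
    (hC.differentiable (by norm_num) t).hasDerivAt
  have hC1 : ContDiff ℝ 1 (deriv w) := by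
    rw [show (2 : WithTop ℕ∞) = 1 + 1 by norm_num, contDiff_succ_iff_deriv] at hC
    exact hC.2.2
  have hw2 : ∀ t, HasDerivAt (deriv w) (d₁ * w t - d₂ * w t ^ 2) t := fun t => by
    rw [← hode]
    exact (hC1.differentiable (by norm_num) t).hasDerivAt
  have hwc : Continuous w := hC.continuous
  -- conservation of energy
  have hE : ∀ t, HasDerivAt (fun t => deriv w t ^ 2 - d₁ * w t ^ 2 + 2 / 3 * d₂ * w t ^ 3) 0 t := by
    intro t
    refine ((((hw2 t).fun_pow 2).fun_sub (((hw1 t).fun_pow 2).const_mul d₁)).fun_add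
      (((hw1 t).fun_pow 3).const_mul (2 / 3 * d₂))).congr_deriv ?_
    norm_num
    ring
  have hconst := is_const_of_deriv_eq_zero (fun x => (hE x).differentiableAt) fun x => (hE x).deriv
  -- the mean value theorem gives points going to infinity at which `w'` tends to zero
  have hmvt : ∀ n : ℕ, ∃ t : ℝ, (n : ℝ) < t ∧ deriv w t = w (n + 1) - w n := by
    intro n
    obtain ⟨t, ht, h⟩ := exists_hasDerivAt_eq_slope w (deriv w) (a := n) (b := n + 1) (by linarith)
      hwc.continuousOn fun t _ => hw1 t
    exact ⟨t, ht.1, by rw [h]; simp⟩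
  choose t ht ht' using hmvt
  have htt : Tendsto t atTop atTop :=
    tendsto_atTop_mono (fun n => (ht n).le) tendsto_natCast_atTop_atTop
  have hd0 : Tendsto (fun n => deriv w (t n)) atTop (𝓝 0) := by
    simp only [ht']
    have h1 : Tendsto (fun n : ℕ => w (n : ℝ)) atTop (𝓝 0) := htop.comp tendsto_natCast_atTop_atTop
    have h2 : Tendsto (fun n : ℕ => w ((n : ℝ) + 1)) atTop (𝓝 0) :=
      htop.comp (tendsto_atTop_add_const_right _ _ tendsto_natCast_atTop_atTop)
    simpa using h2.sub h1
  have hw0 : Tendsto (fun n => w (t n)) atTop (𝓝 0) := htop.comp htt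
  have hE0 : deriv w 0 ^ 2 - d₁ * w 0 ^ 2 + 2 / 3 * d₂ * w 0 ^ 3 = 0 := by
    have h1 : Tendsto (fun n => deriv w (t n) ^ 2 - d₁ * w (t n) ^ 2 + 2 / 3 * d₂ * w (t n) ^ 3)
        atTop (𝓝 (0 ^ 2 - d₁ * 0 ^ 2 + 2 / 3 * d₂ * 0 ^ 3)) :=
      ((hd0.pow 2).sub ((hw0.pow 2).const_mul d₁)).add ((hw0.pow 3).const_mul (2 / 3 * d₂))
    have h2 := h1.congr fun n => hconst (t n) 0
    have h3 := tendsto_const_nhds_iff.1 h2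
    rw [h3]; norm_num
  have hd : deriv w 0 = 0 := by
    have h1 : HasDerivAt (fun x => w (-x)) (-deriv w 0) 0 := by
      have := (hw1 (-0)).scomp (0 : ℝ) (hasDerivAt_neg (0 : ℝ))
      simpa [Function.comp_def] using this
    rw [show (fun x => w (-x)) = w from funext heven] at h1
    exact self_eq_neg.1 ((hw1 0).unique h1)
  -- the difference of two solutions with the same initial data solves a linear equation
  have huniq : ∀ v v' : ℝ → ℝ, Continuous v → (∀ t, HasDerivAt v (v' t) t) →
      (∀ t, HasDerivAt v' (d₁ * v t - d₂ * v t ^ 2) t) → w 0 = v 0 → v' 0 = 0 → w = v := by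
    intro v v' hvc hv hv' h0 h0'
    ext t
    refine sub_eq_zero.1 (eq_zero_of_linear_ode (p := fun t => d₁ - d₂ * (w t + v t))
      (u := fun t => w t - v t) (u' := fun t => deriv w t - v' t) (by fun_prop)
      (fun t => (hw1 t).fun_sub (hv t)) (fun t => ?_) (sub_eq_zero.2 h0)
      (by simp [hd, h0']) t)
    refine ((hw2 t).fun_sub (hv' t)).congr_deriv ?_
    rw [smul_eq_mul]; ring
  rw [hd] at hE0
  have hfac : w 0 ^ 2 * (2 * d₂ * w 0 - 3 * d₁) = 0 := by linear_combination 3 * hE0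
  rcases mul_eq_zero.1 hfac with h | h
  · have h0 : w 0 = 0 := by simpa using h
    have := huniq (fun _ => 0) (fun _ => 0) continuous_const (fun t => hasDerivAt_const t 0)
      (fun t => by simpa using hasDerivAt_const t (0 : ℝ)) h0 rfl
    exact absurd (congrFun this ξ₀) hξ₀
  · refine huniq _ _ (continuous_soliton d₁ d₂) (hasDerivAt_soliton d₁ d₂)
      (hasDerivAt_solitonDeriv hd₁ hd₂) ?_ (solitonDeriv_zero d₁ d₂)
    rw [soliton_zero, eq_div_iff (by positivity)]
    linarith

end Soliton

/-! ### Estimates for the symbols -/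

lemma abs_one_sub_sinc_sq_sub_le (x : ℝ) : |1 - Real.sinc x ^ 2 - x ^ 2 / 3| ≤ |x| ^ 3 := by
  have hs := abs_le.1 (Real.abs_sinc_le_one x)
  have habs : |x| ^ 2 = x ^ 2 := sq_abs x
  have h0 := abs_nonneg x
  rcases le_or_gt |x| 1 with hx | hx
  · rcases eq_or_ne x 0 with rfl | hx0
    · simp
    · have h1 := Real.sin_bound hx
      rw [Real.sinc_of_ne_zero hx0]
      have hpos : 0 < |x| := abs_pos.2 hx0
      obtain ⟨e, he⟩ : ∃ e, Real.sin x / x = 1 - x ^ 2 / 6 + e := ⟨_, (add_sub_cancel _ _).symm⟩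
      have he' : |e| ≤ |x| ^ 3 * (5 / 96) := by
        have h2 : Real.sin x - (x - x ^ 3 / 6) = x * e := by
          rw [div_eq_iff hx0] at he
          rw [he]; ring
        rw [h2, abs_mul] at h1
        refine le_of_mul_le_mul_left (h1.trans ?_) hpos
        have : |x| ^ 5 ≤ |x| ^ 4 := pow_le_pow_of_le_one h0 hx (by norm_num)
        have : 0 ≤ |x| ^ 4 := by positivity
        linarith
      rw [he, show 1 - (1 - x ^ 2 / 6 + e) ^ 2 - x ^ 2 / 3
        = -(x ^ 2 * x ^ 2 / 36) - 2 * e + e * x ^ 2 / 3 - e * e by ring, ← habs]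
      have h3 : |x| ^ 3 ≤ 1 := pow_le_one₀ h0 hx
      have h4 : |x| ^ 2 ≤ 1 := pow_le_one₀ h0 hx
      have h5 : |x| ^ 2 * |x| ^ 2 ≤ |x| ^ 3 := by
        nlinarith [pow_pos hpos 3]
      have h6 : |e * |x| ^ 2| ≤ |e| := by
        rw [abs_mul, abs_of_nonneg (by positivity : 0 ≤ |x| ^ 2)]
        nlinarith [abs_nonneg e]
      have h7 : |e * e| ≤ |e| := by
        rw [abs_mul]; nlinarith [abs_nonneg e]
      have h8 := abs_le.1 h6
      have h9 := abs_le.1 h7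
      have h10 := abs_le.1 (le_refl |e|)
      have h11 : 0 ≤ |x| ^ 2 * |x| ^ 2 := by positivity
      rw [abs_le]
      constructor <;> linarith
  · have h1 : x ^ 2 ≤ |x| ^ 3 := by rw [← habs]; nlinarith [sq_nonneg |x|]
    have h2 : 1 ≤ |x| ^ 3 := one_le_pow₀ hx.le
    have h3 : Real.sinc x ^ 2 ≤ 1 := by nlinarith
    rw [abs_le]
    constructor <;> nlinarith [sq_nonneg (Real.sinc x), sq_nonneg x]

lemma symbolS_nonneg (k z : ℝ) : 0 ≤ symbolS k z := by
  have hs := abs_le.1 (Real.abs_sinc_le_one (k * z / 2))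
  unfold symbolS; nlinarith

lemma symbolS_le_one (k z : ℝ) : symbolS k z ≤ 1 := by
  unfold symbolS; nlinarith [sq_nonneg (Real.sinc (k * z / 2))]

lemma symbolS_le_min_sq (k z : ℝ) : symbolS k z ≤ (k ^ 2 + 1) * min |z| 2 ^ 2 := by
  rcases le_or_gt |z| 2 with hz | hz
  · rw [min_eq_left hz, sq_abs]
    have h1 := abs_le.1 (abs_one_sub_sinc_sq_sub_le (k * z / 2))
    rcases le_or_gt |k * z / 2| 1 with hx | hx
    · have h2 : |k * z / 2| ^ 3 ≤ |k * z / 2| ^ 2 := pow_le_pow_of_le_one (abs_nonneg _) hx (by norm_num)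
      rw [sq_abs] at h2
      unfold symbolS
      nlinarith [h1.2, sq_nonneg (k * z), sq_nonneg z]
    · have h2 : 1 ≤ |k * z / 2| ^ 2 := one_le_pow₀ hx.le
      rw [sq_abs] at h2
      have := symbolS_le_one k z
      nlinarith [sq_nonneg (k * z), sq_nonneg z]
  · rw [min_eq_right hz.le]
    have := symbolS_le_one k z
    nlinarith [sq_nonneg k]

lemma abs_symbolS_sub_le (k z : ℝ) : |symbolS k z - k ^ 2 / 12 * z ^ 2| ≤ |k| ^ 3 * |z| ^ 3 := by
  have h := abs_one_sub_sinc_sq_sub_le (k * z / 2)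
  have e : symbolS k z - k ^ 2 / 12 * z ^ 2
      = 1 - Real.sinc (k * z / 2) ^ 2 - (k * z / 2) ^ 2 / 3 := by
    unfold symbolS; ring
  rw [e]
  refine h.trans ?_
  rw [abs_div, abs_mul, div_pow, mul_pow]
  have : 0 ≤ |k| ^ 3 * |z| ^ 3 := by positivity
  norm_num
  linarith

/-- Comparison of the two quotients `ε² n / D` and `ε² n₀ / D₀`: below the frequency `2` the
denominators have the size `(ε + |y|)²` and differ by `(ε + |y|)³`, above it both quotients are
of order `ε²`. -/
lemma exists_abs_div_sub_div_le {c c' C₁ C₂ : ℝ} (hc : 0 < c) (hc' : 0 < c') (hC₁ : 0 ≤ C₁)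
    (hC₂ : 0 ≤ C₂) (n₀ : ℝ) : ∃ C : ℝ, 0 < C ∧ ∀ ε y D D₀ n : ℝ, 0 < ε → ε ≤ 1 →
      c * (ε ^ 2 + min |y| 2 ^ 2) ≤ D → c' * (ε ^ 2 + y ^ 2) ≤ D₀ →
      |D - D₀| ≤ C₁ * (|y| ^ 3 + ε ^ 2 * y ^ 2 + ε ^ 4) →
      |n - n₀| ≤ C₂ * (ε ^ 2 + min |y| 2 ^ 2) →
      |ε ^ 2 * n / D - ε ^ 2 * n₀ / D₀| ≤ C * ε := by
  set K₁ : ℝ := C₂ / c + |n₀| * (12 * C₁ / (c * c')) with hK₁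
  set K₂ : ℝ := (|n₀| + 5 * C₂) / (4 * c) + |n₀| / (4 * c') with hK₂
  have hK₁0 : 0 ≤ K₁ := by positivity
  have hK₂0 : 0 ≤ K₂ := by positivity
  refine ⟨K₁ + K₂ + 1, by positivity, ?_⟩
  intro ε y D D₀ n hε hε1 hD hD₀ hDD hn
  have hmin : 0 ≤ min |y| 2 := le_min (abs_nonneg _) (by norm_num)
  have hDpos : 0 < D := lt_of_lt_of_le (by positivity) hD
  have hD₀pos : 0 < D₀ := lt_of_lt_of_le (by positivity) hD₀
  have hε2 : ε ^ 2 ≤ ε := by nlinarith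
  rcases le_or_gt |y| 2 with hy | hy
  · rw [min_eq_left hy, sq_abs] at hD hn
    have e : ε ^ 2 * n / D - ε ^ 2 * n₀ / D₀
        = ε ^ 2 * ((n - n₀) / D) - n₀ * (ε ^ 2 * ((D - D₀) / (D * D₀))) := by
      field_simp; ring
    have h1 : |(n - n₀) / D| ≤ C₂ / c := by
      rw [abs_div, abs_of_pos hDpos, div_le_div_iff₀ hDpos hc]
      calc |n - n₀| * c ≤ C₂ * (ε ^ 2 + y ^ 2) * c := by gcongr
        _ = C₂ * (c * (ε ^ 2 + y ^ 2)) := by ring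
        _ ≤ C₂ * D := by gcongr
    have h2 : ε ^ 2 * |(D - D₀) / (D * D₀)| ≤ 12 * C₁ / (c * c') * ε := by
      set N : ℝ := ε + |y| with hN
      have hy0 := abs_nonneg y
      have hNpos : 0 < N := by positivity
      have hN2 : N ^ 2 ≤ 2 * (ε ^ 2 + y ^ 2) := by
        rw [← sq_abs y]; nlinarith [sq_nonneg (ε - |y|)]
      have hD1 : c * N ^ 2 / 2 ≤ D := by nlinarith
      have hD2 : c' * N ^ 2 / 2 ≤ D₀ := by nlinarith
      have hyN : |y| ≤ N := by linarith
      have hεN : ε ≤ N := by linarith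
      have t1 : |y| ^ 3 ≤ N ^ 3 := pow_le_pow_left₀ hy0 hyN 3
      have t2 : ε ^ 2 * y ^ 2 ≤ N ^ 3 := by
        rw [← sq_abs y]
        calc ε ^ 2 * |y| ^ 2 ≤ ε * |y| ^ 2 := by gcongr
          _ ≤ N * N ^ 2 := by gcongr
          _ = N ^ 3 := by ring
      have t3 : ε ^ 4 ≤ N ^ 3 :=
        (pow_le_pow_of_le_one hε.le hε1 (by norm_num)).trans (pow_le_pow_left₀ hε.le hεN 3)
      have h3 : |D - D₀| ≤ 3 * C₁ * N ^ 3 := by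
        refine hDD.trans ?_
        have : C₁ * (|y| ^ 3 + ε ^ 2 * y ^ 2 + ε ^ 4) ≤ C₁ * (N ^ 3 + N ^ 3 + N ^ 3) := by gcongr
        linarith
      rw [abs_div, abs_of_pos (mul_pos hDpos hD₀pos), mul_div_assoc', div_mul_eq_mul_div,
        div_le_div_iff₀ (by positivity) (by positivity)]
      have h4 : c * N ^ 2 / 2 * (c' * N ^ 2 / 2) ≤ D * D₀ := by gcongr
      calc ε ^ 2 * |D - D₀| * (c * c') ≤ ε ^ 2 * (3 * C₁ * N ^ 3) * (c * c') := by gcongr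
        _ = 12 * C₁ * ε * (ε * (c * c' * N ^ 3 / 4)) := by ring
        _ ≤ 12 * C₁ * ε * (N * (c * c' * N ^ 3 / 4)) := by gcongr
        _ = 12 * C₁ * ε * (c * N ^ 2 / 2 * (c' * N ^ 2 / 2)) := by ring
        _ ≤ 12 * C₁ * ε * (D * D₀) := by gcongr
    rw [e]
    calc |ε ^ 2 * ((n - n₀) / D) - n₀ * (ε ^ 2 * ((D - D₀) / (D * D₀)))|
        ≤ |ε ^ 2 * ((n - n₀) / D)| + |n₀ * (ε ^ 2 * ((D - D₀) / (D * D₀)))| := abs_sub _ _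
      _ = ε ^ 2 * |(n - n₀) / D| + |n₀| * (ε ^ 2 * |(D - D₀) / (D * D₀)|) := by
          rw [abs_mul, abs_mul, abs_mul, abs_of_nonneg (sq_nonneg ε)]
      _ ≤ ε * (C₂ / c) + |n₀| * (12 * C₁ / (c * c') * ε) := by gcongr
      _ = K₁ * ε := by rw [hK₁]; ring
      _ ≤ (K₁ + K₂ + 1) * ε := by gcongr; linarith
  · rw [min_eq_right hy.le] at hD hn
    have hD4 : 4 * c ≤ D := by nlinarith [sq_nonneg ε]
    have hy4 : 4 ≤ y ^ 2 := by rw [← sq_abs]; nlinarith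
    have hD₀4 : 4 * c' ≤ D₀ := by nlinarith [sq_nonneg ε]
    have hnb : |n| ≤ |n₀| + 5 * C₂ := by
      have h5 := abs_sub_abs_le_abs_sub n n₀
      have h6 : C₂ * (ε ^ 2 + 2 ^ 2) ≤ C₂ * 5 := by gcongr; linarith
      linarith
    have h1 : |ε ^ 2 * n / D| ≤ ε * ((|n₀| + 5 * C₂) / (4 * c)) := by
      rw [abs_div, abs_mul, abs_of_nonneg (sq_nonneg ε), abs_of_pos hDpos, mul_div_assoc']
      gcongr
    have h2 : |ε ^ 2 * n₀ / D₀| ≤ ε * (|n₀| / (4 * c')) := by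
      rw [abs_div, abs_mul, abs_of_nonneg (sq_nonneg ε), abs_of_pos hD₀pos, mul_div_assoc']
      gcongr
    calc |ε ^ 2 * n / D - ε ^ 2 * n₀ / D₀| ≤ |ε ^ 2 * n / D| + |ε ^ 2 * n₀ / D₀| := abs_sub _ _
      _ ≤ ε * ((|n₀| + 5 * C₂) / (4 * c)) + ε * (|n₀| / (4 * c')) := add_le_add h1 h2
      _ = K₂ * ε := by rw [hK₂]; ring
      _ ≤ (K₁ + K₂ + 1) * ε := by gcongr; linarith

set_option maxHeartbeats 1000000 in
/-- Bounds for the inverse of the matrix symbol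
`N = [[λ² r₀ + ε² + s₁₁, s₁₂ - λ r₀], [s₁₂ - λ r₀, r₀ + ε² + s₂₂]]`, whose entries at `ε = 0` and
frequency `0` form a matrix of rank one. The functions `s` have quadratic Taylor polynomials
`a y²` and `N` is uniformly positive away from the origin. -/
lemma exists_symbol_bounds {r₀ l a₁ a₁₂ a₂ δ C : ℝ} {s₁ s₁₂ s₂ : ℝ → ℝ} (hr₀ : 0 < r₀)
    (hδ : 0 < δ) (hden : 0 < a₁ + 2 * l * a₁₂ + l ^ 2 * a₂) (hC : 0 ≤ C)
    (hs₁ : ∀ y, |s₁ y| ≤ C * min |y| 2 ^ 2) (hs₁₂ : ∀ y, |s₁₂ y| ≤ C * min |y| 2 ^ 2)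
    (hs₂ : ∀ y, |s₂ y| ≤ C * min |y| 2 ^ 2) (ht₁ : ∀ y, |s₁ y - a₁ * y ^ 2| ≤ C * |y| ^ 3)
    (ht₁₂ : ∀ y, |s₁₂ y - a₁₂ * y ^ 2| ≤ C * |y| ^ 3)
    (ht₂ : ∀ y, |s₂ y - a₂ * y ^ 2| ≤ C * |y| ^ 3)
    (hQ : ∀ y, δ * min |y| 2 ^ 2 ≤ r₀ * s₁ y + l ^ 2 * r₀ * s₂ y + 2 * (l * r₀) * s₁₂ y
      + s₁ y * s₂ y - s₁₂ y ^ 2) :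
    ∃ ε₀ K : ℝ, 0 < ε₀ ∧ ε₀ ≤ 1 ∧ 0 < K ∧ ∀ ε y D : ℝ, 0 < ε → ε < ε₀ →
      D = (l ^ 2 * r₀ + ε ^ 2 + s₁ y) * (r₀ + ε ^ 2 + s₂ y) - (s₁₂ y - l * r₀) ^ 2 →
      ε ^ 2 ≤ K * D ∧ min |y| 2 ^ 2 ≤ K * D ∧
      |ε ^ 2 * (r₀ + ε ^ 2 + s₂ y) / D
        - 1 / ((1 + l ^ 2) + (a₁ + 2 * l * a₁₂ + l ^ 2 * a₂) * (y / ε) ^ 2)| ≤ K * ε ∧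
      |ε ^ 2 * (l * r₀ - s₁₂ y) / D
        - l / ((1 + l ^ 2) + (a₁ + 2 * l * a₁₂ + l ^ 2 * a₂) * (y / ε) ^ 2)| ≤ K * ε := by
  set κ : ℝ := r₀ * (1 + l ^ 2) with hκ
  set e : ℝ := r₀ * (a₁ + 2 * l * a₁₂ + l ^ 2 * a₂) with he
  have hκ0 : 0 < κ := by positivity
  have he0 : 0 < e := by positivity
  set c : ℝ := min (δ / 2) κ with hc
  have hc0 : 0 < c := lt_min (by positivity) hκ0
  set c' : ℝ := min κ e with hc'
  have hc'0 : 0 < c' := lt_min hκ0 he0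
  set C₁ : ℝ := (r₀ + l ^ 2 * r₀ + 2 * |l * r₀|) * C + 4 * C ^ 2 + 2 * C + 1 with hC₁
  have hC₁0 : 0 ≤ C₁ := by positivity
  obtain ⟨K₁, hK₁, H₁⟩ := exists_abs_div_sub_div_le hc0 hc'0 hC₁0 (by positivity : 0 ≤ C + 1) r₀
  obtain ⟨K₂, hK₂, H₂⟩ := exists_abs_div_sub_div_le hc0 hc'0 hC₁0 (by positivity : 0 ≤ C + 1)
    (l * r₀)
  refine ⟨min 1 (δ / (4 * C + 1)), K₁ + K₂ + 1 / c, lt_min one_pos (by positivity), min_le_left _ _,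
    by positivity, ?_⟩
  intro ε y D hε hεlt hD
  have hε1 : ε ≤ 1 := (hεlt.trans_le (min_le_left _ _)).le
  have hεδ : ε * (4 * C + 1) ≤ δ := by
    have := (hεlt.trans_le (min_le_right _ _)).le
    rwa [le_div_iff₀ (by positivity)] at this
  have hε2 : ε ^ 2 ≤ ε := by nlinarith
  obtain ⟨Q, hQdef⟩ : ∃ Q, Q = r₀ * s₁ y + l ^ 2 * r₀ * s₂ y + 2 * (l * r₀) * s₁₂ y
      + s₁ y * s₂ y - s₁₂ y ^ 2 := ⟨_, rfl⟩
  have hQy := hQ y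
  rw [← hQdef] at hQy
  have hDQ : D = Q + ε ^ 2 * (κ + s₁ y + s₂ y) + ε ^ 4 := by
    rw [hD, hQdef, hκ]; ring
  have h1 := hs₁ y
  have h12 := hs₁₂ y
  have h2 := hs₂ y
  set μ : ℝ := min |y| 2 with hμ
  have hμ0 : 0 ≤ μ := le_min (abs_nonneg _) (by norm_num)
  have hμ2 : μ ≤ 2 := min_le_right _ _
  have hμy : μ ≤ |y| := min_le_left _ _
  have hDlow : c * (ε ^ 2 + μ ^ 2) ≤ D := by
    have hc1 : c ≤ δ / 2 := min_le_left _ _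
    have hc2 : c ≤ κ := min_le_right _ _
    have e1 : 2 * C * ε ^ 2 ≤ δ / 2 := by nlinarith
    have e2 : 2 * C * ε ^ 2 * μ ^ 2 ≤ δ / 2 * μ ^ 2 := by gcongr
    have e3 : ε ^ 2 * (-(2 * C * μ ^ 2)) ≤ ε ^ 2 * (s₁ y + s₂ y) := by
      gcongr
      linarith [(abs_le.1 h1).1, (abs_le.1 h2).1]
    have e4 : c * ε ^ 2 ≤ κ * ε ^ 2 := by gcongr
    have e5 : c * μ ^ 2 ≤ δ / 2 * μ ^ 2 := by gcongr
    have e6 : 0 ≤ ε ^ 4 := by positivity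
    rw [hDQ]
    linarith
  have hD0 : 0 < D := lt_of_lt_of_le (by positivity) hDlow
  have hD₀low : c' * (ε ^ 2 + y ^ 2) ≤ κ * ε ^ 2 + e * y ^ 2 := by
    have e1 : c' * ε ^ 2 ≤ κ * ε ^ 2 := by gcongr; exact min_le_left _ _
    have e2 : c' * y ^ 2 ≤ e * y ^ 2 := by gcongr; exact min_le_right _ _
    linarith
  have hDD : |D - (κ * ε ^ 2 + e * y ^ 2)| ≤ C₁ * (|y| ^ 3 + ε ^ 2 * y ^ 2 + ε ^ 4) := by
    have e0 : D - (κ * ε ^ 2 + e * y ^ 2) = r₀ * (s₁ y - a₁ * y ^ 2)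
        + l ^ 2 * r₀ * (s₂ y - a₂ * y ^ 2) + 2 * (l * r₀) * (s₁₂ y - a₁₂ * y ^ 2)
        + (s₁ y * s₂ y - s₁₂ y * s₁₂ y) + ε ^ 2 * (s₁ y + s₂ y) + ε ^ 4 := by
      rw [hDQ, hQdef, he]; ring
    have hμ4 : μ ^ 2 * μ ^ 2 ≤ 2 * |y| ^ 3 := by
      calc μ ^ 2 * μ ^ 2 = μ * μ ^ 3 := by ring
        _ ≤ 2 * |y| ^ 3 := by gcongr
    have hμy2 : μ ^ 2 ≤ y ^ 2 := by rw [← sq_abs y]; gcongr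
    have f1 : |r₀ * (s₁ y - a₁ * y ^ 2)| ≤ r₀ * (C * |y| ^ 3) := by
      rw [abs_mul, abs_of_pos hr₀]; gcongr; exact ht₁ y
    have f2 : |l ^ 2 * r₀ * (s₂ y - a₂ * y ^ 2)| ≤ l ^ 2 * r₀ * (C * |y| ^ 3) := by
      rw [abs_mul, abs_of_nonneg (by positivity)]; gcongr; exact ht₂ y
    have f3 : |2 * (l * r₀) * (s₁₂ y - a₁₂ * y ^ 2)| ≤ 2 * |l * r₀| * (C * |y| ^ 3) := by
      rw [abs_mul, abs_mul, abs_of_pos (by norm_num : (0 : ℝ) < 2)]; gcongr; exact ht₁₂ y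
    have f4 : |s₁ y * s₂ y| ≤ C ^ 2 * (2 * |y| ^ 3) := by
      rw [abs_mul]
      calc |s₁ y| * |s₂ y| ≤ (C * μ ^ 2) * (C * μ ^ 2) := by gcongr
        _ = C ^ 2 * (μ ^ 2 * μ ^ 2) := by ring
        _ ≤ _ := by gcongr
    have f5 : |s₁₂ y * s₁₂ y| ≤ C ^ 2 * (2 * |y| ^ 3) := by
      rw [abs_mul]
      calc |s₁₂ y| * |s₁₂ y| ≤ (C * μ ^ 2) * (C * μ ^ 2) := by gcongr
        _ = C ^ 2 * (μ ^ 2 * μ ^ 2) := by ring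
        _ ≤ _ := by gcongr
    have f6 : |ε ^ 2 * (s₁ y + s₂ y)| ≤ ε ^ 2 * (2 * C * y ^ 2) := by
      rw [abs_mul, abs_of_nonneg (sq_nonneg ε)]
      gcongr
      calc |s₁ y + s₂ y| ≤ |s₁ y| + |s₂ y| := abs_add_le _ _
        _ ≤ C * μ ^ 2 + C * μ ^ 2 := add_le_add h1 h2
        _ = 2 * C * μ ^ 2 := by ring
        _ ≤ _ := by gcongr
    have p1 : 0 ≤ |y| ^ 3 := by positivity
    have p2 : 0 ≤ ε ^ 2 * y ^ 2 := by positivity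
    have p3 : 0 ≤ ε ^ 4 := by positivity
    have q1 : 0 ≤ (r₀ + l ^ 2 * r₀ + 2 * |l * r₀|) * C := by positivity
    have q2 : 0 ≤ C ^ 2 := sq_nonneg C
    rw [e0]
    have hsum : |r₀ * (s₁ y - a₁ * y ^ 2)
        + l ^ 2 * r₀ * (s₂ y - a₂ * y ^ 2) + 2 * (l * r₀) * (s₁₂ y - a₁₂ * y ^ 2)
        + (s₁ y * s₂ y - s₁₂ y * s₁₂ y) + ε ^ 2 * (s₁ y + s₂ y) + ε ^ 4|
        ≤ ((r₀ + l ^ 2 * r₀ + 2 * |l * r₀|) * C + 4 * C ^ 2) * |y| ^ 3 + 2 * C * (ε ^ 2 * y ^ 2)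
          + ε ^ 4 := by
      rw [abs_le] at f1 f2 f3 f4 f5 f6 ⊢
      constructor <;> linarith
    refine hsum.trans ?_
    have g1 : ((r₀ + l ^ 2 * r₀ + 2 * |l * r₀|) * C + 4 * C ^ 2) * |y| ^ 3 ≤ C₁ * |y| ^ 3 := by
      gcongr; linarith
    have g2 : 2 * C * (ε ^ 2 * y ^ 2) ≤ C₁ * (ε ^ 2 * y ^ 2) := by gcongr; linarith
    have g3 : 1 * ε ^ 4 ≤ C₁ * ε ^ 4 := by gcongr; linarith
    linarith
  have hn₁ : |(r₀ + ε ^ 2 + s₂ y) - r₀| ≤ (C + 1) * (ε ^ 2 + μ ^ 2) := by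
    rw [show (r₀ + ε ^ 2 + s₂ y) - r₀ = ε ^ 2 + s₂ y by ring]
    have := abs_le.1 h2
    have hCε := mul_nonneg hC (sq_nonneg ε)
    have hμs := sq_nonneg μ
    have hεs := sq_nonneg ε
    rw [abs_le]
    constructor <;> linarith
  have hn₂ : |(l * r₀ - s₁₂ y) - l * r₀| ≤ (C + 1) * (ε ^ 2 + μ ^ 2) := by
    rw [show (l * r₀ - s₁₂ y) - l * r₀ = -s₁₂ y by ring]
    have := abs_le.1 h12
    have hCε := mul_nonneg hC (sq_nonneg ε)
    have hμs := sq_nonneg μ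
    have hεs := sq_nonneg ε
    rw [abs_le]
    constructor <;> linarith
  have G₁ := H₁ ε y D (κ * ε ^ 2 + e * y ^ 2) _ hε hε1 hDlow hD₀low hDD hn₁
  have G₂ := H₂ ε y D (κ * ε ^ 2 + e * y ^ 2) _ hε hε1 hDlow hD₀low hDD hn₂
  have hlim : ε ^ 2 * r₀ / (κ * ε ^ 2 + e * y ^ 2)
      = 1 / ((1 + l ^ 2) + (a₁ + 2 * l * a₁₂ + l ^ 2 * a₂) * (y / ε) ^ 2) := by
    have p1 : 0 < κ * ε ^ 2 + e * y ^ 2 := by positivity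
    have p2 : 0 < (1 + l ^ 2) + (a₁ + 2 * l * a₁₂ + l ^ 2 * a₂) * (y / ε) ^ 2 := by positivity
    rw [div_eq_div_iff p1.ne' p2.ne', hκ, he]
    field_simp
  have hlim' : ε ^ 2 * (l * r₀) / (κ * ε ^ 2 + e * y ^ 2)
      = l / ((1 + l ^ 2) + (a₁ + 2 * l * a₁₂ + l ^ 2 * a₂) * (y / ε) ^ 2) := by
    rw [show ε ^ 2 * (l * r₀) / (κ * ε ^ 2 + e * y ^ 2)
      = l * (ε ^ 2 * r₀ / (κ * ε ^ 2 + e * y ^ 2)) by ring, hlim]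
    ring
  rw [hlim] at G₁
  rw [hlim'] at G₂
  have hcD : ε ^ 2 + μ ^ 2 ≤ 1 / c * D := by
    rw [one_div, ← div_eq_inv_mul, le_div_iff₀ hc0]
    linarith
  have hKD : 1 / c * D ≤ (K₁ + K₂ + 1 / c) * D := by gcongr; linarith
  have hc00 : 0 ≤ 1 / c := by positivity
  refine ⟨by linarith [sq_nonneg μ], by linarith [sq_nonneg ε], G₁.trans ?_, G₂.trans ?_⟩ <;>
  · gcongr
    linarith

/-! ### The matrix symbol of the linear operator -/

namespace LatticeData

variable {M : ℕ} (G : LatticeData M)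

lemma c₃_lt_σ₀ (h : G.c₂ ≠ 0) : 0 < G.σ₀ - G.c₃ := by
  have h1 : |G.c₁ - G.c₃| < √((G.c₁ - G.c₃) ^ 2 + 4 * G.c₂ ^ 2) := by
    refine Real.lt_sqrt_of_sq_lt ?_
    rw [sq_abs]
    have : 0 < G.c₂ ^ 2 := by positivity
    linarith
  have h2 := neg_abs_le (G.c₁ - G.c₃)
  unfold σ₀
  linarith

lemma σ₀_quadratic : (G.σ₀ - G.c₁) * (G.σ₀ - G.c₃) = G.c₂ ^ 2 := by
  have h := Real.sq_sqrt (by positivity : 0 ≤ (G.c₁ - G.c₃) ^ 2 + 4 * G.c₂ ^ 2)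
  unfold σ₀
  linear_combination h / 4

lemma lam_mul (h : G.c₂ ≠ 0) : G.lam * (G.σ₀ - G.c₃) = G.c₂ :=
  div_mul_cancel₀ _ (G.c₃_lt_σ₀ h).ne'

lemma σ₀_sub_c₁ (h : G.c₂ ≠ 0) : G.σ₀ - G.c₁ = G.lam ^ 2 * (G.σ₀ - G.c₃) := by
  have h1 := G.σ₀_quadratic
  have h2 := G.lam_mul h
  have h3 := G.c₃_lt_σ₀ h
  have h4 : (G.σ₀ - G.c₁) * (G.σ₀ - G.c₃) = G.lam ^ 2 * (G.σ₀ - G.c₃) * (G.σ₀ - G.c₃) := by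
    rw [h1, ← h2]; ring
  exact mul_right_cancel₀ h3.ne' h4

/-- The common denominator of `d₁` and `d₂`. -/
def den : ℝ := (G.a₁ + G.lam * G.a₂) + G.lam * (G.b₂ + G.lam * G.b₁)

lemma b₂_eq_a₂ (hs : G.SymmetricCoefficients) : G.b₂ = G.a₂ := by
  unfold b₂ a₂
  exact Finset.sum_congr rfl fun m _ => by rw [(hs m).1]

lemma den_eq (hs : G.SymmetricCoefficients) :
    G.den = G.a₁ + 2 * G.lam * G.a₂ + G.lam ^ 2 * G.b₁ := by
  rw [den, G.b₂_eq_a₂ hs]; ring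

lemma den_pos (hd : 0 < G.d₁) : 0 < G.den := by
  have h1 : G.d₁ = (1 + G.lam ^ 2) / G.den := rfl
  rw [h1] at hd
  have h2 : 0 < 1 + G.lam ^ 2 := by positivity
  exact (div_pos_iff_of_pos_left h2).1 hd

lemma d₁_mul_den (hd : 0 < G.d₁) : G.d₁ * G.den = 1 + G.lam ^ 2 :=
  div_mul_cancel₀ _ (G.den_pos hd).ne'

/-- The function `∑ₘ kₘ² αₘ S_{kₘ}`. -/
def symS (α : Fin M → ℝ) (y : ℝ) : ℝ := ∑ m, G.k m ^ 2 * α m * symbolS (G.k m) y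

lemma exists_symS_bound (α : Fin M → ℝ) : ∃ C : ℝ, 0 ≤ C ∧
    (∀ y, |G.symS α y| ≤ C * min |y| 2 ^ 2) ∧
    ∀ y, |G.symS α y - (∑ m, G.k m ^ 4 / 12 * α m) * y ^ 2| ≤ C * |y| ^ 3 := by
  refine ⟨∑ m, |G.k m ^ 2 * α m| * (G.k m ^ 2 + 1 + |G.k m| ^ 3),
    Finset.sum_nonneg fun m _ => by positivity, fun y => ?_, fun y => ?_⟩
  · rw [symS, Finset.sum_mul]
    refine (Finset.abs_sum_le_sum_abs _ _).trans (Finset.sum_le_sum fun m _ => ?_)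
    rw [abs_mul, mul_assoc]
    refine mul_le_mul_of_nonneg_left ?_ (abs_nonneg _)
    rw [abs_of_nonneg (symbolS_nonneg _ _)]
    refine (symbolS_le_min_sq (G.k m) y).trans (mul_le_mul_of_nonneg_right ?_ (by positivity))
    have : 0 ≤ |G.k m| ^ 3 := by positivity
    linarith
  · rw [symS, Finset.sum_mul, Finset.sum_mul, ← Finset.sum_sub_distrib]
    refine (Finset.abs_sum_le_sum_abs _ _).trans (Finset.sum_le_sum fun m _ => ?_)
    rw [show G.k m ^ 2 * α m * symbolS (G.k m) y - G.k m ^ 4 / 12 * α m * y ^ 2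
      = G.k m ^ 2 * α m * (symbolS (G.k m) y - G.k m ^ 2 / 12 * y ^ 2) by ring, abs_mul, mul_assoc]
    refine mul_le_mul_of_nonneg_left ?_ (abs_nonneg _)
    refine (abs_symbolS_sub_le (G.k m) y).trans (mul_le_mul_of_nonneg_right ?_ (by positivity))
    have : 0 ≤ G.k m ^ 2 := by positivity
    linarith

/-- Bounds at the rescaled frequency `y = 2πεξ`, with `D` the determinant of the matrix symbol of
`B_ε^can`, multiplied by `ε⁴`. The determinant is bounded below because `T` is, and the first
column of the inverse of the symbol of `B_ε` converges to `(1, λ) / (1 + λ² + den (2πξ)²)`. -/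
lemma exists_inverse_symbol_bounds (hs : G.SymmetricCoefficients) (hg : G.Generic)
    (hT : G.SymbolBound) : ∃ ε₀ K : ℝ, 0 < ε₀ ∧ ε₀ ≤ 1 ∧ 0 < K ∧ ∀ ε y D : ℝ, 0 < ε → ε < ε₀ →
      D = (G.σ₀ - G.c₁ + ε ^ 2 + G.symS G.α₁₁ y) * (G.σ₀ - G.c₃ + ε ^ 2 + G.symS G.α₂₂ y)
        - (G.symS G.α₁₂ y - G.c₂) ^ 2 →
      ε ^ 2 ≤ K * D ∧ min |y| 2 ^ 2 ≤ K * D ∧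
      |ε ^ 2 * (G.σ₀ - G.c₃ + ε ^ 2 + G.symS G.α₂₂ y) / D
        - 1 / ((1 + G.lam ^ 2) + G.den * (y / ε) ^ 2)| ≤ K * ε ∧
      |ε ^ 2 * (G.c₂ - G.symS G.α₁₂ y) / D
        - G.lam / ((1 + G.lam ^ 2) + G.den * (y / ε) ^ 2)| ≤ K * ε := by
  obtain ⟨⟨-, hc₂⟩, hd₁, -⟩ := hg
  obtain ⟨δ₀, hδ₀, hT⟩ := hT
  have hr := G.c₃_lt_σ₀ hc₂
  have hp := G.σ₀_sub_c₁ hc₂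
  have hl := G.lam_mul hc₂
  have hκ : 0 < 2 * G.σ₀ - (G.c₁ + G.c₃) := by
    have : 0 ≤ G.lam ^ 2 * (G.σ₀ - G.c₃) := by positivity
    linarith
  obtain ⟨C₁, hC₁, h1, h1'⟩ := G.exists_symS_bound G.α₁₁
  obtain ⟨C₁₂, hC₁₂, h12, h12'⟩ := G.exists_symS_bound G.α₁₂
  obtain ⟨C₂, hC₂, h2, h2'⟩ := G.exists_symS_bound G.α₂₂
  have hden := G.den_pos hd₁
  rw [G.den_eq hs] at hden
  have hmin : ∀ y : ℝ, 0 ≤ min |y| 2 ^ 2 := fun y => by positivity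
  have habs : ∀ y : ℝ, 0 ≤ |y| ^ 3 := fun y => by positivity
  have key := exists_symbol_bounds (r₀ := G.σ₀ - G.c₃) (l := G.lam) (a₁ := G.a₁) (a₁₂ := G.a₂)
    (a₂ := G.b₁) (δ := δ₀ / (2 * G.σ₀ - (G.c₁ + G.c₃))) (C := C₁ + C₁₂ + C₂)
    (s₁ := G.symS G.α₁₁) (s₁₂ := G.symS G.α₁₂) (s₂ := G.symS G.α₂₂) hr (by positivity) hden
    (by positivity)
    (fun y => (h1 y).trans (mul_le_mul_of_nonneg_right (by linarith) (hmin y)))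
    (fun y => (h12 y).trans (mul_le_mul_of_nonneg_right (by linarith) (hmin y)))
    (fun y => (h2 y).trans (mul_le_mul_of_nonneg_right (by linarith) (hmin y)))
    (fun y => (h1' y).trans (mul_le_mul_of_nonneg_right (by linarith) (habs y)))
    (fun y => (h12' y).trans (mul_le_mul_of_nonneg_right (by linarith) (habs y)))
    (fun y => (h2' y).trans (mul_le_mul_of_nonneg_right (by linarith) (habs y)))
    (fun y => by
      rw [div_mul_eq_mul_div, div_le_iff₀ hκ]
      refine (hT y).trans_eq ?_
      rw [← hp, hl, T]
      have : ∑ m, G.k m ^ 2 * ((G.σ₀ - G.c₃) * G.α₁₁ m + (G.σ₀ - G.c₁) * G.α₂₂ m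
          + 2 * G.c₂ * G.α₁₂ m) * symbolS (G.k m) y = (G.σ₀ - G.c₃) * G.symS G.α₁₁ y
          + (G.σ₀ - G.c₁) * G.symS G.α₂₂ y + 2 * G.c₂ * G.symS G.α₁₂ y := by
        simp only [symS, Finset.mul_sum]
        rw [← Finset.sum_add_distrib, ← Finset.sum_add_distrib]
        exact Finset.sum_congr rfl fun m _ => by ring
      rw [this]
      simp only [symS]
      ring)
  rw [← hp, hl, ← G.den_eq hs] at key
  exact key

/-- The symbol of `∑ₘ kₘ² αₘ A_{kₘε}²`. -/
def avSum (ε : ℝ) (α : Fin M → ℝ) : Bdd ℝ :=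
  ∑ m, (G.k m ^ 2 * α m) • avSymbol (G.k m * ε) ^ 2

lemma Bdd.coe_sum {ι : Type*} (s : Finset ι) (f : ι → Bdd ℝ) (x : ℝ) :
    (∑ i ∈ s, f i).1 x = ∑ i ∈ s, (f i).1 x := by
  have h : (∑ i ∈ s, f i).1 = ∑ i ∈ s, (f i).1 := AddSubmonoidClass.coe_finsetSum _ _
  rw [h, Finset.sum_apply]

lemma avSymbol_sq (k ε ξ : ℝ) :
    (avSymbol (k * ε) ^ 2).1 ξ = 1 - symbolS k (2 * Real.pi * ε * ξ) := by
  change Real.sinc (Real.pi * (k * ε) * ξ) ^ 2 = _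
  rw [symbolS, show k * (2 * Real.pi * ε * ξ) / 2 = Real.pi * (k * ε) * ξ by ring]
  ring

lemma avSum_apply (ε : ℝ) (α : Fin M → ℝ) (ξ : ℝ) :
    (G.avSum ε α).1 ξ = (∑ m, G.k m ^ 2 * α m) - G.symS α (2 * Real.pi * ε * ξ) := by
  rw [avSum, Bdd.coe_sum, symS, ← Finset.sum_sub_distrib]
  refine Finset.sum_congr rfl fun m _ => ?_
  change G.k m ^ 2 * α m * (avSymbol (G.k m * ε) ^ 2).1 ξ = _
  rw [avSymbol_sq]
  ring

/-- Entries of the inverse of the matrix symbol of `B_ε`, together with their bounds and their limits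
after multiplication with the symbol of `A_{kₘε}²`. -/
lemma exists_inverse_symbol (hs : G.SymmetricCoefficients) (hg : G.Generic)
    (hT : G.SymbolBound) : ∃ ε₀ K : ℝ, 0 < ε₀ ∧ ε₀ ≤ 1 ∧ 0 < K ∧ ∀ ε : ℝ, 0 < ε → ε < ε₀ →
      ∃ i₁₁ i₁₂ i₂₁ i₂₂ : Bdd ℝ, ∃ n₁₁ n₁₂ n₂₂ : Bdd ℝ,
        n₁₁ = algebraMap ℝ (Bdd ℝ) (G.σ₀ + ε ^ 2) - G.avSum ε G.α₁₁ ∧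
        n₁₂ = -G.avSum ε G.α₁₂ ∧
        n₂₂ = algebraMap ℝ (Bdd ℝ) (G.σ₀ + ε ^ 2) - G.avSum ε G.α₂₂ ∧
        (1 / ε ^ 2) • (n₁₁ + G.lam • n₁₂) * i₁₁ + (1 / ε ^ 2) • (n₁₂ + G.lam • n₂₂) * i₂₁ = 1 ∧
        (1 / ε ^ 2) • (n₁₁ + G.lam • n₁₂) * i₁₂ + (1 / ε ^ 2) • (n₁₂ + G.lam • n₂₂) * i₂₂ = 0 ∧
        n₁₂ * i₁₁ + n₂₂ * i₂₁ = 0 ∧ n₁₂ * i₁₂ + n₂₂ * i₂₂ = 1 ∧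
        (∀ ξ, |i₁₁.1 ξ| ≤ K) ∧ (∀ ξ, |i₁₂.1 ξ| ≤ K) ∧ (∀ ξ, |i₂₁.1 ξ| ≤ K) ∧
        (∀ ξ, |i₂₂.1 ξ| ≤ K) ∧
        (∀ m ξ, |(i₁₁ * avSymbol (G.k m * ε) ^ 2).1 ξ
          - 1 / ((1 + G.lam ^ 2) + G.den * (2 * Real.pi * ξ) ^ 2)| ≤ K * ε) ∧
        (∀ m ξ, |(i₂₁ * avSymbol (G.k m * ε) ^ 2).1 ξ
          - G.lam / ((1 + G.lam ^ 2) + G.den * (2 * Real.pi * ξ) ^ 2)| ≤ K * ε) := by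
  obtain ⟨ε₀, K, hε₀, hε₀1, hK, H⟩ := G.exists_inverse_symbol_bounds hs hg hT
  obtain ⟨⟨-, hc₂⟩, hd₁, -⟩ := hg
  obtain ⟨C₁, hC₁, h1, -⟩ := G.exists_symS_bound G.α₁₁
  obtain ⟨C₁₂, hC₁₂, h12, -⟩ := G.exists_symS_bound G.α₁₂
  obtain ⟨C₂, hC₂, h2, -⟩ := G.exists_symS_bound G.α₂₂
  have hr := G.c₃_lt_σ₀ hc₂
  have hp := G.σ₀_sub_c₁ hc₂
  have hl := G.lam_mul hc₂
  have hden := G.den_pos hd₁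
  -- the constants bounding `r`, `q` and the sum of the `kₘ²`
  set R : ℝ := (G.σ₀ - G.c₃) + 1 + 4 * C₂ with hR
  set R' : ℝ := |G.c₂| + 4 * C₁₂ with hR'
  set k₂ : ℝ := ∑ m, (G.k m ^ 2 + 1) with hk₂
  have hR0 : 0 ≤ R := by positivity
  have hR'0 : 0 ≤ R' := by positivity
  have hk₂0 : 0 ≤ k₂ := Finset.sum_nonneg fun m _ => by positivity
  have hkm : ∀ m, G.k m ^ 2 + 1 ≤ k₂ := fun m =>
    Finset.single_le_sum (f := fun m => G.k m ^ 2 + 1) (fun m _ => by positivity)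
      (Finset.mem_univ m)
  set L : ℝ := 1 + C₁ + C₁₂ + C₂ with hL
  refine ⟨ε₀, K + K * R + K * R' + 2 * (K * (|G.lam| + 1) * L) + K * k₂ * R + K * k₂ * R', hε₀, hε₀1,
    by positivity, ?_⟩
  intro ε hε hεlt
  have hε1 : ε ≤ 1 := hεlt.le.trans hε₀1
  have hε2 : ε ^ 2 ≤ ε := by nlinarith
  have hε20 : 0 < ε ^ 2 := by positivity
  set n₁₁ : Bdd ℝ := algebraMap ℝ (Bdd ℝ) (G.σ₀ + ε ^ 2) - G.avSum ε G.α₁₁ with hn₁₁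
  set n₁₂ : Bdd ℝ := -G.avSum ε G.α₁₂ with hn₁₂
  set n₂₂ : Bdd ℝ := algebraMap ℝ (Bdd ℝ) (G.σ₀ + ε ^ 2) - G.avSum ε G.α₂₂ with hn₂₂
  have en₁₁ : ∀ ξ, n₁₁.1 ξ = G.σ₀ - G.c₁ + ε ^ 2 + G.symS G.α₁₁ (2 * Real.pi * ε * ξ) := by
    intro ξ
    change G.σ₀ + ε ^ 2 - (G.avSum ε G.α₁₁).1 ξ = _
    rw [avSum_apply, ← c₁]; ring
  have en₁₂ : ∀ ξ, n₁₂.1 ξ = G.symS G.α₁₂ (2 * Real.pi * ε * ξ) - G.c₂ := by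
    intro ξ
    change -(G.avSum ε G.α₁₂).1 ξ = _
    rw [avSum_apply, ← c₂]; ring
  have en₂₂ : ∀ ξ, n₂₂.1 ξ = G.σ₀ - G.c₃ + ε ^ 2 + G.symS G.α₂₂ (2 * Real.pi * ε * ξ) := by
    intro ξ
    change G.σ₀ + ε ^ 2 - (G.avSum ε G.α₂₂).1 ξ = _
    rw [avSum_apply, ← c₃]; ring
  set Δ : Bdd ℝ := n₁₁ * n₂₂ - n₁₂ * n₁₂ with hΔ
  have eΔ : ∀ ξ, Δ.1 ξ = n₁₁.1 ξ * n₂₂.1 ξ - n₁₂.1 ξ * n₁₂.1 ξ := fun ξ => rfl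
  have HΔ := fun ξ => H ε (2 * Real.pi * ε * ξ) (Δ.1 ξ) hε hεlt
    (by rw [eΔ, en₁₁, en₁₂, en₂₂]; ring)
  have hΔpos : ∀ ξ, 0 < Δ.1 ξ := fun ξ => by
    have := (HΔ ξ).1
    by_contra hneg
    nlinarith
  let iΔ : Bdd ℝ := ⟨fun ξ => 1 / Δ.1 ξ, Δ.2.1.const_div 1, K / ε ^ 2, fun ξ => by
    rw [Real.norm_of_nonneg (one_div_nonneg.2 (hΔpos ξ).le), div_le_div_iff₀ (hΔpos ξ) hε20]
    linarith [(HΔ ξ).1]⟩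
  have eiΔ : ∀ ξ, iΔ.1 ξ = 1 / Δ.1 ξ := fun ξ => rfl
  have hinv : (n₁₁ * n₂₂ - n₁₂ * n₁₂) * iΔ = 1 := by
    refine Subtype.ext (funext fun ξ => ?_)
    change Δ.1 ξ * (1 / Δ.1 ξ) = 1
    exact mul_one_div_cancel (hΔpos ξ).ne'
  have hee : algebraMap ℝ (Bdd ℝ) (1 / ε ^ 2) * algebraMap ℝ (Bdd ℝ) (ε ^ 2) = 1 := by
    rw [← map_mul, one_div_mul_cancel hε20.ne', map_one]
  -- bounds at a fixed frequency
  have hμ4 : ∀ y : ℝ, min |y| 2 ^ 2 ≤ 4 := fun y => by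
    have : min |y| 2 ^ 2 ≤ 2 ^ 2 :=
      pow_le_pow_left₀ (le_min (abs_nonneg _) (by norm_num)) (min_le_right _ _) 2
    linarith
  have hrb : ∀ ξ, |n₂₂.1 ξ| ≤ R := fun ξ => by
    have := (h2 (2 * Real.pi * ε * ξ)).trans (mul_le_mul_of_nonneg_left (hμ4 _) hC₂)
    rw [en₂₂, abs_le] at *
    constructor <;> linarith
  have hqb : ∀ ξ, |n₁₂.1 ξ| ≤ R' := fun ξ => by
    have h3 := (h12 (2 * Real.pi * ε * ξ)).trans (mul_le_mul_of_nonneg_left (hμ4 _) hC₁₂)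
    have h4 := le_abs_self G.c₂
    have h5 := neg_abs_le G.c₂
    rw [en₁₂, abs_le] at *
    constructor <;> linarith
  have hεΔ : ∀ ξ, ε ^ 2 * (1 / Δ.1 ξ) ≤ K := fun ξ => by
    rw [mul_one_div, div_le_iff₀ (hΔpos ξ)]; exact (HΔ ξ).1
  have hμΔ : ∀ ξ, min |2 * Real.pi * ε * ξ| 2 ^ 2 * (1 / Δ.1 ξ) ≤ K := fun ξ => by
    rw [mul_one_div, div_le_iff₀ (hΔpos ξ)]; exact (HΔ ξ).2.1
  have hΔi : ∀ ξ, 0 ≤ 1 / Δ.1 ξ := fun ξ => one_div_nonneg.2 (hΔpos ξ).le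
  have hKL : ∀ ξ, ∀ x : ℝ, |x| ≤ (|G.lam| + 1) * L
      * (ε ^ 2 + min |2 * Real.pi * ε * ξ| 2 ^ 2) → |x * (1 / Δ.1 ξ)| ≤
      2 * (K * (|G.lam| + 1) * L) := by
    intro ξ x hx
    rw [abs_mul, abs_of_nonneg (hΔi ξ)]
    calc |x| * (1 / Δ.1 ξ) ≤ (|G.lam| + 1) * L * (ε ^ 2 + min |2 * Real.pi * ε * ξ| 2 ^ 2)
          * (1 / Δ.1 ξ) := mul_le_mul_of_nonneg_right hx (hΔi ξ)
      _ = (|G.lam| + 1) * L * (ε ^ 2 * (1 / Δ.1 ξ)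
          + min |2 * Real.pi * ε * ξ| 2 ^ 2 * (1 / Δ.1 ξ)) := by ring
      _ ≤ (|G.lam| + 1) * L * (K + K) := by
          gcongr
          · exact hεΔ ξ
          · exact hμΔ ξ
      _ = _ := by ring
  -- the constant dominates each of its summands
  have hl0 := abs_nonneg G.lam
  have hL0 : 0 ≤ L := by positivity
  have p1 : 0 ≤ K * R := by positivity
  have p2 : 0 ≤ K * R' := by positivity
  have p3 : 0 ≤ 2 * (K * (|G.lam| + 1) * L) := by positivity
  have p4 : 0 ≤ K * k₂ * R := by positivity
  have p5 : 0 ≤ K * k₂ * R' := by positivity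
  have hcb : ∀ (c : Bdd ℝ) (Rc : ℝ), (∀ ξ, |c.1 ξ| ≤ Rc) → 0 ≤ Rc → ∀ ξ,
      |ε ^ 2 * (c.1 ξ * (1 / Δ.1 ξ))| ≤ K * Rc := by
    intro c Rc hc hRc ξ
    rw [show ε ^ 2 * (c.1 ξ * (1 / Δ.1 ξ)) = (ε ^ 2 * (1 / Δ.1 ξ)) * c.1 ξ by ring, abs_mul,
      abs_of_nonneg (mul_nonneg hε20.le (hΔi ξ))]
    exact mul_le_mul (hεΔ ξ) (hc ξ) (abs_nonneg _) hK.le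
  have hlim : ∀ (c : Bdd ℝ) (Rc γ : ℝ), (∀ ξ, |c.1 ξ| ≤ Rc) → 0 ≤ Rc → ∀ m ξ,
      |ε ^ 2 * (c.1 ξ * (1 / Δ.1 ξ)) - γ| ≤ K * ε →
      |ε ^ 2 * (c.1 ξ * (1 / Δ.1 ξ)) * (avSymbol (G.k m * ε) ^ 2).1 ξ - γ|
        ≤ K * ε + K * k₂ * Rc * ε := by
    intro c Rc γ hc hRc m ξ hγ
    rw [avSymbol_sq]
    have hS : |ε ^ 2 * (c.1 ξ * (1 / Δ.1 ξ)) * symbolS (G.k m) (2 * Real.pi * ε * ξ)|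
        ≤ K * k₂ * Rc * ε := by
      have h3 := symbolS_nonneg (G.k m) (2 * Real.pi * ε * ξ)
      have h4 := symbolS_le_min_sq (G.k m) (2 * Real.pi * ε * ξ)
      have h5 : symbolS (G.k m) (2 * Real.pi * ε * ξ) * (1 / Δ.1 ξ) ≤ k₂ * K := by
        calc _ ≤ (k₂ * min |2 * Real.pi * ε * ξ| 2 ^ 2) * (1 / Δ.1 ξ) := by
              refine mul_le_mul_of_nonneg_right (h4.trans ?_) (hΔi ξ)
              exact mul_le_mul_of_nonneg_right (hkm m) (by positivity)
          _ = k₂ * (min |2 * Real.pi * ε * ξ| 2 ^ 2 * (1 / Δ.1 ξ)) := by ring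
          _ ≤ _ := mul_le_mul_of_nonneg_left (hμΔ ξ) hk₂0
      rw [show ε ^ 2 * (c.1 ξ * (1 / Δ.1 ξ)) * symbolS (G.k m) (2 * Real.pi * ε * ξ)
        = c.1 ξ * (ε ^ 2 * (symbolS (G.k m) (2 * Real.pi * ε * ξ) * (1 / Δ.1 ξ))) by ring, abs_mul,
        abs_of_nonneg (mul_nonneg hε20.le (mul_nonneg h3 (hΔi ξ)))]
      calc _ ≤ Rc * (ε * (k₂ * K)) := by
            refine mul_le_mul (hc ξ) ?_ (mul_nonneg hε20.le (mul_nonneg h3 (hΔi ξ))) hRc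
            exact mul_le_mul hε2 h5 (mul_nonneg h3 (hΔi ξ)) hε.le
        _ = _ := by ring
    calc _ = |(ε ^ 2 * (c.1 ξ * (1 / Δ.1 ξ)) - γ)
          - ε ^ 2 * (c.1 ξ * (1 / Δ.1 ξ)) * symbolS (G.k m) (2 * Real.pi * ε * ξ)| := by
          congr 1; ring
      _ ≤ _ := (abs_sub _ _).trans (add_le_add hγ hS)
  have hyε : ∀ ξ : ℝ, 2 * Real.pi * ε * ξ / ε = 2 * Real.pi * ξ := fun ξ => by field_simp
  have hlimK : ∀ x : ℝ, x = K * k₂ * R ∨ x = K * k₂ * R' → K * ε + x * ε ≤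
      (K + K * R + K * R' + 2 * (K * (|G.lam| + 1) * L) + K * k₂ * R + K * k₂ * R') * ε := by
    intro x hx
    rw [← add_mul]
    refine mul_le_mul_of_nonneg_right ?_ hε.le
    rcases hx with rfl | rfl <;> linarith
  refine ⟨(ε ^ 2) • (n₂₂ * iΔ), (-n₁₂ - G.lam • n₂₂) * iΔ, (ε ^ 2) • (-n₁₂ * iΔ),
    (n₁₁ + G.lam • n₁₂) * iΔ, n₁₁, n₁₂, n₂₂, rfl, rfl, rfl, ?_, ?_, ?_, ?_, ?_, ?_, ?_, ?_, ?_, ?_⟩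
  · simp only [Algebra.smul_def]
    linear_combination (n₁₁ * n₂₂ - n₁₂ * n₁₂) * iΔ * hee + hinv
  · simp only [Algebra.smul_def]
    ring
  · simp only [Algebra.smul_def]
    ring
  · simp only [Algebra.smul_def]
    linear_combination hinv
  · intro ξ
    refine (hcb n₂₂ R hrb hR0 ξ).trans ?_
    linarith
  · intro ξ
    refine (hKL ξ (-n₁₂.1 ξ - G.lam * n₂₂.1 ξ) ?_).trans ?_
    · have e : -n₁₂.1 ξ - G.lam * n₂₂.1 ξ = -G.symS G.α₁₂ (2 * Real.pi * ε * ξ)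
          - G.lam * ε ^ 2 - G.lam * G.symS G.α₂₂ (2 * Real.pi * ε * ξ) := by
        rw [en₁₂, en₂₂]; linear_combination -hl
      have t1 := h12 (2 * Real.pi * ε * ξ)
      have t2 := h2 (2 * Real.pi * ε * ξ)
      have t0 : (0 : ℝ) ≤ min |2 * Real.pi * ε * ξ| 2 ^ 2 := by positivity
      set μ : ℝ := min |2 * Real.pi * ε * ξ| 2 ^ 2
      rw [e]
      calc _ ≤ |G.symS G.α₁₂ (2 * Real.pi * ε * ξ)| + |G.lam| * ε ^ 2
            + |G.lam| * |G.symS G.α₂₂ (2 * Real.pi * ε * ξ)| := by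
            refine (abs_sub _ _).trans ?_
            rw [abs_mul G.lam]
            refine add_le_add ((abs_sub _ _).trans ?_) le_rfl
            rw [abs_neg, abs_mul, abs_of_pos hε20]
        _ ≤ C₁₂ * μ + |G.lam| * ε ^ 2 + |G.lam| * (C₂ * μ) := by gcongr
        _ ≤ _ := by
            have u1 : 0 ≤ |G.lam| * C₁ * (ε ^ 2 + μ) := by positivity
            have u2 : 0 ≤ |G.lam| * C₁₂ * (ε ^ 2 + μ) := by positivity
            have u3 : 0 ≤ |G.lam| * C₂ * ε ^ 2 := by positivity
            have u4 : 0 ≤ |G.lam| * μ := by positivity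
            have u5 : 0 ≤ (1 + C₁ + C₂) * (ε ^ 2 + μ) := by positivity
            have u6 : 0 ≤ C₁₂ * ε ^ 2 := by positivity
            rw [hL]
            linarith
    · linarith
  · intro ξ
    have hn : ∀ ξ, |(-n₁₂).1 ξ| ≤ R' := fun ξ => (abs_neg _).trans_le (hqb ξ)
    refine (hcb (-n₁₂) R' hn hR'0 ξ).trans ?_
    linarith
  · intro ξ
    refine (hKL ξ (n₁₁.1 ξ + G.lam * n₁₂.1 ξ) ?_).trans ?_
    · have e : n₁₁.1 ξ + G.lam * n₁₂.1 ξ = ε ^ 2 + G.symS G.α₁₁ (2 * Real.pi * ε * ξ)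
          + G.lam * G.symS G.α₁₂ (2 * Real.pi * ε * ξ) := by
        rw [en₁₂, en₁₁]; linear_combination hp + G.lam * hl
      have t1 := h12 (2 * Real.pi * ε * ξ)
      have t2 := h1 (2 * Real.pi * ε * ξ)
      have t0 : (0 : ℝ) ≤ min |2 * Real.pi * ε * ξ| 2 ^ 2 := by positivity
      set μ : ℝ := min |2 * Real.pi * ε * ξ| 2 ^ 2
      rw [e]
      calc _ ≤ ε ^ 2 + |G.symS G.α₁₁ (2 * Real.pi * ε * ξ)|
            + |G.lam| * |G.symS G.α₁₂ (2 * Real.pi * ε * ξ)| := by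
            refine (abs_add_le _ _).trans ?_
            rw [abs_mul G.lam]
            refine add_le_add ((abs_add_le _ _).trans ?_) le_rfl
            rw [abs_of_pos hε20]
        _ ≤ ε ^ 2 + C₁ * μ + |G.lam| * (C₁₂ * μ) := by gcongr
        _ ≤ _ := by
            have u1 : 0 ≤ |G.lam| * (1 + C₁ + C₂) * (ε ^ 2 + μ) := by positivity
            have u2 : 0 ≤ |G.lam| * C₁₂ * ε ^ 2 := by positivity
            have u5 : 0 ≤ (C₁₂ + C₂) * (ε ^ 2 + μ) := by positivity
            have u6 : 0 ≤ C₁ * ε ^ 2 := by positivity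
            rw [hL]
            linarith
    · linarith
  · intro m ξ
    refine (hlim n₂₂ R _ hrb hR0 m ξ ?_).trans (hlimK _ (Or.inl rfl))
    have := (HΔ ξ).2.2.1
    rw [hyε, ← en₂₂, mul_div_assoc] at this
    rwa [mul_one_div]
  · intro m ξ
    have hn : ∀ ξ, |(-n₁₂).1 ξ| ≤ R' := fun ξ => (abs_neg _).trans_le (hqb ξ)
    refine (hlim (-n₁₂) R' _ hn hR'0 m ξ ?_).trans (hlimK _ (Or.inr rfl))
    have := (HΔ ξ).2.2.2
    rw [hyε, show G.c₂ - G.symS G.α₁₂ (2 * Real.pi * ε * ξ) = (-n₁₂).1 ξ by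
      change _ = -n₁₂.1 ξ
      rw [en₁₂]; ring, mul_div_assoc] at this
    rwa [mul_one_div]

end LatticeData

/-! ### Invertibility of the linear operator on pairs of complex-valued functions -/

/-- Operators near an invertible operator are invertible, with uniformly bounded inverses. -/
lemma exists_isUnit_of_norm_sub_le {E : Type*} [NormedAddCommGroup E] [NormedSpace ℂ E]
    [CompleteSpace E] {S₀ : E →L[ℂ] E} (hS₀ : IsUnit S₀) :
    ∃ r C : ℝ, 0 < r ∧ 0 < C ∧ ∀ S : E →L[ℂ] E, ‖S - S₀‖ ≤ r →
      IsUnit S ∧ ∀ v, ‖v‖ ≤ C * ‖S v‖ := by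
  obtain ⟨u, rfl⟩ := hS₀
  obtain ⟨r₁, hr₁, h₁⟩ := Metric.isOpen_iff.1 (Units.isOpen (R := E →L[ℂ] E)) u u.isUnit
  set c : ℝ := ‖(↑u⁻¹ : E →L[ℂ] E)‖ + 1 with hc
  have hc0 : 0 < c := by positivity
  refine ⟨min (r₁ / 2) (1 / (2 * c)), 2 * c, by positivity, by positivity, fun S hS => ⟨?_, ?_⟩⟩
  · refine h₁ ?_
    rw [mem_ball_iff_norm]
    exact (hS.trans (min_le_left _ _)).trans_lt (by linarith)
  · intro v
    have e : v = (↑u⁻¹ : E →L[ℂ] E) (S v - (S - u) v) := by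
      have : (↑u⁻¹ * ↑u : E →L[ℂ] E) v = v := by rw [u.inv_mul]; rfl
      rw [sub_apply, sub_sub_cancel]
      exact this.symm
    have h2 : ‖(S - u) v‖ ≤ 1 / (2 * c) * ‖v‖ :=
      (S - u).le_of_opNorm_le (hS.trans (min_le_right _ _)) v
    have h3 : ‖v‖ ≤ c * (‖S v‖ + 1 / (2 * c) * ‖v‖) := by
      calc ‖v‖ = ‖(↑u⁻¹ : E →L[ℂ] E) (S v - (S - u) v)‖ := by rw [← e]
        _ ≤ c * ‖S v - (S - u) v‖ := (↑u⁻¹ : E →L[ℂ] E).le_of_opNorm_le (by linarith) _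
        _ ≤ _ := mul_le_mul_of_nonneg_left ((norm_sub_le _ _).trans (by linarith)) hc0.le
    have h4 : c * (1 / (2 * c) * ‖v‖) = ‖v‖ / 2 := by field_simp
    linarith [mul_add c ‖S v‖ (1 / (2 * c) * ‖v‖)]

/-- The soliton as a bounded function. -/
def solitonBdd (d₁ d₂ : ℝ) : Bdd ℝ :=
  ⟨soliton d₁ d₂, (continuous_soliton d₁ d₂).measurable, _, fun x =>
    (abs_soliton_le d₁ d₂ x).trans
      (mul_le_of_le_one_right (by positivity) (sechSq_le_one _ _))⟩

namespace LatticeData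

variable {M : ℕ} (G : LatticeData M)

/-- The operator `f ↦ ∑ₘ ηₘ A_{kₘε}((A_{kₘε} W)(A_{kₘε} f))`. -/
def avMulOp (ε : ℝ) (W : Bdd ℝ) (η : Fin M → ℝ) : L2C →L[ℂ] L2C :=
  ∑ m, η m • (avOp (G.k m * ε) ∘L mulOp (avBdd (G.k m * ε) W) ∘L avOp (G.k m * ε))

lemma avMulOp_apply (ε : ℝ) (W : Bdd ℝ) (η : Fin M → ℝ) (f : L2C) :
    G.avMulOp ε W η f = ∑ m, η m •
      avOp (G.k m * ε) (mulOp (avBdd (G.k m * ε) W) (avOp (G.k m * ε) f)) := by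
  rw [avMulOp, sum_apply]
  rfl

lemma norm_avMulOp_apply_le (ε : ℝ) (W : Bdd ℝ) (η : Fin M → ℝ) {b : ℝ} (hW : ∀ x, |W.1 x| ≤ b)
    (f : L2C) : ‖G.avMulOp ε W η f‖ ≤ (∑ m, |η m|) * b * ‖f‖ := by
  rw [avMulOp_apply, mul_assoc, Finset.sum_mul]
  refine norm_sum_le_of_le _ fun m _ => ?_
  rw [norm_smul, Real.norm_eq_abs]
  refine mul_le_mul_of_nonneg_left ((norm_avOp_apply_le _ _).trans ?_) (abs_nonneg _)
  refine ((mulOp (avBdd (G.k m * ε) W)).le_of_opNorm_le (norm_mulOp_le _ (C := b) fun x =>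
    norm_av_le_of_forall (Bdd.locInt W) _ x fun y _ => hW y) _).trans ?_
  exact mul_le_mul_of_nonneg_left (norm_avOp_apply_le _ _) ((abs_nonneg _).trans (hW 0))

/-- If the symbol `i A_{kₘε}²` is close to `γ`, then `i A_{kₘε} (A_{kₘε} W) A_{kₘε}` is close to
`γ W`: the averages almost commute with the multiplication by a Lipschitz function. -/
lemma norm_fourierMul_avMulOp_sub_le {ε : ℝ} (hε : 0 < ε) {W : Bdd ℝ} {η : Fin M → ℝ}
    (hη : ∀ m, G.k m = 0 → η m = 0) {i γ : Bdd ℝ} {δ K Kw b : ℝ} (hi : ∀ ξ, |i.1 ξ| ≤ K)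
    (hγ : ∀ m ξ, |(i * avSymbol (G.k m * ε) ^ 2).1 ξ - γ.1 ξ| ≤ δ) (hWb : ∀ x, |W.1 x| ≤ b)
    (hKw : 0 ≤ Kw) (hW : ∀ x y, |W.1 x - W.1 y| ≤ Kw * |x - y|) (f : L2C) :
    ‖fourierMul i (G.avMulOp ε W η f) - (∑ m, η m) • fourierMul γ (mulOp W f)‖
      ≤ (∑ m, |η m| * (δ * b + K * Kw * |G.k m * ε|)) * ‖f‖ := by
  have hsm : ∀ (c : ℝ) (g : L2C), fourierMul i (c • g) = c • fourierMul i g := fun c g =>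
    (fourierMul i).map_smul_of_tower c g
  rw [avMulOp_apply, map_sum, Finset.sum_smul, ← Finset.sum_sub_distrib, Finset.sum_mul]
  refine norm_sum_le_of_le _ fun m _ => ?_
  rw [hsm, ← smul_sub, norm_smul, Real.norm_eq_abs, mul_assoc]
  rcases eq_or_ne (G.k m) 0 with hk | hk
  · rw [hη m hk]; simp
  refine mul_le_mul_of_nonneg_left ?_ (abs_nonneg _)
  have hη0 : G.k m * ε ≠ 0 := mul_ne_zero hk hε.ne'
  have hK : 0 ≤ K := (abs_nonneg _).trans (hi 0)
  have hδ : 0 ≤ δ := (abs_nonneg _).trans (hγ m 0)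
  set A := avOp (G.k m * ε) with hA
  set X := mulOp (avBdd (G.k m * ε) W) (A f) with hX
  have e1 : fourierMul i (A X) - fourierMul γ (mulOp W f)
      = fourierMul i (A (X - A (mulOp W f)))
        + fourierMul (i * avSymbol (G.k m * ε) ^ 2 - γ) (mulOp W f) := by
    rw [map_sub, map_sub, map_sub, sub_apply, map_mul, map_pow]
    have : (fourierMul i * fourierMul (avSymbol (G.k m * ε)) ^ 2) (mulOp W f)
        = fourierMul i (A (A (mulOp W f))) := by
      rw [pow_two]; rfl
    rw [this]
    abel
  rw [e1, add_mul, add_comm (δ * b * ‖f‖)]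
  refine norm_add_le_of_le ?_ ?_
  · refine ((fourierMul i).le_of_opNorm_le (norm_fourierMul_le i hi) _).trans ?_
    rw [mul_assoc K, mul_assoc K]
    refine mul_le_mul_of_nonneg_left ((norm_avOp_apply_le _ _).trans ?_) hK
    exact norm_avOp_commutator_le hKw hW hη0 f
  · refine ((fourierMul _).le_of_opNorm_le (norm_fourierMul_le _ (hγ m)) _).trans ?_
    rw [mul_assoc]
    exact mul_le_mul_of_nonneg_left ((mulOp W).le_of_opNorm_le (norm_mulOp_le W hWb) f) hδ

/-- The constants `∑ₘ η_{1,j}^m` combine to twice the coefficient of the nonlinearity. -/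
lemma sum_η₁₁_add (hd : 0 < G.d₁) :
    (∑ m, G.η₁₁ m) + G.lam * ∑ m, G.η₁₂ m = 2 * G.den * G.d₂ := by
  have h1 : G.den * G.d₂ = (G.a₃ + G.lam ^ 2 * G.a₄ + G.lam * G.a₅)
      + G.lam * (G.lam * G.b₅ + G.lam ^ 2 * G.b₃ + G.b₄) :=
    mul_div_cancel₀ _ (G.den_pos hd).ne'
  rw [mul_assoc, h1]
  simp only [a₃, a₄, a₅, b₅, b₃, b₄, Finset.mul_sum, ← Finset.sum_add_distrib, η₁₁, η₁₂]
  refine Finset.sum_congr rfl fun m _ => by ring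

end LatticeData

/-- The limit operator `v ↦ (T v, l T v)`, with `T v = δ (a² - ∂²)⁻¹ (W (h₁ P v₁ + h₂ P v₂))` and the
projection `P` onto the even functions. -/
def kdvOp (a : ℝ) (ha : 0 < a) (W : Bdd ℝ) (δ h₁ h₂ l : ℝ) : L2C × L2C →L[ℂ] L2C × L2C :=
  ((1 : L2C →L[ℂ] L2C).prod (l • (1 : L2C →L[ℂ] L2C))) ∘L (greenOp a ha ∘L mulOp W) ∘L
    (δ • (h₁ • (evenOp ∘L ContinuousLinearMap.fst ℂ L2C L2C)
      + h₂ • (evenOp ∘L ContinuousLinearMap.snd ℂ L2C L2C)))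

lemma kdvOp_apply (a : ℝ) (ha : 0 < a) (W : Bdd ℝ) (δ h₁ h₂ l : ℝ) (v : L2C × L2C) :
    kdvOp a ha W δ h₁ h₂ l v =
      (greenOp a ha (mulOp W (δ • (h₁ • evenOp v.1 + h₂ • evenOp v.2))),
        l • greenOp a ha (mulOp W (δ • (h₁ • evenOp v.1 + h₂ • evenOp v.2)))) := rfl

/-- The limit operator is invertible. It is a compact perturbation of the identity, so that its kernel
decides; an element of the kernel gives an even solution of the linearized soliton equation
`u'' = (d₁ - 2 d₂ W) u`, whose decaying solutions are the multiples of the odd function `W'`. -/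
lemma isUnit_one_sub_kdvOp {d₁ d₂ δ h₁ h₂ l : ℝ} (hd₁ : 0 < d₁) (hd₂ : d₂ ≠ 0)
    (h : δ * (h₁ + l * h₂) = 2 * d₂) (ha : 0 < √d₁) :
    IsUnit (1 - kdvOp (√d₁) ha (solitonBdd d₁ d₂) δ h₁ h₂ l) := by
  have hW : MemLp (solitonBdd d₁ d₂).1 2 volume := by
    have := (memLp_sechSq (κ := 1 / 2 * √d₁) (by positivity)).const_mul (3 * d₁ / (2 * d₂))
    exact this
  have hc : IsCompactOperator (kdvOp (√d₁) ha (solitonBdd d₁ d₂) δ h₁ h₂ l) :=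
    ((isCompactOperator_greenOp_mulOp ha hW).comp_clm (δ • (h₁ • (evenOp ∘L
      ContinuousLinearMap.fst ℂ L2C L2C) + h₂ • (evenOp ∘L ContinuousLinearMap.snd ℂ L2C L2C)))).clm_comp
      ((1 : L2C →L[ℂ] L2C).prod (l • (1 : L2C →L[ℂ] L2C)))
  rcases hc.hasEigenvalue_or_mem_resolventSet (one_ne_zero (α := ℂ)) with he | he
  · exfalso
    obtain ⟨v, hv, hv0⟩ := he.exists_hasEigenvector
    rw [Module.End.mem_eigenspace_iff, one_smul] at hv
    have hv' : kdvOp (√d₁) ha (solitonBdd d₁ d₂) δ h₁ h₂ l v = v := hv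
    rw [kdvOp_apply] at hv'
    set T := greenOp (√d₁) ha (mulOp (solitonBdd d₁ d₂) (δ • (h₁ • evenOp v.1 + h₂ • evenOp v.2)))
    have e1 : T = v.1 := congrArg Prod.fst hv'
    have e2 : l • T = v.2 := congrArg Prod.snd hv'
    rw [e1] at e2
    have hT : v.1 = greenOp (√d₁) ha (mulOp ((2 * d₂) • solitonBdd d₁ d₂) (evenOp v.1)) := by
      rw [← e1]
      have e3 : δ • (h₁ • evenOp v.1 + h₂ • evenOp v.2) = (2 * d₂) • evenOp v.1 := by
        rw [← e2, ← h, evenOp.map_smul_of_tower, smul_smul h₂ l, ← add_smul, smul_smul]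
        congr 2; ring
      have e4 : mulOp ((2 * d₂) • solitonBdd d₁ d₂) (evenOp v.1)
          = mulOp (solitonBdd d₁ d₂) ((2 * d₂) • evenOp v.1) := by
        refine Lp.ext ?_
        filter_upwards [mulOp_coeFn ((2 * d₂) • solitonBdd d₁ d₂) (evenOp v.1),
          mulOp_coeFn (solitonBdd d₁ d₂) ((2 * d₂) • evenOp v.1),
          Lp.coeFn_smul (2 * d₂) (evenOp v.1)] with x x1 x2 x3
        rw [x1, x2, x3, Pi.smul_apply, smul_comm, smul_smul]
        rfl
      rw [e1, e4, ← e3]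
      exact e1.symm
    have h0 : v.1 = 0 := by
      refine eq_zero_of_eq_greenOp ha (p := (2 * d₂) • solitonBdd d₁ d₂)
        (φ := solitonDeriv d₁ d₂) (φ' := fun t => d₁ * soliton d₁ d₂ t - d₂ * soliton d₁ d₂ t ^ 2)
        ?_ ?_ (hasDerivAt_solitonDeriv hd₁ hd₂) ?_ (solitonDeriv_zero _ _) ?_
        (tendsto_solitonDeriv_atTop hd₁) ?_ hT
      · exact (continuous_soliton d₁ d₂).const_smul (2 * d₂)
      · intro x
        change 2 * d₂ * soliton d₁ d₂ (-x) = 2 * d₂ * soliton d₁ d₂ x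
        rw [soliton_neg]
      · intro t
        have := ((hasDerivAt_soliton d₁ d₂ t).const_mul d₁).sub
          (((hasDerivAt_soliton d₁ d₂ t).pow 2).const_mul d₂)
        refine this.congr_deriv ?_
        change _ = ((√d₁) ^ 2 - 2 * d₂ * soliton d₁ d₂ t) * _
        rw [Real.sq_sqrt hd₁.le]
        ring
      · simp only [soliton_zero]
        intro h0
        have : d₁ ^ 2 = 0 := by
          field_simp at h0
          nlinarith
        exact hd₁.ne' (pow_eq_zero_iff (two_ne_zero) |>.1 this)
      · have := ((tendsto_soliton_atTop (d₂ := d₂) hd₁).const_mul d₁).sub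
          (((tendsto_soliton_atTop (d₂ := d₂) hd₁).pow 2).const_mul d₂)
        simpa using this
    exact hv0 (Prod.ext h0 (by rw [← e2, h0, smul_zero]; rfl))
  · have h2 : IsUnit (algebraMap ℂ (L2C × L2C →L[ℂ] L2C × L2C) 1 - _) := he
    rwa [map_one] at h2

/-! ### Operator matrices and the preconditioned operator -/

lemma reflOp_avOp (η : ℝ) (f : L2C) : reflOp (avOp η f) = avOp η (reflOp f) := by
  rcases eq_or_ne η 0 with rfl | hη
  · have h : avSymbol 0 = 1 := by ext ξ; simp [avSymbol]
    simp [avOp, h]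
  · refine Lp.ext ?_
    filter_upwards [reflOp_coeFn (avOp η f), ae_neg (avOp_coeFn hη f), avOp_coeFn hη (reflOp f)]
      with x h1 h2 h3
    rw [h1, h2, h3, ← av_comp_neg, av_congr_ae (reflOp_coeFn f)]

lemma reflOp_mulOp {W : Bdd ℝ} (hW : ∀ x, W.1 (-x) = W.1 x) (f : L2C) :
    reflOp (mulOp W f) = mulOp W (reflOp f) := by
  refine Lp.ext ?_
  filter_upwards [reflOp_coeFn (mulOp W f), ae_neg (mulOp_coeFn W f), mulOp_coeFn W (reflOp f),
    reflOp_coeFn f] with x h1 h2 h3 h4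
  rw [h1, h2, h3, h4, hW]

lemma avBdd_neg {W : Bdd ℝ} (hW : ∀ x, W.1 (-x) = W.1 x) (η x : ℝ) :
    (avBdd η W).1 (-x) = (avBdd η W).1 x := by
  change av η W.1 (-x) = av η W.1 x
  rw [← av_comp_neg]
  simp only [hW]

/-- The operator on pairs given by a matrix of operators. -/
def opMat (a b c d : L2C →L[ℂ] L2C) : L2C × L2C →L[ℂ] L2C × L2C :=
  (a ∘L ContinuousLinearMap.fst ℂ L2C L2C + b ∘L ContinuousLinearMap.snd ℂ L2C L2C).prod
    (c ∘L ContinuousLinearMap.fst ℂ L2C L2C + d ∘L ContinuousLinearMap.snd ℂ L2C L2C)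

lemma opMat_apply (a b c d : L2C →L[ℂ] L2C) (v : L2C × L2C) :
    opMat a b c d v = (a v.1 + b v.2, c v.1 + d v.2) := rfl

lemma opMat_mul (a b c d a' b' c' d' : L2C →L[ℂ] L2C) : opMat a b c d * opMat a' b' c' d' =
    opMat (a * a' + b * c') (a * b' + b * d') (c * a' + d * c') (c * b' + d * d') := by
  refine ContinuousLinearMap.ext fun v => ?_
  rw [mul_apply_eq_comp, opMat_apply, opMat_apply, opMat_apply]
  simp only [map_add, add_apply, mul_apply_eq_comp]
  refine Prod.ext ?_ ?_ <;> exact add_add_add_comm _ _ _ _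

lemma opMat_one : opMat 1 0 0 1 = 1 := by
  refine ContinuousLinearMap.ext fun v => ?_
  rw [opMat_apply]
  simp

/-- A right inverse of a matrix over a commutative ring is a left inverse. -/
lemma left_inverse_of_right_inverse {R : Type*} [CommRing R]
    {a b c d i₁₁ i₁₂ i₂₁ i₂₂ : R} (I1 : a * i₁₁ + b * i₂₁ = 1) (I2 : a * i₁₂ + b * i₂₂ = 0)
    (I3 : c * i₁₁ + d * i₂₁ = 0) (I4 : c * i₁₂ + d * i₂₂ = 1) :
    i₁₁ * a + i₁₂ * c = 1 ∧ i₁₁ * b + i₁₂ * d = 0 ∧ i₂₁ * a + i₂₂ * c = 0 ∧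
      i₂₁ * b + i₂₂ * d = 1 := by
  have h : !![a, b; c, d] * !![i₁₁, i₁₂; i₂₁, i₂₂] = 1 := by
    rw [Matrix.mul_fin_two, I1, I2, I3, I4, Matrix.one_fin_two]
  have h' := mul_eq_one_comm.1 h
  rw [Matrix.mul_fin_two, Matrix.one_fin_two] at h'
  refine ⟨?_, ?_, ?_, ?_⟩
  · simpa using congrFun (congrFun h' 0) 0
  · simpa using congrFun (congrFun h' 0) 1
  · simpa using congrFun (congrFun h' 1) 0
  · simpa using congrFun (congrFun h' 1) 1

/-- If `1 - B⁻¹ M P` is invertible then `B - M` is invertible on the fixed space of `R`, on which `P`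
is the identity. -/
lemma bijective_of_preconditioned {E : Type*} [NormedAddCommGroup E] [NormedSpace ℂ E]
    {B Bi Mo R P : E →L[ℂ] E} {C K : ℝ} (h1 : B * Bi = 1) (h2 : Bi * B = 1)
    (hRB : R * B = B * R) (hRM : R * (Mo * P) = Mo * P) (hP : ∀ v, R v = v → P v = v)
    (hu : IsUnit (1 - Bi * (Mo * P))) (hC : 0 ≤ C) (hb : ∀ v, ‖v‖ ≤ C * ‖(1 - Bi * (Mo * P)) v‖)
    (hK : ∀ v, ‖Bi v‖ ≤ K * ‖v‖) :
    (∀ g, R g = g → ∃ w, R w = w ∧ B w - Mo w = g) ∧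
      ∀ w, R w = w → ‖w‖ ≤ C * (K * ‖B w - Mo w‖) := by
  have h1' : ∀ v, B (Bi v) = v := fun v => DFunLike.congr_fun h1 v
  have h2' : ∀ v, Bi (B v) = v := fun v => DFunLike.congr_fun h2 v
  have hRB' : ∀ v, R (B v) = B (R v) := fun v => DFunLike.congr_fun hRB v
  have hRM' : ∀ v, R (Mo (P v)) = Mo (P v) := fun v => DFunLike.congr_fun hRM v
  have eS : ∀ v, (1 - Bi * (Mo * P)) v = v - Bi (Mo (P v)) := fun v => rfl
  refine ⟨fun g hg => ?_, fun w hw => ?_⟩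
  · obtain ⟨u, hu⟩ := hu
    set w : E := (↑u⁻¹ : E →L[ℂ] E) (Bi g) with hw
    have hSw : (u : E →L[ℂ] E) w = Bi g := by
      have : (↑u * ↑u⁻¹ : E →L[ℂ] E) = 1 := u.mul_inv
      exact DFunLike.congr_fun this _
    rw [hu, eS] at hSw
    have hBw : B w = g + Mo (P w) := by
      rw [sub_eq_iff_eq_add.1 hSw, map_add, h1', h1']
      rw [← sub_eq_iff_eq_add.1 hSw]
    have hRw : R w = w := by
      rw [← h2' (R w), ← hRB', hBw, map_add, hg, hRM', ← hBw, h2']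
    refine ⟨w, hRw, ?_⟩
    rw [hBw, hP w hRw, add_sub_cancel_right]
  · have := hb w
    rw [eS, hP w hw] at this
    refine this.trans (mul_le_mul_of_nonneg_left ?_ hC)
    have e : w - Bi (Mo w) = Bi (B w - Mo w) := by rw [map_sub, h2']
    rw [e]
    exact hK _

namespace LatticeData

variable {M : ℕ} (G : LatticeData M)

lemma reflOp_avMulOp (ε : ℝ) {W : Bdd ℝ} (hW : ∀ x, W.1 (-x) = W.1 x) (η : Fin M → ℝ) (f : L2C) :
    reflOp (G.avMulOp ε W η f) = G.avMulOp ε W η (reflOp f) := by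
  rw [avMulOp_apply, avMulOp_apply, map_sum]
  refine Finset.sum_congr rfl fun m _ => ?_
  rw [reflOp.map_smul_of_tower, reflOp_avOp, reflOp_mulOp (avBdd_neg hW _), reflOp_avOp]

/-- The symbol of `σ₀ + ε² - ∑ₘ kₘ² αₘ A_{kₘε}²`. -/
def diagSymbol (ε : ℝ) (α : Fin M → ℝ) : Bdd ℝ :=
  algebraMap ℝ (Bdd ℝ) (G.σ₀ + ε ^ 2) - G.avSum ε α

lemma commute_reflOp_avSum (ε : ℝ) (α : Fin M → ℝ) :
    Commute reflOp (fourierMul (G.avSum ε α)) := by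
  rw [avSum, map_sum]
  refine Commute.sum_right _ _ _ fun m _ => ?_
  rw [fourierMul_smul, map_pow]
  refine Commute.smul_right (Commute.pow_right ?_ 2) _
  exact ContinuousLinearMap.ext fun f => reflOp_avOp _ f

lemma commute_reflOp_diagSymbol (ε : ℝ) (α : Fin M → ℝ) :
    Commute reflOp (fourierMul (G.diagSymbol ε α)) := by
  rw [diagSymbol, map_sub, Algebra.algebraMap_eq_smul_one, fourierMul_smul, map_one]
  exact ((Commute.one_right _).smul_right _).sub_right (G.commute_reflOp_avSum ε α)

/-- The upper left entry of the matrix symbol of `B_ε`. -/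
def symbB₁₁ (ε : ℝ) : Bdd ℝ :=
  (1 / ε ^ 2) • (G.diagSymbol ε G.α₁₁ + G.lam • -G.avSum ε G.α₁₂)
/-- The upper right entry of the matrix symbol of `B_ε`. -/
def symbB₁₂ (ε : ℝ) : Bdd ℝ :=
  (1 / ε ^ 2) • (-G.avSum ε G.α₁₂ + G.lam • G.diagSymbol ε G.α₂₂)
/-- The lower left entry of the matrix symbol of `B_ε`. -/
def symbB₂₁ (ε : ℝ) : Bdd ℝ := -G.avSum ε G.α₁₂
/-- The lower right entry of the matrix symbol of `B_ε`. -/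
def symbB₂₂ (ε : ℝ) : Bdd ℝ := G.diagSymbol ε G.α₂₂

/-- The soliton `W_*` as a bounded function. -/
def wave : Bdd ℝ := solitonBdd G.d₁ G.d₂

/-- The operator `B_ε` on pairs of complex-valued functions. -/
def opB (ε : ℝ) : L2C × L2C →L[ℂ] L2C × L2C :=
  opMat (fourierMul (G.symbB₁₁ ε)) (fourierMul (G.symbB₁₂ ε)) (fourierMul (G.symbB₂₁ ε))
    (fourierMul (G.symbB₂₂ ε))

/-- The operator `M_ε` on pairs of complex-valued functions. -/
def opM (ε : ℝ) : L2C × L2C →L[ℂ] L2C × L2C :=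
  opMat (G.avMulOp ε G.wave G.η₁₁) (G.avMulOp ε G.wave G.η₁₂) (ε ^ 2 • G.avMulOp ε G.wave G.η₂₁)
    (ε ^ 2 • G.avMulOp ε G.wave G.η₂₂)

/-- One row of `B_ε⁻¹ M_ε` converges, in operator norm, to a row of the limit operator. -/
lemma exists_norm_row_sub_le {W : Bdd ℝ} {K Kw b : ℝ} (hK : 0 ≤ K) (hWb : ∀ x, |W.1 x| ≤ b)
    (hKw : 0 ≤ Kw) (hW : ∀ x y, |W.1 x - W.1 y| ≤ Kw * |x - y|) :
    ∃ C : ℝ, 0 ≤ C ∧ ∀ (ε : ℝ), 0 < ε → ε ≤ 1 → ∀ (i i' γ : Bdd ℝ), (∀ ξ, |i.1 ξ| ≤ K) →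
      (∀ ξ, |i'.1 ξ| ≤ K) →
      (∀ m ξ, |(i * avSymbol (G.k m * ε) ^ 2).1 ξ - γ.1 ξ| ≤ K * ε) → ∀ f g : L2C,
      ‖fourierMul i (G.avMulOp ε W G.η₁₁ f + G.avMulOp ε W G.η₁₂ g)
        + fourierMul i' (ε ^ 2 • G.avMulOp ε W G.η₂₁ f + ε ^ 2 • G.avMulOp ε W G.η₂₂ g)
        - ((∑ m, G.η₁₁ m) • fourierMul γ (mulOp W f) + (∑ m, G.η₁₂ m) • fourierMul γ (mulOp W g))‖
        ≤ C * ε * (‖f‖ + ‖g‖) := by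
  have hb : 0 ≤ b := (abs_nonneg _).trans (hWb 0)
  set e : (Fin M → ℝ) → ℝ := fun η => ∑ m, |η m| * (K * b + K * Kw * |G.k m|) with he
  set e' : (Fin M → ℝ) → ℝ := fun η => K * ((∑ m, |η m|) * b) with he'
  have he0 : ∀ η, 0 ≤ e η := fun η => Finset.sum_nonneg fun m _ => by positivity
  have he'0 : ∀ η, 0 ≤ e' η := fun η =>
    mul_nonneg hK (mul_nonneg (Finset.sum_nonneg fun m _ => abs_nonneg _) hb)
  refine ⟨e G.η₁₁ + e G.η₁₂ + e' G.η₂₁ + e' G.η₂₂, by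
    have := he0 G.η₁₁; have := he0 G.η₁₂; have := he'0 G.η₂₁; have := he'0 G.η₂₂
    positivity, ?_⟩
  intro ε hε hε1 i i' γ hi hi' hγ f g
  have h1 : ∀ (η : Fin M → ℝ), (∀ m, G.k m = 0 → η m = 0) → ∀ f : L2C,
      ‖fourierMul i (G.avMulOp ε W η f) - (∑ m, η m) • fourierMul γ (mulOp W f)‖
        ≤ e η * ε * ‖f‖ := by
    intro η hη f
    refine (G.norm_fourierMul_avMulOp_sub_le hε hη hi hγ hWb hKw hW f).trans_eq ?_
    rw [he]
    simp only [Finset.sum_mul, abs_mul, abs_of_pos hε]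
    refine Finset.sum_congr rfl fun m _ => by ring
  have h2 : ∀ (η : Fin M → ℝ) (f : L2C),
      ‖fourierMul i' (ε ^ 2 • G.avMulOp ε W η f)‖ ≤ e' η * ε * ‖f‖ := by
    intro η f
    refine ((fourierMul i').le_of_opNorm_le (norm_fourierMul_le i' hi') _).trans ?_
    rw [norm_smul, Real.norm_of_nonneg (by positivity)]
    have h3 := G.norm_avMulOp_apply_le ε W η hWb f
    have h4 : ε ^ 2 ≤ ε := by nlinarith
    calc K * (ε ^ 2 * ‖G.avMulOp ε W η f‖) ≤ K * (ε * ((∑ m, |η m|) * b * ‖f‖)) := by gcongr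
      _ = _ := by rw [he']; ring
  have hk : ∀ m, G.k m = 0 → G.η₁₁ m = 0 ∧ G.η₁₂ m = 0 := fun m hm => by
    simp [η₁₁, η₁₂, hm]
  have t1 := h1 G.η₁₁ (fun m hm => (hk m hm).1) f
  have t2 := h1 G.η₁₂ (fun m hm => (hk m hm).2) g
  have t3 := h2 G.η₂₁ f
  have t4 := h2 G.η₂₂ g
  have hdec : fourierMul i (G.avMulOp ε W G.η₁₁ f + G.avMulOp ε W G.η₁₂ g)
        + fourierMul i' (ε ^ 2 • G.avMulOp ε W G.η₂₁ f + ε ^ 2 • G.avMulOp ε W G.η₂₂ g)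
        - ((∑ m, G.η₁₁ m) • fourierMul γ (mulOp W f) + (∑ m, G.η₁₂ m) • fourierMul γ (mulOp W g))
      = (fourierMul i (G.avMulOp ε W G.η₁₁ f) - (∑ m, G.η₁₁ m) • fourierMul γ (mulOp W f))
        + (fourierMul i (G.avMulOp ε W G.η₁₂ g) - (∑ m, G.η₁₂ m) • fourierMul γ (mulOp W g))
        + (fourierMul i' (ε ^ 2 • G.avMulOp ε W G.η₂₁ f)
          + fourierMul i' (ε ^ 2 • G.avMulOp ε W G.η₂₂ g)) := by
    rw [map_add, map_add]
    abel
  rw [hdec]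
  refine (norm_add₃_le.trans (add_le_add (add_le_add t1 t2) (norm_add_le_of_le t3 t4))).trans ?_
  have q1 := mul_nonneg (mul_nonneg (he0 G.η₁₁) hε.le) (norm_nonneg g)
  have q2 := mul_nonneg (mul_nonneg (he0 G.η₁₂) hε.le) (norm_nonneg f)
  have q3 := mul_nonneg (mul_nonneg (he'0 G.η₂₁) hε.le) (norm_nonneg g)
  have q4 := mul_nonneg (mul_nonneg (he'0 G.η₂₂) hε.le) (norm_nonneg f)
  linarith

lemma wave_neg (x : ℝ) : G.wave.1 (-x) = G.wave.1 x := soliton_neg _ _ x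

lemma exists_wave_bound : ∃ b, ∀ x, |G.wave.1 x| ≤ b := by
  obtain ⟨_, b, hb⟩ := id G.wave.2
  exact ⟨b, hb⟩

lemma exists_wave_lipschitz :
    ∃ K, 0 ≤ K ∧ ∀ x y, |G.wave.1 x - G.wave.1 y| ≤ K * |x - y| := by
  refine ⟨_, (abs_nonneg _).trans ((abs_solitonDeriv_le G.d₁ G.d₂ 0).trans
    (mul_le_of_le_one_right (by positivity) (sechSq_le_one _ _))), fun x y => ?_⟩
  have := Convex.norm_image_sub_le_of_norm_hasDerivWithin_le (f := soliton G.d₁ G.d₂)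
    (s := Set.univ) (x := y) (y := x) (fun t _ => (hasDerivAt_soliton G.d₁ G.d₂ t).hasDerivWithinAt)
    (fun t _ => (abs_solitonDeriv_le G.d₁ G.d₂ t).trans
      (mul_le_of_le_one_right (by positivity) (sechSq_le_one _ _)))
    convex_univ (Set.mem_univ _) (Set.mem_univ _)
  exact this

lemma commute_reflOp_symbB (ε : ℝ) :
    Commute reflOp (fourierMul (G.symbB₁₁ ε)) ∧ Commute reflOp (fourierMul (G.symbB₁₂ ε)) ∧
    Commute reflOp (fourierMul (G.symbB₂₁ ε)) ∧ Commute reflOp (fourierMul (G.symbB₂₂ ε)) := by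
  refine ⟨?_, ?_, ?_, G.commute_reflOp_diagSymbol ε _⟩
  · rw [symbB₁₁, fourierMul_smul, map_add, fourierMul_smul, map_neg]
    exact ((G.commute_reflOp_diagSymbol ε _).add_right
      ((G.commute_reflOp_avSum ε _).neg_right.smul_right _)).smul_right _
  · rw [symbB₁₂, fourierMul_smul, map_add, fourierMul_smul, map_neg]
    exact ((G.commute_reflOp_avSum ε _).neg_right.add_right
      ((G.commute_reflOp_diagSymbol ε _).smul_right _)).smul_right _
  · rw [symbB₂₁, map_neg]
    exact (G.commute_reflOp_avSum ε _).neg_right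

/-- With a bounded inverse of the matrix symbol of `B_ε` whose first column converges to the symbol of
the linearized KdV equation, the preconditioned operator `1 - B_ε⁻¹ M_ε P` converges. -/
lemma exists_norm_preconditioned_sub_le (hd₁ : 0 < G.d₁) (ha : 0 < √G.d₁) {K : ℝ} (hK : 0 ≤ K) :
    ∃ C : ℝ, 0 ≤ C ∧ ∀ (ε : ℝ), 0 < ε → ε ≤ 1 → ∀ (i₁₁ i₁₂ i₂₁ i₂₂ : Bdd ℝ),
      (∀ ξ, |i₁₁.1 ξ| ≤ K) → (∀ ξ, |i₁₂.1 ξ| ≤ K) → (∀ ξ, |i₂₁.1 ξ| ≤ K) → (∀ ξ, |i₂₂.1 ξ| ≤ K) →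
      (∀ m ξ, |(i₁₁ * avSymbol (G.k m * ε) ^ 2).1 ξ
          - 1 / ((1 + G.lam ^ 2) + G.den * (2 * Real.pi * ξ) ^ 2)| ≤ K * ε) →
      (∀ m ξ, |(i₂₁ * avSymbol (G.k m * ε) ^ 2).1 ξ
          - G.lam / ((1 + G.lam ^ 2) + G.den * (2 * Real.pi * ξ) ^ 2)| ≤ K * ε) →
      ‖(1 - opMat (fourierMul i₁₁) (fourierMul i₁₂) (fourierMul i₂₁) (fourierMul i₂₂)
          * (G.opM ε * opMat evenOp 0 0 evenOp))
        - (1 - kdvOp (√G.d₁) ha (solitonBdd G.d₁ G.d₂) G.den⁻¹ (∑ m, G.η₁₁ m) (∑ m, G.η₁₂ m)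
            G.lam)‖ ≤ C * ε := by
  obtain ⟨b, hb⟩ := G.exists_wave_bound
  obtain ⟨Kw, hKw, hW⟩ := G.exists_wave_lipschitz
  obtain ⟨Cr, hCr, Hr⟩ := G.exists_norm_row_sub_le hK hb hKw hW
  have hden := G.den_pos hd₁
  refine ⟨2 * Cr, by positivity, ?_⟩
  intro ε hε hε1 i₁₁ i₁₂ i₂₁ i₂₂ b11 b12 b21 b22 l1 l2
  refine ContinuousLinearMap.opNorm_le_bound _ (by positivity) fun v => ?_
  set g : Bdd ℝ := G.den⁻¹ • greenSymbol (√G.d₁) ha with hgdef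
  have hgval : ∀ ξ, g.1 ξ = 1 / ((1 + G.lam ^ 2) + G.den * (2 * Real.pi * ξ) ^ 2) := by
    intro ξ
    change G.den⁻¹ * (1 / ((√G.d₁) ^ 2 + (2 * Real.pi * ξ) ^ 2)) = _
    rw [Real.sq_sqrt hd₁.le, ← G.d₁_mul_den hd₁]
    have : 0 < G.d₁ + (2 * Real.pi * ξ) ^ 2 := by positivity
    field_simp
  have hgop : ∀ f, fourierMul g f = G.den⁻¹ • greenOp (√G.d₁) ha f := fun f => by
    rw [hgdef, fourierMul_smul]; rfl
  have r1 := Hr ε hε hε1 i₁₁ i₁₂ g b11 b12 (fun m ξ => by rw [hgval]; exact l1 m ξ)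
    (evenOp v.1) (evenOp v.2)
  have r2 := Hr ε hε hε1 i₂₁ i₂₂ (G.lam • g) b21 b22 (fun m ξ => by
    change |_ - G.lam * g.1 ξ| ≤ _
    rw [hgval, mul_one_div]; exact l2 m ξ) (evenOp v.1) (evenOp v.2)
  have hv1 : ‖evenOp v.1‖ ≤ ‖v‖ := (norm_evenOp_le _).trans (norm_fst_le v)
  have hv2 : ‖evenOp v.2‖ ≤ ‖v‖ := (norm_evenOp_le _).trans (norm_snd_le v)
  have hfin : Cr * ε * (‖evenOp v.1‖ + ‖evenOp v.2‖) ≤ 2 * Cr * ε * ‖v‖ := by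
    have h2 : Cr * ε * (‖evenOp v.1‖ + ‖evenOp v.2‖) ≤ Cr * ε * (‖v‖ + ‖v‖) := by gcongr
    linarith
  set T := greenOp (√G.d₁) ha (mulOp G.wave (G.den⁻¹ • ((∑ m, G.η₁₁ m) • evenOp v.1
        + (∑ m, G.η₁₂ m) • evenOp v.2))) with hTdef
  have hT : (∑ m, G.η₁₁ m) • fourierMul g (mulOp G.wave (evenOp v.1))
      + (∑ m, G.η₁₂ m) • fourierMul g (mulOp G.wave (evenOp v.2)) = T := by
    rw [hTdef, hgop, hgop, (mulOp G.wave).map_smul_of_tower, (greenOp _ ha).map_smul_of_tower,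
      map_add, map_add, (mulOp G.wave).map_smul_of_tower, (greenOp _ ha).map_smul_of_tower,
      (mulOp G.wave).map_smul_of_tower, (greenOp _ ha).map_smul_of_tower, smul_add,
      smul_comm G.den⁻¹, smul_comm G.den⁻¹]
  have hlg : ∀ f, fourierMul (G.lam • g) f = G.lam • fourierMul g f := fun f => by
    rw [fourierMul_smul]; rfl
  rw [hlg, hlg, smul_comm _ G.lam, smul_comm _ G.lam, ← smul_add G.lam, hT] at r2
  rw [hT] at r1
  set x₁ := G.avMulOp ε G.wave G.η₁₁ (evenOp v.1) + G.avMulOp ε G.wave G.η₁₂ (evenOp v.2)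
  set x₂ := ε ^ 2 • G.avMulOp ε G.wave G.η₂₁ (evenOp v.1)
    + ε ^ 2 • G.avMulOp ε G.wave G.η₂₂ (evenOp v.2)
  have eM : (G.opM ε * opMat evenOp 0 0 evenOp) v = (x₁, x₂) := by
    rw [mul_apply_eq_comp, opMat_apply]
    simp only [zero_apply, add_zero, zero_add]
    rfl
  have e0 : ((1 - opMat (fourierMul i₁₁) (fourierMul i₁₂) (fourierMul i₂₁) (fourierMul i₂₂)
          * (G.opM ε * opMat evenOp 0 0 evenOp))
        - (1 - kdvOp (√G.d₁) ha (solitonBdd G.d₁ G.d₂) G.den⁻¹ (∑ m, G.η₁₁ m) (∑ m, G.η₁₂ m)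
            G.lam)) v = -((fourierMul i₁₁ x₁ + fourierMul i₁₂ x₂, fourierMul i₂₁ x₁ + fourierMul i₂₂ x₂)
            - (T, G.lam • T)) := by
    rw [sub_sub_sub_cancel_left, sub_apply, mul_apply_eq_comp, eM, opMat_apply, kdvOp_apply, neg_sub]
    rfl
  rw [e0, norm_neg, Prod.mk_sub_mk, norm_prod_le_iff]
  exact ⟨r1.trans hfin, r2.trans hfin⟩

/-- Uniform invertibility of `L_ε` on pairs of even complex-valued functions: `L_ε v = g` is
equivalent to `(1 - B_ε⁻¹ M_ε) v = B_ε⁻¹ g`, where `1 - B_ε⁻¹ M_ε` is a small perturbation of the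
operator that belongs to the linearized KdV equation. -/
theorem exists_opB_sub_opM_bijective (hs : G.SymmetricCoefficients) (hg : G.Generic)
    (hT : G.SymbolBound) : ∃ ε₀ C : ℝ, 0 < ε₀ ∧ ε₀ ≤ 1 ∧ 0 < C ∧ ∀ ε : ℝ, 0 < ε → ε < ε₀ →
      (∀ g : L2C × L2C, (reflOp g.1, reflOp g.2) = g → ∃ w : L2C × L2C,
        (reflOp w.1, reflOp w.2) = w ∧ G.opB ε w - G.opM ε w = g) ∧
      ∀ w : L2C × L2C, (reflOp w.1, reflOp w.2) = w → ‖w‖ ≤ C * ‖G.opB ε w - G.opM ε w‖ := by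
  obtain ⟨ε₀, K, hε₀, hε₀1, hK, H⟩ := G.exists_inverse_symbol hs hg hT
  obtain ⟨-, hd₁, hd₂⟩ := hg
  have hden := G.den_pos hd₁
  have ha : 0 < √G.d₁ := Real.sqrt_pos.2 hd₁
  have hcoef : G.den⁻¹ * ((∑ m, G.η₁₁ m) + G.lam * ∑ m, G.η₁₂ m) = 2 * G.d₂ := by
    rw [G.sum_η₁₁_add hd₁]; field_simp
  obtain ⟨Cr, hCr, Hr⟩ := G.exists_norm_preconditioned_sub_le hd₁ ha hK.le
  obtain ⟨r, C, hr, hC, hS⟩ := exists_isUnit_of_norm_sub_le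
    (isUnit_one_sub_kdvOp hd₁ hd₂ hcoef ha)
  refine ⟨min ε₀ (r / (Cr + 1)), C * (2 * K), by positivity, (min_le_left _ _).trans hε₀1,
    by positivity, ?_⟩
  intro ε hε hεlt
  have hεε₀ : ε < ε₀ := hεlt.trans_le (min_le_left _ _)
  have hε1 : ε ≤ 1 := hεε₀.le.trans hε₀1
  have hCε : Cr * ε ≤ r := by
    have h1 : ε * (Cr + 1) ≤ r :=
      (le_div_iff₀ (by positivity)).1 (hεlt.le.trans (min_le_right _ _))
    linarith
  obtain ⟨i₁₁, i₁₂, i₂₁, i₂₂, _, _, _, rfl, rfl, rfl, I1, I2, I3, I4, b11, b12, b21, b22, l1, l2⟩ :=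
    H ε hε hεε₀
  obtain ⟨hSu, hSb⟩ := hS _ ((Hr ε hε hε1 i₁₁ i₁₂ i₂₁ i₂₂ b11 b12 b21 b22 l1 l2).trans hCε)
  change G.symbB₁₁ ε * i₁₁ + G.symbB₁₂ ε * i₂₁ = 1 at I1
  change G.symbB₁₁ ε * i₁₂ + G.symbB₁₂ ε * i₂₂ = 0 at I2
  change G.symbB₂₁ ε * i₁₁ + G.symbB₂₂ ε * i₂₁ = 0 at I3
  change G.symbB₂₁ ε * i₁₂ + G.symbB₂₂ ε * i₂₂ = 1 at I4
  obtain ⟨J1, J2, J3, J4⟩ := left_inverse_of_right_inverse I1 I2 I3 I4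
  obtain ⟨k1, k2, k3, k4⟩ := G.commute_reflOp_symbB ε
  have hK' : ∀ (i i' : Bdd ℝ), (∀ ξ, |i.1 ξ| ≤ K) → (∀ ξ, |i'.1 ξ| ≤ K) → ∀ v : L2C × L2C,
      ‖fourierMul i v.1 + fourierMul i' v.2‖ ≤ 2 * K * ‖v‖ := fun i i' hi hi' v => by
    have h1 := (fourierMul i).le_of_opNorm_le (norm_fourierMul_le i hi) v.1
    have h2 := (fourierMul i').le_of_opNorm_le (norm_fourierMul_le i' hi') v.2
    have h3 := mul_le_mul_of_nonneg_left (norm_fst_le v) hK.le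
    have h4 := mul_le_mul_of_nonneg_left (norm_snd_le v) hK.le
    exact (norm_add_le_of_le h1 h2).trans (by linarith)
  have hR : ∀ v : L2C × L2C, opMat reflOp 0 0 reflOp v = (reflOp v.1, reflOp v.2) := fun v => by
    rw [opMat_apply]; simp
  have key := bijective_of_preconditioned (B := G.opB ε)
    (Bi := opMat (fourierMul i₁₁) (fourierMul i₁₂) (fourierMul i₂₁) (fourierMul i₂₂))
    (Mo := G.opM ε) (R := opMat reflOp 0 0 reflOp) (P := opMat evenOp 0 0 evenOp) (C := C)
    (K := 2 * K) ?_ ?_ ?_ ?_ ?_ hSu hC.le hSb ?_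
  · simp only [hR] at key
    refine ⟨key.1, fun w hw => ?_⟩
    rw [mul_assoc C]
    exact key.2 w hw
  · rw [opB, opMat_mul]
    simp only [← map_mul, ← map_add, I1, I2, I3, I4, map_one, map_zero, opMat_one]
  · rw [opB, opMat_mul]
    simp only [← map_mul, ← map_add, J1, J2, J3, J4, map_one, map_zero, opMat_one]
  · rw [opB, opMat_mul, opMat_mul]
    simp only [zero_mul, mul_zero, add_zero, zero_add, k1.eq, k2.eq, k3.eq, k4.eq]
  · rw [opM, opMat_mul, opMat_mul]
    have h1 : ∀ η, reflOp * (G.avMulOp ε G.wave η * evenOp) = G.avMulOp ε G.wave η * evenOp :=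
      fun η => ContinuousLinearMap.ext fun f => by
        change reflOp (G.avMulOp ε G.wave η (evenOp f)) = _
        rw [reflOp_avMulOp _ _ G.wave_neg, reflOp_evenOp]; rfl
    have h2 : ∀ η, reflOp * ((ε ^ 2 • G.avMulOp ε G.wave η) * evenOp)
        = (ε ^ 2 • G.avMulOp ε G.wave η) * evenOp :=
      fun η => ContinuousLinearMap.ext fun f => by
        change reflOp (ε ^ 2 • G.avMulOp ε G.wave η (evenOp f)) = _
        rw [reflOp.map_smul_of_tower, reflOp_avMulOp _ _ G.wave_neg, reflOp_evenOp]; rfl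
    simp only [zero_mul, mul_zero, add_zero, zero_add, h1, h2]
  · intro v hv
    rw [hR] at hv
    rw [opMat_apply]
    have h1 : reflOp v.1 = v.1 := congrArg Prod.fst hv
    have h2 : reflOp v.2 = v.2 := congrArg Prod.snd hv
    rw [evenOp_of_reflOp h1, evenOp_of_reflOp h2]
    simp
  · intro v
    rw [opMat_apply, norm_prod_le_iff]
    exact ⟨hK' _ _ b11 b12 v, hK' _ _ b21 b22 v⟩

end LatticeData

/-! ### Square integrable real functions with a bound on the norm -/

/-- `f` is square integrable and `‖f‖₂ ≤ C`. -/
structure L2Le (f : ℝ → ℝ) (C : ℝ) : Prop where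
  memLp : MemLp f 2 volume
  nonneg : 0 ≤ C
  le : eLpNorm f 2 volume ≤ ENNReal.ofReal C

namespace L2Le

variable {f g : ℝ → ℝ} {C D : ℝ}

lemma mono (hf : L2Le f C) (h : C ≤ D) : L2Le f D :=
  ⟨hf.memLp, hf.nonneg.trans h, hf.le.trans (ENNReal.ofReal_le_ofReal h)⟩

lemma congr (hf : L2Le f C) (h : f =ᵐ[volume] g) : L2Le g C :=
  ⟨(memLp_congr_ae h).1 hf.memLp, hf.nonneg, (eLpNorm_congr_ae h).symm.trans_le hf.le⟩

lemma add (hf : L2Le f C) (hg : L2Le g D) : L2Le (f + g) (C + D) :=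
  ⟨hf.memLp.add hg.memLp, add_nonneg hf.nonneg hg.nonneg,
    (eLpNorm_add_le hf.memLp.1 hg.memLp.1 (by norm_num)).trans (by
      rw [ENNReal.ofReal_add hf.nonneg hg.nonneg]; exact add_le_add hf.le hg.le)⟩

lemma zero : L2Le 0 0 := ⟨MemLp.zero, le_rfl, by simp⟩

lemma of_abs_le (hf : L2Le f C) (hg : AEStronglyMeasurable g volume) {c : ℝ} (hc : 0 ≤ c)
    (h : ∀ᵐ x, |g x| ≤ c * |f x|) : L2Le g (c * C) :=
  ⟨hf.memLp.of_le_mul hg h, mul_nonneg hc hf.nonneg, by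
    rw [ENNReal.ofReal_mul hc]
    exact (eLpNorm_le_mul_eLpNorm_of_ae_le_mul h 2).trans (by gcongr; exact hf.le)⟩

lemma const_mul (hf : L2Le f C) (c : ℝ) : L2Le (fun x => c * f x) (|c| * C) :=
  hf.of_abs_le (hf.memLp.1.const_mul c) (abs_nonneg c) (ae_of_all _ fun _ => (abs_mul c _).le)

lemma sum {ι : Type*} {s : Finset ι} {f : ι → ℝ → ℝ} {C : ι → ℝ} (h : ∀ i ∈ s, L2Le (f i) (C i)) :
    L2Le (fun x => ∑ i ∈ s, f i x) (∑ i ∈ s, C i) := by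
  classical
  induction s using Finset.induction_on with
  | empty => exact L2Le.zero
  | insert a s ha ih =>
    simp only [Finset.sum_insert ha]
    exact (h a (Finset.mem_insert_self _ _)).add
      (ih fun i hi => h i (Finset.mem_insert_of_mem hi))

lemma of_norm_le {u : L2C} (hf : AEStronglyMeasurable f volume) (h : ∀ᵐ x, |f x| ≤ ‖u x‖) :
    L2Le f ‖u‖ :=
  ⟨(Lp.memLp u).of_le hf h, norm_nonneg _, by
    rw [Lp.norm_def, ENNReal.ofReal_toReal (Lp.memLp u).2.ne]
    exact eLpNorm_mono_ae h⟩

end L2Le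

lemma MeasureTheory.MemLp.exists_l2Le {f : ℝ → ℝ} (hf : MemLp f 2 volume) : ∃ C, L2Le f C :=
  ⟨(eLpNorm f 2 volume).toReal, hf, ENNReal.toReal_nonneg, by
    rw [ENNReal.ofReal_toReal hf.2.ne]⟩

/-! ### From complex-valued to real-valued functions -/

/-- The complex-valued version of a real square integrable function. -/
def ofRealL2 {f : ℝ → ℝ} (hf : MemLp f 2 volume) : L2C := (hf.ofReal (K := ℂ)).toLp

lemma ofRealL2_coeFn {f : ℝ → ℝ} (hf : MemLp f 2 volume) :
    ofRealL2 hf =ᵐ[volume] fun x => ((f x : ℝ) : ℂ) := (hf.ofReal (K := ℂ)).coeFn_toLp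

/-- `f` represents the image of `u` under the real-linear functional `φ` (the real part or the
imaginary part). -/
def Represents (φ : ℂ →L[ℝ] ℝ) (u : L2C) (f : ℝ → ℝ) : Prop := f =ᵐ[volume] fun x => φ (u x)

namespace Represents

variable {φ : ℂ →L[ℝ] ℝ} {u v : L2C} {f g : ℝ → ℝ}

lemma memLp (h : Represents φ u f) : MemLp f 2 volume :=
  (memLp_congr_ae h).2 (φ.comp_memLp' (Lp.memLp u))

lemma add (hu : Represents φ u f) (hv : Represents φ v g) : Represents φ (u + v) (f + g) := by
  filter_upwards [hu, hv, Lp.coeFn_add u v] with x h1 h2 h3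
  rw [Pi.add_apply, h1, h2, h3, Pi.add_apply, map_add]

lemma sub (hu : Represents φ u f) (hv : Represents φ v g) : Represents φ (u - v) (f - g) := by
  filter_upwards [hu, hv, Lp.coeFn_sub u v] with x h1 h2 h3
  rw [Pi.sub_apply, h1, h2, h3, Pi.sub_apply, map_sub]

lemma smul (hu : Represents φ u f) (c : ℝ) : Represents φ (c • u) (c • f) := by
  filter_upwards [hu, Lp.coeFn_smul c u] with x h1 h2
  rw [Pi.smul_apply, h1, h2, Pi.smul_apply, map_smul]

lemma zero : Represents φ 0 0 := by
  filter_upwards [Lp.coeFn_zero ℂ 2 (volume : Measure ℝ)] with x h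
  rw [h]; simp

lemma sum {ι : Type*} {s : Finset ι} {u : ι → L2C} {f : ι → ℝ → ℝ} (h : ∀ i, Represents φ (u i) (f i)) :
    Represents φ (∑ i ∈ s, u i) (∑ i ∈ s, f i) := by
  classical
  induction s using Finset.induction_on with
  | empty => simpa using Represents.zero
  | insert a s ha ih =>
    simp only [Finset.sum_insert ha]
    exact (h a).add ih

lemma av (hu : Represents φ u f) {η : ℝ} (hη : η ≠ 0) : Represents φ (avOp η u) (av η f) := by
  filter_upwards [avOp_coeFn hη u] with x h1
  rw [av_congr_ae hu, av_clm φ η (Lp.memLp u).locInt, h1]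

lemma mulOp (hu : Represents φ u f) (W : Bdd ℝ) : Represents φ (mulOp W u) (fun x => W.1 x * f x) := by
  filter_upwards [hu, mulOp_coeFn W u] with x h1 h2
  rw [h1, h2, map_smul, smul_eq_mul]

lemma unique (hf : Represents φ u f) (hg : Represents φ u g) : f =ᵐ[volume] g := hf.trans hg.symm

lemma ofReal (hf : MemLp f 2 volume) : Represents Complex.reCLM (ofRealL2 hf) f := by
  filter_upwards [ofRealL2_coeFn hf] with x h
  rw [h]; simp

lemma ofReal_im (hf : MemLp f 2 volume) : Represents Complex.imCLM (ofRealL2 hf) 0 := by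
  filter_upwards [ofRealL2_coeFn hf] with x h
  rw [h]; simp

end Represents

namespace LatticeData

variable {M : ℕ} (G : LatticeData M)

lemma rep_avSum {ε : ℝ} (hε : 0 < ε) (α : Fin M → ℝ) {φ : ℂ →L[ℝ] ℝ} {u : L2C} {f : ℝ → ℝ}
    (h : Represents φ u f) : Represents φ (fourierMul (G.avSum ε α) u)
      (∑ m, (G.k m ^ 2 * α m) • avg (G.k m * ε) (avg (G.k m * ε) f)) := by
  have e : fourierMul (G.avSum ε α) u
      = ∑ m, (G.k m ^ 2 * α m) • avOp (G.k m * ε) (avOp (G.k m * ε) u) := by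
    rw [avSum, map_sum, sum_apply]
    refine Finset.sum_congr rfl fun m _ => ?_
    rw [fourierMul_smul, map_pow, pow_two]
    rfl
  rw [e]
  refine Represents.sum fun m => ?_
  rcases eq_or_ne (G.k m) 0 with hk | hk
  · simpa [hk] using Represents.zero
  · have hη : G.k m * ε ≠ 0 := mul_ne_zero hk hε.ne'
    exact ((h.av hη).av hη).smul _

lemma rep_diagSymbol {ε : ℝ} (hε : 0 < ε) (α : Fin M → ℝ) {φ : ℂ →L[ℝ] ℝ} {u : L2C} {f : ℝ → ℝ}
    (h : Represents φ u f) : Represents φ (fourierMul (G.diagSymbol ε α) u)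
      ((G.σ₀ + ε ^ 2) • f - ∑ m, (G.k m ^ 2 * α m) • avg (G.k m * ε) (avg (G.k m * ε) f)) := by
  rw [diagSymbol, map_sub, Algebra.algebraMap_eq_smul_one, fourierMul_smul, map_one, sub_apply]
  exact (h.smul _).sub (G.rep_avSum hε α h)

lemma rep_avMulOp {ε : ℝ} (hε : 0 < ε) {η : Fin M → ℝ} (hη : ∀ m, G.k m = 0 → η m = 0)
    {φ : ℂ →L[ℝ] ℝ} {u : L2C} {f : ℝ → ℝ} (h : Represents φ u f) :
    Represents φ (G.avMulOp ε G.wave η u) (∑ m, η m • G.quadTerm ε m G.Wstar f) := by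
  rw [avMulOp_apply]
  refine Represents.sum fun m => ?_
  rcases eq_or_ne (G.k m) 0 with hk | hk
  · rw [hη m hk, zero_smul, zero_smul]; exact Represents.zero
  · have hη : G.k m * ε ≠ 0 := mul_ne_zero hk hε.ne'
    exact (((h.av hη).mulOp _).av hη).smul _

/-- The operators on pairs of complex-valued functions extend `L_ε`. -/
lemma rep_opB_sub_opM (hs : G.SymmetricCoefficients) {ε : ℝ} (hε : 0 < ε) {φ : ℂ →L[ℝ] ℝ}
    {w : L2C × L2C} {V : ℝ → Plane} (h0 : Represents φ w.1 (comp V 0)) (h1 : Represents φ w.2 (comp V 1)) :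
    Represents φ (G.opB ε w - G.opM ε w).1 (comp (G.L ε V) 0) ∧
      Represents φ (G.opB ε w - G.opM ε w).2 (comp (G.L ε V) 1) := by
  have hα : G.α₂₁ = G.α₁₂ := funext fun m => (hs m).1.symm
  have hk : ∀ m, G.k m = 0 → G.η₁₁ m = 0 ∧ G.η₁₂ m = 0 ∧ G.η₂₁ m = 0 ∧ G.η₂₂ m = 0 :=
    fun m hm => by simp [η₁₁, η₁₂, η₂₁, η₂₂, hm]
  constructor
  · have e : (G.opB ε w - G.opM ε w).1 = (1 / ε ^ 2) • (fourierMul (G.diagSymbol ε G.α₁₁) w.1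
          - G.lam • fourierMul (G.avSum ε G.α₁₂) w.1)
        + (1 / ε ^ 2) • (G.lam • fourierMul (G.diagSymbol ε G.α₂₂) w.2
          - fourierMul (G.avSum ε G.α₁₂) w.2)
        - (G.avMulOp ε G.wave G.η₁₁ w.1 + G.avMulOp ε G.wave G.η₁₂ w.2) := by
      rw [opB, opM, opMat_apply, opMat_apply, symbB₁₁, symbB₁₂]
      simp only [fourierMul_smul, map_add, map_neg]
      simp only [smul_apply, add_apply, neg_apply, smul_neg, sub_eq_add_neg]
      rw [add_comm (-_) (G.lam • fourierMul (G.diagSymbol ε G.α₂₂) w.2)]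
      rfl
    rw [e]
    have := ((((G.rep_diagSymbol hε G.α₁₁ h0).sub ((G.rep_avSum hε G.α₁₂ h0).smul G.lam)).smul
      (1 / ε ^ 2)).add ((((G.rep_diagSymbol hε G.α₂₂ h1).smul G.lam).sub
        (G.rep_avSum hε G.α₁₂ h1)).smul (1 / ε ^ 2))).sub
        ((G.rep_avMulOp hε (fun m hm => (hk m hm).1) h0).add
        (G.rep_avMulOp hε (fun m hm => (hk m hm).2.1) h1))
    convert this using 1
    ext x
    simp only [comp, L, B, Bcan, Mop, hα, Pi.sub_apply, Pi.add_apply, Pi.smul_apply,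
      Finset.sum_apply, smul_eq_mul, Finset.sum_add_distrib, PiLp.sub_apply, PiLp.toLp_apply,
      Matrix.cons_val_zero, Matrix.cons_val_one]
    ring
  · have e : (G.opB ε w - G.opM ε w).2 = (fourierMul (G.diagSymbol ε G.α₂₂) w.2
          - fourierMul (G.avSum ε G.α₁₂) w.1)
        - (ε ^ 2 • G.avMulOp ε G.wave G.η₂₁ w.1 + ε ^ 2 • G.avMulOp ε G.wave G.η₂₂ w.2) := by
      rw [opB, opM, opMat_apply, opMat_apply, symbB₂₁, symbB₂₂]
      simp only [map_neg]
      simp only [smul_apply, neg_apply, sub_eq_add_neg]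
      rw [add_comm (-_) (fourierMul (G.diagSymbol ε G.α₂₂) w.2)]
      rfl
    rw [e]
    have := ((G.rep_diagSymbol hε G.α₂₂ h1).sub (G.rep_avSum hε G.α₁₂ h0)).sub
        (((G.rep_avMulOp hε (fun m hm => (hk m hm).2.2.1) h0).smul (ε ^ 2)).add
        ((G.rep_avMulOp hε (fun m hm => (hk m hm).2.2.2) h1).smul (ε ^ 2)))
    convert this using 1
    ext x
    simp only [comp, L, B, Bcan, Mop, hα, Pi.sub_apply, Pi.add_apply, Pi.smul_apply,
      Finset.sum_apply, smul_eq_mul, Finset.sum_add_distrib, PiLp.sub_apply, PiLp.toLp_apply,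
      Matrix.cons_val_zero, Matrix.cons_val_one]
    field_simp
    ring

end LatticeData

/-! ### Plane-valued functions -/

lemma abs_coord_le (x : Plane) (i : Fin 2) : |x i| ≤ ‖x‖ := PiLp.norm_apply_le x i

lemma norm_plane_le (x : Plane) : ‖x‖ ≤ |x 0| + |x 1| := by
  rw [EuclideanSpace.norm_eq, Fin.sum_univ_two]
  refine Real.sqrt_le_iff.2 ⟨by positivity, ?_⟩
  simp only [Real.norm_eq_abs]
  nlinarith [abs_nonneg (x 0), abs_nonneg (x 1)]

lemma MeasureTheory.MemLp.comp_plane {f : ℝ → Plane} (hf : MemLp f 2 volume) (i : Fin 2) :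
    MemLp (comp f i) 2 volume :=
  (EuclideanSpace.proj i : Plane →L[ℝ] ℝ).comp_memLp' hf

lemma aestronglyMeasurable_plane {f : ℝ → Plane} (h0 : AEStronglyMeasurable (comp f 0) volume)
    (h1 : AEStronglyMeasurable (comp f 1) volume) : AEStronglyMeasurable f volume := by
  have e : f = fun x => comp f 0 x • (!₂[1, 0] : Plane) + comp f 1 x • (!₂[0, 1] : Plane) := by
    ext x i
    fin_cases i <;> simp [comp]
  rw [e]
  exact (h0.smul_const _).add (h1.smul_const _)

lemma memLp_plane {f : ℝ → Plane} (h0 : MemLp (comp f 0) 2 volume)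
    (h1 : MemLp (comp f 1) 2 volume) : MemLp f 2 volume := by
  refine (h0.norm.add h1.norm).of_le (aestronglyMeasurable_plane h0.1 h1.1) (ae_of_all _ fun x => ?_)
  exact (norm_plane_le _).trans (le_abs_self _)

lemma eLpNorm_plane_le {f : ℝ → Plane} {C D : ℝ} (h0 : L2Le (comp f 0) C) (h1 : L2Le (comp f 1) D) :
    eLpNorm f 2 volume ≤ ENNReal.ofReal (C + D) := by
  have h : L2Le ((fun x => |comp f 0 x|) + fun x => |comp f 1 x|) (C + D) :=
    (((h0.of_abs_le h0.memLp.1.norm zero_le_one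
      (ae_of_all _ fun x => by simp)).mono (one_mul _).le).add
      ((h1.of_abs_le h1.memLp.1.norm zero_le_one
      (ae_of_all _ fun x => by simp)).mono (one_mul _).le))
  refine (eLpNorm_mono_ae (ae_of_all _ fun x => ?_)).trans h.le
  exact (norm_plane_le _).trans (le_abs_self _)

/-- `f` is even, up to null sets. -/
def AEEven {E : Type*} (f : ℝ → E) : Prop := ∀ᵐ x : ℝ, f (-x) = f x

lemma AEEven.comp {f : ℝ → Plane} (hf : AEEven f) (i : Fin 2) : AEEven (comp f i) := by
  filter_upwards [hf] with x hx
  simp only [_root_.comp, hx]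

lemma isEvenL2_of_comp {f : ℝ → Plane} (h0 : MemLp (comp f 0) 2 volume)
    (h1 : MemLp (comp f 1) 2 volume) (he0 : AEEven (comp f 0)) (he1 : AEEven (comp f 1)) :
    IsEvenL2 f := by
  refine ⟨memLp_plane h0 h1, ?_⟩
  filter_upwards [he0, he1] with x hx0 hx1
  ext i
  fin_cases i
  · exact hx0
  · exact hx1

/-- The element of `(L²_even)²` represented by `f`. -/
def IsEvenL2.toL2Even {f : ℝ → Plane} (hf : IsEvenL2 f) : L2Even :=
  ⟨hf.1.toLp, by
    change ∀ᵐ x : ℝ, (hf.1.toLp : Lp Plane 2 volume) (-x) = (hf.1.toLp : Lp Plane 2 volume) x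
    filter_upwards [hf.1.coeFn_toLp, ae_neg hf.1.coeFn_toLp, hf.2] with x h1 h2 h3
    rw [h1, h2, h3]⟩

lemma IsEvenL2.rep_toL2Even {f : ℝ → Plane} (hf : IsEvenL2 f) : rep hf.toL2Even =ᵐ[volume] f :=
  hf.1.coeFn_toLp

lemma comp_congr_ae {f g : ℝ → Plane} (h : f =ᵐ[volume] g) (i : Fin 2) :
    comp f i =ᵐ[volume] comp g i := by
  filter_upwards [h] with x hx
  simp only [comp, hx]

lemma ae_eq_of_comp {f g : ℝ → Plane} (h0 : comp f 0 =ᵐ[volume] comp g 0)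
    (h1 : comp f 1 =ᵐ[volume] comp g 1) : f =ᵐ[volume] g := by
  filter_upwards [h0, h1] with x hx0 hx1
  ext i
  fin_cases i
  · exact hx0
  · exact hx1

lemma isEvenL2_rep (V : L2Even) : IsEvenL2 (rep V) := ⟨Lp.memLp _, V.2⟩

lemma memLp_rep (V : L2Even) (i : Fin 2) : MemLp (comp (rep V) i) 2 volume :=
  (isEvenL2_rep V).1.comp_plane i

lemma aeEven_rep (V : L2Even) (i : Fin 2) : AEEven (comp (rep V) i) :=
  AEEven.comp (isEvenL2_rep V).2 i

lemma rep_sub (U V : L2Even) : rep (U - V) =ᵐ[volume] rep U - rep V :=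
  Lp.coeFn_sub _ _

lemma rep_smul (c : ℝ) (U : L2Even) : rep (c • U) =ᵐ[volume] c • rep U :=
  Lp.coeFn_smul _ _

lemma l2Le_rep (V : L2Even) (i : Fin 2) : L2Le (comp (rep V) i) ‖V‖ := by
  refine ⟨memLp_rep V i, norm_nonneg _, ?_⟩
  have h : ENNReal.ofReal ‖V‖ = eLpNorm (rep V) 2 volume := by
    rw [Submodule.coe_norm, Lp.norm_def, ENNReal.ofReal_toReal (Lp.memLp _).2.ne]; rfl
  rw [h]
  exact eLpNorm_mono_ae (ae_of_all _ fun x => abs_coord_le _ i)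

lemma norm_le_of_l2Le {V : L2Even} {C D : ℝ} (h0 : L2Le (comp (rep V) 0) C)
    (h1 : L2Le (comp (rep V) 1) D) : ‖V‖ ≤ C + D := by
  have h := eLpNorm_plane_le h0 h1
  rw [Submodule.coe_norm, Lp.norm_def]
  exact ENNReal.toReal_le_of_le_ofReal (add_nonneg h0.nonneg h1.nonneg) h

/-- Averages of even functions are even. -/
lemma AEEven.av {f : ℝ → ℝ} (hf : AEEven f) (η x : ℝ) : avg η f (-x) = avg η f x := by
  rw [avg_eq_av, ← av_comp_neg, av_congr_ae hf]

lemma reflOp_ofRealL2 {f : ℝ → ℝ} (hf : MemLp f 2 volume) (he : AEEven f) :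
    reflOp (ofRealL2 hf) = ofRealL2 hf := by
  refine Lp.ext ?_
  filter_upwards [reflOp_coeFn (ofRealL2 hf), ofRealL2_coeFn hf, ae_neg (ofRealL2_coeFn hf), he]
    with x h1 h2 h3 h4
  rw [h1, h2, h3, h4]

lemma L2Le.norm_ofRealL2 {f : ℝ → ℝ} {C : ℝ} (hf : L2Le f C) : ‖ofRealL2 hf.memLp‖ ≤ C := by
  rw [ofRealL2, Lp.norm_toLp]
  refine ENNReal.toReal_le_of_le_ofReal hf.nonneg ((eLpNorm_congr_norm_ae ?_).trans_le hf.le)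
  exact ae_of_all _ fun x => by simp

namespace LatticeData

variable {M : ℕ} (G : LatticeData M)

lemma quadTerm_neg (ε : ℝ) (m : Fin M) {f g : ℝ → ℝ} (hf : AEEven f) (hg : AEEven g) (x : ℝ) :
    G.quadTerm ε m f g (-x) = G.quadTerm ε m f g x := by
  refine AEEven.av (ae_of_all _ fun y => ?_) _ _
  simp only [hf.av, hg.av]

lemma aeEven_Wstar : AEEven G.Wstar := ae_of_all _ fun x => soliton_neg _ _ x

lemma aeEven_B (ε : ℝ) {V : ℝ → Plane} (hV : AEEven V) : AEEven (G.B ε V) := by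
  filter_upwards [hV] with x hx
  have h : ∀ (m : Fin M) i, avg (G.k m * ε) (avg (G.k m * ε) (comp V i)) (-x)
      = avg (G.k m * ε) (avg (G.k m * ε) (comp V i)) x := fun m i =>
    AEEven.av (ae_of_all _ fun y => (hV.comp i).av _ y) _ _
  simp only [B, Bcan, h, hx]

lemma aeEven_Mop (ε : ℝ) {V : ℝ → Plane} (hV : AEEven V) : AEEven (G.Mop ε V) := by
  refine ae_of_all _ fun x => ?_
  simp only [Mop, G.quadTerm_neg ε _ G.aeEven_Wstar (hV.comp _) x]

lemma aeEven_L (ε : ℝ) {V : ℝ → Plane} (hV : AEEven V) : AEEven (G.L ε V) := by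
  filter_upwards [G.aeEven_B ε hV, G.aeEven_Mop ε hV] with x h1 h2
  simp only [L, Pi.sub_apply, h1, h2]

lemma L_zero (ε : ℝ) : G.L ε 0 = 0 := by
  have h0 : ∀ i, comp (0 : ℝ → Plane) i = 0 := fun i => by ext x; simp [comp]
  have h1 : ∀ η, avg η (0 : ℝ → ℝ) = 0 := fun η => by ext x; simp [avg]
  have h2 : ∀ m, G.quadTerm ε m G.Wstar 0 = 0 := fun m => by
    simp only [quadTerm, h1, Pi.zero_apply, mul_zero]
    exact h1 _
  ext x i
  fin_cases i <;> simp [L, B, Bcan, Mop, h0, h1, h2]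

/-- The pair of complex-valued functions that belongs to `V`. -/
def toPair (V : L2Even) : L2C × L2C := (ofRealL2 (memLp_rep V 0), ofRealL2 (memLp_rep V 1))

lemma represents_L_toPair (hs : G.SymmetricCoefficients) {ε : ℝ} (hε : 0 < ε) (V : L2Even) :
    Represents Complex.reCLM (G.opB ε (toPair V) - G.opM ε (toPair V)).1 (comp (G.L ε (rep V)) 0) ∧
      Represents Complex.reCLM (G.opB ε (toPair V) - G.opM ε (toPair V)).2
        (comp (G.L ε (rep V)) 1) :=
  G.rep_opB_sub_opM hs hε (Represents.ofReal (memLp_rep V 0)) (Represents.ofReal (memLp_rep V 1))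

lemma represents_im_L_toPair (hs : G.SymmetricCoefficients) {ε : ℝ} (hε : 0 < ε) (V : L2Even) :
    Represents Complex.imCLM (G.opB ε (toPair V) - G.opM ε (toPair V)).1 0 ∧
      Represents Complex.imCLM (G.opB ε (toPair V) - G.opM ε (toPair V)).2 0 := by
  have h0 : ∀ i, comp (0 : ℝ → Plane) i = 0 := fun i => by ext x; simp [comp]
  have := G.rep_opB_sub_opM hs hε (φ := Complex.imCLM) (w := toPair V) (V := 0)
    (by rw [h0]; exact Represents.ofReal_im (memLp_rep V 0))
    (by rw [h0]; exact Represents.ofReal_im (memLp_rep V 1))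
  rwa [L_zero, h0, h0] at this

lemma isEvenL2_L (hs : G.SymmetricCoefficients) {ε : ℝ} (hε : 0 < ε) (V : L2Even) :
    IsEvenL2 (G.L ε (rep V)) :=
  ⟨memLp_plane (G.represents_L_toPair hs hε V).1.memLp (G.represents_L_toPair hs hε V).2.memLp,
    G.aeEven_L ε V.2⟩

/-- `L_ε` is additive on classes of functions. -/
lemma L_sub_ae (hs : G.SymmetricCoefficients) {ε : ℝ} (hε : 0 < ε) (U V : L2Even) :
    G.L ε (rep (U - V)) =ᵐ[volume] G.L ε (rep U) - G.L ε (rep V) := by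
  have hU := G.represents_L_toPair hs hε U
  have hV := G.represents_L_toPair hs hε V
  have hUV : ∀ i, comp (rep (U - V)) i =ᵐ[volume] comp (rep U) i - comp (rep V) i := fun i =>
    comp_congr_ae (rep_sub U V) i
  have h := G.rep_opB_sub_opM hs hε (φ := Complex.reCLM) (w := toPair U - toPair V)
    (V := rep (U - V))
    ((hUV 0).trans ((Represents.ofReal (memLp_rep U 0)).sub (Represents.ofReal (memLp_rep V 0))))
    ((hUV 1).trans ((Represents.ofReal (memLp_rep U 1)).sub (Represents.ofReal (memLp_rep V 1))))
  rw [map_sub, map_sub, sub_sub_sub_comm] at h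
  exact ae_eq_of_comp (h.1.unique (hU.1.sub hV.1)) (h.2.unique (hU.2.sub hV.2))

/-- A complex-valued function whose real part is `f` and whose imaginary part vanishes has the norm
of `f`. -/
lemma norm_le_of_represents {u : L2C} {f : ℝ → ℝ} {C : ℝ} (hre : Represents Complex.reCLM u f)
    (him : Represents Complex.imCLM u 0) (hf : L2Le f C) : ‖u‖ ≤ C := by
  have h : u = ofRealL2 hf.memLp := by
    refine Lp.ext ?_
    filter_upwards [hre, him, ofRealL2_coeFn hf.memLp] with x h1 h2 h3
    rw [h3]
    refine Complex.ext ?_ ?_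
    · rw [Complex.ofReal_re, h1]; rfl
    · rw [Complex.ofReal_im]; exact h2.symm
  rw [h]
  exact hf.norm_ofRealL2

/-- Invertibility of `L_ε` on `(L²_even)²` and a uniform bound for the inverse. -/
theorem exists_lInvertible (hs : G.SymmetricCoefficients) (hg : G.Generic)
    (hT : G.SymbolBound) : ∃ ε₀ C : ℝ, 0 < ε₀ ∧ ε₀ ≤ 1 ∧ 0 < C ∧ ∀ ε : ℝ, 0 < ε → ε < ε₀ →
      G.LInvertible ε ∧ ∀ (U : L2Even) (b₁ b₂ : ℝ), L2Le (comp (G.L ε (rep U)) 0) b₁ →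
        L2Le (comp (G.L ε (rep U)) 1) b₂ → ‖U‖ ≤ C * (b₁ + b₂) := by
  obtain ⟨ε₀, C, hε₀, hε₀1, hC, H⟩ := G.exists_opB_sub_opM_bijective hs hg hT
  refine ⟨ε₀, 2 * C, hε₀, hε₀1, by positivity, fun ε hε hεlt => ?_⟩
  obtain ⟨hsurj, hbound⟩ := H ε hε hεlt
  have hb : ∀ (U : L2Even) (b₁ b₂ : ℝ), L2Le (comp (G.L ε (rep U)) 0) b₁ →
      L2Le (comp (G.L ε (rep U)) 1) b₂ → ‖U‖ ≤ 2 * C * (b₁ + b₂) := by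
    intro U b₁ b₂ h1 h2
    have hre := G.represents_L_toPair hs hε U
    have him := G.represents_im_L_toPair hs hε U
    have h3 := hbound (toPair U) (Prod.ext (reflOp_ofRealL2 (memLp_rep U 0) (aeEven_rep U 0))
      (reflOp_ofRealL2 (memLp_rep U 1) (aeEven_rep U 1)))
    have h4 : ‖G.opB ε (toPair U) - G.opM ε (toPair U)‖ ≤ b₁ + b₂ := by
      have h5 := norm_le_of_represents hre.1 him.1 h1
      have h6 := norm_le_of_represents hre.2 him.2 h2
      rw [norm_prod_le_iff]
      exact ⟨by linarith [h2.nonneg], by linarith [h1.nonneg]⟩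
    have h7 : ‖toPair U‖ ≤ C * (b₁ + b₂) := h3.trans (mul_le_mul_of_nonneg_left h4 hC.le)
    have h8 : ∀ i (hm : MemLp (comp (rep U) i) 2 volume), ‖ofRealL2 hm‖ ≤ C * (b₁ + b₂) →
        L2Le (comp (rep U) i) (C * (b₁ + b₂)) := by
      intro i hm h
      refine (L2Le.of_norm_le (u := ofRealL2 hm) hm.1 ?_).mono h
      filter_upwards [ofRealL2_coeFn hm] with x hx
      rw [hx]; simp
    have h9 := norm_le_of_l2Le (h8 0 (memLp_rep U 0) ((norm_fst_le _).trans h7))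
      (h8 1 (memLp_rep U 1) ((norm_snd_le _).trans h7))
    linarith
  refine ⟨⟨fun V => G.isEvenL2_L hs hε V, fun g hg' => ?_⟩, hb⟩
  obtain ⟨w, hw, hwg⟩ := hsurj (ofRealL2 (hg'.1.comp_plane 0), ofRealL2 (hg'.1.comp_plane 1))
    (Prod.ext (reflOp_ofRealL2 (hg'.1.comp_plane 0) (AEEven.comp hg'.2 0))
      (reflOp_ofRealL2 (hg'.1.comp_plane 1) (AEEven.comp hg'.2 1)))
  have hw1 : reflOp w.1 = w.1 := congrArg Prod.fst hw
  have hw2 : reflOp w.2 = w.2 := congrArg Prod.snd hw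
  let f : ℝ → Plane := fun x => !₂[(w.1 x).re, (w.2 x).re]
  have hre : ∀ u : L2C, MemLp (fun x => (u x).re) 2 volume := fun u =>
    Complex.reCLM.comp_memLp' (Lp.memLp u)
  have hree : ∀ u : L2C, reflOp u = u → AEEven fun x => (u x).re := fun u hu => by
    have := reflOp_coeFn u
    rw [hu] at this
    filter_upwards [this] with x hx
    rw [← hx]
  have hf : IsEvenL2 f := isEvenL2_of_comp (hre w.1) (hre w.2) (hree _ hw1) (hree _ hw2)
  have hrep := hf.rep_toL2Even
  have hL := G.rep_opB_sub_opM hs hε (φ := Complex.reCLM) (w := w) (V := rep hf.toL2Even)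
    (comp_congr_ae hrep 0) (comp_congr_ae hrep 1)
  rw [hwg] at hL
  have hU : G.L ε (rep hf.toL2Even) =ᵐ[volume] g :=
    ae_eq_of_comp (hL.1.unique (Represents.ofReal (hg'.1.comp_plane 0)))
      (hL.2.unique (Represents.ofReal (hg'.1.comp_plane 1)))
  refine ⟨hf.toL2Even, hU, fun U' hU' => ?_⟩
  have hdiff := G.L_sub_ae hs hε U' hf.toL2Even
  have hz : G.L ε (rep (U' - hf.toL2Even)) =ᵐ[volume] 0 := by
    filter_upwards [hdiff, hU, hU'] with x h1 h2 h3
    rw [h1, Pi.sub_apply, h2, h3, sub_self]; rfl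
  have hz' : ∀ i, L2Le (comp (G.L ε (rep (U' - hf.toL2Even))) i) 0 := fun i =>
    L2Le.zero.congr (by
      filter_upwards [hz] with x hx
      simp [comp, hx])
  have := hb _ 0 0 (hz' 0) (hz' 1)
  rw [add_zero, mul_zero] at this
  exact sub_eq_zero.1 (norm_le_zero_iff.1 this)

end LatticeData

/-! ### Averages of smooth exponentially decaying functions -/

/-- Integration of a power bound for the derivative; its iteration replaces Taylor's formula. -/
lemma abs_le_mul_pow_succ {g g' : ℝ → ℝ} {K h : ℝ} {n : ℕ} (hg : ∀ t, HasDerivAt g (g' t) t)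
    (h0 : g 0 = 0) (hb : ∀ t, 0 ≤ t → t ≤ h → |g' t| ≤ K * t ^ n) :
    ∀ t, 0 ≤ t → t ≤ h → |g t| ≤ K * t ^ (n + 1) := by
  intro t ht hth
  have hK : ∀ u ∈ Set.Icc 0 t, ‖g' u‖ ≤ K * t ^ n := fun u hu => by
    refine (hb u hu.1 (hu.2.trans hth)).trans ?_
    rcases ht.eq_or_lt with rfl | ht'
    · rw [le_antisymm hu.2 hu.1]
    have hK0 : 0 ≤ K := by
      have := (abs_nonneg _).trans (hb t ht hth)
      exact nonneg_of_mul_nonneg_left this (pow_pos ht' n)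
    exact mul_le_mul_of_nonneg_left (pow_le_pow_left₀ hu.1 hu.2 n) hK0
  have := Convex.norm_image_sub_le_of_norm_hasDerivWithin_le (f := g) (s := Set.Icc 0 t) (x := 0)
    (y := t) (fun u _ => (hg u).hasDerivWithinAt) hK (convex_Icc 0 t)
    (Set.left_mem_Icc.2 ht) (Set.right_mem_Icc.2 ht)
  rw [h0, sub_zero, sub_zero, Real.norm_eq_abs, Real.norm_of_nonneg ht] at this
  exact this.trans_eq (by ring)

section Averages

variable {κ C R η : ℝ} {f f₁ f₂ f₃ f₄ : ℝ → ℝ}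

lemma hasDerivAt_add_arg {f f₁ : ℝ → ℝ} (h : ∀ t, HasDerivAt f (f₁ t) t) (x t : ℝ) :
    HasDerivAt (fun t => f (x + t)) (f₁ (x + t)) t := by
  simpa using HasDerivAt.comp_const_add x t (h (x + t))

lemma hasDerivAt_sub_arg {f f₁ : ℝ → ℝ} (h : ∀ t, HasDerivAt f (f₁ t) t) (x t : ℝ) :
    HasDerivAt (fun t => f (x - t)) (-f₁ (x - t)) t :=
  HasDerivAt.comp_const_sub x t (h (x - t))

/-- Values of `sech²` at nearby points are comparable. -/
lemma sechSq_le_of_abs_le {κ x y R : ℝ} (h : |x - y| ≤ R) :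
    sechSq κ y ≤ Real.exp (2 * |κ| * R) * sechSq κ x := by
  refine (sechSq_le_exp_mul κ x y).trans ?_
  refine mul_le_mul_of_nonneg_right (Real.exp_le_exp.2 ?_) (sechSq_pos _ _).le
  rw [abs_mul, ← mul_assoc]
  exact mul_le_mul_of_nonneg_left h (by positivity)

lemma abs_av_le_sechSq (hf : LocInt f) (hC : 0 ≤ C) (hb : ∀ x, |f x| ≤ C * sechSq κ x)
    (hη : |η| ≤ R) (x : ℝ) : |av η f x| ≤ C * Real.exp (2 * |κ| * R) * sechSq κ x := by
  refine norm_av_le_of_forall hf η x fun y hy => (hb y).trans ?_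
  rw [mul_assoc]
  refine mul_le_mul_of_nonneg_left (sechSq_le_of_abs_le ?_) hC
  rw [abs_sub_comm]
  linarith [abs_nonneg η]

lemma hasDerivAt_symm_integral (hf : Continuous f) (x t : ℝ) :
    HasDerivAt (fun t => ∫ y in (x - t)..(x + t), f y) (f (x + t) + f (x - t)) t := by
  have hF : ∀ u, HasDerivAt (fun u => ∫ y in (0 : ℝ)..u, f y) (f u) u := fun u =>
    intervalIntegral.integral_hasDerivAt_right (hf.intervalIntegrable _ _)
      (hf.stronglyMeasurableAtFilter _ _) hf.continuousAt
  have h := (hasDerivAt_add_arg hF x t).sub (hasDerivAt_sub_arg hF x t)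
  rw [sub_neg_eq_add] at h
  refine h.congr_of_eventuallyEq (Eventually.of_forall fun u => ?_)
  simp only [Pi.sub_apply]
  rw [intervalIntegral.integral_interval_sub_left (hf.intervalIntegrable _ _)
    (hf.intervalIntegrable _ _)]

lemma av_eq_half (η : ℝ) (f : ℝ → ℝ) (x : ℝ) :
    av η f x = (2 * (|η| / 2))⁻¹ * ∫ y in (x - |η| / 2)..(x + |η| / 2), f y := by
  rw [← av_abs]
  simp only [av, smul_eq_mul]
  congr 2
  ring

/-- An average over an interval of length `η` differs from the value at the midpoint by `O(η²)`. -/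
lemma abs_av_sub_le (h1 : ∀ t, HasDerivAt f (f₁ t) t) (h2 : ∀ t, HasDerivAt f₁ (f₂ t) t)
    (hC : 0 ≤ C) (hb : ∀ x, |f₂ x| ≤ C * sechSq κ x) (hη : η ≠ 0) (hηR : |η| ≤ R) (x : ℝ) :
    |av η f x - f x| ≤ C * Real.exp (2 * |κ| * R) * η ^ 2 * sechSq κ x := by
  have hf : Continuous f := continuous_iff_continuousAt.2 fun t => (h1 t).continuousAt
  set K := C * Real.exp (2 * |κ| * R) * sechSq κ x with hK
  have hK0 : 0 ≤ K := by have := sechSq_pos κ x; positivity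
  set h := |η| / 2 with hh
  have hh0 : 0 < h := by have := abs_pos.2 hη; positivity
  have b2 : ∀ y, |x - y| ≤ h → |f₂ y| ≤ K := fun y hy => (hb y).trans (by
    rw [hK, mul_assoc]
    exact mul_le_mul_of_nonneg_left (sechSq_le_of_abs_le (by linarith)) hC)
  have d1 : ∀ t, HasDerivAt (fun t => f (x + t) + f (x - t) - 2 * f x)
      (f₁ (x + t) - f₁ (x - t)) t := fun t =>
    ((hasDerivAt_add_arg h1 x t).add (hasDerivAt_sub_arg h1 x t)).sub_const _
  have d2 : ∀ t, HasDerivAt (fun t => f₁ (x + t) - f₁ (x - t)) (f₂ (x + t) + f₂ (x - t)) t :=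
    fun t => by
      have := (hasDerivAt_add_arg h2 x t).sub (hasDerivAt_sub_arg h2 x t)
      rwa [sub_neg_eq_add] at this
  have d0 : ∀ t, HasDerivAt (fun t => (∫ y in (x - t)..(x + t), f y) - 2 * f x * t)
      (f (x + t) + f (x - t) - 2 * f x) t := fun t => by
    have := (hasDerivAt_symm_integral hf x t).sub ((hasDerivAt_id t).const_mul (2 * f x))
    rwa [mul_one] at this
  have s2 : ∀ t, 0 ≤ t → t ≤ h → |f₂ (x + t) + f₂ (x - t)| ≤ 2 * K * t ^ 0 := fun t ht hth => by
    have e1 := b2 (x + t) (by rw [sub_add_cancel_left, abs_neg, abs_of_nonneg ht]; exact hth)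
    have e2 := b2 (x - t) (by rw [sub_sub_cancel, abs_of_nonneg ht]; exact hth)
    rw [pow_zero, mul_one]
    exact (abs_add_le _ _).trans (by linarith)
  have s1 := abs_le_mul_pow_succ d2 (by simp) s2
  have s0 := abs_le_mul_pow_succ d1 (by simp; ring) s1
  have s := abs_le_mul_pow_succ d0 (by simp) s0 h hh0.le le_rfl
  have e : av η f x - f x
      = (2 * h)⁻¹ * ((∫ y in (x - h)..(x + h), f y) - 2 * f x * h) := by
    rw [av_eq_half, ← hh]
    field_simp
  rw [e, abs_mul, abs_of_pos (by positivity)]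
  calc (2 * h)⁻¹ * _ ≤ (2 * h)⁻¹ * (2 * K * h ^ 3) := by gcongr
    _ = K * h ^ 2 := by field_simp
    _ ≤ K * η ^ 2 := by
        refine mul_le_mul_of_nonneg_left ?_ hK0
        rw [hh, div_pow, sq_abs]
        linarith [sq_nonneg η]
    _ = _ := by rw [hK]; ring

/-- The expansion `A_η f = f + η² f'' / 24 + O(η⁴)`. -/
lemma abs_av_sub_sub_le (h1 : ∀ t, HasDerivAt f (f₁ t) t) (h2 : ∀ t, HasDerivAt f₁ (f₂ t) t)
    (h3 : ∀ t, HasDerivAt f₂ (f₃ t) t) (h4 : ∀ t, HasDerivAt f₃ (f₄ t) t)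
    (hC : 0 ≤ C) (hb : ∀ x, |f₄ x| ≤ C * sechSq κ x) (hη : η ≠ 0) (hηR : |η| ≤ R) (x : ℝ) :
    |av η f x - f x - η ^ 2 / 24 * f₂ x| ≤ C * Real.exp (2 * |κ| * R) * η ^ 4 * sechSq κ x := by
  have hf : Continuous f := continuous_iff_continuousAt.2 fun t => (h1 t).continuousAt
  set K := C * Real.exp (2 * |κ| * R) * sechSq κ x with hK
  have hK0 : 0 ≤ K := by have := sechSq_pos κ x; positivity
  set h := |η| / 2 with hh
  have hh0 : 0 < h := by have := abs_pos.2 hη; positivity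
  have b4 : ∀ y, |x - y| ≤ h → |f₄ y| ≤ K := fun y hy => (hb y).trans (by
    rw [hK, mul_assoc]
    exact mul_le_mul_of_nonneg_left (sechSq_le_of_abs_le (by linarith)) hC)
  have d0 : ∀ t, HasDerivAt (fun t => (∫ y in (x - t)..(x + t), f y) - 2 * f x * t
      - f₂ x / 3 * t ^ 3) (f (x + t) + f (x - t) - 2 * f x - f₂ x * t ^ 2) t := fun t => by
    have := ((hasDerivAt_symm_integral hf x t).sub ((hasDerivAt_id t).const_mul (2 * f x))).sub
      ((hasDerivAt_pow 3 t).const_mul (f₂ x / 3))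
    refine this.congr_deriv ?_
    push_cast
    ring
  have d1 : ∀ t, HasDerivAt (fun t => f (x + t) + f (x - t) - 2 * f x - f₂ x * t ^ 2)
      (f₁ (x + t) - f₁ (x - t) - 2 * f₂ x * t) t := fun t => by
    have := (((hasDerivAt_add_arg h1 x t).add (hasDerivAt_sub_arg h1 x t)).sub_const (2 * f x)).sub
      ((hasDerivAt_pow 2 t).const_mul (f₂ x))
    refine this.congr_deriv ?_
    push_cast
    ring
  have d2 : ∀ t, HasDerivAt (fun t => f₁ (x + t) - f₁ (x - t) - 2 * f₂ x * t)
      (f₂ (x + t) + f₂ (x - t) - 2 * f₂ x) t := fun t => by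
    have := ((hasDerivAt_add_arg h2 x t).sub (hasDerivAt_sub_arg h2 x t)).sub
      ((hasDerivAt_id t).const_mul (2 * f₂ x))
    refine this.congr_deriv ?_
    ring
  have d3 : ∀ t, HasDerivAt (fun t => f₂ (x + t) + f₂ (x - t) - 2 * f₂ x)
      (f₃ (x + t) - f₃ (x - t)) t := fun t =>
    ((hasDerivAt_add_arg h3 x t).add (hasDerivAt_sub_arg h3 x t)).sub_const _
  have d4 : ∀ t, HasDerivAt (fun t => f₃ (x + t) - f₃ (x - t)) (f₄ (x + t) + f₄ (x - t)) t :=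
    fun t => by
      have := (hasDerivAt_add_arg h4 x t).sub (hasDerivAt_sub_arg h4 x t)
      rwa [sub_neg_eq_add] at this
  have s4 : ∀ t, 0 ≤ t → t ≤ h → |f₄ (x + t) + f₄ (x - t)| ≤ 2 * K * t ^ 0 := fun t ht hth => by
    have e1 := b4 (x + t) (by rw [sub_add_cancel_left, abs_neg, abs_of_nonneg ht]; exact hth)
    have e2 := b4 (x - t) (by rw [sub_sub_cancel, abs_of_nonneg ht]; exact hth)
    rw [pow_zero, mul_one]
    exact (abs_add_le _ _).trans (by linarith)
  have s3 := abs_le_mul_pow_succ d4 (by simp) s4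
  have s2 := abs_le_mul_pow_succ d3 (by simp; ring) s3
  have s1 := abs_le_mul_pow_succ d2 (by simp) s2
  have s0 := abs_le_mul_pow_succ d1 (by simp; ring) s1
  have s := abs_le_mul_pow_succ d0 (by simp) s0 h hh0.le le_rfl
  have e : av η f x - f x - η ^ 2 / 24 * f₂ x
      = (2 * h)⁻¹ * ((∫ y in (x - h)..(x + h), f y) - 2 * f x * h - f₂ x / 3 * h ^ 3) := by
    have : η ^ 2 = (2 * h) ^ 2 := by rw [hh, mul_div_cancel₀ _ (two_ne_zero), sq_abs]
    rw [av_eq_half, this, ← hh]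
    field_simp
    ring
  rw [e, abs_mul, abs_of_pos (by positivity)]
  calc (2 * h)⁻¹ * _ ≤ (2 * h)⁻¹ * (2 * K * h ^ 5) := by gcongr
    _ = K * h ^ 4 := by field_simp
    _ ≤ K * η ^ 4 := by
        refine mul_le_mul_of_nonneg_left ?_ hK0
        have : h ^ 4 = (η ^ 2) ^ 2 / 16 := by rw [hh, ← sq_abs η]; ring
        rw [this]
        nlinarith [sq_nonneg (η ^ 2)]
    _ = _ := by rw [hK]; ring

end Averages

/-- Asymptotics of the averages of the soliton `w`: `A_η² w = w + η² w'' / 12 + O(η⁴)`, where `w''` is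
given by the differential equation, and `A_η (A_η w)² = w² + O(η²)`. The errors decay like `w`. -/
lemma exists_soliton_average_bounds {d₁ d₂ : ℝ} (hd₁ : 0 < d₁) (hd₂ : d₂ ≠ 0) (R : ℝ) :
    ∃ C : ℝ, 0 ≤ C ∧ ∀ η : ℝ, η ≠ 0 → |η| ≤ R → ∀ x : ℝ,
      |av η (soliton d₁ d₂) x| ≤ C * sechSq (1 / 2 * √d₁) x ∧
      |av η (av η (soliton d₁ d₂)) x - soliton d₁ d₂ x
        - η ^ 2 / 12 * (d₁ * soliton d₁ d₂ x - d₂ * soliton d₁ d₂ x ^ 2)|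
        ≤ C * η ^ 4 * sechSq (1 / 2 * √d₁) x ∧
      |av η (fun y => av η (soliton d₁ d₂) y * av η (soliton d₁ d₂) y) x - soliton d₁ d₂ x ^ 2|
        ≤ C * η ^ 2 * sechSq (1 / 2 * √d₁) x := by
  set κ := 1 / 2 * √d₁ with hκ
  set w := soliton d₁ d₂ with hw
  set w₁ := solitonDeriv d₁ d₂ with hw₁
  set w₂ : ℝ → ℝ := fun x => d₁ * w x - d₂ * w x ^ 2 with hw₂
  set w₃ : ℝ → ℝ := fun x => d₁ * w₁ x - 2 * d₂ * (w x * w₁ x) with hw₃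
  set w₄ : ℝ → ℝ := fun x => d₁ * w₂ x - 2 * d₂ * (w₁ x * w₁ x + w x * w₂ x) with hw₄
  have D1 : ∀ t, HasDerivAt w (w₁ t) t := hasDerivAt_soliton d₁ d₂
  have D2 : ∀ t, HasDerivAt w₁ (w₂ t) t := hasDerivAt_solitonDeriv hd₁ hd₂
  have D3 : ∀ t, HasDerivAt w₂ (w₃ t) t := fun t => by
    refine (((D1 t).const_mul d₁).sub (((D1 t).pow 2).const_mul d₂)).congr_deriv ?_
    simp only [hw₃]
    push_cast
    ring
  have D4 : ∀ t, HasDerivAt w₃ (w₄ t) t := fun t => by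
    refine (((D2 t).const_mul d₁).sub (((D1 t).mul (D2 t)).const_mul (2 * d₂))).congr_deriv ?_
    simp only [hw₄]
  have E1 : ∀ t, HasDerivAt (fun t => w t ^ 2) (2 * (w t * w₁ t)) t := fun t => by
    refine ((D1 t).pow 2).congr_deriv ?_
    push_cast
    ring
  have E2 : ∀ t, HasDerivAt (fun t => 2 * (w t * w₁ t)) (2 * (w₁ t * w₁ t + w t * w₂ t)) t :=
    fun t => ((D1 t).mul (D2 t)).const_mul 2
  -- functions bounded by a multiple of `sech²`
  have hmul : ∀ {f g : ℝ → ℝ} {a b : ℝ}, 0 ≤ a → 0 ≤ b → (∀ x, |f x| ≤ a * sechSq κ x) →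
      (∀ x, |g x| ≤ b * sechSq κ x) → ∀ x, |f x * g x| ≤ a * b * sechSq κ x := by
    intro f g a b ha hb hf hg x
    have h1 : |f x| ≤ a := (hf x).trans (mul_le_of_le_one_right ha (sechSq_le_one _ _))
    rw [abs_mul, mul_assoc]
    exact mul_le_mul h1 (hg x) (abs_nonneg _) ha
  have hlin : ∀ {f g : ℝ → ℝ} {a b : ℝ} (p q : ℝ), (∀ x, |f x| ≤ a * sechSq κ x) →
      (∀ x, |g x| ≤ b * sechSq κ x) → ∀ x, |p * f x - q * g x|
        ≤ (|p| * a + |q| * b) * sechSq κ x := by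
    intro f g a b p q hf hg x
    refine (abs_sub _ _).trans ?_
    rw [abs_mul, abs_mul, add_mul, mul_assoc, mul_assoc]
    exact add_le_add (mul_le_mul_of_nonneg_left (hf x) (abs_nonneg _))
      (mul_le_mul_of_nonneg_left (hg x) (abs_nonneg _))
  have hadd : ∀ {f g : ℝ → ℝ} {a b : ℝ}, (∀ x, |f x| ≤ a * sechSq κ x) →
      (∀ x, |g x| ≤ b * sechSq κ x) → ∀ x, |f x + g x| ≤ (a + b) * sechSq κ x := by
    intro f g a b hf hg x
    rw [add_mul]
    exact (abs_add_le _ _).trans (add_le_add (hf x) (hg x))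
  obtain ⟨c0, hc0, b0⟩ : ∃ c, 0 ≤ c ∧ ∀ x, |w x| ≤ c * sechSq κ x :=
    ⟨_, abs_nonneg _, abs_soliton_le d₁ d₂⟩
  obtain ⟨c1, hc1, b1⟩ : ∃ c, 0 ≤ c ∧ ∀ x, |w₁ x| ≤ c * sechSq κ x :=
    ⟨_, by positivity, abs_solitonDeriv_le d₁ d₂⟩
  have bw2 : ∀ x, |w x ^ 2| ≤ c0 * c0 * sechSq κ x := fun x => by
    rw [pow_two]; exact hmul hc0 hc0 b0 b0 x
  obtain ⟨c2, hc2, b2⟩ : ∃ c, 0 ≤ c ∧ ∀ x, |w₂ x| ≤ c * sechSq κ x :=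
    ⟨_, by positivity, hlin d₁ d₂ b0 bw2⟩
  obtain ⟨e2, he2, be2⟩ : ∃ c, 0 ≤ c ∧ ∀ x, |w₁ x * w₁ x + w x * w₂ x| ≤ c * sechSq κ x :=
    ⟨_, by positivity, hadd (hmul hc1 hc1 b1 b1) (hmul hc0 hc2 b0 b2)⟩
  obtain ⟨c4, hc4, b4⟩ : ∃ c, 0 ≤ c ∧ ∀ x, |w₄ x| ≤ c * sechSq κ x :=
    ⟨_, by positivity, hlin d₁ (2 * d₂) b2 be2⟩
  have be2' : ∀ x, |2 * (w₁ x * w₁ x + w x * w₂ x)| ≤ 2 * e2 * sechSq κ x := fun x => by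
    rw [abs_mul, abs_two, mul_assoc]
    exact mul_le_mul_of_nonneg_left (be2 x) two_pos.le
  set e := Real.exp (2 * |κ| * R) with he
  have he0 : 0 < e := Real.exp_pos _
  have cw : Continuous w := continuous_soliton d₁ d₂
  have cw2 : Continuous w₂ := continuous_iff_continuousAt.2 fun t => (D3 t).continuousAt
  have hs := fun x => (sechSq_pos κ x).le
  refine ⟨c0 * e + (c4 * e + c4 * e + c4 * e * e) + (2 * e2 * e + (c0 * e + c0) * (c2 * e) * e),
    by positivity, fun η hη hηR x => ?_⟩
  have A1 := abs_av_sub_sub_le D1 D2 D3 D4 hc4 b4 hη hηR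
  have A2 := abs_av_sub_le D3 D4 hc4 b4 hη hηR x
  have A3 := abs_av_sub_le D1 D2 hc2 b2 hη hηR
  have A4 := abs_av_sub_le E1 E2 (by positivity) be2' hη hηR x
  have A5 := abs_av_le_sechSq cw.locInt hc0 b0 hηR
  rw [← he] at A2 A4
  have hcav : Continuous (av η w) := continuous_av cw.locInt η
  refine ⟨(A5 x).trans ?_, ?_, ?_⟩
  · refine mul_le_mul_of_nonneg_right ?_ (hs x)
    have : 0 ≤ (c4 * e + c4 * e + c4 * e * e) + (2 * e2 * e + (c0 * e + c0) * (c2 * e) * e) := by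
      positivity
    linarith
  · have A6 := abs_av_le_sechSq (κ := κ) (R := R) (η := η) (C := c4 * e * η ^ 4)
      (f := av η w - w - (η ^ 2 / 24) • w₂)
      ((hcav.locInt.sub cw.locInt).sub (cw2.locInt.const_smul _)) (by positivity)
      (fun y => A1 y) hηR x
    rw [av_sub η (hcav.locInt.sub cw.locInt) (cw2.locInt.const_smul _),
      av_sub η hcav.locInt cw.locInt, av_smul] at A6
    simp only [Pi.sub_apply, Pi.smul_apply, smul_eq_mul] at A6
    have A7 : |η ^ 2 / 24 * (av η w₂ x - w₂ x)| ≤ c4 * e * η ^ 4 * sechSq κ x := by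
      rw [abs_mul, abs_of_nonneg (by positivity)]
      calc η ^ 2 / 24 * |av η w₂ x - w₂ x| ≤ η ^ 2 * (c4 * e * η ^ 2 * sechSq κ x) := by
            refine mul_le_mul ?_ A2 (abs_nonneg _) (by positivity)
            linarith [sq_nonneg η]
        _ = _ := by ring
    have key : av η (av η w) x - w x - η ^ 2 / 12 * (d₁ * w x - d₂ * w x ^ 2)
        = (av η (av η w) x - av η w x - η ^ 2 / 24 * av η w₂ x)
          + (av η w x - w x - η ^ 2 / 24 * w₂ x) + η ^ 2 / 24 * (av η w₂ x - w₂ x) := by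
      simp only [hw₂]; ring
    rw [key]
    refine (abs_add_three _ _ _).trans ((add_le_add (add_le_add A6 (A1 x)) A7).trans ?_)
    have : 0 ≤ (c0 * e + (2 * e2 * e + (c0 * e + c0) * (c2 * e) * e)) * η ^ 4 * sechSq κ x := by
      have := hs x; positivity
    rw [← he]
    linarith
  · have A8 : ∀ y, |av η w y * av η w y - w y ^ 2|
        ≤ (c0 * e + c0) * (c2 * e) * η ^ 2 * sechSq κ y := fun y => by
      rw [show av η w y * av η w y - w y ^ 2 = (av η w y + w y) * (av η w y - w y) by ring, abs_mul]
      have h1 : |av η w y + w y| ≤ c0 * e + c0 := by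
        refine (abs_add_le _ _).trans (add_le_add ?_ ?_)
        · exact (A5 y).trans (mul_le_of_le_one_right (by positivity) (sechSq_le_one _ _))
        · exact (b0 y).trans (mul_le_of_le_one_right hc0 (sechSq_le_one _ _))
      calc _ ≤ (c0 * e + c0) * (c2 * e * η ^ 2 * sechSq κ y) :=
            mul_le_mul h1 (A3 y) (abs_nonneg _) (by positivity)
        _ = _ := by ring
    have L1 : LocInt fun y => av η w y * av η w y := (hcav.mul hcav).locInt
    have L2 : LocInt fun y => w y ^ 2 := (cw.pow 2).locInt
    have A9 := abs_av_le_sechSq (κ := κ) (R := R) (η := η) (C := (c0 * e + c0) * (c2 * e) * η ^ 2)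
      (f := (fun y => av η w y * av η w y) - fun y => w y ^ 2)
      (L1.sub L2) (by positivity) A8 hηR x
    rw [av_sub η L1 L2, Pi.sub_apply] at A9
    have key : av η (fun y => av η w y * av η w y) x - w x ^ 2
        = (av η (fun y => av η w y * av η w y) x - av η (fun y => w y ^ 2) x)
          + (av η (fun y => w y ^ 2) x - w x ^ 2) := by ring
    rw [key]
    refine (abs_add_le _ _).trans ((add_le_add A9 A4).trans ?_)
    have : 0 ≤ (c0 * e + (c4 * e + c4 * e + c4 * e * e)) * η ^ 2 * sechSq κ x := by
      have := hs x; positivity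
    rw [← he]
    linarith

/-! ### The residual of the limit profile -/

namespace LatticeData

lemma IsCubicRemainder.exists_nonneg {ψ : Plane → ℝ} (h : IsCubicRemainder ψ) :
    ∃ γ : ℝ, 0 ≤ γ ∧ ∀ x y : Plane, |ψ x - ψ y|
      ≤ γ * (x 0 ^ 2 + x 1 ^ 2 + y 0 ^ 2 + y 1 ^ 2) * (|x 0 - y 0| + |x 1 - y 1|) := by
  obtain ⟨-, γ, hγ⟩ := h
  refine ⟨|γ|, abs_nonneg _, fun x y => (hγ x y).trans ?_⟩
  gcongr
  exact le_abs_self γ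

lemma IsCubicRemainder.continuous {ψ : Plane → ℝ} (h : IsCubicRemainder ψ) : Continuous ψ := by
  obtain ⟨γ, -, hγ⟩ := h.exists_nonneg
  refine continuous_iff_continuousAt.2 fun y => ?_
  refine tendsto_iff_norm_sub_tendsto_zero.2 ?_
  refine squeeze_zero (fun _ => norm_nonneg _) (fun x => hγ x y) ?_
  have hc : Continuous fun x : Plane =>
      γ * (x 0 ^ 2 + x 1 ^ 2 + y 0 ^ 2 + y 1 ^ 2) * (|x 0 - y 0| + |x 1 - y 1|) := by fun_prop
  simpa using hc.tendsto y

lemma IsCubicRemainder.exists_abs_le {ψ : Plane → ℝ} (h : IsCubicRemainder ψ) :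
    ∃ γ : ℝ, 0 ≤ γ ∧ ∀ x : Plane, |ψ x| ≤ γ * (|x 0| + |x 1|) ^ 3 := by
  obtain ⟨γ, hγ0, hγ⟩ := h.exists_nonneg
  refine ⟨γ, hγ0, fun x => ?_⟩
  have := hγ x 0
  simp only [h.1, sub_zero, PiLp.zero_apply] at this
  refine this.trans ?_
  have h1 := abs_nonneg (x 0)
  have h2 := abs_nonneg (x 1)
  rw [← sq_abs (x 0), ← sq_abs (x 1), pow_succ (|x 0| + |x 1|) 2, ← mul_assoc]
  refine mul_le_mul_of_nonneg_right (mul_le_mul_of_nonneg_left ?_ hγ0) (by positivity)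
  have := mul_nonneg h1 h2
  linarith [add_sq (|x 0|) (|x 1|)]

variable {M : ℕ} (G : LatticeData M)

lemma comp_W₀_zero : comp G.W₀ 0 = G.Wstar := rfl

lemma comp_W₀_one : comp G.W₀ 1 = G.lam • G.Wstar := rfl

lemma continuous_Wstar : Continuous G.Wstar := continuous_soliton _ _

lemma quadTerm_smul_right (ε : ℝ) (m : Fin M) (f g : ℝ → ℝ) (c : ℝ) :
    G.quadTerm ε m f (c • g) = c • G.quadTerm ε m f g := by
  have h : (fun x => avg (G.k m * ε) f x * avg (G.k m * ε) (c • g) x)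
      = c • fun x => avg (G.k m * ε) f x * avg (G.k m * ε) g x := by
    ext x
    simp only [avg_eq_av, av_smul, Pi.smul_apply, smul_eq_mul]
    ring
  rw [quadTerm, h, avg_eq_av, av_smul]
  rfl

lemma quadTerm_comm (ε : ℝ) (m : Fin M) (f g : ℝ → ℝ) :
    G.quadTerm ε m f g = G.quadTerm ε m g f := by
  simp only [quadTerm, mul_comm]

lemma quadTerm_smul_left (ε : ℝ) (m : Fin M) (f g : ℝ → ℝ) (c : ℝ) :
    G.quadTerm ε m (c • f) g = c • G.quadTerm ε m f g := by
  rw [quadTerm_comm, quadTerm_smul_right, quadTerm_comm]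

lemma continuous_quadTerm (ε : ℝ) (m : Fin M) {f g : ℝ → ℝ} (hf : LocInt f) (hg : LocInt g) :
    Continuous (G.quadTerm ε m f g) :=
  continuous_av ((continuous_av hf _).mul (continuous_av hg _)).locInt _

/-- The decay rate of the soliton. -/
def rate : ℝ := 1 / 2 * √G.d₁

/-- Sums of double averages of the soliton and sums of averages of its square. -/
lemma exists_sum_average_bounds (hg : G.Generic) :
    ∃ C₀ : ℝ, 0 ≤ C₀ ∧ (∀ x, |G.Wstar x| ≤ C₀ * sechSq G.rate x) ∧
      (∀ ε : ℝ, 0 < ε → ε ≤ 1 → ∀ m x, G.k m ≠ 0 →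
        |avg (G.k m * ε) G.Wstar x| ≤ C₀ * sechSq G.rate x) ∧
      (∀ α : Fin M → ℝ, ∃ E : ℝ, 0 ≤ E ∧ ∀ ε : ℝ, 0 < ε → ε ≤ 1 → ∀ x,
        |(∑ m, G.k m ^ 2 * α m * avg (G.k m * ε) (avg (G.k m * ε) G.Wstar) x)
          - ((∑ m, G.k m ^ 2 * α m) * G.Wstar x + ε ^ 2 * ((∑ m, G.k m ^ 4 / 12 * α m)
            * (G.d₁ * G.Wstar x - G.d₂ * G.Wstar x ^ 2)))| ≤ ε ^ 4 * E * sechSq G.rate x) ∧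
      (∀ β : Fin M → ℝ, ∃ E : ℝ, 0 ≤ E ∧ ∀ ε : ℝ, 0 < ε → ε ≤ 1 → ∀ x,
        |(∑ m, G.k m ^ 3 * β m * G.quadTerm ε m G.Wstar G.Wstar x)
          - (∑ m, G.k m ^ 3 * β m) * G.Wstar x ^ 2| ≤ ε ^ 2 * E * sechSq G.rate x) := by
  obtain ⟨-, hd₁, hd₂⟩ := hg
  obtain ⟨C, hC, H⟩ := exists_soliton_average_bounds hd₁ hd₂ (∑ m, |G.k m|)
  have hR : ∀ m ε, 0 < ε → ε ≤ 1 → |G.k m * ε| ≤ ∑ m, |G.k m| := fun m ε hε hε1 => by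
    rw [abs_mul, abs_of_pos hε]
    exact (mul_le_of_le_one_right (abs_nonneg _) hε1).trans
      (Finset.single_le_sum (f := fun m => |G.k m|) (fun _ _ => abs_nonneg _) (Finset.mem_univ m))
  refine ⟨|3 * G.d₁ / (2 * G.d₂)| + C, by positivity, fun x => ?_, fun ε hε hε1 m x hk => ?_,
    fun α => ⟨∑ m, |G.k m ^ 2 * α m| * (C * G.k m ^ 4),
      Finset.sum_nonneg fun m _ => by positivity, fun ε hε hε1 x => ?_⟩,
    fun β => ⟨∑ m, |G.k m ^ 3 * β m| * (C * G.k m ^ 2),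
      Finset.sum_nonneg fun m _ => by positivity, fun ε hε hε1 x => ?_⟩⟩
  · refine (abs_soliton_le G.d₁ G.d₂ x).trans ?_
    exact mul_le_mul_of_nonneg_right (by linarith) (sechSq_pos _ _).le
  · refine (H _ (mul_ne_zero hk hε.ne') (hR m ε hε hε1) x).1.trans ?_
    exact mul_le_mul_of_nonneg_right (by linarith [abs_nonneg (3 * G.d₁ / (2 * G.d₂))])
      (sechSq_pos _ _).le
  · rw [Finset.sum_mul, Finset.sum_mul, Finset.mul_sum, ← Finset.sum_add_distrib,
      ← Finset.sum_sub_distrib, Finset.mul_sum, Finset.sum_mul]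
    refine (Finset.abs_sum_le_sum_abs _ _).trans (Finset.sum_le_sum fun m _ => ?_)
    rcases eq_or_ne (G.k m) 0 with hk | hk
    · simp [hk]
    have h := (H _ (mul_ne_zero hk hε.ne') (hR m ε hε hε1) x).2.1
    calc _ = |G.k m ^ 2 * α m| * |avg (G.k m * ε) (avg (G.k m * ε) G.Wstar) x - G.Wstar x
          - (G.k m * ε) ^ 2 / 12 * (G.d₁ * G.Wstar x - G.d₂ * G.Wstar x ^ 2)| := by
          rw [← abs_mul]; congr 1; ring
      _ ≤ |G.k m ^ 2 * α m| * (C * (G.k m * ε) ^ 4 * sechSq G.rate x) :=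
          mul_le_mul_of_nonneg_left h (abs_nonneg _)
      _ = _ := by ring
  · rw [Finset.sum_mul, ← Finset.sum_sub_distrib, Finset.mul_sum, Finset.sum_mul]
    refine (Finset.abs_sum_le_sum_abs _ _).trans (Finset.sum_le_sum fun m _ => ?_)
    rcases eq_or_ne (G.k m) 0 with hk | hk
    · simp [hk]
    have h := (H _ (mul_ne_zero hk hε.ne') (hR m ε hε hε1) x).2.2
    calc _ = |G.k m ^ 3 * β m| * |G.quadTerm ε m G.Wstar G.Wstar x - G.Wstar x ^ 2| := by
          rw [← abs_mul]; congr 1; ring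
      _ ≤ |G.k m ^ 3 * β m| * (C * (G.k m * ε) ^ 2 * sechSq G.rate x) :=
          mul_le_mul_of_nonneg_left h (abs_nonneg _)
      _ = _ := by ring

/-- The components of `B_ε^can W₀` in terms of double averages of the soliton. -/
lemma Bcan_W₀ (ε x : ℝ) :
    G.Bcan ε G.W₀ x 0 = (1 / ε ^ 2) * ((G.σ₀ + ε ^ 2) * G.Wstar x
        - (∑ m, G.k m ^ 2 * G.α₁₁ m * avg (G.k m * ε) (avg (G.k m * ε) G.Wstar) x)
        - G.lam * ∑ m, G.k m ^ 2 * G.α₁₂ m * avg (G.k m * ε) (avg (G.k m * ε) G.Wstar) x) ∧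
    G.Bcan ε G.W₀ x 1 = (1 / ε ^ 2) * ((G.σ₀ + ε ^ 2) * (G.lam * G.Wstar x)
        - (∑ m, G.k m ^ 2 * G.α₂₁ m * avg (G.k m * ε) (avg (G.k m * ε) G.Wstar) x)
        - G.lam * ∑ m, G.k m ^ 2 * G.α₂₂ m * avg (G.k m * ε) (avg (G.k m * ε) G.Wstar) x) := by
  have h : ∀ η, avg η (avg η (G.lam • G.Wstar)) = G.lam • avg η (avg η G.Wstar) := fun η => by
    simp only [avg_eq_av, av_smul]
  have h2 : ∀ α : Fin M → ℝ, ∑ m, G.k m ^ 2 * α m *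
      avg (G.k m * ε) (avg (G.k m * ε) (G.lam • G.Wstar)) x
      = G.lam * ∑ m, G.k m ^ 2 * α m * avg (G.k m * ε) (avg (G.k m * ε) G.Wstar) x := fun α => by
    rw [Finset.mul_sum]
    refine Finset.sum_congr rfl fun m _ => ?_
    rw [h, Pi.smul_apply, smul_eq_mul]
    ring
  rw [← h2, ← h2]
  exact ⟨rfl, rfl⟩

/-- The components of `Q_ε[W₀]`. -/
lemma Qop_W₀ (ε x : ℝ) :
    G.Qop ε G.W₀ x 0 = (1 / 2) * ∑ m, G.k m ^ 3 * ((G.β₁₁₁ m + G.lam * G.β₂₁₁ m)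
        + 2 * G.lam * (G.β₁₁₂ m + G.lam * G.β₂₁₂ m)
        + G.lam ^ 2 * (G.β₁₂₂ m + G.lam * G.β₂₂₂ m)) * G.quadTerm ε m G.Wstar G.Wstar x ∧
    G.Qop ε G.W₀ x 1 = (ε ^ 2 / 2) * ∑ m, G.k m ^ 3 * (G.β₂₁₁ m + 2 * G.lam * G.β₂₁₂ m
        + G.lam ^ 2 * G.β₂₂₂ m) * G.quadTerm ε m G.Wstar G.Wstar x := by
  simp only [Qop, comp_W₀_zero, comp_W₀_one, quadTerm_smul_right, quadTerm_smul_left, Pi.smul_apply,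
    smul_eq_mul, PiLp.toLp_apply, Matrix.cons_val_zero, Matrix.cons_val_one]
  constructor
  · congr 1
    exact Finset.sum_congr rfl fun m _ => by ring
  · congr 1
    exact Finset.sum_congr rfl fun m _ => by ring

/-- The residual of `W₀` is bounded uniformly in `ε`. In the expansion of `B_ε W₀ - Q_ε[W₀]` the terms
of lowest order cancel as `(1, λ)` spans the kernel of the matrix `σ₀ - [[c₁, c₂], [c₂, c₃]]`, and in
the first component those of order one cancel by the KdV equation. -/
lemma exists_Rop_bound (hs : G.SymmetricCoefficients) (hg : G.Generic) :
    ∃ C : ℝ, 0 ≤ C ∧ ∀ ε : ℝ, 0 < ε → ε ≤ 1 → ∀ x,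
      |G.Rop ε x 0| ≤ C * sechSq G.rate x ∧ |G.Rop ε x 1| ≤ C * sechSq G.rate x := by
  obtain ⟨C₀, hC₀, hw, -, HA, HQ⟩ := G.exists_sum_average_bounds hg
  obtain ⟨⟨-, hc₂⟩, hd₁, hd₂⟩ := hg
  have hl := G.lam_mul hc₂
  have hp := G.σ₀_sub_c₁ hc₂
  obtain ⟨E11, hE11, A11⟩ := HA G.α₁₁
  obtain ⟨E12, hE12, A12⟩ := HA G.α₁₂
  obtain ⟨E21, hE21, A21⟩ := HA G.α₂₁
  obtain ⟨E22, hE22, A22⟩ := HA G.α₂₂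
  obtain ⟨F1, hF1, Q1⟩ := HQ fun m => (G.β₁₁₁ m + G.lam * G.β₂₁₁ m)
        + 2 * G.lam * (G.β₁₁₂ m + G.lam * G.β₂₁₂ m) + G.lam ^ 2 * (G.β₁₂₂ m + G.lam * G.β₂₂₂ m)
  obtain ⟨F2, hF2, Q2⟩ := HQ fun m => G.β₂₁₁ m + 2 * G.lam * G.β₂₁₂ m + G.lam ^ 2 * G.β₂₂₂ m
  set K2 : ℝ := ∑ m, G.k m ^ 3 * (G.β₂₁₁ m + 2 * G.lam * G.β₂₁₂ m + G.lam ^ 2 * G.β₂₂₂ m) with hK2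
  have hα21 : G.α₂₁ = G.α₁₂ := funext fun m => (hs m).1.symm
  have hd : G.d₁ * G.den = 1 + G.lam ^ 2 := G.d₁_mul_den hd₁
  have hden : G.den * G.d₂ = (G.a₃ + G.lam ^ 2 * G.a₄ + G.lam * G.a₅)
      + G.lam * (G.lam * G.b₅ + G.lam ^ 2 * G.b₃ + G.b₄) :=
    mul_div_cancel₀ _ (G.den_pos hd₁).ne'
  have hK1 : ∑ m, G.k m ^ 3 * ((G.β₁₁₁ m + G.lam * G.β₂₁₁ m)
        + 2 * G.lam * (G.β₁₁₂ m + G.lam * G.β₂₁₂ m)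
        + G.lam ^ 2 * (G.β₁₂₂ m + G.lam * G.β₂₂₂ m)) = 2 * (G.den * G.d₂) := by
    rw [hden]
    simp only [a₃, a₄, a₅, b₅, b₃, b₄, Finset.mul_sum, ← Finset.sum_add_distrib]
    exact Finset.sum_congr rfl fun m _ => by ring
  rw [hK1] at Q1
  have hc1 : ∑ m, G.k m ^ 2 * G.α₁₁ m = G.c₁ := rfl
  have hc2 : ∑ m, G.k m ^ 2 * G.α₁₂ m = G.c₂ := rfl
  have hc2' : ∑ m, G.k m ^ 2 * G.α₂₁ m = G.c₂ := by rw [hα21]; rfl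
  have hc3 : ∑ m, G.k m ^ 2 * G.α₂₂ m = G.c₃ := rfl
  have ha1 : ∑ m, G.k m ^ 4 / 12 * G.α₁₁ m = G.a₁ := rfl
  have ha2 : ∑ m, G.k m ^ 4 / 12 * G.α₁₂ m = G.a₂ := rfl
  have hb1 : ∑ m, G.k m ^ 4 / 12 * G.α₂₂ m = G.b₁ := rfl
  have hb2 : ∑ m, G.k m ^ 4 / 12 * G.α₂₁ m = G.b₂ := rfl
  rw [hc1, ha1] at A11
  rw [hc2, ha2] at A12
  rw [hc2', hb2] at A21
  rw [hc3, hb1] at A22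
  set l := |G.lam| with hl'
  have hl0 : 0 ≤ l := abs_nonneg _
  -- bounds for the soliton, its square and its second derivative
  set D : ℝ := |G.d₁| * C₀ + |G.d₂| * (C₀ * C₀) with hD
  set X : ℝ := F1 + (E11 + l * E12 + l * (E21 + l * E22)) with hX
  set Y : ℝ := (F2 + |K2| * (C₀ * C₀)) + (l * C₀ + (|G.b₂| + l * |G.b₁|) * D + (E21 + l * E22))
    with hY
  refine ⟨X + Y, by positivity, ?_⟩
  intro ε hε hε1 x
  have hε2 : 0 < ε ^ 2 := by positivity
  have hε2' : ε ^ 2 ≤ 1 := pow_le_one₀ hε.le hε1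
  have hs0 := (sechSq_pos G.rate x).le
  have hs1 := sechSq_le_one G.rate x
  set s := sechSq G.rate x with hsdef
  set w := G.Wstar x with hwdef
  have bw : |w| ≤ C₀ * s := hw x
  have bw2 : |w ^ 2| ≤ C₀ * C₀ * s := by
    rw [pow_two, abs_mul, mul_assoc]
    exact mul_le_mul (bw.trans (mul_le_of_le_one_right hC₀ hs1)) bw (abs_nonneg _) hC₀
  set w₂ := G.d₁ * w - G.d₂ * w ^ 2 with hw₂
  have bw₂ : |w₂| ≤ D * s := by
    refine (abs_sub _ _).trans ?_
    rw [abs_mul, abs_mul, hD, add_mul, mul_assoc, mul_assoc]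
    exact add_le_add (mul_le_mul_of_nonneg_left bw (abs_nonneg _))
      (mul_le_mul_of_nonneg_left bw2 (abs_nonneg _))
  have a11 := A11 ε hε hε1 x
  have a12 := A12 ε hε hε1 x
  have a21 := A21 ε hε hε1 x
  have a22 := A22 ε hε hε1 x
  have q1 := Q1 ε hε hε1 x
  have q2 := Q2 ε hε hε1 x
  rw [← hwdef, ← hw₂] at a11 a12 a21 a22
  rw [← hwdef] at q1 q2
  obtain ⟨B1, B2⟩ := G.Bcan_W₀ ε x
  obtain ⟨R1, R2⟩ := G.Qop_W₀ ε x
  rw [← hwdef] at B1 B2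
  set S11 := ∑ m, G.k m ^ 2 * G.α₁₁ m * avg (G.k m * ε) (avg (G.k m * ε) G.Wstar) x
  set S12 := ∑ m, G.k m ^ 2 * G.α₁₂ m * avg (G.k m * ε) (avg (G.k m * ε) G.Wstar) x
  set S21 := ∑ m, G.k m ^ 2 * G.α₂₁ m * avg (G.k m * ε) (avg (G.k m * ε) G.Wstar) x
  set S22 := ∑ m, G.k m ^ 2 * G.α₂₂ m * avg (G.k m * ε) (avg (G.k m * ε) G.Wstar) x
  set e11 := S11 - (G.c₁ * w + ε ^ 2 * (G.a₁ * w₂)) with he11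
  set e12 := S12 - (G.c₂ * w + ε ^ 2 * (G.a₂ * w₂)) with he12
  set e21 := S21 - (G.c₂ * w + ε ^ 2 * (G.b₂ * w₂)) with he21
  set e22 := S22 - (G.c₃ * w + ε ^ 2 * (G.b₁ * w₂)) with he22
  have lin1 : |e11 + G.lam * e12| ≤ ε ^ 4 * (E11 + l * E12) * s := by
    refine (abs_add_le _ _).trans ?_
    rw [abs_mul]
    have := mul_le_mul_of_nonneg_left a12 hl0
    linarith
  have lin2 : |e21 + G.lam * e22| ≤ ε ^ 4 * (E21 + l * E22) * s := by
    refine (abs_add_le _ _).trans ?_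
    rw [abs_mul]
    have := mul_le_mul_of_nonneg_left a22 hl0
    linarith
  have B1' : G.Bcan ε G.W₀ x 0 = w - (G.a₁ + G.lam * G.a₂) * w₂
      - (1 / ε ^ 2) * (e11 + G.lam * e12) := by
    rw [B1, he11, he12]
    field_simp
    linear_combination w * hp + G.lam * w * hl
  have B2' : G.Bcan ε G.W₀ x 1 = G.lam * w - (G.b₂ + G.lam * G.b₁) * w₂
      - (1 / ε ^ 2) * (e21 + G.lam * e22) := by
    rw [B2, he21, he22]
    field_simp
    linear_combination w * hl
  have x1 : G.Rop ε x 0 = (1 / ε ^ 2) * (G.Qop ε G.W₀ x 0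
      - (G.Bcan ε G.W₀ x 0 + G.lam * G.Bcan ε G.W₀ x 1)) := rfl
  have x2 : G.Rop ε x 1 = (1 / ε ^ 2) * (G.Qop ε G.W₀ x 1 - ε ^ 2 * G.Bcan ε G.W₀ x 1) := rfl
  have hXY : X * s ≤ (X + Y) * s ∧ Y * s ≤ (X + Y) * s := by
    have hX0 : 0 ≤ X := by positivity
    have hY0 : 0 ≤ Y := by positivity
    exact ⟨mul_le_mul_of_nonneg_right (by linarith) hs0,
      mul_le_mul_of_nonneg_right (by linarith) hs0⟩
  set q1' := ∑ m, G.k m ^ 3 * ((G.β₁₁₁ m + G.lam * G.β₂₁₁ m)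
        + 2 * G.lam * (G.β₁₁₂ m + G.lam * G.β₂₁₂ m)
        + G.lam ^ 2 * (G.β₁₂₂ m + G.lam * G.β₂₂₂ m)) * G.quadTerm ε m G.Wstar G.Wstar x
  set q2' := ∑ m, G.k m ^ 3 * (G.β₂₁₁ m + 2 * G.lam * G.β₂₁₂ m
        + G.lam ^ 2 * G.β₂₂₂ m) * G.quadTerm ε m G.Wstar G.Wstar x
  constructor
  · refine le_trans ?_ hXY.1
    have key : G.Rop ε x 0 = (1 / ε ^ 2) * ((1 / 2) * (q1' - 2 * (G.den * G.d₂) * w ^ 2)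
        + (1 / ε ^ 2) * ((e11 + G.lam * e12) + G.lam * (e21 + G.lam * e22))) := by
      rw [x1, R1, B1', B2']
      congr 1
      have hden' : G.den = (G.a₁ + G.lam * G.a₂) + G.lam * (G.b₂ + G.lam * G.b₁) := rfl
      have : (1 + G.lam ^ 2) * w - G.den * w₂ = G.den * G.d₂ * w ^ 2 := by
        rw [hw₂, ← hd]; ring
      rw [hden'] at this ⊢
      linear_combination -this
    rw [key, abs_mul, abs_of_pos (by positivity : (0 : ℝ) < 1 / ε ^ 2)]
    have h3 : |(1 / 2) * (q1' - 2 * (G.den * G.d₂) * w ^ 2)| ≤ ε ^ 2 * F1 * s := by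
      rw [abs_mul, abs_of_pos (by norm_num : (0 : ℝ) < 1 / 2)]
      linarith [abs_nonneg (q1' - 2 * (G.den * G.d₂) * w ^ 2)]
    have h4 : |(1 / ε ^ 2) * ((e11 + G.lam * e12) + G.lam * (e21 + G.lam * e22))|
        ≤ ε ^ 2 * (E11 + l * E12 + l * (E21 + l * E22)) * s := by
      rw [abs_mul, abs_of_pos (by positivity : (0 : ℝ) < 1 / ε ^ 2), one_div, inv_mul_le_iff₀ hε2]
      refine (abs_add_le _ _).trans ?_
      rw [abs_mul]
      have := mul_le_mul_of_nonneg_left lin2 hl0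
      linarith
    have hfin : ∀ Z T : ℝ, Z ≤ ε ^ 2 * T → 1 / ε ^ 2 * Z ≤ T := fun Z T h => by
      rw [one_div, inv_mul_le_iff₀ hε2]; exact h
    refine hfin _ _ ((abs_add_le _ _).trans ?_)
    rw [hX]
    linarith only [h3, h4]
  · refine le_trans ?_ hXY.2
    have key : G.Rop ε x 1 = (1 / 2) * ((q2' - K2 * w ^ 2) + K2 * w ^ 2)
        - (G.lam * w - (G.b₂ + G.lam * G.b₁) * w₂ - (1 / ε ^ 2) * (e21 + G.lam * e22)) := by
      rw [x2, R2, B2']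
      field_simp
      ring
    have h3 : |(1 / 2) * ((q2' - K2 * w ^ 2) + K2 * w ^ 2)| ≤ (F2 + |K2| * (C₀ * C₀)) * s := by
      rw [abs_mul, abs_of_pos (by norm_num : (0 : ℝ) < 1 / 2)]
      have h5 : |K2 * w ^ 2| ≤ |K2| * (C₀ * C₀ * s) := by
        rw [abs_mul]
        exact mul_le_mul_of_nonneg_left bw2 (abs_nonneg _)
      have h6 : ε ^ 2 * F2 * s ≤ F2 * s := by
        rw [mul_assoc]
        exact mul_le_of_le_one_left (by positivity) hε2'
      have h7 := abs_add_le (q2' - K2 * w ^ 2) (K2 * w ^ 2)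
      have h8 := abs_nonneg ((q2' - K2 * w ^ 2) + K2 * w ^ 2)
      linarith
    have h4 : |(1 / ε ^ 2) * (e21 + G.lam * e22)| ≤ (E21 + l * E22) * s := by
      rw [abs_mul, abs_of_pos (by positivity : (0 : ℝ) < 1 / ε ^ 2), one_div, inv_mul_le_iff₀ hε2]
      refine lin2.trans ?_
      rw [← mul_assoc]
      refine mul_le_mul_of_nonneg_right (mul_le_mul_of_nonneg_right ?_ (by positivity)) hs0
      calc ε ^ 4 = ε ^ 2 * ε ^ 2 := by ring
        _ ≤ ε ^ 2 := mul_le_of_le_one_right hε2.le hε2'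
    have h5 : |(G.b₂ + G.lam * G.b₁) * w₂| ≤ (|G.b₂| + l * |G.b₁|) * (D * s) := by
      rw [abs_mul]
      refine mul_le_mul ((abs_add_le _ _).trans_eq ?_) bw₂ (abs_nonneg _) (by positivity)
      rw [abs_mul]
    have h6 : |G.lam * w| ≤ l * (C₀ * s) := by
      rw [abs_mul]
      exact mul_le_mul_of_nonneg_left bw hl0
    rw [key]
    refine (abs_sub _ _).trans ?_
    have h7 := (abs_sub (G.lam * w - (G.b₂ + G.lam * G.b₁) * w₂) ((1 / ε ^ 2) * (e21 + G.lam * e22)))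
    have h8 := abs_sub (G.lam * w) ((G.b₂ + G.lam * G.b₁) * w₂)
    rw [hY]
    linarith only [h3, h4, h5, h6, h7, h8]

end LatticeData

/-! ### Estimates for the nonlinear operators -/

lemma L2Le.integral_sq_le {f : ℝ → ℝ} {C : ℝ} (hf : L2Le f C) : ∫ x, f x ^ 2 ≤ C ^ 2 := by
  have h1 := norm_sq_eq_integral (ofRealL2 hf.memLp)
  have h2 : ∫ x, ‖ofRealL2 hf.memLp x‖ ^ 2 = ∫ x, f x ^ 2 := by
    refine integral_congr_ae ?_
    filter_upwards [ofRealL2_coeFn hf.memLp] with x hx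
    rw [hx]; simp
  rw [← h2, ← h1]
  exact pow_le_pow_left₀ (norm_nonneg _) hf.norm_ofRealL2 2

/-- Averages of square integrable functions are bounded; this follows from
`|f| ≤ (C + f² / C) / 2`. -/
lemma L2Le.abs_avg_le {f : ℝ → ℝ} {C : ℝ} (hf : L2Le f C) {η : ℝ} (hη : η ≠ 0) (x : ℝ) :
    |avg η f x| ≤ (1 + 1 / |η|) * C := by
  have hη' : 0 < |η| := abs_pos.2 hη
  rcases hf.nonneg.eq_or_lt with rfl | hC
  · have h0 : eLpNorm f 2 volume = 0 := by simpa using hf.le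
    have h1 : f =ᵐ[volume] fun _ => 0 := (eLpNorm_eq_zero_iff hf.memLp.1 (by norm_num)).1 h0
    rw [avg_eq_av, av_congr_ae h1, av_const hη]
    simp
  have hsq : Integrable fun x => f x ^ 2 := hf.memLp.integrable_sq
  have hl : LocInt fun y => f y ^ 2 := fun a b => hsq.intervalIntegrable
  have hl2 : LocInt fun y => C / 2 + (1 / (2 * C)) * f y ^ 2 := fun a b =>
    intervalIntegrable_const.add ((hl a b).const_mul _)
  have h1 : av η (fun y => ‖f y‖) x ≤ av η (fun y => C / 2 + (1 / (2 * C)) * f y ^ 2) x := by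
    refine av_mono η hf.memLp.locInt.norm hl2 x fun y _ => ?_
    rw [Real.norm_eq_abs, ← sq_abs (f y)]
    have : 0 ≤ (C - |f y|) ^ 2 / (2 * C) := by positivity
    have e : C / 2 + 1 / (2 * C) * |f y| ^ 2 = |f y| + (C - |f y|) ^ 2 / (2 * C) := by
      field_simp; ring
    rw [e]; linarith
  have h2 : av η (fun y => C / 2 + (1 / (2 * C)) * f y ^ 2) x
      = C / 2 + (1 / (2 * C)) * av η (fun y => f y ^ 2) x := by
    have := congrFun (av_add η (f := fun _ => C / 2) (g := (1 / (2 * C)) • fun y => f y ^ 2)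
      continuous_const.locInt (hl.const_smul _)) x
    rw [av_smul, Pi.add_apply, av_const hη, Pi.smul_apply, smul_eq_mul] at this
    exact this
  have h3 : av η (fun y => f y ^ 2) x ≤ 1 / |η| * C ^ 2 := by
    rw [← av_abs]
    simp only [av, smul_eq_mul, one_div]
    refine mul_le_mul_of_nonneg_left ?_ (by positivity)
    rw [intervalIntegral.integral_of_le (by linarith)]
    exact (setIntegral_le_integral hsq (ae_of_all _ fun y => sq_nonneg _)).trans hf.integral_sq_le
  rw [avg_eq_av]
  refine (norm_av_le η f x).trans (h1.trans ?_)
  rw [h2]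
  have h4 : 1 / (2 * C) * av η (fun y => f y ^ 2) x ≤ 1 / (2 * C) * (1 / |η| * C ^ 2) :=
    mul_le_mul_of_nonneg_left h3 (by positivity)
  have h5 : 1 / (2 * C) * (1 / |η| * C ^ 2) = (1 / |η| * C) / 2 := by field_simp
  have h6 : 0 < 1 / |η| * C := by positivity
  linarith

lemma L2Le.avg {f : ℝ → ℝ} {C : ℝ} (hf : L2Le f C) {η : ℝ} (hη : η ≠ 0) : L2Le (avg η f) C := by
  have h := (Represents.ofReal hf.memLp).av hη
  refine (L2Le.of_norm_le (u := avOp η (ofRealL2 hf.memLp)) h.memLp.1 ?_).mono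
    ((norm_avOp_apply_le _ _).trans hf.norm_ofRealL2)
  filter_upwards [h] with x hx
  rw [hx]
  exact Complex.abs_re_le_norm _

lemma continuous_plane {f : ℝ → Plane} (h0 : Continuous (comp f 0)) (h1 : Continuous (comp f 1)) :
    Continuous f := by
  have e : f = fun x => comp f 0 x • (!₂[1, 0] : Plane) + comp f 1 x • (!₂[0, 1] : Plane) := by
    ext x i
    fin_cases i <;> simp [comp]
  rw [e]
  exact (h0.smul continuous_const).add (h1.smul continuous_const)

namespace LatticeData

variable {M : ℕ} (G : LatticeData M)

lemma one_add_one_div_le {k ε : ℝ} (hk : k ≠ 0) (hε : 0 < ε) (hε1 : ε ≤ 1) :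
    1 + 1 / |k * ε| ≤ (1 + 1 / |k|) / ε := by
  have hk' : 0 < |k| := abs_pos.2 hk
  rw [abs_mul, abs_of_pos hε, le_div_iff₀ hε]
  have : (1 + 1 / (|k| * ε)) * ε = ε + 1 / |k| := by field_simp
  rw [this]
  linarith

/-- The quadratic terms are locally Lipschitz continuous, with a constant of order `1 / ε`. -/
lemma l2Le_quadTerm_sub {ε : ℝ} (hε : 0 < ε) (hε1 : ε ≤ 1) {m : Fin M} (hk : G.k m ≠ 0)
    {f f' g g' : ℝ → ℝ} {D δ : ℝ} (hf' : L2Le f' D) (hg : L2Le g D)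
    (hf : MemLp f 2 volume) (hg' : MemLp g' 2 volume)
    (hff : L2Le (f - f') δ) (hgg : L2Le (g - g') δ) :
    L2Le (G.quadTerm ε m f g - G.quadTerm ε m f' g')
      (2 * ((1 + 1 / |G.k m|) / ε * D) * δ) := by
  have hη : G.k m * ε ≠ 0 := mul_ne_zero hk hε.ne'
  set η := G.k m * ε with hηdef
  have hc := one_add_one_div_le hk hε hε1
  set c := (1 + 1 / |G.k m|) / ε with hcdef
  have cf := continuous_av hf.locInt η
  have cf' := continuous_av hf'.memLp.locInt η
  have cg := continuous_av hg.memLp.locInt η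
  have cg' := continuous_av hg'.locInt η
  have h1 : L2Le ((fun x => avg η f x * avg η g x) - fun x => avg η f' x * avg η g' x)
      (2 * (c * D) * δ) := by
    have e1 : ∀ x, avg η f x - avg η f' x = avg η (f - f') x := fun x => by
      simp only [avg_eq_av]
      rw [av_sub η hf.locInt hf'.memLp.locInt]; rfl
    have e2 : ∀ x, avg η g x - avg η g' x = avg η (g - g') x := fun x => by
      simp only [avg_eq_av]
      rw [av_sub η hg.memLp.locInt hg'.locInt]; rfl
    have i1 : L2Le (fun x => avg η g x * avg η (f - f') x) (c * D * δ) := by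
      refine (hff.avg hη).of_abs_le ?_ (mul_nonneg (by positivity) hg.nonneg) (ae_of_all _ fun x => ?_)
      · exact cg.aestronglyMeasurable.mul
          (continuous_av hff.memLp.locInt η).aestronglyMeasurable
      · rw [abs_mul]
        refine mul_le_mul_of_nonneg_right ((hg.abs_avg_le hη x).trans ?_) (abs_nonneg _)
        exact mul_le_mul_of_nonneg_right hc hg.nonneg
    have i2 : L2Le (fun x => avg η f' x * avg η (g - g') x) (c * D * δ) := by
      refine (hgg.avg hη).of_abs_le ?_ (mul_nonneg (by positivity) hf'.nonneg)
        (ae_of_all _ fun x => ?_)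
      · exact cf'.aestronglyMeasurable.mul
          (continuous_av hgg.memLp.locInt η).aestronglyMeasurable
      · rw [abs_mul]
        refine mul_le_mul_of_nonneg_right ((hf'.abs_avg_le hη x).trans ?_) (abs_nonneg _)
        exact mul_le_mul_of_nonneg_right hc hf'.nonneg
    refine ((i1.add i2).mono (le_of_eq (by ring))).congr (ae_of_all _ fun x => ?_)
    simp only [Pi.add_apply, Pi.sub_apply, ← e1, ← e2]
    ring
  have h2 := h1.avg hη
  have e : avg η ((fun x => avg η f x * avg η g x) - fun x => avg η f' x * avg η g' x)
      = G.quadTerm ε m f g - G.quadTerm ε m f' g' :=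
    av_sub η (cf.mul cg).locInt (cf'.mul cg').locInt
  rwa [e] at h2

/-- `Q_ε` is locally Lipschitz continuous on `L²`, with a constant of order `1 / ε`. -/
lemma exists_Qop_lipschitz : ∃ K : ℝ, 0 ≤ K ∧ ∀ (ε : ℝ), 0 < ε → ε ≤ 1 →
    ∀ (v v' : ℝ → Plane) (D δ : ℝ), (∀ i, L2Le (comp v i) D) → (∀ i, L2Le (comp v' i) D) →
      (∀ i, L2Le (comp v i - comp v' i) δ) →
      ∀ i, L2Le (comp (G.Qop ε v) i - comp (G.Qop ε v') i) (K / ε * D * δ) := by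
  -- a general quadratic expression with coefficients `b`
  have key : ∀ b₀ b₁ b₂ : Fin M → ℝ, ∃ K : ℝ, 0 ≤ K ∧ ∀ (ε : ℝ), 0 < ε → ε ≤ 1 →
      ∀ (v v' : ℝ → Plane) (D δ : ℝ), (∀ i, L2Le (comp v i) D) → (∀ i, L2Le (comp v' i) D) →
      (∀ i, L2Le (comp v i - comp v' i) δ) →
      L2Le (fun ξ => ∑ m, G.k m ^ 3 *
        (b₀ m * (G.quadTerm ε m (comp v 0) (comp v 0) - G.quadTerm ε m (comp v' 0) (comp v' 0)) ξ
        + b₁ m * (G.quadTerm ε m (comp v 0) (comp v 1) - G.quadTerm ε m (comp v' 0) (comp v' 1)) ξ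
        + b₂ m * (G.quadTerm ε m (comp v 1) (comp v 1)
          - G.quadTerm ε m (comp v' 1) (comp v' 1)) ξ)) (K / ε * D * δ) := by
    intro b₀ b₁ b₂
    refine ⟨∑ m, |G.k m ^ 3| * ((|b₀ m| + |b₁ m| + |b₂ m|) * (2 * (1 + 1 / |G.k m|))),
      Finset.sum_nonneg fun m _ => by positivity, ?_⟩
    intro ε hε hε1 v v' D δ hv hv' hd
    rw [Finset.sum_div, Finset.sum_mul, Finset.sum_mul]
    refine L2Le.sum fun m _ => ?_
    rcases eq_or_ne (G.k m) 0 with hk | hk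
    · have h0 : L2Le (fun _ : ℝ => (0 : ℝ)) 0 := L2Le.zero
      simpa [hk] using h0
    have h : ∀ i j, L2Le (G.quadTerm ε m (comp v i) (comp v j)
        - G.quadTerm ε m (comp v' i) (comp v' j)) (2 * ((1 + 1 / |G.k m|) / ε * D) * δ) := fun i j =>
      G.l2Le_quadTerm_sub hε hε1 hk (hv' i) (hv j) (hv i).memLp (hv' j).memLp (hd i) (hd j)
    refine (((((h 0 0).const_mul (b₀ m)).add ((h 0 1).const_mul (b₁ m))).add
      ((h 1 1).const_mul (b₂ m))).const_mul (G.k m ^ 3)).mono (le_of_eq ?_)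
    ring
  obtain ⟨K₁, hK₁, H₁⟩ := key (fun m => G.β₁₁₁ m + G.lam * G.β₂₁₁ m)
    (fun m => 2 * (G.β₁₁₂ m + G.lam * G.β₂₁₂ m)) (fun m => G.β₁₂₂ m + G.lam * G.β₂₂₂ m)
  obtain ⟨K₂, hK₂, H₂⟩ := key G.β₂₁₁ (fun m => 2 * G.β₂₁₂ m) G.β₂₂₂
  refine ⟨K₁ + K₂, by positivity, fun ε hε hε1 v v' D δ hv hv' hd i => ?_⟩
  have hD := (hv 0).nonneg
  have hδ := (hd 0).nonneg
  have t1 : 0 ≤ K₁ / ε * D * δ := by positivity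
  have t2 : 0 ≤ K₂ / ε * D * δ := by positivity
  have e3 : (K₁ + K₂) / ε * D * δ = K₁ / ε * D * δ + K₂ / ε * D * δ := by ring
  rw [e3]
  fin_cases i
  · refine (((H₁ ε hε hε1 v v' D δ hv hv' hd).const_mul (1 / 2)).mono ?_).congr
      (ae_of_all _ fun ξ => ?_)
    · rw [abs_of_pos (by norm_num : (0 : ℝ) < 1 / 2)]; linarith
    · change _ = G.Qop ε v ξ 0 - G.Qop ε v' ξ 0
      simp only [Qop, Pi.sub_apply, PiLp.toLp_apply, Matrix.cons_val_zero]
      rw [← mul_sub, ← Finset.sum_sub_distrib]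
      congr 1
      exact Finset.sum_congr rfl fun m _ => by ring
  · refine (((H₂ ε hε hε1 v v' D δ hv hv' hd).const_mul (ε ^ 2 / 2)).mono ?_).congr
      (ae_of_all _ fun ξ => ?_)
    · rw [abs_of_pos (by positivity : (0 : ℝ) < ε ^ 2 / 2)]
      have : ε ^ 2 / 2 ≤ 1 := by nlinarith
      have := mul_le_of_le_one_left t2 this
      linarith
    · change _ = G.Qop ε v ξ 1 - G.Qop ε v' ξ 1
      simp only [Qop, Pi.sub_apply, PiLp.toLp_apply, Matrix.cons_val_one, Matrix.cons_val_zero]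
      rw [← mul_sub, ← Finset.sum_sub_distrib]
      congr 1
      exact Finset.sum_congr rfl fun m _ => by ring

lemma continuous_arg (ε : ℝ) (m : Fin M) {W : ℝ → Plane} (h : ∀ i, LocInt (comp W i)) :
    Continuous (G.arg ε m W) :=
  continuous_plane (continuous_const.mul (continuous_av (h 0) _))
    (continuous_const.mul (continuous_av (h 1) _))

lemma locInt_W₀ (i : Fin 2) : LocInt (comp G.W₀ i) := by
  fin_cases i
  · exact G.continuous_Wstar.locInt
  · exact (continuous_const.mul G.continuous_Wstar).locInt

lemma comp_W₀_add (ε : ℝ) (v : ℝ → Plane) (i : Fin 2) :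
    comp (G.W₀ + ε ^ 2 • v) i = comp G.W₀ i + ε ^ 2 • comp v i := rfl

lemma locInt_W₀_add (ε : ℝ) {v : ℝ → Plane} (hv : ∀ i, LocInt (comp v i)) (i : Fin 2) :
    LocInt (comp (G.W₀ + ε ^ 2 • v) i) := by
  rw [comp_W₀_add]
  exact (G.locInt_W₀ i).add ((hv i).const_smul _)

lemma exists_abs_avg_W₀_le (hg : G.Generic) : ∃ C : ℝ, 0 ≤ C ∧ ∀ ε : ℝ, 0 < ε → ε ≤ 1 →
    ∀ m i x, G.k m ≠ 0 → |avg (G.k m * ε) (comp G.W₀ i) x| ≤ C * sechSq G.rate x := by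
  obtain ⟨C₀, hC₀, -, h, -⟩ := G.exists_sum_average_bounds hg
  refine ⟨(1 + |G.lam|) * C₀, by positivity, fun ε hε hε1 m i x hk => ?_⟩
  have h1 := h ε hε hε1 m x hk
  have h2 : 0 ≤ C₀ * sechSq G.rate x := mul_nonneg hC₀ (sechSq_pos _ _).le
  have h3 : 0 ≤ |G.lam| * (C₀ * sechSq G.rate x) := by positivity
  fin_cases i
  · refine h1.trans ?_
    linarith
  · change |avg (G.k m * ε) (G.lam • G.Wstar) x| ≤ _
    rw [avg_eq_av, av_smul, Pi.smul_apply, smul_eq_mul, abs_mul]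
    have := mul_le_mul_of_nonneg_left h1 (abs_nonneg G.lam)
    rw [avg_eq_av] at this
    linarith

/-- The cubic terms are locally Lipschitz continuous, with a constant of order `ε⁸`. -/
lemma exists_cubic_lipschitz (hg : G.Generic) {ψ : Plane → ℝ} (hψ : IsCubicRemainder ψ)
    (m : Fin M) (hk : G.k m ≠ 0) :
    ∃ K : ℝ, 0 ≤ K ∧ ∀ (ε : ℝ), 0 < ε → ε ≤ 1 →
    ∀ (v v' : ℝ → Plane) (D δ : ℝ), (∀ i, L2Le (comp v i) D) → (∀ i, L2Le (comp v' i) D) →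
      (∀ i, L2Le (comp v i - comp v' i) δ) →
      L2Le ((fun x => ψ (G.arg ε m (G.W₀ + ε ^ 2 • v) x))
        - fun x => ψ (G.arg ε m (G.W₀ + ε ^ 2 • v') x)) (ε ^ 8 * (K * (1 + D) ^ 2 * δ)) := by
  obtain ⟨C, hC, hW⟩ := G.exists_abs_avg_W₀_le hg
  obtain ⟨γ, hγ0, hγ⟩ := hψ.exists_nonneg
  have hk' : 0 < |G.k m| := abs_pos.2 hk
  set b : ℝ := C + (1 + 1 / |G.k m|) with hb
  refine ⟨γ * (4 * (|G.k m| * b) ^ 2) * |G.k m| * 2, by positivity, ?_⟩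
  intro ε hε hε1 v v' D δ hv hv' hd
  have hD := (hv 0).nonneg
  have hη : G.k m * ε ≠ 0 := mul_ne_zero hk hε.ne'
  have hc := one_add_one_div_le hk hε hε1
  -- the arguments of the nonlinearity are of order `ε²`
  have harg : ∀ u : ℝ → Plane, (∀ i, L2Le (comp u i) D) → ∀ i x,
      |ε ^ 2 * G.k m * avg (G.k m * ε) (comp (G.W₀ + ε ^ 2 • u) i) x|
        ≤ ε ^ 2 * (|G.k m| * b * (1 + D)) := by
    intro u hu i x
    rw [comp_W₀_add, avg_eq_av, av_add _ (G.locInt_W₀ i) ((hu i).memLp.locInt.const_smul _), av_smul,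
      abs_mul, abs_mul, abs_of_pos (by positivity : 0 < ε ^ 2), mul_assoc, mul_assoc |G.k m|]
    refine mul_le_mul_of_nonneg_left (mul_le_mul_of_nonneg_left ?_ (abs_nonneg _)) (by positivity)
    rw [Pi.add_apply, Pi.smul_apply, smul_eq_mul]
    refine (abs_add_le _ _).trans ?_
    have h1 : |av (G.k m * ε) (comp G.W₀ i) x| ≤ C :=
      (hW ε hε hε1 m i x hk).trans (mul_le_of_le_one_right hC (sechSq_le_one _ _))
    have h2 : |ε ^ 2 * av (G.k m * ε) (comp u i) x| ≤ (1 + 1 / |G.k m|) * D := by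
      rw [abs_mul, abs_of_pos (by positivity : 0 < ε ^ 2)]
      have h3 := ((hu i).abs_avg_le hη x).trans (mul_le_mul_of_nonneg_right hc hD)
      rw [avg_eq_av] at h3
      calc _ ≤ ε ^ 2 * ((1 + 1 / |G.k m|) / ε * D) := by gcongr
        _ = ε * ((1 + 1 / |G.k m|) * D) := by field_simp
        _ ≤ _ := mul_le_of_le_one_left (by positivity) hε1
    have h4 : 0 ≤ C * D := by positivity
    have h5 : 0 ≤ 1 + 1 / |G.k m| := by positivity
    rw [hb]
    linarith
  have hdiff : ∀ i x, ε ^ 2 * G.k m * avg (G.k m * ε) (comp (G.W₀ + ε ^ 2 • v) i) x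
      - ε ^ 2 * G.k m * avg (G.k m * ε) (comp (G.W₀ + ε ^ 2 • v') i) x
      = ε ^ 4 * (G.k m * avg (G.k m * ε) (comp v i - comp v' i) x) := by
    intro i x
    simp only [comp_W₀_add, avg_eq_av]
    rw [av_add _ (G.locInt_W₀ i) ((hv i).memLp.locInt.const_smul _),
      av_add _ (G.locInt_W₀ i) ((hv' i).memLp.locInt.const_smul _),
      av_sub _ (hv i).memLp.locInt (hv' i).memLp.locInt, av_smul, av_smul]
    simp only [Pi.add_apply, Pi.smul_apply, Pi.sub_apply, smul_eq_mul]
    ring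
  have hsum : L2Le ((fun x => |avg (G.k m * ε) (comp v 0 - comp v' 0) x|)
      + fun x => |avg (G.k m * ε) (comp v 1 - comp v' 1) x|) (2 * δ) := by
    have h : ∀ i, L2Le (fun x => |avg (G.k m * ε) (comp v i - comp v' i) x|) δ := fun i =>
      (((hd i).avg hη).of_abs_le ((hd i).avg hη).memLp.1.norm zero_le_one
        (ae_of_all _ fun x => by simp)).mono (one_mul _).le
    exact ((h 0).add (h 1)).mono (by linarith)
  have hcont : ∀ u : ℝ → Plane, (∀ i, L2Le (comp u i) D) →
      Continuous fun x => ψ (G.arg ε m (G.W₀ + ε ^ 2 • u) x) := fun u hu =>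
    hψ.continuous.comp (G.continuous_arg ε m (G.locInt_W₀_add ε fun i => (hu i).memLp.locInt))
  refine (hsum.of_abs_le (c := γ * (4 * (ε ^ 2 * (|G.k m| * b * (1 + D))) ^ 2) * (ε ^ 4 * |G.k m|))
    ((hcont v hv).sub (hcont v' hv')).aestronglyMeasurable (by positivity)
    (ae_of_all _ fun x => ?_)).mono (le_of_eq (by ring))
  rw [Pi.sub_apply, Pi.add_apply]
  refine (hγ _ _).trans ?_
  have hsq : ∀ u : ℝ → Plane, (∀ i, L2Le (comp u i) D) → ∀ i,
      (ε ^ 2 * G.k m * avg (G.k m * ε) (comp (G.W₀ + ε ^ 2 • u) i) x) ^ 2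
        ≤ (ε ^ 2 * (|G.k m| * b * (1 + D))) ^ 2 := fun u hu i => by
    rw [← sq_abs]
    exact pow_le_pow_left₀ (abs_nonneg _) (harg u hu i x) 2
  have s1 := hsq v hv 0
  have s2 := hsq v hv 1
  have s3 := hsq v' hv' 0
  have s4 := hsq v' hv' 1
  have d0 : |G.arg ε m (G.W₀ + ε ^ 2 • v) x 0 - G.arg ε m (G.W₀ + ε ^ 2 • v') x 0|
      = ε ^ 4 * |G.k m| * |avg (G.k m * ε) (comp v 0 - comp v' 0) x| := by
    change |ε ^ 2 * G.k m * avg (G.k m * ε) (comp (G.W₀ + ε ^ 2 • v) 0) x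
      - ε ^ 2 * G.k m * avg (G.k m * ε) (comp (G.W₀ + ε ^ 2 • v') 0) x| = _
    rw [hdiff, abs_mul, abs_mul, abs_of_pos (by positivity : 0 < ε ^ 4)]
    ring
  have d1 : |G.arg ε m (G.W₀ + ε ^ 2 • v) x 1 - G.arg ε m (G.W₀ + ε ^ 2 • v') x 1|
      = ε ^ 4 * |G.k m| * |avg (G.k m * ε) (comp v 1 - comp v' 1) x| := by
    change |ε ^ 2 * G.k m * avg (G.k m * ε) (comp (G.W₀ + ε ^ 2 • v) 1) x
      - ε ^ 2 * G.k m * avg (G.k m * ε) (comp (G.W₀ + ε ^ 2 • v') 1) x| = _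
    rw [hdiff, abs_mul, abs_mul, abs_of_pos (by positivity : 0 < ε ^ 4)]
    ring
  have habs : 0 ≤ |avg (G.k m * ε) (comp v 0 - comp v' 0) x|
      + |avg (G.k m * ε) (comp v 1 - comp v' 1) x| := add_nonneg (abs_nonneg _) (abs_nonneg _)
  have hfac : 0 ≤ ε ^ 4 * |G.k m| := by positivity
  rw [d0, d1, ← mul_add, ← mul_assoc, abs_of_nonneg habs]
  refine mul_le_mul_of_nonneg_right (mul_le_mul_of_nonneg_right
    (mul_le_mul_of_nonneg_left ?_ hγ0) hfac) habs
  change (ε ^ 2 * G.k m * avg (G.k m * ε) (comp (G.W₀ + ε ^ 2 • v) 0) x) ^ 2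
    + (ε ^ 2 * G.k m * avg (G.k m * ε) (comp (G.W₀ + ε ^ 2 • v) 1) x) ^ 2
    + (ε ^ 2 * G.k m * avg (G.k m * ε) (comp (G.W₀ + ε ^ 2 • v') 0) x) ^ 2
    + (ε ^ 2 * G.k m * avg (G.k m * ε) (comp (G.W₀ + ε ^ 2 • v') 1) x) ^ 2 ≤ _
  linarith only [s1, s2, s3, s4]

end LatticeData

/-! ### The higher order terms and the residual -/

namespace LatticeData

lemma IsCubicRemainder.add_const_mul {ψ χ : Plane → ℝ} (hψ : IsCubicRemainder ψ)
    (hχ : IsCubicRemainder χ) (c : ℝ) : IsCubicRemainder fun x => ψ x + c * χ x := by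
  obtain ⟨γ, -, hγ⟩ := hψ.exists_nonneg
  obtain ⟨δ, -, hδ⟩ := hχ.exists_nonneg
  refine ⟨by simp [hψ.1, hχ.1], γ + |c| * δ, fun x y => ?_⟩
  have h := mul_le_mul_of_nonneg_left (hδ x y) (abs_nonneg c)
  rw [← abs_mul] at h
  have e : ψ x + c * χ x - (ψ y + c * χ y) = (ψ x - ψ y) + c * (χ x - χ y) := by ring
  rw [e]
  refine (abs_add_le _ _).trans ((add_le_add (hγ x y) h).trans (le_of_eq ?_))
  ring

variable {M : ℕ} (G : LatticeData M)

lemma isCubicRemainder_comb (h : G.CubicRemainders) (m : Fin M) :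
    IsCubicRemainder fun x => G.Ψ₁ m x + G.lam * G.Ψ₂ m x :=
  (h m).1.add_const_mul (h m).2 G.lam

lemma exists_sum_cubic_lipschitz (hg : G.Generic) {ψ : Fin M → Plane → ℝ}
    (hψ : ∀ m, IsCubicRemainder (ψ m)) :
    ∃ K : ℝ, 0 ≤ K ∧ ∀ (ε : ℝ), 0 < ε → ε ≤ 1 →
    ∀ (v v' : ℝ → Plane) (D δ : ℝ), (∀ i, L2Le (comp v i) D) → (∀ i, L2Le (comp v' i) D) →
      (∀ i, L2Le (comp v i - comp v' i) δ) →
      L2Le (fun ξ => (∑ m, G.k m * avg (G.k m * ε) (fun x => ψ m (G.arg ε m (G.W₀ + ε ^ 2 • v) x)) ξ)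
        - ∑ m, G.k m * avg (G.k m * ε) (fun x => ψ m (G.arg ε m (G.W₀ + ε ^ 2 • v') x)) ξ)
        (ε ^ 8 * (K * (1 + D) ^ 2 * δ)) := by
  have key : ∀ m, ∃ K : ℝ, 0 ≤ K ∧ ∀ (ε : ℝ), 0 < ε → ε ≤ 1 →
      ∀ (v v' : ℝ → Plane) (D δ : ℝ), (∀ i, L2Le (comp v i) D) → (∀ i, L2Le (comp v' i) D) →
      (∀ i, L2Le (comp v i - comp v' i) δ) →
      L2Le (fun ξ => G.k m * avg (G.k m * ε) (fun x => ψ m (G.arg ε m (G.W₀ + ε ^ 2 • v) x)) ξ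
        - G.k m * avg (G.k m * ε) (fun x => ψ m (G.arg ε m (G.W₀ + ε ^ 2 • v') x)) ξ)
        (ε ^ 8 * (K * (1 + D) ^ 2 * δ)) := by
    intro m
    rcases eq_or_ne (G.k m) 0 with hk | hk
    · refine ⟨0, le_rfl, fun ε hε hε1 v v' D δ hv hv' hd => ?_⟩
      have h0 : L2Le (fun _ : ℝ => (0 : ℝ)) 0 := L2Le.zero
      simpa [hk] using h0
    obtain ⟨K, hK, H⟩ := G.exists_cubic_lipschitz hg (hψ m) m hk
    refine ⟨|G.k m| * K, by positivity, fun ε hε hε1 v v' D δ hv hv' hd => ?_⟩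
    have hcont : ∀ u : ℝ → Plane, (∀ i, L2Le (comp u i) D) →
        LocInt fun x => ψ m (G.arg ε m (G.W₀ + ε ^ 2 • u) x) := fun u hu =>
      ((hψ m).continuous.comp
        (G.continuous_arg ε m (G.locInt_W₀_add ε fun i => (hu i).memLp.locInt))).locInt
    have h1 := ((H ε hε hε1 v v' D δ hv hv' hd).avg (mul_ne_zero hk hε.ne')).const_mul (G.k m)
    rw [avg_eq_av, av_sub _ (hcont v hv) (hcont v' hv')] at h1
    refine (h1.mono (le_of_eq (by ring))).congr (ae_of_all _ fun x => ?_)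
    simp only [Pi.sub_apply, mul_sub, avg_eq_av]
  choose K hK H using key
  refine ⟨∑ m, K m, Finset.sum_nonneg fun m _ => hK m, fun ε hε hε1 v v' D δ hv hv' hd => ?_⟩
  simp only [← Finset.sum_sub_distrib]
  rw [Finset.sum_mul, Finset.sum_mul, Finset.mul_sum]
  exact L2Le.sum fun m _ => H m ε hε hε1 v v' D δ hv hv' hd

/-- `N_ε[W₀; ·]` is locally Lipschitz continuous on `L²`, uniformly in `ε`. -/
lemma exists_Nop_lipschitz (hg : G.Generic) (hc : G.CubicRemainders) :
    ∃ K : ℝ, 0 ≤ K ∧ ∀ (ε : ℝ), 0 < ε → ε ≤ 1 →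
    ∀ (v v' : ℝ → Plane) (D δ : ℝ), (∀ i, L2Le (comp v i) D) → (∀ i, L2Le (comp v' i) D) →
      (∀ i, L2Le (comp v i - comp v' i) δ) →
      ∀ i, L2Le (comp (G.Nop ε v) i - comp (G.Nop ε v') i) (K * (1 + D) ^ 2 * δ) := by
  obtain ⟨K₁, hK₁, H₁⟩ := G.exists_sum_cubic_lipschitz hg (G.isCubicRemainder_comb hc)
  obtain ⟨K₂, hK₂, H₂⟩ := G.exists_sum_cubic_lipschitz hg fun m => (hc m).2
  refine ⟨K₁ + K₂, by positivity, fun ε hε hε1 v v' D δ hv hv' hd i => ?_⟩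
  have hδ := (hd 0).nonneg
  have t1 : 0 ≤ K₁ * (1 + D) ^ 2 * δ := by positivity
  have t2 : 0 ≤ K₂ * (1 + D) ^ 2 * δ := by positivity
  have e3 : (K₁ + K₂) * (1 + D) ^ 2 * δ = K₁ * (1 + D) ^ 2 * δ + K₂ * (1 + D) ^ 2 * δ := by ring
  rw [e3]
  fin_cases i
  · refine (((H₁ ε hε hε1 v v' D δ hv hv' hd).const_mul (1 / ε ^ 8)).mono ?_).congr
      (ae_of_all _ fun ξ => ?_)
    · rw [abs_of_pos (by positivity : 0 < 1 / ε ^ 8), ← mul_assoc,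
        one_div_mul_cancel (by positivity), one_mul]
      linarith
    · change _ = (1 / ε ^ 2) * (G.Pop ε (G.W₀ + ε ^ 2 • v) ξ 0 - G.Pop ε G.W₀ ξ 0)
        - (1 / ε ^ 2) * (G.Pop ε (G.W₀ + ε ^ 2 • v') ξ 0 - G.Pop ε G.W₀ ξ 0)
      simp only [Pop, PiLp.toLp_apply, Matrix.cons_val_zero]
      field_simp
      ring
  · refine (((H₂ ε hε hε1 v v' D δ hv hv' hd).const_mul (1 / ε ^ 6)).mono ?_).congr
      (ae_of_all _ fun ξ => ?_)
    · have e : |1 / ε ^ 6| * (ε ^ 8 * (K₂ * (1 + D) ^ 2 * δ)) = ε ^ 2 * (K₂ * (1 + D) ^ 2 * δ) := by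
        rw [abs_of_pos (by positivity : 0 < 1 / ε ^ 6)]
        field_simp
      rw [e]
      have := mul_le_of_le_one_left t2 (pow_le_one₀ hε.le hε1 : ε ^ 2 ≤ 1)
      linarith
    · change _ = (1 / ε ^ 2) * (G.Pop ε (G.W₀ + ε ^ 2 • v) ξ 1 - G.Pop ε G.W₀ ξ 1)
        - (1 / ε ^ 2) * (G.Pop ε (G.W₀ + ε ^ 2 • v') ξ 1 - G.Pop ε G.W₀ ξ 1)
      simp only [Pop, PiLp.toLp_apply, Matrix.cons_val_one, Matrix.cons_val_zero]
      field_simp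
      ring

/-- The nonlinear part of the corrector equation is locally Lipschitz continuous on `L²`. The
constant of order `1 / ε` is compensated by the factor `ε²` in the definition of `F_ε`. -/
lemma exists_nonlinear_lipschitz (hg : G.Generic) (hc : G.CubicRemainders) :
    ∃ K : ℝ, 0 ≤ K ∧ ∀ (ε : ℝ), 0 < ε → ε ≤ 1 →
    ∀ (v v' : ℝ → Plane) (D δ : ℝ), (∀ i, L2Le (comp v i) D) → (∀ i, L2Le (comp v' i) D) →
      (∀ i, L2Le (comp v i - comp v' i) δ) →
      ∀ i, L2Le (comp (G.Qop ε v + G.Nop ε v) i - comp (G.Qop ε v' + G.Nop ε v') i)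
        (K / ε * (1 + D) ^ 2 * δ) := by
  obtain ⟨K₁, hK₁, H₁⟩ := G.exists_Qop_lipschitz
  obtain ⟨K₂, hK₂, H₂⟩ := G.exists_Nop_lipschitz hg hc
  refine ⟨K₁ + K₂, by positivity, fun ε hε hε1 v v' D δ hv hv' hd i => ?_⟩
  have hδ := (hd 0).nonneg
  have hD := (hv 0).nonneg
  refine (((H₁ ε hε hε1 v v' D δ hv hv' hd i).add (H₂ ε hε hε1 v v' D δ hv hv' hd i)).mono
    ?_).congr (ae_of_all _ fun x => ?_)
  · have h1 : K₁ / ε * D * δ ≤ K₁ / ε * (1 + D) ^ 2 * δ := by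
      gcongr
      nlinarith
    have h2 : K₂ * (1 + D) ^ 2 * δ ≤ K₂ / ε * (1 + D) ^ 2 * δ := by
      gcongr
      exact le_div_self hK₂ hε hε1
    have e : (K₁ + K₂) / ε * (1 + D) ^ 2 * δ
        = K₁ / ε * (1 + D) ^ 2 * δ + K₂ / ε * (1 + D) ^ 2 * δ := by ring
    rw [e]
    exact add_le_add h1 h2
  · simp only [comp, Pi.add_apply, Pi.sub_apply, PiLp.add_apply]
    ring

lemma Qop_zero (ε : ℝ) : G.Qop ε 0 = 0 := by
  have h0 : ∀ i, comp (0 : ℝ → Plane) i = 0 := fun i => by ext x; simp [comp]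
  have h1 : ∀ η, avg η (0 : ℝ → ℝ) = 0 := fun η => by ext x; simp [avg]
  have h2 : ∀ m, G.quadTerm ε m 0 0 = 0 := fun m => by
    simp only [quadTerm, h1, Pi.zero_apply, mul_zero]
    exact h1 _
  ext x i
  fin_cases i <;> simp [Qop, h0, h2]

lemma Nop_zero (ε : ℝ) : G.Nop ε 0 = 0 := by
  simp [Nop]

lemma aeEven_Qop (ε : ℝ) {W : ℝ → Plane} (hW : AEEven W) : AEEven (G.Qop ε W) := by
  refine ae_of_all _ fun x => ?_
  simp only [Qop, G.quadTerm_neg ε _ (hW.comp _) (hW.comp _) x]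

lemma arg_neg (ε : ℝ) (m : Fin M) {W : ℝ → Plane} (hW : AEEven W) (x : ℝ) :
    G.arg ε m W (-x) = G.arg ε m W x := by
  simp only [arg, (hW.comp _).av]

lemma aeEven_Pop (ε : ℝ) {W : ℝ → Plane} (hW : AEEven W) : AEEven (G.Pop ε W) := by
  refine ae_of_all _ fun x => ?_
  have h : ∀ (m : Fin M) (ψ : Plane → ℝ), avg (G.k m * ε) (fun y => ψ (G.arg ε m W y)) (-x)
      = avg (G.k m * ε) (fun y => ψ (G.arg ε m W y)) x := fun m ψ =>
    AEEven.av (ae_of_all _ fun y => by rw [G.arg_neg ε m hW]) _ _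
  have h1 := fun m => h m fun y => G.Ψ₁ m y + G.lam * G.Ψ₂ m y
  have h2 := fun m => h m (G.Ψ₂ m)
  simp only [Pop, h1, h2]

lemma W₀_neg (x : ℝ) : G.W₀ (-x) = G.W₀ x := by
  simp only [W₀, Wstar, mul_neg, Real.cosh_neg]

lemma aeEven_W₀ : AEEven G.W₀ := ae_of_all _ G.W₀_neg

lemma isEvenL2_W₀ (hg : G.Generic) : IsEvenL2 G.W₀ := by
  have h : MemLp G.Wstar 2 volume :=
    (memLp_sechSq (κ := 1 / 2 * √G.d₁) (by have := Real.sqrt_pos.2 hg.2.1; positivity)).const_mul _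
  exact ⟨memLp_plane h (h.const_mul _), G.aeEven_W₀⟩

lemma aeEven_Nop (ε : ℝ) {v : ℝ → Plane} (hv : AEEven v) : AEEven (G.Nop ε v) := by
  have h : AEEven (G.W₀ + ε ^ 2 • v) := by
    filter_upwards [hv] with x hx
    simp only [Pi.add_apply, Pi.smul_apply, hx, G.W₀_neg]
  filter_upwards [G.aeEven_Pop ε h, G.aeEven_Pop ε G.aeEven_W₀] with x h1 h2
  simp only [Nop, Pi.smul_apply, Pi.sub_apply, h1, h2]

lemma aeEven_Rop (ε : ℝ) : AEEven (G.Rop ε) := by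
  filter_upwards [G.aeEven_Qop ε G.aeEven_W₀, G.aeEven_B ε G.aeEven_W₀] with x h1 h2
  simp only [Rop, Pi.smul_apply, Pi.sub_apply, h1, h2]

lemma exists_sum_cubic_bound (hg : G.Generic) {ψ : Fin M → Plane → ℝ}
    (hψ : ∀ m, IsCubicRemainder (ψ m)) :
    ∃ C : ℝ, 0 ≤ C ∧ ∀ (ε : ℝ), 0 < ε → ε ≤ 1 → ∀ ξ,
      |∑ m, G.k m * avg (G.k m * ε) (fun x => ψ m (G.arg ε m G.W₀ x)) ξ|
        ≤ ε ^ 6 * (C * sechSq G.rate ξ) := by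
  obtain ⟨C, hC, hW⟩ := G.exists_abs_avg_W₀_le hg
  have key : ∀ m, ∃ E : ℝ, 0 ≤ E ∧ ∀ (ε : ℝ), 0 < ε → ε ≤ 1 → ∀ ξ,
      |G.k m * avg (G.k m * ε) (fun x => ψ m (G.arg ε m G.W₀ x)) ξ|
        ≤ ε ^ 6 * (E * sechSq G.rate ξ) := by
    intro m
    rcases eq_or_ne (G.k m) 0 with hk | hk
    · refine ⟨0, le_rfl, fun ε hε hε1 ξ => ?_⟩
      simp [hk]
    obtain ⟨γ, hγ0, hγ⟩ := (hψ m).exists_abs_le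
    refine ⟨|G.k m| * (γ * (2 * (|G.k m| * C)) ^ 3 * Real.exp (2 * |G.rate| * |G.k m|)),
      by positivity, fun ε hε hε1 ξ => ?_⟩
    have hloc : LocInt fun x => ψ m (G.arg ε m G.W₀ x) :=
      ((hψ m).continuous.comp (G.continuous_arg ε m G.locInt_W₀)).locInt
    have hb : ∀ x, |ψ m (G.arg ε m G.W₀ x)|
        ≤ (ε ^ 6 * (γ * (2 * (|G.k m| * C)) ^ 3)) * sechSq G.rate x := by
      intro x
      have hs0 := (sechSq_pos G.rate x).le
      have hs1 := sechSq_le_one G.rate x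
      have ha : ∀ i, |ε ^ 2 * G.k m * avg (G.k m * ε) (comp G.W₀ i) x|
          ≤ ε ^ 2 * (|G.k m| * C * sechSq G.rate x) := fun i => by
        rw [abs_mul, abs_mul, abs_of_pos (by positivity : 0 < ε ^ 2), mul_assoc, mul_assoc |G.k m|]
        have := hW ε hε hε1 m i x hk
        gcongr
      have h01 : |G.arg ε m G.W₀ x 0| + |G.arg ε m G.W₀ x 1|
          ≤ ε ^ 2 * (2 * (|G.k m| * C)) * sechSq G.rate x :=
        (add_le_add (ha 0) (ha 1)).trans (le_of_eq (by ring))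
      refine (hγ _).trans ?_
      have h3 : sechSq G.rate x ^ 3 ≤ sechSq G.rate x := pow_le_of_le_one hs0 hs1 (by norm_num)
      calc γ * (|G.arg ε m G.W₀ x 0| + |G.arg ε m G.W₀ x 1|) ^ 3
          ≤ γ * (ε ^ 2 * (2 * (|G.k m| * C)) * sechSq G.rate x) ^ 3 := by gcongr
        _ = (ε ^ 6 * (γ * (2 * (|G.k m| * C)) ^ 3)) * sechSq G.rate x ^ 3 := by ring
        _ ≤ _ := by gcongr
    have hη : |G.k m * ε| ≤ |G.k m| := by
      rw [abs_mul, abs_of_pos hε]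
      exact mul_le_of_le_one_right (abs_nonneg _) hε1
    have h := abs_av_le_sechSq hloc (by positivity) hb hη ξ
    rw [abs_mul]
    refine (mul_le_mul_of_nonneg_left h (abs_nonneg _)).trans (le_of_eq ?_)
    ring
  choose E hE H using key
  refine ⟨∑ m, E m, Finset.sum_nonneg fun m _ => hE m, fun ε hε hε1 ξ => ?_⟩
  rw [Finset.sum_mul, Finset.mul_sum]
  exact (Finset.abs_sum_le_sum_abs _ _).trans (Finset.sum_le_sum fun m _ => H m ε hε hε1 ξ)

lemma exists_Pop_W₀_bound (hg : G.Generic) (hc : G.CubicRemainders) :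
    ∃ C : ℝ, 0 ≤ C ∧ ∀ (ε : ℝ), 0 < ε → ε ≤ 1 → ∀ i ξ,
      |G.Pop ε G.W₀ ξ i| ≤ C * sechSq G.rate ξ := by
  obtain ⟨C₁, hC₁, H₁⟩ := G.exists_sum_cubic_bound hg (G.isCubicRemainder_comb hc)
  obtain ⟨C₂, hC₂, H₂⟩ := G.exists_sum_cubic_bound hg fun m => (hc m).2
  refine ⟨C₁ + C₂, by positivity, fun ε hε hε1 i ξ => ?_⟩
  have hs := (sechSq_pos G.rate ξ).le
  have t1 := mul_nonneg hC₁ hs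
  have t2 := mul_nonneg hC₂ hs
  rw [add_mul]
  fin_cases i
  · change |(1 / ε ^ 6) * _| ≤ _
    rw [abs_mul, abs_of_pos (by positivity : 0 < 1 / ε ^ 6), one_div_mul_eq_div,
      div_le_iff₀ (by positivity)]
    refine (H₁ ε hε hε1 ξ).trans ?_
    rw [mul_comm]
    gcongr
    linarith
  · change |(1 / ε ^ 4) * _| ≤ _
    rw [abs_mul, abs_of_pos (by positivity : 0 < 1 / ε ^ 4), one_div_mul_eq_div,
      div_le_iff₀ (by positivity)]
    refine (H₂ ε hε hε1 ξ).trans ?_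
    rw [mul_comm]
    refine mul_le_mul (by linarith) ?_ (by positivity) (by positivity)
    exact pow_le_pow_of_le_one hε.le hε1 (by norm_num)

lemma continuous_W₀ : Continuous G.W₀ :=
  continuous_plane G.continuous_Wstar (continuous_const.mul G.continuous_Wstar)

lemma continuous_B (ε : ℝ) {W : ℝ → Plane} (hW : Continuous W) : Continuous (G.B ε W) := by
  have h0 : ∀ i, Continuous (comp W i) := fun i => by unfold comp; fun_prop
  have h : ∀ (m : Fin M) i, Continuous (avg (G.k m * ε) (avg (G.k m * ε) (comp W i))) := fun m i =>
    continuous_av (continuous_av (h0 i).locInt _).locInt _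
  have he : ∀ (a b : Fin M → ℝ) i, Continuous fun x : ℝ => (1 / ε ^ 2) * ((G.σ₀ + ε ^ 2) * comp W i x
      - ∑ m, a m * avg (G.k m * ε) (avg (G.k m * ε) (comp W 0)) x
      - ∑ m, b m * avg (G.k m * ε) (avg (G.k m * ε) (comp W 1)) x) := fun a b i =>
    continuous_const.mul (((continuous_const.mul (h0 i)).sub
      (continuous_finsetSum _ fun m _ => continuous_const.mul (h m 0))).sub
      (continuous_finsetSum _ fun m _ => continuous_const.mul (h m 1)))
  have hb : ∀ i, Continuous (comp (G.Bcan ε W) i) := by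
    intro i
    fin_cases i
    · exact he (fun m => G.k m ^ 2 * G.α₁₁ m) (fun m => G.k m ^ 2 * G.α₁₂ m) 0
    · exact he (fun m => G.k m ^ 2 * G.α₂₁ m) (fun m => G.k m ^ 2 * G.α₂₂ m) 1
  exact continuous_plane ((hb 0).add (continuous_const.mul (hb 1))) (continuous_const.mul (hb 1))

lemma continuous_Qop (ε : ℝ) {W : ℝ → Plane} (hW : ∀ i, LocInt (comp W i)) :
    Continuous (G.Qop ε W) := by
  have h : ∀ (m : Fin M) i j, Continuous (G.quadTerm ε m (comp W i) (comp W j)) := fun m i j =>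
    G.continuous_quadTerm ε m (hW i) (hW j)
  refine continuous_plane ?_ ?_ <;>
    exact continuous_const.mul (continuous_finsetSum _ fun m _ => continuous_const.mul
      (((continuous_const.mul (h m 0 0)).add (continuous_const.mul (h m 0 1))).add
        (continuous_const.mul (h m 1 1))))

lemma continuous_Pop (hc : G.CubicRemainders) (ε : ℝ) {W : ℝ → Plane}
    (hW : ∀ i, LocInt (comp W i)) : Continuous (G.Pop ε W) := by
  have h : ∀ (m : Fin M) (ψ : Plane → ℝ), IsCubicRemainder ψ →
      Continuous (avg (G.k m * ε) fun x => ψ (G.arg ε m W x)) := fun m ψ hψ =>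
    continuous_av (hψ.continuous.comp (G.continuous_arg ε m hW)).locInt _
  exact continuous_plane
    (continuous_const.mul (continuous_finsetSum _ fun m _ => continuous_const.mul
      (h m _ (G.isCubicRemainder_comb hc m))))
    (continuous_const.mul (continuous_finsetSum _ fun m _ => continuous_const.mul
      (h m _ (hc m).2)))

lemma continuous_Rop (ε : ℝ) : Continuous (G.Rop ε) :=
  ((G.continuous_Qop ε G.locInt_W₀).sub (G.continuous_B ε G.continuous_W₀)).const_smul _

/-- The inhomogeneity of the corrector equation is bounded in `L²` uniformly in `ε`. -/
lemma exists_residual_bound (hs : G.SymmetricCoefficients) (hg : G.Generic)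
    (hc : G.CubicRemainders) : ∃ C : ℝ, ∀ ε : ℝ, 0 < ε → ε ≤ 1 →
      ∀ i, L2Le (comp (G.Rop ε + G.Pop ε G.W₀) i) C := by
  obtain ⟨C₁, hC₁, H₁⟩ := G.exists_Rop_bound hs hg
  obtain ⟨C₂, hC₂, H₂⟩ := G.exists_Pop_W₀_bound hg hc
  have hrate : 0 < G.rate := by
    have := Real.sqrt_pos.2 hg.2.1
    unfold rate; positivity
  obtain ⟨S, hS⟩ := (memLp_sechSq hrate).exists_l2Le
  refine ⟨(C₁ + C₂) * S, fun ε hε hε1 i => hS.of_abs_le ?_ (by positivity) (ae_of_all _ fun x => ?_)⟩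
  · have h := (G.continuous_Rop ε).add (G.continuous_Pop hc ε G.locInt_W₀)
    have h' : Continuous (comp (G.Rop ε + G.Pop ε G.W₀) i) := by
      unfold comp; fun_prop
    exact h'.aestronglyMeasurable
  · rw [abs_of_pos (sechSq_pos _ _), add_mul]
    refine (abs_add_le _ _).trans (add_le_add ?_ (H₂ ε hε hε1 i x))
    fin_cases i
    · exact (H₁ ε hε hε1 x).1
    · exact (H₁ ε hε hε1 x).2

lemma isEvenL2_residual (hs : G.SymmetricCoefficients) (hg : G.Generic)
    (hc : G.CubicRemainders) {ε : ℝ} (hε : 0 < ε) (hε1 : ε ≤ 1) :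
    IsEvenL2 (G.Rop ε + G.Pop ε G.W₀) := by
  obtain ⟨C, h⟩ := G.exists_residual_bound hs hg hc
  refine ⟨memLp_plane (h ε hε hε1 0).memLp (h ε hε hε1 1).memLp, ?_⟩
  filter_upwards [G.aeEven_Rop ε, G.aeEven_Pop ε G.aeEven_W₀] with x h1 h2
  simp only [Pi.add_apply, h1, h2]

lemma isEvenL2_nonlinear (hg : G.Generic) (hc : G.CubicRemainders) {ε : ℝ} (hε : 0 < ε)
    (hε1 : ε ≤ 1) (V : L2Even) : IsEvenL2 (G.Qop ε (rep V) + G.Nop ε (rep V)) := by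
  obtain ⟨K, -, H⟩ := G.exists_nonlinear_lipschitz hg hc
  have h0 : ∀ i, comp (0 : ℝ → Plane) i = 0 := fun i => by ext x; simp [comp]
  have h := H ε hε hε1 (rep V) 0 ‖V‖ ‖V‖ (l2Le_rep V)
    (fun i => by rw [h0]; exact L2Le.zero.mono (norm_nonneg _))
    (fun i => by rw [h0, sub_zero]; exact l2Le_rep V i)
  rw [Qop_zero, Nop_zero, add_zero] at h
  simp only [h0, sub_zero] at h
  refine ⟨memLp_plane (h 0).memLp (h 1).memLp, ?_⟩
  filter_upwards [G.aeEven_Qop ε (isEvenL2_rep V).2, G.aeEven_Nop ε (isEvenL2_rep V).2] with x h1 h2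
  simp only [Pi.add_apply, h1, h2]

end LatticeData

/-! ### The contraction -/

/-- `(L²_even)²` is complete, as the set of fixed points of the reflection. -/
instance : CompleteSpace L2Even := by
  have hmp := Measure.measurePreserving_neg (volume : Measure ℝ)
  have h : (L2Even : Set (Lp Plane 2 (volume : Measure ℝ)))
      = {f | Lp.compMeasurePreservingₗᵢ ℝ (fun x : ℝ => -x) hmp f = f} := by
    ext f
    have h1 := Lp.coeFn_compMeasurePreserving f hmp
    change (∀ᵐ x : ℝ, f (-x) = f x) ↔ Lp.compMeasurePreserving (fun x : ℝ => -x) hmp f = f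
    constructor
    · intro hf
      refine Lp.ext ?_
      filter_upwards [h1, hf] with x h2 h3
      rw [h2, Function.comp_apply, h3]
    · intro hf
      rw [hf] at h1
      filter_upwards [h1] with x h2
      rw [h2, Function.comp_apply]
  have hc : IsClosed (L2Even : Set (Lp Plane 2 (volume : Measure ℝ))) := by
    rw [h]
    exact isClosed_eq (LinearIsometry.continuous _) continuous_id
  exact hc.completeSpace_coe

namespace LatticeData

variable {M : ℕ} (G : LatticeData M)

lemma LInvertible.L_Linv {G : LatticeData M} {ε : ℝ} (h : G.LInvertible ε) {g : ℝ → Plane}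
    (hg : IsEvenL2 g) : G.L ε (rep (G.Linv ε g)) =ᵐ[volume] g :=
  Classical.epsilon_spec (p := fun U : L2Even => G.L ε (rep U) =ᵐ[volume] g) (h.2 g hg).exists

/-- For small `ε`, the map `F_ε` is a contraction of a ball whose radius does not depend on `ε`. -/
theorem exists_Fop_contraction (hs : G.SymmetricCoefficients) (hg : G.Generic)
    (hc : G.CubicRemainders) (hT : G.SymbolBound) :
    ∃ D ε₀ : ℝ, 0 < D ∧ 0 < ε₀ ∧ ε₀ ≤ 1 ∧ ∀ ε : ℝ, 0 < ε → ε < ε₀ → G.LInvertible ε ∧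
      Set.MapsTo (G.Fop ε) (Metric.closedBall 0 D) (Metric.closedBall 0 D) ∧
      LipschitzOnWith (1 / 2) (G.Fop ε) (Metric.closedBall 0 D) := by
  obtain ⟨ε₁, C, hε₁, hε₁1, hC, HL⟩ := G.exists_lInvertible hs hg hT
  obtain ⟨K, hK, HN⟩ := G.exists_nonlinear_lipschitz hg hc
  obtain ⟨R, HR⟩ := G.exists_residual_bound hs hg hc
  have hR : 0 ≤ R := (HR 1 one_pos le_rfl 0).nonneg
  -- `C * (R + R)` bounds the inhomogeneous part of `F_ε`
  set D : ℝ := 2 * (C * (R + R)) + 1 with hD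
  have hD0 : 0 < D := by positivity
  have hε₂ : 0 < 1 / (4 * C * K * (1 + D) ^ 2 + 1) := by positivity
  refine ⟨D, min ε₁ (1 / (4 * C * K * (1 + D) ^ 2 + 1)), hD0, lt_min hε₁ hε₂,
    (min_le_left _ _).trans hε₁1, fun ε hε hlt => ?_⟩
  have hlt1 := hlt.trans_le (min_le_left _ _)
  have hε1 : ε ≤ 1 := hlt1.le.trans hε₁1
  have hsmall : 2 * C * K * (1 + D) ^ 2 * ε ≤ 1 / 2 := by
    have h1 := (lt_div_iff₀ (by positivity)).1 (hlt.trans_le (min_le_right _ _))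
    nlinarith
  obtain ⟨hinv, hbound⟩ := HL ε hε hlt1
  have hscale : ∀ δ : ℝ, 0 ≤ δ →
      ε ^ 2 * (C * (K / ε * (1 + D) ^ 2 * δ + K / ε * (1 + D) ^ 2 * δ)) ≤ 1 / 2 * δ := by
    intro δ hδ
    have e : ε ^ 2 * (C * (K / ε * (1 + D) ^ 2 * δ + K / ε * (1 + D) ^ 2 * δ))
        = 2 * C * K * (1 + D) ^ 2 * ε * δ := by field_simp; ring
    rw [e]
    exact mul_le_mul_of_nonneg_right hsmall hδ
  have hnorm : ∀ (g : ℝ → Plane) (b : ℝ), IsEvenL2 g → (∀ i, L2Le (comp g i) b) →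
      ‖G.Linv ε g‖ ≤ C * (b + b) := fun g b hge hgb =>
    hbound _ b b ((hgb 0).congr (comp_congr_ae (hinv.L_Linv hge).symm 0))
      ((hgb 1).congr (comp_congr_ae (hinv.L_Linv hge).symm 1))
  have hsub : ∀ (g g' : ℝ → Plane) (b : ℝ), IsEvenL2 g → IsEvenL2 g' →
      (∀ i, L2Le (comp g i - comp g' i) b) →
      ‖G.Linv ε g - G.Linv ε g'‖ ≤ C * (b + b) := by
    intro g g' b hge hge' hgb
    have h : G.L ε (rep (G.Linv ε g - G.Linv ε g')) =ᵐ[volume] g - g' :=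
      (G.L_sub_ae hs hε _ _).trans ((hinv.L_Linv hge).sub (hinv.L_Linv hge'))
    exact hbound _ b b ((hgb 0).congr (comp_congr_ae h.symm 0))
      ((hgb 1).congr (comp_congr_ae h.symm 1))
  have hN := G.isEvenL2_nonlinear hg hc hε hε1
  have hRe := G.isEvenL2_residual hs hg hc hε hε1
  have hrep : ∀ V : L2Even, V ∈ Metric.closedBall (0 : L2Even) D → ∀ i, L2Le (comp (rep V) i) D :=
    fun V hV i => (l2Le_rep V i).mono (mem_closedBall_zero_iff.1 hV)
  refine ⟨hinv, fun V hV => ?_, LipschitzOnWith.of_dist_le_mul fun V hV V' hV' => ?_⟩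
  · have h0 : ∀ i, comp (0 : ℝ → Plane) i = 0 := fun i => by ext x; simp [comp]
    have h1 := HN ε hε hε1 (rep V) 0 D ‖V‖ (hrep V hV)
      (fun i => by rw [h0]; exact L2Le.zero.mono hD0.le)
      (fun i => by rw [h0, sub_zero]; exact l2Le_rep V i)
    rw [Qop_zero, Nop_zero, add_zero] at h1
    simp only [h0, sub_zero] at h1
    have h2 := hnorm _ _ (hN V) h1
    have h3 := hnorm _ _ hRe (HR ε hε hε1)
    have h4 := hscale ‖V‖ (norm_nonneg V)
    rw [mem_closedBall_zero_iff] at hV ⊢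
    refine (norm_add_le _ _).trans ?_
    rw [norm_smul, Real.norm_of_nonneg (by positivity : 0 ≤ ε ^ 2)]
    have h5 := mul_le_mul_of_nonneg_left h2 (by positivity : 0 ≤ ε ^ 2)
    linarith
  · have h1 := HN ε hε hε1 (rep V) (rep V') D ‖V - V'‖ (hrep V hV) (hrep V' hV') fun i =>
      (l2Le_rep (V - V') i).congr (comp_congr_ae (rep_sub V V') i)
    have h2 := hsub _ _ _ (hN V) (hN V') h1
    have h5 := mul_le_mul_of_nonneg_left h2 (by positivity : 0 ≤ ε ^ 2)
    rw [dist_eq_norm, dist_eq_norm, Fop, Fop, add_sub_add_right_eq_sub, ← smul_sub, norm_smul,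
      Real.norm_of_nonneg (by positivity : 0 ≤ ε ^ 2)]
    refine (h5.trans (hscale _ (norm_nonneg _))).trans (le_of_eq ?_)
    norm_num

end LatticeData

/-- The Banach fixed point theorem on a closed ball. -/
lemma exists_unique_fixedPoint_closedBall {E : Type*} [NormedAddCommGroup E] [CompleteSpace E]
    {f : E → E} {D : ℝ} (hD : 0 ≤ D) {q : ℝ≥0} (hq : q < 1)
    (hm : Set.MapsTo f (Metric.closedBall 0 D) (Metric.closedBall 0 D))
    (hl : LipschitzOnWith q f (Metric.closedBall 0 D)) :
    ∃ V, (V ∈ Metric.closedBall (0 : E) D ∧ f V = V) ∧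
      ∀ V', V' ∈ Metric.closedBall (0 : E) D → f V' = V' → V' = V := by
  have hcon : ContractingWith q (hm.restrict f _ _) := ⟨hq, hl.mapsToRestrict hm⟩
  obtain ⟨V, hV, hfix, -⟩ := hcon.exists_fixedPoint' Metric.isClosed_closedBall.isComplete hm
    (Metric.mem_closedBall_self hD) (edist_ne_top _ _)
  refine ⟨V, ⟨hV, hfix⟩, fun V' hV' hfix' => ?_⟩
  have h := hl.dist_le_mul V' hV' V hV
  rw [hfix', hfix] at h
  have hq' : (q : ℝ) < 1 := by exact_mod_cast hq
  refine dist_le_zero.1 ?_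
  nlinarith [dist_nonneg (x := V') (y := V)]

/-! ### The equation for the full profile -/

lemma hasDerivAt_av {F : Type*} [NormedAddCommGroup F] [NormedSpace ℝ F] [CompleteSpace F]
    {g : ℝ → F} (hg : Continuous g) (η x : ℝ) :
    HasDerivAt (av η g) (η⁻¹ • (g (x + η / 2) - g (x - η / 2))) x := by
  have h0 : ∀ y, HasDerivAt (fun y => ∫ t in (0 : ℝ)..y, g t) (g y) y := fun y =>
    intervalIntegral.integral_hasDerivAt_right (hg.intervalIntegrable _ _)
      (hg.stronglyMeasurableAtFilter _ _) hg.continuousAt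
  have h : av η g = fun y => η⁻¹ • ((∫ t in (0 : ℝ)..(y + η / 2), g t)
      - ∫ t in (0 : ℝ)..(y - η / 2), g t) := by
    ext y
    simp only [av]
    rw [intervalIntegral.integral_interval_sub_left (hg.intervalIntegrable _ _)
      (hg.intervalIntegrable _ _)]
  rw [h]
  exact (((h0 _).comp_add_const x (η / 2)).sub ((h0 _).comp_sub_const x (η / 2))).const_smul _

lemma avg_add_smul {f g : ℝ → ℝ} (hf : LocInt f) (hg : LocInt g) (η c : ℝ) :
    avg η (f + c • g) = avg η f + c • avg η g := by
  simp only [avg_eq_av]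
  rw [av_add η hf (hg.const_smul c), av_smul]

lemma locInt_avg {f : ℝ → ℝ} (hf : LocInt f) (η : ℝ) : LocInt (avg η f) :=
  (continuous_av hf η).locInt

namespace LatticeData

variable {M : ℕ} (G : LatticeData M)

lemma B_add_smul (ε c : ℝ) {U v : ℝ → Plane} (hU : ∀ i, LocInt (comp U i))
    (hv : ∀ i, LocInt (comp v i)) : G.B ε (U + c • v) = G.B ε U + c • G.B ε v := by
  have hc : ∀ i, comp (U + c • v) i = comp U i + c • comp v i := fun i => rfl
  have hs : ∀ (a : Fin M → ℝ) i ξ,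
      ∑ m, a m * avg (G.k m * ε) (avg (G.k m * ε) (comp (U + c • v) i)) ξ
      = ∑ m, a m * avg (G.k m * ε) (avg (G.k m * ε) (comp U i)) ξ
        + c * ∑ m, a m * avg (G.k m * ε) (avg (G.k m * ε) (comp v i)) ξ := by
    intro a i ξ
    rw [Finset.mul_sum, ← Finset.sum_add_distrib]
    refine Finset.sum_congr rfl fun m _ => ?_
    rw [hc, avg_add_smul (hU i) (hv i), avg_add_smul (locInt_avg (hU i) _) (locInt_avg (hv i) _),
      Pi.add_apply, Pi.smul_apply, smul_eq_mul]
    ring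
  have hW : ∀ ξ i, (U + c • v) ξ i = U ξ i + c * v ξ i := fun ξ i => rfl
  ext ξ i
  rw [Pi.add_apply, Pi.smul_apply, PiLp.add_apply, PiLp.smul_apply, smul_eq_mul]
  fin_cases i
  · change (1 / ε ^ 2) * _ + G.lam * ((1 / ε ^ 2) * _)
      = ((1 / ε ^ 2) * _ + G.lam * ((1 / ε ^ 2) * _))
        + c * ((1 / ε ^ 2) * _ + G.lam * ((1 / ε ^ 2) * _))
    simp only [hs, hW]
    ring
  · change ε ^ 2 * ((1 / ε ^ 2) * _) = ε ^ 2 * ((1 / ε ^ 2) * _) + c * (ε ^ 2 * ((1 / ε ^ 2) * _))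
    simp only [hs, hW]
    ring

lemma quadTerm_add_smul (ε c : ℝ) (m : Fin M) {f f' g g' : ℝ → ℝ} (hf : LocInt f) (hf' : LocInt f')
    (hg : LocInt g) (hg' : LocInt g') (ξ : ℝ) :
    G.quadTerm ε m (f + c • f') (g + c • g') ξ = G.quadTerm ε m f g ξ
      + c * (G.quadTerm ε m f g' ξ + G.quadTerm ε m f' g ξ) + c ^ 2 * G.quadTerm ε m f' g' ξ := by
  set η := G.k m * ε with hη
  have p : ∀ {a b : ℝ → ℝ}, LocInt a → LocInt b → LocInt fun x => avg η a x * avg η b x :=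
    fun ha hb => ((continuous_av ha η).mul (continuous_av hb η)).locInt
  have e : (fun x => avg η (f + c • f') x * avg η (g + c • g') x)
      = ((fun x => avg η f x * avg η g x) + c • ((fun x => avg η f x * avg η g' x)
        + fun x => avg η f' x * avg η g x)) + c ^ 2 • fun x => avg η f' x * avg η g' x := by
    ext x
    rw [avg_add_smul hf hf', avg_add_smul hg hg']
    simp only [Pi.add_apply, Pi.smul_apply, smul_eq_mul]
    ring
  have h1 := (p hf hg').add (p hf' hg)
  simp only [quadTerm, ← hη]
  rw [e, avg_add_smul ((p hf hg).add (h1.const_smul c)) (p hf' hg'), avg_add_smul (p hf hg) h1,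
    avg_eq_av η ((fun x => avg η f x * avg η g' x) + _), av_add η (p hf hg') (p hf' hg)]
  rfl

/-- The Taylor expansion of the quadratic operator at `W₀`, in which `M_ε` is the linear part. -/
lemma Qop_W₀_add_smul (ε c : ℝ) {v : ℝ → Plane} (hv : ∀ i, LocInt (comp v i)) :
    G.Qop ε (G.W₀ + c • v) = G.Qop ε G.W₀ + c • G.Mop ε v + c ^ 2 • G.Qop ε v := by
  have h : ∀ m i j ξ, G.quadTerm ε m (comp (G.W₀ + c • v) i) (comp (G.W₀ + c • v) j) ξ
      = G.quadTerm ε m (comp G.W₀ i) (comp G.W₀ j) ξ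
        + c * (G.quadTerm ε m (comp G.W₀ i) (comp v j) ξ
          + G.quadTerm ε m (comp G.W₀ j) (comp v i) ξ)
        + c ^ 2 * G.quadTerm ε m (comp v i) (comp v j) ξ := fun m i j ξ => by
    rw [G.quadTerm_comm ε m (comp G.W₀ j)]
    exact G.quadTerm_add_smul ε c m (G.locInt_W₀ i) (hv i) (G.locInt_W₀ j) (hv j) ξ
  have hl : ∀ m j ξ, G.quadTerm ε m (comp G.W₀ 1) (comp v j) ξ
      = G.lam * G.quadTerm ε m G.Wstar (comp v j) ξ := fun m j ξ => by
    rw [comp_W₀_one, quadTerm_smul_left]; rfl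
  have hl0 : ∀ m j ξ, G.quadTerm ε m (comp G.W₀ 0) (comp v j) ξ
      = G.quadTerm ε m G.Wstar (comp v j) ξ := fun m j ξ => rfl
  ext ξ i
  rw [Pi.add_apply, Pi.add_apply, Pi.smul_apply, Pi.smul_apply, PiLp.add_apply, PiLp.add_apply,
    PiLp.smul_apply, PiLp.smul_apply, smul_eq_mul, smul_eq_mul]
  fin_cases i
  · change (1 / 2) * _ = (1 / 2) * _ + c * (∑ m : Fin M, _) + c ^ 2 * ((1 / 2) * _)
    simp only [Finset.mul_sum, ← Finset.sum_add_distrib]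
    refine Finset.sum_congr rfl fun m _ => ?_
    simp only [h, hl, hl0, η₁₁, η₁₂]
    ring
  · change (ε ^ 2 / 2) * _ = (ε ^ 2 / 2) * _ + c * (ε ^ 2 * _) + c ^ 2 * ((ε ^ 2 / 2) * _)
    simp only [Finset.mul_sum, ← Finset.sum_add_distrib]
    refine Finset.sum_congr rfl fun m _ => ?_
    simp only [h, hl, hl0, η₂₁, η₂₂]
    ring

lemma L_congr_ae (ε : ℝ) {f g : ℝ → Plane} (h : f =ᵐ[volume] g) : G.L ε f =ᵐ[volume] G.L ε g := by
  have ha : ∀ η i, avg η (comp f i) = avg η (comp g i) := fun η i =>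
    av_congr_ae (comp_congr_ae h i)
  filter_upwards [h] with x hx
  simp only [L, B, Bcan, Mop, quadTerm, Pi.sub_apply, ha, hx]

lemma L_smul (ε c : ℝ) {f : ℝ → Plane} (hf : ∀ i, LocInt (comp f i)) :
    G.L ε (c • f) = c • G.L ε f := by
  have h0 : ∀ i, LocInt (comp (0 : ℝ → Plane) i) := fun i => (continuous_const (y := (0 : ℝ))).locInt
  have hB := G.B_add_smul ε c h0 hf
  have hB0 := G.B_add_smul ε (-1) h0 h0
  rw [smul_zero, add_zero, neg_one_smul, add_neg_cancel] at hB0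
  rw [zero_add, hB0, zero_add] at hB
  have hM : G.Mop ε (c • f) = c • G.Mop ε f := by
    have hc : ∀ i, comp (c • f) i = c • comp f i := fun i => rfl
    ext ξ i
    rw [Pi.smul_apply, PiLp.smul_apply, smul_eq_mul]
    fin_cases i
    · change ∑ m : Fin M, _ = c * ∑ m : Fin M, _
      rw [Finset.mul_sum]
      refine Finset.sum_congr rfl fun m _ => ?_
      rw [hc, hc, quadTerm_smul_right, quadTerm_smul_right, Pi.smul_apply, Pi.smul_apply,
        smul_eq_mul, smul_eq_mul]
      ring
    · change ε ^ 2 * ∑ m : Fin M, _ = c * (ε ^ 2 * ∑ m : Fin M, _)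
      rw [mul_left_comm c]
      congr 1
      rw [Finset.mul_sum]
      refine Finset.sum_congr rfl fun m _ => ?_
      rw [hc, hc, quadTerm_smul_right, quadTerm_smul_right, Pi.smul_apply, Pi.smul_apply,
        smul_eq_mul, smul_eq_mul]
      ring
  rw [L, L, hB, hM, smul_sub]

/-- A fixed point of `F_ε` solves the corrector equation. -/
lemma L_fixedPoint (hs : G.SymmetricCoefficients) (hg : G.Generic) (hc : G.CubicRemainders)
    {ε : ℝ} (hε : 0 < ε) (hε1 : ε ≤ 1) (hinv : G.LInvertible ε) {V : L2Even} (hV : G.Fop ε V = V) :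
    G.L ε (rep V) =ᵐ[volume] ε ^ 2 • (G.Qop ε (rep V) + G.Nop ε (rep V))
      + (G.Rop ε + G.Pop ε G.W₀) := by
  set U₁ := G.Linv ε (G.Qop ε (rep V) + G.Nop ε (rep V)) with hU₁
  set U₂ := G.Linv ε (G.Rop ε + G.Pop ε G.W₀) with hU₂
  have h1 := hinv.L_Linv (G.isEvenL2_nonlinear hg hc hε hε1 V)
  have h2 := hinv.L_Linv (G.isEvenL2_residual hs hg hc hε hε1)
  rw [← hU₁] at h1
  rw [← hU₂] at h2
  have e : U₂ = V - ε ^ 2 • U₁ := by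
    nth_rewrite 1 [← hV]
    rw [Fop, ← hU₁, ← hU₂, add_sub_cancel_left]
  have h3 := G.L_sub_ae hs hε V (ε ^ 2 • U₁)
  rw [← e] at h3
  have h4 : G.L ε (rep (ε ^ 2 • U₁)) =ᵐ[volume] ε ^ 2 • G.L ε (rep U₁) := by
    rw [← G.L_smul ε (ε ^ 2) fun i => (memLp_rep U₁ i).locInt]
    exact G.L_congr_ae ε (rep_smul _ _)
  filter_upwards [h1, h2, h3, h4] with x a1 a2 a3 a4
  rw [a2, Pi.sub_apply, a4, Pi.smul_apply, a1] at a3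
  rw [Pi.add_apply, Pi.smul_apply, a3, add_sub_cancel]

/-- The profile `W₀ + ε² V` solves `B_ε W = Q_ε[W] + ε² P_ε[W]`. -/
lemma B_profile (hs : G.SymmetricCoefficients) (hg : G.Generic) (hc : G.CubicRemainders)
    {ε : ℝ} (hε : 0 < ε) (hε1 : ε ≤ 1) (hinv : G.LInvertible ε) {V : L2Even} (hV : G.Fop ε V = V) :
    G.B ε (G.W₀ + ε ^ 2 • rep V) =ᵐ[volume]
      G.Qop ε (G.W₀ + ε ^ 2 • rep V) + ε ^ 2 • G.Pop ε (G.W₀ + ε ^ 2 • rep V) := by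
  have hv : ∀ i, LocInt (comp (rep V) i) := fun i => (memLp_rep V i).locInt
  have hB := G.B_add_smul ε (ε ^ 2) G.locInt_W₀ hv
  have hQ := G.Qop_W₀_add_smul ε (ε ^ 2) hv
  filter_upwards [G.L_fixedPoint hs hg hc hε hε1 hinv hV] with x hx
  rw [hB, hQ]
  ext i
  have hi := congrArg (fun p : Plane => p i) hx
  simp only [L, Rop, Nop, Pi.add_apply, Pi.sub_apply, Pi.smul_apply, PiLp.add_apply,
    PiLp.sub_apply, PiLp.smul_apply, smul_eq_mul] at hi ⊢
  field_simp at hi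
  linear_combination hi

lemma continuous_F_arg (hc : G.CubicRemainders) (ε : ℝ) (m : Fin M) {W : ℝ → Plane}
    (hW : ∀ i, LocInt (comp W i)) : Continuous fun x => G.F m (G.arg ε m W x) := by
  have ha := G.continuous_arg ε m hW
  have h : ∀ i, Continuous fun x => ε ^ 2 * G.k m * avg (G.k m * ε) (comp W i) x := fun i =>
    continuous_const.mul (continuous_av (hW i) _)
  have hp : ∀ (p q : ℝ → ℝ), Continuous p → Continuous q → ∀ a b c d e : ℝ,
      Continuous fun x => a * p x + b * q x
        + (1 / 2) * (c * p x ^ 2 + 2 * d * p x * q x + e * q x ^ 2) := fun p q hp hq a b c d e => by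
    fun_prop
  exact continuous_plane
    ((hp _ _ (h 0) (h 1) _ _ _ _ _).add ((hc m).1.continuous.comp ha))
    ((hp _ _ (h 0) (h 1) _ _ _ _ _).add ((hc m).2.continuous.comp ha))

end LatticeData

/-! ### From the corrector to the lattice wave -/

lemma avg_quadratic {p q s : ℝ → ℝ} (hp : Continuous p) (hq : Continuous q) (hs : Continuous s)
    (η t a b c d e ξ : ℝ) :
    avg η (fun x => a * (t * p x) + b * (t * q x)
      + (1 / 2) * (c * (t * p x) ^ 2 + 2 * d * (t * p x) * (t * q x) + e * (t * q x) ^ 2) + s x) ξ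
    = t * (a * avg η p ξ + b * avg η q ξ) + t ^ 2 / 2 * (c * avg η (fun x => p x * p x) ξ
      + 2 * d * avg η (fun x => p x * q x) ξ + e * avg η (fun x => q x * q x) ξ) + avg η s ξ := by
  have h : (fun x => a * (t * p x) + b * (t * q x)
      + (1 / 2) * (c * (t * p x) ^ 2 + 2 * d * (t * p x) * (t * q x) + e * (t * q x) ^ 2) + s x)
      = ((((s + (t * a) • p) + (t * b) • q) + (t ^ 2 / 2 * c) • fun x => p x * p x)
        + (t ^ 2 * d) • fun x => p x * q x) + (t ^ 2 / 2 * e) • fun x => q x * q x := by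
    ext x
    simp only [Pi.add_apply, Pi.smul_apply, smul_eq_mul]
    ring
  have m1 : LocInt fun x => p x * p x := (hp.mul hp).locInt
  have m2 : LocInt fun x => p x * q x := (hp.mul hq).locInt
  have m3 : LocInt fun x => q x * q x := (hq.mul hq).locInt
  have l1 := hs.locInt.add (hp.locInt.const_smul (t * a))
  have l2 := l1.add (hq.locInt.const_smul (t * b))
  have l3 := l2.add (m1.const_smul (t ^ 2 / 2 * c))
  have l4 := l3.add (m2.const_smul (t ^ 2 * d))
  rw [h, avg_add_smul l4 m3, avg_add_smul l3 m2, avg_add_smul l2 m1, avg_add_smul l1 hq.locInt,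
    avg_add_smul hs.locInt hp.locInt]
  simp only [Pi.add_apply, Pi.smul_apply, smul_eq_mul]
  ring

namespace LatticeData

variable {M : ℕ} (G : LatticeData M)

/-- The advance-delay equation for the velocity profile, integrated once. -/
lemma profile_eq_ae (hc : G.CubicRemainders) {ε : ℝ} (hε : 0 < ε) {W : ℝ → Plane}
    (hW : ∀ i, LocInt (comp W i))
    (h : G.B ε W =ᵐ[volume] G.Qop ε W + ε ^ 2 • G.Pop ε W) :
    ∀ᵐ ξ, ∀ i, (G.σ₀ + ε ^ 2) * ε ^ 2 * W ξ i
      = ∑ m, G.k m * avg (G.k m * ε) (fun x => G.F m (G.arg ε m W x) i) ξ := by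
  have ha := fun m i => continuous_av (hW i) (G.k m * ε)
  have hΨ₁ : ∀ m, Continuous fun x => G.Ψ₁ m (G.arg ε m W x) := fun m =>
    (hc m).1.continuous.comp (G.continuous_arg ε m hW)
  have hΨ₂ : ∀ m, Continuous fun x => G.Ψ₂ m (G.arg ε m W x) := fun m =>
    (hc m).2.continuous.comp (G.continuous_arg ε m hW)
  filter_upwards [h] with ξ hξ
  -- the three parts of the nonlinearities: linear, quadratic, and of higher order
  have hF : ∀ (a b c d e : Fin M → ℝ) (s : Fin M → ℝ → ℝ), (∀ m, Continuous (s m)) →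
      ∑ m, G.k m * avg (G.k m * ε) (fun x => a m * G.arg ε m W x 0 + b m * G.arg ε m W x 1
        + (1 / 2) * (c m * G.arg ε m W x 0 ^ 2 + 2 * d m * G.arg ε m W x 0 * G.arg ε m W x 1
          + e m * G.arg ε m W x 1 ^ 2) + s m x) ξ
      = ε ^ 2 * ((∑ m, G.k m ^ 2 * a m * avg (G.k m * ε) (avg (G.k m * ε) (comp W 0)) ξ)
          + ∑ m, G.k m ^ 2 * b m * avg (G.k m * ε) (avg (G.k m * ε) (comp W 1)) ξ)
        + ε ^ 4 / 2 * (∑ m, G.k m ^ 3 * (c m * G.quadTerm ε m (comp W 0) (comp W 0) ξ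
          + 2 * d m * G.quadTerm ε m (comp W 0) (comp W 1) ξ
          + e m * G.quadTerm ε m (comp W 1) (comp W 1) ξ))
        + ∑ m, G.k m * avg (G.k m * ε) (s m) ξ := by
    intro a b c d e s hs
    simp only [Finset.mul_sum, ← Finset.sum_add_distrib]
    refine Finset.sum_congr rfl fun m _ => ?_
    have := avg_quadratic (ha m 0) (ha m 1) (hs m) (G.k m * ε) (ε ^ 2 * G.k m)
      (a m) (b m) (c m) (d m) (e m) ξ
    simp only [← avg_eq_av] at this
    change G.k m * avg (G.k m * ε) (fun x => a m * (ε ^ 2 * G.k m * avg (G.k m * ε) (comp W 0) x)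
      + b m * (ε ^ 2 * G.k m * avg (G.k m * ε) (comp W 1) x) + (1 / 2) * (
        c m * (ε ^ 2 * G.k m * avg (G.k m * ε) (comp W 0) x) ^ 2
        + 2 * d m * (ε ^ 2 * G.k m * avg (G.k m * ε) (comp W 0) x)
          * (ε ^ 2 * G.k m * avg (G.k m * ε) (comp W 1) x)
        + e m * (ε ^ 2 * G.k m * avg (G.k m * ε) (comp W 1) x) ^ 2) + s m x) ξ = _
    rw [this]
    simp only [quadTerm]
    ring
  have hF₁ := hF G.α₁₁ G.α₁₂ G.β₁₁₁ G.β₁₁₂ G.β₁₂₂ (fun m x => G.Ψ₁ m (G.arg ε m W x)) hΨ₁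
  have hF₂ := hF G.α₂₁ G.α₂₂ G.β₂₁₁ G.β₂₁₂ G.β₂₂₂ (fun m x => G.Ψ₂ m (G.arg ε m W x)) hΨ₂
  have hP : ∑ m, G.k m * avg (G.k m * ε)
        (fun x => G.Ψ₁ m (G.arg ε m W x) + G.lam * G.Ψ₂ m (G.arg ε m W x)) ξ
      = (∑ m, G.k m * avg (G.k m * ε) (fun x => G.Ψ₁ m (G.arg ε m W x)) ξ)
        + G.lam * ∑ m, G.k m * avg (G.k m * ε) (fun x => G.Ψ₂ m (G.arg ε m W x)) ξ := by
    rw [Finset.mul_sum, ← Finset.sum_add_distrib]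
    refine Finset.sum_congr rfl fun m _ => ?_
    have := congrFun (avg_add_smul (hΨ₁ m).locInt (hΨ₂ m).locInt (G.k m * ε) G.lam) ξ
    rw [Pi.add_apply, Pi.smul_apply, smul_eq_mul] at this
    rw [mul_left_comm, ← mul_add, ← this]
    rfl
  have hQ : ∑ m, G.k m ^ 3 *
        ((G.β₁₁₁ m + G.lam * G.β₂₁₁ m) * G.quadTerm ε m (comp W 0) (comp W 0) ξ
          + 2 * (G.β₁₁₂ m + G.lam * G.β₂₁₂ m) * G.quadTerm ε m (comp W 0) (comp W 1) ξ
          + (G.β₁₂₂ m + G.lam * G.β₂₂₂ m) * G.quadTerm ε m (comp W 1) (comp W 1) ξ)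
      = (∑ m, G.k m ^ 3 * (G.β₁₁₁ m * G.quadTerm ε m (comp W 0) (comp W 0) ξ
          + 2 * G.β₁₁₂ m * G.quadTerm ε m (comp W 0) (comp W 1) ξ
          + G.β₁₂₂ m * G.quadTerm ε m (comp W 1) (comp W 1) ξ))
        + G.lam * ∑ m, G.k m ^ 3 * (G.β₂₁₁ m * G.quadTerm ε m (comp W 0) (comp W 0) ξ
          + 2 * G.β₂₁₂ m * G.quadTerm ε m (comp W 0) (comp W 1) ξ
          + G.β₂₂₂ m * G.quadTerm ε m (comp W 1) (comp W 1) ξ) := by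
    rw [Finset.mul_sum, ← Finset.sum_add_distrib]
    exact Finset.sum_congr rfl fun m _ => by ring
  have h0 : G.B ε W ξ 0 = G.Qop ε W ξ 0 + ε ^ 2 * G.Pop ε W ξ 0 :=
    congrArg (fun p : Plane => p 0) hξ
  have h1 : G.B ε W ξ 1 = G.Qop ε W ξ 1 + ε ^ 2 * G.Pop ε W ξ 1 :=
    congrArg (fun p : Plane => p 1) hξ
  simp only [B, Bcan, Qop, Pop, PiLp.toLp_apply, Matrix.cons_val_zero, Matrix.cons_val_one] at h0 h1
  rw [hP, hQ] at h0
  have algebra₂ : ∀ {σ w X Y S P : ℝ},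
      ε ^ 2 * (1 / ε ^ 2 * (σ * w - X - Y)) = ε ^ 2 / 2 * S + ε ^ 2 * (1 / ε ^ 4 * P) →
      σ * ε ^ 2 * w = ε ^ 2 * (X + Y) + ε ^ 4 / 2 * S + P := fun {σ w X Y S P} h => by
    field_simp at h
    linear_combination h / 2
  have algebra₁ : ∀ {σ l w X Y S P w' X' Y' S' P' : ℝ},
      1 / ε ^ 2 * (σ * w - X - Y) + l * (1 / ε ^ 2 * (σ * w' - X' - Y'))
        = 1 / 2 * (S + l * S') + ε ^ 2 * (1 / ε ^ 6 * (P + l * P')) →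
      σ * ε ^ 2 * w' = ε ^ 2 * (X' + Y') + ε ^ 4 / 2 * S' + P' →
      σ * ε ^ 2 * w = ε ^ 2 * (X + Y) + ε ^ 4 / 2 * S + P :=
    fun {σ l w X Y S P w' X' Y' S' P'} h h' => by
    field_simp at h
    linear_combination h / 2 - l * h'
  intro i
  have e1 : (G.σ₀ + ε ^ 2) * ε ^ 2 * W ξ 1
      = ∑ m, G.k m * avg (G.k m * ε) (fun x => G.F m (G.arg ε m W x) 1) ξ := by
    refine Eq.trans ?_ hF₂.symm
    exact algebra₂ h1
  fin_cases i
  · refine Eq.trans ?_ hF₁.symm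
    exact algebra₁ h0 (e1.trans hF₂)
  · exact e1

/-- The velocity profile that is determined by the right-hand side of the integrated equation. -/
def profile (ε : ℝ) (W : ℝ → Plane) : ℝ → Plane := fun ξ =>
  ((G.σ₀ + ε ^ 2) * ε ^ 2)⁻¹ • ∑ m, G.k m • av (G.k m * ε) (fun x => G.F m (G.arg ε m W x)) ξ

lemma continuous_profile (hc : G.CubicRemainders) (ε : ℝ) {W : ℝ → Plane}
    (hW : ∀ i, LocInt (comp W i)) : Continuous (G.profile ε W) := by
  have h := fun m => continuous_av (G.continuous_F_arg hc ε m hW).locInt (G.k m * ε)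
  unfold profile
  fun_prop

lemma profile_congr_ae (ε : ℝ) {W Y : ℝ → Plane} (h : W =ᵐ[volume] Y) :
    G.profile ε W = G.profile ε Y := by
  have ha : ∀ η i, avg η (comp W i) = avg η (comp Y i) := fun η i =>
    av_congr_ae (comp_congr_ae h i)
  unfold profile arg
  simp only [ha]

/-- A solution of `B_ε W = Q_ε[W] + ε² P_ε[W]` coincides almost everywhere with the profile that it
determines, which is smoother. -/
lemma profile_ae_eq (hc : G.CubicRemainders) (hσ : 0 < G.σ₀) {ε : ℝ} (hε : 0 < ε) {W : ℝ → Plane}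
    (hW : ∀ i, LocInt (comp W i))
    (h : G.B ε W =ᵐ[volume] G.Qop ε W + ε ^ 2 • G.Pop ε W) : G.profile ε W =ᵐ[volume] W := by
  filter_upwards [G.profile_eq_ae hc hε hW h] with ξ hξ
  rw [profile, inv_smul_eq_iff₀ (by positivity)]
  ext i
  rw [PiLp.smul_apply, smul_eq_mul, hξ i, WithLp.ofLp_sum, Finset.sum_apply]
  refine Finset.sum_congr rfl fun m _ => ?_
  rw [PiLp.smul_apply, smul_eq_mul]
  congr 1
  exact (av_clm (EuclideanSpace.proj i : Plane →L[ℝ] ℝ) (G.k m * ε)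
    (G.continuous_F_arg hc ε m hW).locInt ξ).symm

/-- The argument of the nonlinearities in the advance-delay equation is an average of the velocity,
taken at the midpoint of the interval. -/
lemma smul_diffPlus_eq_arg (ε : ℝ) (m : Fin M) {Y Q : ℝ → Plane} (hY : Continuous Y)
    (hQ : ∀ x, HasDerivAt Q (Y x) x) (ζ : ℝ) :
    (G.k m * ε ^ 2) • diffPlus (G.k m * ε) Q ζ = G.arg ε m Y (ζ + G.k m * ε / 2) := by
  have h : Q (ζ + G.k m * ε) - Q ζ = ∫ x in ζ..(ζ + G.k m * ε), Y x :=
    (intervalIntegral.integral_eq_sub_of_hasDerivAt (fun x _ => hQ x)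
      (hY.intervalIntegrable _ _)).symm
  have hi : ∀ i : Fin 2, (∫ x in ζ..(ζ + G.k m * ε), Y x) i
      = ∫ x in ζ..(ζ + G.k m * ε), comp Y i x := fun i =>
    ((EuclideanSpace.proj i : Plane →L[ℝ] ℝ).intervalIntegral_comp_comm
      (hY.intervalIntegrable _ _)).symm
  have hav : ∀ i, avg (G.k m * ε) (comp Y i) (ζ + G.k m * ε / 2)
      = (G.k m * ε)⁻¹ * ∫ x in ζ..(ζ + G.k m * ε), comp Y i x := fun i => by
    rw [avg, add_sub_cancel_right, add_assoc, add_halves]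
  rw [diffPlus, h]
  ext i
  rw [PiLp.smul_apply, PiLp.smul_apply, hi, smul_eq_mul, smul_eq_mul, ← hav]
  fin_cases i
  · change _ = ε ^ 2 * G.k m * avg (G.k m * ε) (comp Y 0) (ζ + G.k m * ε / 2)
    rw [mul_comm (G.k m)]; rfl
  · change _ = ε ^ 2 * G.k m * avg (G.k m * ε) (comp Y 1) (ζ + G.k m * ε / 2)
    rw [mul_comm (G.k m)]; rfl

/-- A continuous profile that reproduces itself is the velocity of a lattice wave. -/
lemma exists_isLatticeWave (hc : G.CubicRemainders) (hσ : 0 < G.σ₀) {ε : ℝ} (hε : 0 < ε)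
    {Y : ℝ → Plane} (hY : Continuous Y) (h : G.profile ε Y = Y) :
    ∃ Q : ℝ → Plane, G.IsLatticeWave ε (√(G.σ₀ + ε ^ 2)) Q ∧ deriv Q = Y := by
  have hl : ∀ i, LocInt (comp Y i) := fun i => Continuous.locInt (by unfold comp; fun_prop)
  have hg := fun m => G.continuous_F_arg hc ε m hl
  set g : Fin M → ℝ → Plane := fun m x => G.F m (G.arg ε m Y x) with hgdef
  have hQ : ∀ x, HasDerivAt (fun x => ∫ t in (0 : ℝ)..x, Y t) (Y x) x := fun x =>
    intervalIntegral.integral_hasDerivAt_right (hY.intervalIntegrable _ _)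
      (hY.stronglyMeasurableAtFilter _ _) hY.continuousAt
  have hdQ : deriv (fun x => ∫ t in (0 : ℝ)..x, Y t) = Y := funext fun x => (hQ x).deriv
  have hdY : ∀ x, HasDerivAt Y (((G.σ₀ + ε ^ 2) * ε ^ 2)⁻¹ • ∑ m, G.k m • ((G.k m * ε)⁻¹ •
      (g m (x + G.k m * ε / 2) - g m (x - G.k m * ε / 2)))) x := fun x => by
    have := (HasDerivAt.fun_sum fun m (_ : m ∈ Finset.univ) =>
      (hasDerivAt_av (hg m) (G.k m * ε) x).const_smul (G.k m)).const_smul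
        ((G.σ₀ + ε ^ 2) * ε ^ 2)⁻¹
    rw [← h]
    exact this
  refine ⟨fun x => ∫ t in (0 : ℝ)..x, Y t, ⟨?_, fun ξ => ?_⟩, hdQ⟩
  · have h2 : (2 : WithTop ℕ∞) = 1 + 1 := by norm_num
    rw [h2, contDiff_succ_iff_deriv, hdQ, contDiff_one_iff_deriv]
    refine ⟨fun x => (hQ x).differentiableAt, by simp, fun x => (hdY x).differentiableAt, ?_⟩
    rw [funext fun x => (hdY x).deriv]
    fun_prop
  · rw [hdQ, (hdY ξ).deriv, Real.sq_sqrt (by positivity), smul_smul, Finset.smul_sum]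
    refine Finset.sum_congr rfl fun m _ => ?_
    simp only [G.smul_diffPlus_eq_arg ε m hY hQ]
    rw [diffMinus]
    have e : ξ - G.k m * ε + G.k m * ε / 2 = ξ - G.k m * ε / 2 := by ring
    rw [e, smul_smul, smul_smul, smul_smul]
    change _ • (g m _ - g m _) = _ • (g m _ - g m _)
    congr 1
    have : G.σ₀ + ε ^ 2 ≠ 0 := by positivity
    rcases eq_or_ne (G.k m) 0 with hk | hk
    · simp [hk]
    · field_simp

end LatticeData

/-! ### The wave that belongs to a fixed point -/

namespace LatticeData

variable {M : ℕ} (G : LatticeData M)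

lemma isEvenL2_profile (hg : G.Generic) (ε : ℝ) (V : L2Even) :
    IsEvenL2 (G.W₀ + ε ^ 2 • rep V) := by
  refine ⟨(G.isEvenL2_W₀ hg).1.add ((isEvenL2_rep V).1.const_smul _), ?_⟩
  filter_upwards [(isEvenL2_rep V).2] with x hx
  rw [Pi.add_apply, Pi.add_apply, Pi.smul_apply, Pi.smul_apply, hx, G.W₀_neg]

/-- A fixed point of `F_ε` is the corrector of a lattice wave. -/
theorem exists_wave_of_fixedPoint (hs : G.SymmetricCoefficients) (hg : G.Generic)
    (hc : G.CubicRemainders) {ε : ℝ} (hε : 0 < ε) (hε1 : ε ≤ 1) (hinv : G.LInvertible ε)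
    {V : L2Even} (hV : G.Fop ε V = V) :
    ∃ Q : ℝ → Plane, G.IsLatticeWave ε (√(G.σ₀ + ε ^ 2)) Q ∧ IsEvenL2 (deriv Q) ∧
      deriv Q =ᵐ[volume] G.W₀ + ε ^ 2 • rep V := by
  have hW := G.isEvenL2_profile hg ε V
  have hl : ∀ i, LocInt (comp (G.W₀ + ε ^ 2 • rep V) i) := fun i => (hW.1.comp_plane i).locInt
  have hae := G.profile_ae_eq hc hg.1.1 hε hl (G.B_profile hs hg hc hε hε1 hinv hV)
  obtain ⟨Q, hQ, hd⟩ := G.exists_isLatticeWave hc hg.1.1 hε (G.continuous_profile hc ε hl)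
    (G.profile_congr_ae ε hae)
  refine ⟨Q, hQ, ?_, hd ▸ hae⟩
  rw [hd]
  refine ⟨(memLp_congr_ae hae).2 hW.1, ?_⟩
  filter_upwards [hae, ae_neg hae, hW.2] with x h1 h2 h3
  rw [h1, h2, h3]

lemma eLpNorm_profile_sub_le {ε D : ℝ} {V : L2Even} {f : ℝ → Plane}
    (hf : f =ᵐ[volume] G.W₀ + ε ^ 2 • rep V) (hV : ‖V‖ ≤ D) :
    eLpNorm (f - G.W₀) 2 volume ≤ ENNReal.ofReal (D * ε ^ 2) := by
  have h : f - G.W₀ =ᵐ[volume] ε ^ 2 • rep V := by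
    filter_upwards [hf] with x hx
    rw [Pi.sub_apply, hx, Pi.add_apply, add_sub_cancel_left]
  have hn : eLpNorm (rep V) 2 volume ≤ ENNReal.ofReal D := by
    refine ENNReal.le_ofReal_iff_toReal_le (Lp.memLp _).2.ne ((norm_nonneg V).trans hV) |>.2 ?_
    exact hV
  rw [eLpNorm_congr_ae h, eLpNorm_const_smul, Real.enorm_eq_ofReal (by positivity),
    mul_comm D, ENNReal.ofReal_mul (by positivity)]
  gcongr

end LatticeData

end

theorem theorem1 {M : ℕ} (G : LatticeData M)
    (h_symm : G.SymmetricCoefficients) (h_gen : G.Generic)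
    (h_cubic : G.CubicRemainders) (h_symbol : G.SymbolBound) :
    (∀ w : ℝ → ℝ, IsKdVWave G.d₁ G.d₂ w ↔ w = G.Wstar) ∧ IsEvenL2 G.W₀ ∧
    ∃ C : ℝ, 0 < C ∧ ∃ D : ℝ, 0 < D ∧ ∃ q : ℝ≥0, q < 1 ∧ ∃ ε₀ : ℝ, 0 < ε₀ ∧
      ∀ ε : ℝ, 0 < ε → ε < ε₀ →
        -- the map `F_ε` is well defined
        G.LInvertible ε ∧
        (∀ V : L2Even, IsEvenL2 (G.Qop ε (rep V) + G.Nop ε (rep V))) ∧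
        IsEvenL2 (G.Rop ε + G.Pop ε G.W₀) ∧
        -- `F_ε` is a contraction of the ball of radius `D`
        Set.MapsTo (G.Fop ε) (Metric.closedBall 0 D) (Metric.closedBall 0 D) ∧
        LipschitzOnWith q (G.Fop ε) (Metric.closedBall 0 D) ∧
        -- its unique fixed point is the corrector of a lattice wave
        ∃ V : L2Even, (V ∈ Metric.closedBall (0 : L2Even) D ∧ G.Fop ε V = V) ∧
          (∀ V' : L2Even, V' ∈ Metric.closedBall (0 : L2Even) D → G.Fop ε V' = V' → V' = V) ∧
          ∃ Q : ℝ → Plane, G.IsLatticeWave ε (√(G.σ₀ + ε ^ 2)) Q ∧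
            IsEvenL2 (deriv Q) ∧
            deriv Q =ᵐ[volume] G.W₀ + ε ^ 2 • (rep V) ∧
            eLpNorm (deriv Q - G.W₀) 2 volume ≤ ENNReal.ofReal (C * ε ^ 2) := by
  have hσ : 0 < G.σ₀ := h_gen.1.1
  have hd₁ : 0 < G.d₁ := h_gen.2.1
  have hd₂ : G.d₂ ≠ 0 := h_gen.2.2
  refine ⟨fun w => ⟨fun hw => hw.eq_soliton hd₁ hd₂, fun hw => hw ▸ isKdVWave_soliton hd₁ hd₂⟩,
    G.isEvenL2_W₀ h_gen, ?_⟩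
  obtain ⟨D, ε₀, hD, hε₀, hε₀1, H⟩ := G.exists_Fop_contraction h_symm h_gen h_cubic h_symbol
  refine ⟨D, hD, D, hD, 1 / 2, NNReal.half_lt_self one_ne_zero, ε₀, hε₀, fun ε hε hlt => ?_⟩
  have hε1 : ε ≤ 1 := hlt.le.trans hε₀1
  obtain ⟨hinv, hmaps, hlip⟩ := H ε hε hlt
  obtain ⟨V, ⟨hVD, hVfix⟩, huniq⟩ := exists_unique_fixedPoint_closedBall hD.le
    (NNReal.half_lt_self one_ne_zero) hmaps hlip
  refine ⟨hinv, G.isEvenL2_nonlinear h_gen h_cubic hε hε1,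
    G.isEvenL2_residual h_symm h_gen h_cubic hε hε1, hmaps, hlip, V, ⟨hVD, hVfix⟩, huniq, ?_⟩
  obtain ⟨Q, hwave, hderiv, hae⟩ :=
    G.exists_wave_of_fixedPoint h_symm h_gen h_cubic hε hε1 hinv hVfix
  exact ⟨Q, hwave, hderiv, hae, G.eLpNorm_profile_sub_le hae (mem_closedBall_zero_iff.1 hVD)⟩
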